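/- **Setting.** Let $\alpha\in(0,1)$, let $Y\in\mathbb R^d$ and $Z,Z^{(1)},Z^{(2)},\dots\in\mathbb R^{q}$ be independent, the $Z$'s identically distributed, and let $\varphi$ be measurable with $\varphi(Y,Z)\in L^2(\mathbb P)$. Put $X_0=\mathbb E[\varphi(Y,Z)\mid Y]$, $X_{h}=\frac1K\sum_{k=1}^K\varphi(Y,Z^{(k)})$ for $h=\frac1K\in\mathcal H=\{\frac1K:K\ge1\}$, $\overline{\mathcal H}=\mathcal H\cup\{0\}$, $V_h(\xi)=\xi+\frac1{1-\alpha}\mathbb E[(X_h-\xi)^+]$, and let $\xi^h_\star$ minimise $V_h$ and $\chi^h_\star=V_h(\xi^h_\star)$. Assume: 1. for $h\in\mathcal H$, $F_{X_h}(\xi)-F_{X_0}(\xi)=v(\xi)h+w(\xi,h)h$ on $\mathbb R$ where, for every minimiser $\xi^0_\star$ of $V_0$, $v$ is integrable on $(\xi^0_\star,\infty)$ and $w(\xi^0_\star,h)\to0$, $\int_{\xi^0_\star}^\infty w(\xi,h)\,d\xi\to0$ as $h\downarrow0$; 2. each $X_h$, $h\in\overline{\mathcal H}$, has a continuous density $f_{X_h}$,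 and $f_{X_h}\to f_{X_0}$ locally uniformly as $h\downarrow 0$; 3. for every $R>0$, $\inf\{f_{X_h}(\xi):h\in\overline{\mathcal H},|\xi-\xi^0_\star|<R\}>0$, and the $f_{X_h}$, $h\in\overline{\mathcal H}$, are uniformly bounded and uniformly Lipschitz; 4. there are $C,\delta>0$ with $\sup_{\xi\in\mathcal K}|f_{X_h}(\xi)-f_{X_0}(\xi)|\le Ch^{\frac14+\delta}$ for all $h\in\mathcal H$ and all compact $\mathcal K\subset\mathbb R$. Let $$\bar\lambda_2=\inf_{h\in\overline{\mathcal H}}\min\Big(\tfrac34V_h''(\xi^h_\star),\ 4\|V_h''\|_\infty\frac{V_h''(\xi^h_\star)^4}{4[V_h'']_{\rm Lip}^2}\Big),\qquad k_\alpha=\max\Big(1,\frac\alpha{1-\alpha}\Big).$$ **Algorithm.** Fix integers $K_0\ge1$, $M\ge2$, let $h_0=1/K_0$ and $h_\ell=h_0/M^\ell$. Given $\gamma_n=\gamma_1n^{-\beta}$ ($\gamma_1>0$), a scheme with initial value $(\xi_0,\chi_0)$ and samples $x_1,x_2,\dots$ iterates $$\xi_{n+1}=\xi_n-\gamma_{n+1}\Big(1-\frac{\mathbf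 1_{x_{n+1}\ge\xi_n}}{1-\alpha}\Big),\qquad \chi_{n+1}=\chi_n-\frac1{n+1}\Big(\chi_n-\xi_n-\frac{(x_{n+1}-\xi_n)^+}{1-\alpha}\Big).$$ At level $0$, $N_0$ iterations are run with i.i.d. copies of $X_{h_0}$; at level $\ell\in\{1,\dots,L\}$, $N_\ell$ iterations of a fine and of a coarse scheme are run with i.i.d. copies of the pair $(X_{h_\ell},X_{h_{\ell-1}})$ (built from the same copy of $Y$ and the same inner copies of $Z$, of which the coarse one uses the first $K_0M^{\ell-1}$). The samples of all levels are independent, and independent of the initializations. The MLSA estimator is $$(\xi^{\rm ML}_{\mathbf N},\chi^{\rm ML}_{\mathbf N})=(\xi^{h_0}_{N_0},\chi^{h_0}_{N_0})+\sum_{\ell=1}^L\big\{(\xi^{h_\ell}_{N_\ell},\chi^{h_\ell}_{N_\ell})-(\xi^{h_{\ell-1}}_{N_\ell},\chi^{h_{\ell-1}}_{N_\ell})\big\}.$$ Over all the initializations $(\xi_0,\chi_0)$ used, $\sup\mathbb E\big[|\xi_0|^4\exp\big(\frac{16}{1-\alpha}k_\alpha\sup_{h\in\overline{\mathcal H}}\|f_{X_h}\|_\infty|\xi_0|\big)\big]+\sup\mathbb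 E[\chi_0^2]<\infty$. The cost counts, with fixed positive unit costs, every initialization, simulated copy of $Y$ and of $Z$, evaluation of $\varphi$, update of a pair $(\xi,\chi)$, and final addition or subtraction. **Scenarios.** Assume one of the following and define $\epsilon(h)$ accordingly. (a) $\mathbb E\big[|\varphi(Y,Z)-\mathbb E[\varphi(Y,Z)|Y]|^{p_*}\big]<\infty$ for some $p_*>1$; $\epsilon(h)=h^{\frac{p_*}{2(1+p_*)}}$. (b) For some $C_g\ge0$ and all $u\in\mathbb R$, $\mathbb E\big[\exp(u(\varphi(Y,Z)-\mathbb E[\varphi(Y,Z)|Y]))\big|Y\big]\le e^{C_gu^2}$ a.s.; $\epsilon(h)=h^{\frac12}|\ln h|^{\frac12}$. (c) With $G_\ell=h_\ell^{-1/2}(X_{h_\ell}-X_{h_{\ell-1}})$ and $K_\ell(g)$ the best Lipschitz constant of $x\mapsto\mathbb P(X_{h_{\ell-1}}\le x\mid G_\ell=g)$, $\sup_{\ell\ge1}\mathbb E[|G_\ell|K_\ell(G_\ell)]<\infty$; $\epsilon(h)=h^{\frac12}$. **Theorem.** For $\varepsilon\in(0,h_0)$ let $L=\lceil\ln(h_0\varepsilon^{-1})/\ln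 M\rceil$. Constants $C$ below do not depend on $\varepsilon$. (i) (VaR focused) In scenario (b) suppose moreover $h_0<1$. Let $\beta\in(0,1]$, $\gamma_1>0$, with $\bar\lambda_2\gamma_1>2$ if $\beta=1$, let $\kappa>0$ be any constant, and set, for $0\le\ell\le L$, $$N_\ell=\bigg\lceil(\kappa\gamma_1)^{\frac1\beta}\varepsilon^{-\frac2\beta}\Big(\sum_{\ell'=0}^Lh_{\ell'}^{-\frac\beta{1+\beta}}\epsilon(h_{\ell'})^{\frac1{1+\beta}}\Big)^{\frac1\beta}h_\ell^{\frac1{1+\beta}}\epsilon(h_\ell)^{\frac1{1+\beta}}\bigg\rceil .$$ Then $\mathbb E[(\xi^{\rm ML}_{\mathbf N}-\xi^{h_L}_\star)^2]^{1/2}\le C\varepsilon$ for all $\varepsilon\in(0,h_0)$. The order of the cost is smallest for $\beta=1$ (with $\bar\lambda_2\gamma_1>2$): the cost for $\beta=1$ is at most $C$ times the cost for any other $\beta\in(0,1]$ (and any $\gamma_1,\kappa>0$), for all $\varepsilon\in(0,h_0)$; and for $\beta=1$ it satisfies, for all $\varepsilon\in(0,h_0)$, $$\mathrm{Cost}\le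 C\begin{cases}\varepsilon^{-3+\frac{p_*}{2(1+p_*)}}&\text{in scenario (a)},\\ \varepsilon^{-\frac52}|\ln\varepsilon|^{\frac12}&\text{in scenario (b)},\\ \varepsilon^{-\frac52}&\text{in scenario (c)}.\end{cases}$$ (ii) (ES focused) Let $\beta=1$, $\bar\lambda_2\gamma_1>2$, let $\kappa>0$ be any constant, and set $N_\ell=\lceil\kappa\varepsilon^{-2}Lh_\ell\rceil$ for $0\le\ell\le L$. Then $\mathbb E[(\chi^{\rm ML}_{\mathbf N}-\chi^{h_L}_\star)^2]^{1/2}\le C\varepsilon$ for all $\varepsilon\in(0,h_0)$, and, for every $\varepsilon_0\in(0,1)$ there is $C$ with $\mathrm{Cost}\le C\varepsilon^{-2}|\ln\varepsilon|^2$ for all $\varepsilon\in(0,h_0)$ with $\varepsilon\le\varepsilon_0$. -/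

import Mathlib

open MeasureTheory ProbabilityTheory Filter Topology Set

noncomputable section

namespace MLSA

/-! ### The nested loss and its approximations -/

section Loss

variable {Ω : Type*} [MeasurableSpace Ω] {d q : ℕ}

/-- The mean `(1/K) ∑_{k < K} φ(y, z_k)` of the first `K` inner simulations. -/
def innerMean (φ : (Fin d → ℝ) → (Fin q → ℝ) → ℝ) (K : ℕ) (y : Fin d → ℝ)
    (z : ℕ → Fin q → ℝ) : ℝ :=
  (∑ k ∈ Finset.range K, φ y (z k)) / K

/-- The bias parameter `h ∈ {0} ∪ {1/K : K ≥ 1}` is encoded by a natural number `K`: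
`K ≥ 1` stands for `h = 1/K`, and `K = 0` stands for `h = 0` (recall `0⁻¹ = 0` in Lean). -/
def bias (K : ℕ) : ℝ := (K : ℝ)⁻¹

/-- The loss `X_h`: `X_0 = E[φ(Y, Z) | Y]` (with `Z` the first variable of the i.i.d. sequence),
and `X_{1/K} = (1/K) ∑_{k ≤ K} φ(Y, Z^{(k)})` for `K ≥ 1`. -/
def loss (μ : Measure Ω) (φ : (Fin d → ℝ) → (Fin q → ℝ) → ℝ) (Y : Ω → Fin d → ℝ)
    (Z : ℕ → Ω → Fin q → ℝ) (K : ℕ) : Ω → ℝ :=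
  if K = 0 then condExp (MeasurableSpace.comap Y inferInstance) μ (fun ω => φ (Y ω) (Z 0 ω))
  else fun ω => innerMean φ K (Y ω) (fun k => Z k ω)

/-- `Y, Z 0, Z 1, …` are mutually independent random vectors and the `Z k` are identically
distributed. -/
structure IsGeneric (μ : Measure Ω) (Y : Ω → Fin d → ℝ) (Z : ℕ → Ω → Fin q → ℝ) : Prop where
  measurable_Y : Measurable Y
  measurable_Z : ∀ k, Measurable (Z k)
  ident_Z : ∀ k, IdentDistrib (Z k) (Z 0) μ μ
  indep : iIndep (fun i : Option ℕ => match i with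
    | none => MeasurableSpace.comap Y inferInstance
    | some k => MeasurableSpace.comap (Z k) inferInstance) μ

/-- `V(ξ) = ξ + E[(X - ξ)^+] / (1 - α)`. -/
def objective (μ : Measure Ω) (α : ℝ) (X : Ω → ℝ) (ξ : ℝ) : ℝ :=
  ξ + (1 - α)⁻¹ * ∫ ω, max (X ω - ξ) 0 ∂μ

/-- `f` is the continuous probability density function of `X`. -/
structure IsContinuousPDF (μ : Measure Ω) (X : Ω → ℝ) (f : ℝ → ℝ) : Prop where
  continuous : Continuous f
  nonneg : ∀ x, 0 ≤ f x
  law : μ.map X = (volume : Measure ℝ).withDensity (fun x => ENNReal.ofReal (f x))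

end Loss

/-! ### Norms and constants -/

/-- The supremum norm (for bounded functions). -/
def supNorm (f : ℝ → ℝ) : ℝ := ⨆ x, |f x|

/-- The best Lipschitz constant (for Lipschitz functions). -/
def lipConst (f : ℝ → ℝ) : ℝ := ⨆ p : ℝ × ℝ, |f p.1 - f p.2| / |p.1 - p.2|

/-- `k_α = 1 ∨ α / (1 - α)`. -/
def kAlpha (α : ℝ) : ℝ := max 1 (α / (1 - α))

/-- For `V` with minimiser `ξs`, the constant
`(3/8) q V''(ξs) ∧ q² ‖V''‖_∞ V''(ξs)⁴ / (4 [V'']_Lip²)`. -/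
def lyapunovRate (q : ℕ) (V : ℝ → ℝ) (ξs : ℝ) : ℝ :=
  min (3 / 8 * q * iteratedDeriv 2 V ξs)
    ((q : ℝ) ^ 2 * supNorm (iteratedDeriv 2 V) *
      (iteratedDeriv 2 V ξs ^ 4 / (4 * lipConst (iteratedDeriv 2 V) ^ 2)))

/-- The infimum `λ̄_q` of the preceding constants over all bias parameters. -/
def lambdaBar (q : ℕ) (V : ℕ → ℝ → ℝ) (ξs : ℕ → ℝ) : ℝ :=
  ⨅ K : ℕ, lyapunovRate q (V K) (ξs K)

/-! ### Assumptions on the family of losses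

Here `X K`, `V K`, `f K` are the loss, its objective function and its density at bias
parameter `bias K`. -/

section Assumptions

variable {Ω : Type*} [MeasurableSpace Ω]

/-- First order expansion of the distribution functions in the bias parameter. -/
def WeakExpansion (μ : Measure Ω) (X : ℕ → Ω → ℝ) (V : ℕ → ℝ → ℝ) : Prop :=
  ∃ (v : ℝ → ℝ) (w : ℝ → ℕ → ℝ),
    (∀ K : ℕ, 1 ≤ K → ∀ ξ : ℝ,
      μ.real {ω | X K ω ≤ ξ} - μ.real {ω | X 0 ω ≤ ξ} = v ξ * bias K + w ξ K * bias K) ∧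
    ∀ ξ₀ : ℝ, (∀ ξ, V 0 ξ₀ ≤ V 0 ξ) →
      IntegrableOn v (Ioi ξ₀) ∧
      Tendsto (fun K => w ξ₀ K) atTop (𝓝 0) ∧
      Tendsto (fun K => ∫ ξ in Ioi ξ₀, w ξ K) atTop (𝓝 0)

/-- The densities are bounded away from zero on bounded sets, uniformly in the bias parameter. -/
def UniformlyPositive (f : ℕ → ℝ → ℝ) (ξ₀ : ℝ) : Prop :=
  ∀ R : ℝ, 0 < R → ∃ c : ℝ, 0 < c ∧ ∀ K : ℕ, ∀ ξ ∈ Metric.ball ξ₀ R, c ≤ f K ξ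

/-- The densities are uniformly bounded and uniformly Lipschitz. -/
def UniformlyBoundedLipschitz (f : ℕ → ℝ → ℝ) : Prop :=
  ∃ C : ℝ, ∀ K : ℕ, (∀ x, |f K x| ≤ C) ∧ ∀ x y, |f K x - f K y| ≤ C * |x - y|

/-- Rate `h^{1/4 + δ}` for the convergence of the densities. -/
def DensityRate (f : ℕ → ℝ → ℝ) : Prop :=
  ∃ C δ : ℝ, 0 < C ∧ 0 < δ ∧ ∀ K : ℕ, 1 ≤ K → ∀ S : Set ℝ, IsCompact S →
    ∀ ξ ∈ S, |f K ξ - f 0 ξ| ≤ C * bias K ^ (1 / 4 + δ)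

end Assumptions

/-! ### The three integrability scenarios -/

/-- Finite `p`-th moment, Gaussian concentration, or Lipschitz conditional distribution functions. -/
inductive Scenario where
  | moment (p : ℝ)
  | gaussian
  | lipschitz

namespace Scenario

/-- The function `ϵ(h)` attached to each scenario. -/
def rate : Scenario → ℝ → ℝ
  | moment p, h => h ^ (p / (2 * (1 + p)))
  | gaussian, h => h ^ (1 / 2 : ℝ) * |Real.log h| ^ (1 / 2 : ℝ)
  | lipschitz, h => h ^ (1 / 2 : ℝ)

/-- The complexity order of the VaR focused parametrization in each scenario. -/
def complexity : Scenario → ℝ → ℝ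
  | moment p, ε => ε ^ (-3 + p / (2 * (1 + p)))
  | gaussian, ε => ε ^ (-5 / 2 : ℝ) * |Real.log ε| ^ (1 / 2 : ℝ)
  | lipschitz, ε => ε ^ (-5 / 2 : ℝ)

section

variable {Ω : Type*} [MeasurableSpace Ω] {d q : ℕ}

/-- `G_{ℓ+1} = h_{ℓ+1}^{-1/2} (X_{h_{ℓ+1}} - X_{h_ℓ})`, where `h_ℓ = 1 / (K₀ M^ℓ)`. -/
def increment (X : ℕ → Ω → ℝ) (K₀ M ℓ : ℕ) (ω : Ω) : ℝ :=
  bias (K₀ * M ^ (ℓ + 1)) ^ (-1 / 2 : ℝ) * (X (K₀ * M ^ (ℓ + 1)) ω - X (K₀ * M ^ ℓ) ω)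

/-- The best Lipschitz constant in `[0, ∞]` of the distribution function of `X_{h_ℓ}`
conditionally on `G_{ℓ+1} = g`. -/
def condLip (μ : Measure Ω) [IsFiniteMeasure μ] (X : ℕ → Ω → ℝ) (K₀ M ℓ : ℕ) (g : ℝ) : ENNReal :=
  ⨆ (x : ℝ) (y : ℝ) (_ : x ≠ y), ENNReal.ofReal
    (|(condDistrib (X (K₀ * M ^ ℓ)) (increment X K₀ M ℓ) μ g).real (Iic x) -
      (condDistrib (X (K₀ * M ^ ℓ)) (increment X K₀ M ℓ) μ g).real (Iic y)| / |x - y|)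

/-- The integrability condition defining each scenario. -/
def Holds (μ : Measure Ω) [IsFiniteMeasure μ] (φ : (Fin d → ℝ) → (Fin q → ℝ) → ℝ)
    (Y : Ω → Fin d → ℝ) (Z : ℕ → Ω → Fin q → ℝ) (K₀ M : ℕ) : Scenario → Prop
  | moment p => 1 < p ∧
      Integrable (fun ω => |φ (Y ω) (Z 0 ω) - loss μ φ Y Z 0 ω| ^ p) μ
  | gaussian => ∃ Cg : ℝ, 0 ≤ Cg ∧ ∀ u : ℝ,
      Integrable (fun ω => Real.exp (u * (φ (Y ω) (Z 0 ω) - loss μ φ Y Z 0 ω))) μ ∧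
      ∀ᵐ ω ∂μ, condExp (MeasurableSpace.comap Y inferInstance) μ
        (fun ω => Real.exp (u * (φ (Y ω) (Z 0 ω) - loss μ φ Y Z 0 ω))) ω ≤ Real.exp (Cg * u ^ 2)
  | lipschitz => (⨆ ℓ : ℕ, ∫⁻ ω, ENNReal.ofReal |increment (loss μ φ Y Z) K₀ M ℓ ω| *
      condLip μ (loss μ φ Y Z) K₀ M ℓ (increment (loss μ φ Y Z) K₀ M ℓ ω) ∂μ) < ⊤

end

end Scenario

/-! ### The multilevel stochastic approximation algorithm -/

/-- `H₁(ξ, x) = 1 - 1_{x ≥ ξ} / (1 - α)`. -/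
def H₁ (α ξ x : ℝ) : ℝ := 1 - (1 - α)⁻¹ * (if ξ ≤ x then 1 else 0)

/-- `H₂(ξ, χ, x) = χ - (ξ + (x - ξ)^+ / (1 - α))`. -/
def H₂ (α ξ χ x : ℝ) : ℝ := χ - (ξ + (1 - α)⁻¹ * max (x - ξ) 0)

/-- The learning rates `γ_n = γ₁ n^{-β}`. -/
def stepSize (γ₁ β : ℝ) (n : ℕ) : ℝ := γ₁ * (n : ℝ) ^ (-β)

/-- The two-time-scale iterates `(ξ_n, χ_n)` started from `θ₀ = (ξ_0, χ_0)` and driven by the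
samples `x`; the sample used in iteration `n + 1` is `x n`. -/
def iterate (α : ℝ) (γ : ℕ → ℝ) (θ₀ : ℝ × ℝ) (x : ℕ → ℝ) : ℕ → ℝ × ℝ
  | 0 => θ₀
  | n + 1 =>
    let θ := iterate α γ θ₀ x n
    (θ.1 - γ (n + 1) * H₁ α θ.1 (x n), θ.2 - 1 / ((n : ℝ) + 1) * H₂ α θ.1 θ.2 (x n))

section Algorithm

variable {Ω : Type*} {d q : ℕ}

/-- The iterates at level `ℓ` computed with `K` inner simulations per outer simulation.
Within a level, the outer simulations `Ys ℓ n` and inner simulations `Zs ℓ n k` are shared between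
different values of `K`. -/
def levelIterate (α : ℝ) (γ : ℕ → ℝ) (φ : (Fin d → ℝ) → (Fin q → ℝ) → ℝ)
    (Ys : ℕ → ℕ → Ω → Fin d → ℝ) (Zs : ℕ → ℕ → ℕ → Ω → Fin q → ℝ)
    (ℓ K : ℕ) (θ₀ : Ω → ℝ × ℝ) (n : ℕ) (ω : Ω) : ℝ × ℝ :=
  iterate α γ (θ₀ ω) (fun i => innerMean φ K (Ys ℓ i ω) (fun k => Zs ℓ i k ω)) n

/-- The multilevel estimator `(ξ^ML, χ^ML)` with `L` levels, base number `K₀` of inner simulations,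
refinement factor `M` and `N ℓ` iterations at level `ℓ`. The initialization at level `ℓ` is
`θ₀ ℓ true` for the fine scheme and `θ₀ ℓ false` for the coarse one (unused for `ℓ = 0`). -/
def estimator (α : ℝ) (γ : ℕ → ℝ) (φ : (Fin d → ℝ) → (Fin q → ℝ) → ℝ)
    (Ys : ℕ → ℕ → Ω → Fin d → ℝ) (Zs : ℕ → ℕ → ℕ → Ω → Fin q → ℝ)
    (θ₀ : ℕ → Bool → Ω → ℝ × ℝ) (K₀ M L : ℕ) (N : ℕ → ℕ) (ω : Ω) : ℝ × ℝ :=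
  levelIterate α γ φ Ys Zs 0 K₀ (θ₀ 0 true) (N 0) ω +
    ∑ ℓ ∈ Finset.Icc 1 L,
      (levelIterate α γ φ Ys Zs ℓ (K₀ * M ^ ℓ) (θ₀ ℓ true) (N ℓ) ω -
        levelIterate α γ φ Ys Zs ℓ (K₀ * M ^ (ℓ - 1)) (θ₀ ℓ false) (N ℓ) ω)

/-- Labels of the independent sources of randomness used by the algorithm: the initializations
(jointly), the outer simulations, the inner simulations. -/
inductive Source where
  | init
  | outer (ℓ n : ℕ)
  | inner (ℓ n k : ℕ)

/-- The σ-algebra generated by a source. -/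
@[reducible]
def Source.sigma (Ys : ℕ → ℕ → Ω → Fin d → ℝ) (Zs : ℕ → ℕ → ℕ → Ω → Fin q → ℝ)
    (θ₀ : ℕ → Bool → Ω → ℝ × ℝ) : Source → MeasurableSpace Ω
  | init => ⨆ (ℓ : ℕ) (j : Bool), MeasurableSpace.comap (θ₀ ℓ j) inferInstance
  | outer ℓ n => MeasurableSpace.comap (Ys ℓ n) inferInstance
  | inner ℓ n k => MeasurableSpace.comap (Zs ℓ n k) inferInstance

/-- The simulations at all levels and iterations are independent copies of `Y` and `Z`, and the
family of initializations is independent of them. -/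
structure IsSimulation [MeasurableSpace Ω] (μ : Measure Ω) (Y : Ω → Fin d → ℝ)
    (Z : Ω → Fin q → ℝ) (Ys : ℕ → ℕ → Ω → Fin d → ℝ) (Zs : ℕ → ℕ → ℕ → Ω → Fin q → ℝ)
    (θ₀ : ℕ → Bool → Ω → ℝ × ℝ) : Prop where
  measurable_Ys : ∀ ℓ n, Measurable (Ys ℓ n)
  measurable_Zs : ∀ ℓ n k, Measurable (Zs ℓ n k)
  measurable_init : ∀ ℓ j, Measurable (θ₀ ℓ j)
  ident_Ys : ∀ ℓ n, IdentDistrib (Ys ℓ n) Y μ μ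
  ident_Zs : ∀ ℓ n k, IdentDistrib (Zs ℓ n k) Z μ μ
  indep : iIndep (Source.sigma Ys Zs θ₀) μ

/-- `sup E[|ξ_0|⁴ exp(16 k_α F |ξ_0| / (1 - α))] + sup E[χ_0²] < ∞`, with suprema over all the
initializations; `F` is a bound of the densities. -/
def InitMoment [MeasurableSpace Ω] (μ : Measure Ω) (α F : ℝ) (θ₀ : ℕ → Bool → Ω → ℝ × ℝ) : Prop :=
  (⨆ (ℓ : ℕ) (j : Bool), ∫⁻ ω, ENNReal.ofReal (|(θ₀ ℓ j ω).1| ^ 4 *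
      Real.exp (16 / (1 - α) * kAlpha α * F * |(θ₀ ℓ j ω).1|)) ∂μ) +
    (⨆ (ℓ : ℕ) (j : Bool), ∫⁻ ω, ENNReal.ofReal ((θ₀ ℓ j ω).2 ^ 2) ∂μ) < ⊤

end Algorithm

/-! ### Computational cost -/

/-- Unit costs of the elementary tasks of the algorithm. -/
structure UnitCosts where
  /-- choosing the initialization of one scheme -/
  init : ℝ
  /-- simulating a copy of `Y` -/
  drawY : ℝ
  /-- simulating a copy of `Z` -/
  drawZ : ℝ
  /-- evaluating `φ` and adding the result to a running sum -/
  evalφ : ℝ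
  /-- one update of a pair `(ξ, χ)` -/
  update : ℝ
  /-- adding a pair `(ξ, χ)` to, or subtracting it from, the output -/
  combine : ℝ
  init_pos : 0 < init
  drawY_pos : 0 < drawY
  drawZ_pos : 0 < drawZ
  evalφ_pos : 0 < evalφ
  update_pos : 0 < update
  combine_pos : 0 < combine

/-- The number of schemes run in parallel at level `ℓ`: a single one at level `0`, and the coarse
and the fine one at the other levels. -/
def numSchemes (ℓ : ℕ) : ℕ := if ℓ = 0 then 1 else 2

/-- The cost of one iteration at level `ℓ`: one copy of `Y`, `K₀ M^ℓ` copies of `Z`, as many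
evaluations of `φ`, and one update per scheme. -/
def iterationCost (c : UnitCosts) (K₀ M ℓ : ℕ) : ℝ :=
  c.drawY + ∑ _k ∈ Finset.range (K₀ * M ^ ℓ), (c.drawZ + c.evalφ) + numSchemes ℓ * c.update

/-- The total cost of one run of the algorithm. -/
def cost (c : UnitCosts) (K₀ M L : ℕ) (N : ℕ → ℕ) : ℝ :=
  ∑ ℓ ∈ Finset.range (L + 1),
    (numSchemes ℓ * c.init + ∑ _n ∈ Finset.range (N ℓ), iterationCost c K₀ M ℓ +
      numSchemes ℓ * c.combine)

/-! ### Choice of the parameters -/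

/-- `L = ⌈ln(h₀ / ε) / ln M⌉`, where `h₀ = 1 / K₀`. -/
def numLevels (K₀ M : ℕ) (ε : ℝ) : ℕ := ⌈Real.log (bias K₀ / ε) / Real.log M⌉₊

/-- The bias parameter `h_ℓ = 1 / (K₀ M^ℓ)`. -/
def levelBias (K₀ M ℓ : ℕ) : ℝ := bias (K₀ * M ^ ℓ)

/-- The VaR focused number of iterations
`⌈(κ γ₁)^{1/β} ε^{-2/β} (∑_{ℓ' ≤ L} h_{ℓ'}^{-β/(1+β)} ϵ(h_{ℓ'})^{1/(1+β)})^{1/β}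
  h_ℓ^{1/(1+β)} ϵ(h_ℓ)^{1/(1+β)}⌉`. -/
def itersVaR (s : Scenario) (κ γ₁ β : ℝ) (K₀ M : ℕ) (ε : ℝ) (ℓ : ℕ) : ℕ :=
  ⌈(κ * γ₁) ^ (1 / β) * ε ^ (-2 / β) *
    (∑ i ∈ Finset.range (numLevels K₀ M ε + 1),
      levelBias K₀ M i ^ (-β / (1 + β)) * s.rate (levelBias K₀ M i) ^ (1 / (1 + β))) ^ (1 / β) *
    levelBias K₀ M ℓ ^ (1 / (1 + β)) * s.rate (levelBias K₀ M ℓ) ^ (1 / (1 + β))⌉₊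

/-- The ES focused number of iterations `⌈κ ε^{-2} L h_ℓ⌉`. -/
def itersES (κ : ℝ) (K₀ M : ℕ) (ε : ℝ) (ℓ : ℕ) : ℕ :=
  ⌈κ * ε ^ (-2 : ℝ) * numLevels K₀ M ε * levelBias K₀ M ℓ⌉₊

/-- The cost of the algorithm under the VaR focused parametrization. -/
def costVaR (c : UnitCosts) (s : Scenario) (κ γ₁ β : ℝ) (K₀ M : ℕ) (ε : ℝ) : ℝ :=
  cost c K₀ M (numLevels K₀ M ε) (itersVaR s κ γ₁ β K₀ M ε)

/-- The cost of the algorithm under the ES focused parametrization. -/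
def costES (c : UnitCosts) (κ : ℝ) (K₀ M : ℕ) (ε : ℝ) : ℝ :=
  cost c K₀ M (numLevels K₀ M ε) (itersES κ K₀ M ε)

end MLSA

end

noncomputable section

namespace MLSA

/-! ### Integrating out one of two independent variables -/

section Independence

variable {Ω : Type*} {mΩ : MeasurableSpace Ω} {μ : Measure Ω} [IsProbabilityMeasure μ]
  {β γ : Type*} [MeasurableSpace β] [MeasurableSpace γ]

/-! The proof combines two estimates that are uniform in the bias `h` (moments of one scheme, and
the difference of two coupled schemes) with orthogonality between levels. The choice of the
parameters then reduces to geometric sums.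

One scheme. `V_h` is convex with derivative `(F_h - α)/(1 - α)`, and `ξ_n` is stochastic gradient
descent on it with bounded increments. Since `V_h` grows only linearly at infinity, powers of `U =
V_h - V_h(ξ⋆)` do not contract at a uniform rate, but `exp(mU) - 1 - mU` does, with `m = 16A` and `A
= sup ‖f_h‖/(1 - α)`. Near the minimiser the contraction comes from strong convexity, far away from
a lower bound on the gradient, and both regimes together allow the rate `lambdaBar 2`
(`isPotential_of_lipschitz`, `lyap_step`). This Lyapunov function dominates `(ξ - ξ⋆)⁴`, so a
discrete Gronwall lemma (`recursion_le`) yields `E|ξ_n - ξ⋆|⁴ ≤ D γ_n²` (`Setup.moment_four`). For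
`β = 1` the condition `λ̄ γ₁ > 2` says that the contraction beats the decay of `γ_n² ~ n⁻²`.

VaR, one level. With the common slope `λ = V_0''(ξ⋆_0)` for all levels, the difference of the fine
and coarse errors splits into `noisePart`, a linear recursion started at zero and driven by centred
noise, and `biasPart`, driven by the linearization errors. The noise variance is the probability
that the fine and coarse losses fall on different sides of their thresholds. It is of order
`γ_n^{1/2} + h + ϵ(h)`, where `ϵ(h)` comes from the scenario: moments of partial sums and Markov, a
Chernoff bound, or the conditional Lipschitz property (`Setup.exists_rate`). The linearization error
at `y` is `O(y² + h^{1/4+δ}|y|)`, so the bias part is `O(γ_n + h^{1/4+δ} γ_n^{1/2})` in `L²`.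

ES, one level. As the averaging steps are `1/(n+1)`, `χ_n` is an exact empirical mean. Its error is
a martingale of variance `O((log n)/n² + h/n)` plus an average of `V(ξ_k) - V(ξ⋆) = O(|ξ_k - ξ⋆|²)`,
which the fourth moments bound in `L²` by `O((log n)/n)`.

All levels. The noise of an iteration is centred given every source of randomness except the samples
of that iteration. Noises of different levels are therefore orthogonal even if the initializations
are dependent. Squares of noise terms add up over the levels, while bias and drift terms are added
by the triangle inequality.

Parameters. The VaR choice makes `ϵ(h_ℓ) γ_{N_ℓ}` at most `ε²/κ` times the share of level `ℓ` in a
sum of weights. Since `ϵ(h_ℓ) ≥ a √ε`, the remaining terms are `O(ε)` as well. For `β = 1` the cost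
is dominated by the finest level, hence of order `ε⁻² ϵ(h_L)/h_L`; for any `β` the finest level
alone costs at least that much up to a constant, because `y^{1/β}` dominates `y = ε⁻² ϵ(h_L)`, which
stays away from zero. For the ES, the factor `L` in `N_ℓ` cancels both the number of levels and the
logarithms. -/

theorem integrable_prod_of_indepFun {A : Ω → β} {B : Ω → γ} (hA : Measurable A)
    (hB : Measurable B) (h : IndepFun A B μ) {Ψ : β × γ → ℝ} (hΨ : Measurable Ψ)
    (hint : Integrable (fun ω => Ψ (A ω, B ω)) μ) :
    Integrable Ψ ((μ.map A).prod (μ.map B)) := by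
  rw [← (indepFun_iff_map_prod_eq_prod_map_map hA.aemeasurable hB.aemeasurable).1 h]
  exact (integrable_map_measure hΨ.aestronglyMeasurable (hA.prodMk hB).aemeasurable).2 hint

theorem integral_comp_indepFun {A : Ω → β} {B : Ω → γ} (hA : Measurable A) (hB : Measurable B)
    (h : IndepFun A B μ) {Ψ : β × γ → ℝ} (hΨ : Measurable Ψ)
    (hint : Integrable (fun ω => Ψ (A ω, B ω)) μ) :
    ∫ ω, Ψ (A ω, B ω) ∂μ = ∫ ω, ∫ b, Ψ (A ω, b) ∂(μ.map B) ∂μ := by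
  have : IsProbabilityMeasure (μ.map B) := Measure.isProbabilityMeasure_map hB.aemeasurable
  have : IsProbabilityMeasure (μ.map A) := Measure.isProbabilityMeasure_map hA.aemeasurable
  have hi := integrable_prod_of_indepFun hA hB h hΨ hint
  calc ∫ ω, Ψ (A ω, B ω) ∂μ = ∫ p, Ψ p ∂(μ.map (fun ω => (A ω, B ω))) :=
        (integral_map (hA.prodMk hB).aemeasurable hΨ.aestronglyMeasurable).symm
    _ = ∫ p, Ψ p ∂((μ.map A).prod (μ.map B)) := by
        rw [(indepFun_iff_map_prod_eq_prod_map_map hA.aemeasurable hB.aemeasurable).1 h]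
    _ = ∫ a, ∫ b, Ψ (a, b) ∂(μ.map B) ∂(μ.map A) := integral_prod _ hi
    _ = _ := integral_map hA.aemeasurable
        (hΨ.stronglyMeasurable.integral_prod_right' (ν := μ.map B)).aestronglyMeasurable

theorem integrable_comp_indepFun {A : Ω → β} {B : Ω → γ} (hA : Measurable A) (hB : Measurable B)
    (h : IndepFun A B μ) {Ψ : β × γ → ℝ} (hΨ : Measurable Ψ)
    (hint : Integrable (fun ω => Ψ (A ω, B ω)) μ) :
    Integrable (fun ω => ∫ b, Ψ (A ω, b) ∂(μ.map B)) μ := by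
  have : IsProbabilityMeasure (μ.map B) := Measure.isProbabilityMeasure_map hB.aemeasurable
  have hi := (integrable_prod_of_indepFun hA hB h hΨ hint).integral_prod_left
  exact (integrable_map_measure hi.aestronglyMeasurable hA.aemeasurable).1 hi

theorem lintegral_comp_indepFun {A : Ω → β} {B : Ω → γ} (hA : Measurable A) (hB : Measurable B)
    (h : IndepFun A B μ) {Ψ : β × γ → ENNReal} (hΨ : Measurable Ψ) :
    ∫⁻ ω, Ψ (A ω, B ω) ∂μ = ∫⁻ ω, ∫⁻ b, Ψ (A ω, b) ∂(μ.map B) ∂μ := by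
  have : IsProbabilityMeasure (μ.map B) := Measure.isProbabilityMeasure_map hB.aemeasurable
  calc ∫⁻ ω, Ψ (A ω, B ω) ∂μ = ∫⁻ p, Ψ p ∂(μ.map (fun ω => (A ω, B ω))) :=
        (lintegral_map hΨ (hA.prodMk hB)).symm
    _ = ∫⁻ p, Ψ p ∂((μ.map A).prod (μ.map B)) := by
        rw [(indepFun_iff_map_prod_eq_prod_map_map hA.aemeasurable hB.aemeasurable).1 h]
    _ = ∫⁻ a, ∫⁻ b, Ψ (a, b) ∂(μ.map B) ∂(μ.map A) := lintegral_prod _ hΨ.aemeasurable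
    _ = _ := lintegral_map hΨ.lintegral_prod_right' hA

/-- Conditioning on the first of two independent variables amounts to integrating the second
one out. -/
theorem condExp_comap_of_indepFun {A : Ω → β} {B : Ω → γ} (hA : Measurable A) (hB : Measurable B)
    (h : IndepFun A B μ) {Ψ : β × γ → ℝ} (hΨ : Measurable Ψ)
    (hint : Integrable (fun ω => Ψ (A ω, B ω)) μ) :
    condExp (MeasurableSpace.comap A inferInstance) μ (fun ω => Ψ (A ω, B ω)) =ᵐ[μ]
      fun ω => ∫ b, Ψ (A ω, b) ∂(μ.map B) := by
  have : IsProbabilityMeasure (μ.map B) := Measure.isProbabilityMeasure_map hB.aemeasurable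
  symm
  refine ae_eq_condExp_of_forall_setIntegral_eq hA.comap_le hint
    (fun s _ _ => (integrable_comp_indepFun hA hB h hΨ hint).integrableOn) ?_ ?_
  · rintro _ ⟨t, ht, rfl⟩ -
    -- The indicator of a σ(A)-measurable set is a function of `A`, so it can be put inside the
    -- inner integral.
    have hm : Measurable (fun p : β × γ => t.indicator (fun _ => (1 : ℝ)) p.1 * Ψ p) :=
      ((measurable_const.indicator ht).comp measurable_fst).mul hΨ
    have e : ∀ ω, (A ⁻¹' t).indicator (fun ω => Ψ (A ω, B ω)) ω =
        t.indicator (fun _ => (1 : ℝ)) (A ω) * Ψ (A ω, B ω) := by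
      intro ω; by_cases hω : A ω ∈ t <;> simp [indicator, hω]
    have e' : ∀ ω, (A ⁻¹' t).indicator (fun ω => ∫ b, Ψ (A ω, b) ∂(μ.map B)) ω =
        ∫ b, t.indicator (fun _ => (1 : ℝ)) (A ω) * Ψ (A ω, b) ∂(μ.map B) := by
      intro ω; by_cases hω : A ω ∈ t <;> simp [indicator, hω]
    rw [← integral_indicator (hA ht), ← integral_indicator (hA ht)]
    simp_rw [e, e']
    refine (integral_comp_indepFun hA hB h hm ?_).symm
    have := hint.indicator (hA ht)
    rwa [show (A ⁻¹' t).indicator (fun ω => Ψ (A ω, B ω)) = _ from funext e] at this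
  · refine StronglyMeasurable.aestronglyMeasurable ?_
    exact (hΨ.stronglyMeasurable.integral_prod_right' (ν := μ.map B)).comp_measurable
      (comap_measurable A)

end Independence

/-! ### A discrete Gronwall lemma for decreasing step sizes -/

section Recursion

theorem stepSize_pos {γ₁ : ℝ} (hγ : 0 < γ₁) (β : ℝ) {n : ℕ} (hn : 1 ≤ n) :
    0 < stepSize γ₁ β n := by
  have : (0 : ℝ) < n := by exact_mod_cast hn
  unfold stepSize; positivity

theorem stepSize_le {γ₁ β : ℝ} (hγ : 0 < γ₁) (hβ : 0 ≤ β) {n : ℕ} (hn : 1 ≤ n) :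
    stepSize γ₁ β n ≤ γ₁ := by
  have : (1 : ℝ) ≤ n := by exact_mod_cast hn
  unfold stepSize
  have := Real.rpow_le_one_of_one_le_of_nonpos this (neg_nonpos.2 hβ)
  nlinarith

theorem tendsto_stepSize {γ₁ β : ℝ} (hβ : 0 < β) :
    Tendsto (fun n => stepSize γ₁ β n) atTop (𝓝 0) := by
  have := ((tendsto_rpow_neg_atTop hβ).comp tendsto_natCast_atTop_atTop).const_mul γ₁
  simpa [stepSize] using this

/-- A sequence decreasing at most as fast as `n ^ (-2 β)`. -/
def SlowlyDecreasing (β : ℝ) (w : ℕ → ℝ) : Prop :=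
  ∀ n, 1 ≤ n → 0 ≤ w n ∧ w n ≤ (1 + 1 / (n : ℝ)) ^ (2 * β) * w (n + 1)

theorem SlowlyDecreasing.add {β : ℝ} {w w' : ℕ → ℝ} (h : SlowlyDecreasing β w)
    (h' : SlowlyDecreasing β w') : SlowlyDecreasing β (fun n => w n + w' n) := fun n hn =>
  ⟨add_nonneg (h n hn).1 (h' n hn).1, by linarith [(h n hn).2, (h' n hn).2]⟩

theorem SlowlyDecreasing.const_mul {β c : ℝ} {w : ℕ → ℝ} (h : SlowlyDecreasing β w)
    (hc : 0 ≤ c) : SlowlyDecreasing β (fun n => c * w n) := fun n hn =>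
  ⟨mul_nonneg hc (h n hn).1, by nlinarith [(h n hn).2]⟩

theorem slowlyDecreasing_stepSize_rpow {γ₁ β p : ℝ} (hγ : 0 < γ₁) (hβ : 0 ≤ β)
    (hp2 : p ≤ 2) : SlowlyDecreasing β (fun n => stepSize γ₁ β n ^ p) := by
  intro n hn
  have hn0 : (0 : ℝ) < n := by exact_mod_cast hn
  refine ⟨(Real.rpow_pos_of_pos (stepSize_pos hγ β hn) p).le, ?_⟩
  have e : ∀ m : ℕ, 1 ≤ m → stepSize γ₁ β m ^ p = γ₁ ^ p * (m : ℝ) ^ (-(β * p)) := by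
    intro m hm
    unfold stepSize
    rw [Real.mul_rpow hγ.le (by positivity), ← Real.rpow_mul (by positivity)]
    ring_nf
  have h1 : (n : ℝ) ^ (-(β * p)) = (1 + 1 / (n : ℝ)) ^ (β * p) * ((n + 1 : ℕ) : ℝ) ^ (-(β * p)) := by
    rw [show (1 + 1 / (n : ℝ)) = ((n + 1 : ℕ) : ℝ) * (n : ℝ)⁻¹ by push_cast; field_simp,
      Real.mul_rpow (by positivity) (by positivity), Real.inv_rpow hn0.le, Real.rpow_neg hn0.le,
      Real.rpow_neg (by positivity)]
    field_simp
  have h2 : (1 + 1 / (n : ℝ)) ^ (β * p) ≤ (1 + 1 / (n : ℝ)) ^ (2 * β) :=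
    Real.rpow_le_rpow_of_exponent_le (by simp) (by nlinarith)
  simp only
  rw [e n hn, e (n + 1) (by omega), h1]
  have : 0 ≤ γ₁ ^ p * ((n + 1 : ℕ) : ℝ) ^ (-(β * p)) := by positivity
  nlinarith

/-- `(1 + 1/n)^{2β} ≤ 1 + s γ_{n+1}` asymptotically, when `s γ₁ > 2` or `β < 1`. -/
theorem eventually_ratio_le {γ₁ β s : ℝ} (hγ : 0 < γ₁) (hβ : β ∈ Ioc (0 : ℝ) 1) (hs : 0 < s)
    (h1 : β = 1 → 2 < s * γ₁) :
    ∀ᶠ n : ℕ in atTop, (1 + 1 / (n : ℝ)) ^ (2 * β) ≤ 1 + s * stepSize γ₁ β (n + 1) := by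
  rcases eq_or_lt_of_le hβ.2 with rfl | hlt
  · have h := h1 rfl
    filter_upwards [eventually_ge_atTop (max 1 ⌈(2 * s * γ₁ + 4) / (s * γ₁ - 2)⌉₊)] with n hn
    have hn1 : (1 : ℝ) ≤ n := by exact_mod_cast (le_max_left _ _).trans hn
    have hn2 : (2 * s * γ₁ + 4) / (s * γ₁ - 2) ≤ n :=
      (Nat.le_ceil _).trans (by exact_mod_cast (le_max_right _ _).trans hn)
    rw [div_le_iff₀ (by linarith)] at hn2
    have : (1 + 1 / (n : ℝ)) ^ (2 * 1 : ℝ) = 1 + 2 / n + 1 / n ^ 2 := by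
      rw [mul_one, show (2 : ℝ) = ((2 : ℕ) : ℝ) by norm_num, Real.rpow_natCast]
      field_simp; push_cast; ring
    rw [this, stepSize, Real.rpow_neg_one]
    push_cast
    have e : 1 + s * (γ₁ * ((n : ℝ) + 1)⁻¹) - (1 + 2 / (n : ℝ) + 1 / (n : ℝ) ^ 2) =
      (s * γ₁ * n ^ 2 - (2 * n + 1) * (n + 1)) / (n ^ 2 * (n + 1)) := by
      field_simp; ring
    have : 0 ≤ (s * γ₁ * n ^ 2 - (2 * n + 1) * (n + 1)) / (n ^ 2 * ((n : ℝ) + 1)) := by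
      apply div_nonneg _ (by positivity)
      nlinarith
    linarith
  -- For `β < 1` one has `n γ_n → ∞`, so `s γ_{n+1}` eventually exceeds the `3/n` that bounds the
  -- left side.
  · have ht : Tendsto (fun n : ℕ => (((n + 1 : ℕ) : ℝ)) ^ (1 - β)) atTop atTop :=
      (tendsto_rpow_atTop (by linarith)).comp
        (tendsto_natCast_atTop_atTop.comp (tendsto_add_atTop_nat 1))
    filter_upwards [ht.eventually_ge_atTop (6 / (s * γ₁)), eventually_ge_atTop 1] with n hn hn1
    have hn1' : (1 : ℝ) ≤ n := by exact_mod_cast hn1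
    have hb : (1 + 1 / (n : ℝ)) ^ (2 * β) ≤ 1 + 3 / n := by
      calc (1 + 1 / (n : ℝ)) ^ (2 * β) ≤ (1 + 1 / (n : ℝ)) ^ (2 : ℝ) :=
            Real.rpow_le_rpow_of_exponent_le (by simp) (by nlinarith [hβ.2])
        _ = 1 + 2 / n + 1 / n ^ 2 := by
            rw [show (2 : ℝ) = ((2 : ℕ) : ℝ) by norm_num, Real.rpow_natCast]
            field_simp; push_cast; ring
        _ ≤ 1 + 3 / n := by
            have : 1 / (n : ℝ) ^ 2 ≤ 1 / n := by
              apply one_div_le_one_div_of_le (by positivity); nlinarith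
            have e : 3 / (n : ℝ) = 2 / n + 1 / n := by ring
            linarith
    refine hb.trans ?_
    have hpos : (0 : ℝ) < ((n + 1 : ℕ) : ℝ) := by positivity
    have e2 : ((n + 1 : ℕ) : ℝ) ^ (-β) = ((n + 1 : ℕ) : ℝ) ^ (1 - β) * ((n + 1 : ℕ) : ℝ)⁻¹ := by
      rw [← Real.rpow_neg_one, ← Real.rpow_add hpos]; ring_nf
    have h6 : 6 ≤ s * γ₁ * ((n + 1 : ℕ) : ℝ) ^ (1 - β) := by
      rwa [div_le_iff₀' (by positivity)] at hn
    have h7 : 6 * ((n + 1 : ℕ) : ℝ)⁻¹ ≤ s * stepSize γ₁ β (n + 1) := by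
      rw [stepSize, e2]
      have : 0 ≤ ((n + 1 : ℕ) : ℝ)⁻¹ := by positivity
      nlinarith
    have h8 : 3 / (n : ℝ) ≤ 6 * ((n + 1 : ℕ) : ℝ)⁻¹ := by
      rw [← div_eq_mul_inv, div_le_div_iff₀ (by positivity) hpos]; push_cast; linarith
    linarith

/-- Along `w` one loses at most a factor `1 + s γ_{n+1}` per step with some `s < c`, whereas `a`
contracts by `1 - c γ_{n+1}` up to second order. The bound `C' w n` therefore reproduces itself for
large `n`, with a margin `(c - s)/2 · γ` that absorbs the forcing. The constant depends neither on
`a` nor on `w`, which is what gives uniformity over levels and biases. -/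
theorem recursion_le {γ₁ β c C B : ℝ} (hγ : 0 < γ₁) (hβ : β ∈ Ioc (0 : ℝ) 1) (hc : 0 < c)
    (hc1 : β = 1 → 2 < c * γ₁) (hC : 0 ≤ C) (hB : 0 ≤ B) :
    ∃ C' : ℝ, 0 < C' ∧ ∀ a w : ℕ → ℝ, SlowlyDecreasing β w → (∀ n, 0 ≤ a n) → a 1 ≤ B * w 1 →
      (∀ n, 1 ≤ n → a (n + 1) ≤
        (1 - c * stepSize γ₁ β (n + 1) + C * stepSize γ₁ β (n + 1) ^ 2) * a n +
          B * stepSize γ₁ β (n + 1) * w (n + 1)) →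
      ∀ n, 1 ≤ n → a n ≤ C' * w n := by
  -- For `β = 1`, `s` is the midpoint of `2/γ₁` and `c`.
  obtain ⟨s, hs0, hsc, hs1⟩ : ∃ s, 0 < s ∧ s < c ∧ (β = 1 → 2 < s * γ₁) := by
    by_cases h : β = 1
    · refine ⟨(c + 2 / γ₁) / 2, by positivity, ?_, fun _ => ?_⟩
      · have := (div_lt_iff₀ hγ).2 (hc1 h); linarith
      · have := hc1 h
        have e : (c + 2 / γ₁) / 2 * γ₁ = (c * γ₁ + 2) / 2 := by field_simp
        rw [e]; linarith
    · exact ⟨c / 2, by linarith, by linarith, fun h' => absurd h' h⟩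
  -- With `C2 ≥ c²` the coefficient `1 - cγ + C2 γ²` is nonnegative, so an upper bound on `a n` can
  -- be inserted.
  obtain ⟨C2, hC2, hC2c, hCC2⟩ : ∃ C2, C ≤ C2 ∧ c ^ 2 ≤ C2 ∧ 0 ≤ C2 :=
    ⟨C + c ^ 2, by nlinarith [sq_nonneg c], by linarith, by positivity⟩
  have hev : ∀ᶠ n : ℕ in atTop, (1 + 1 / (n : ℝ)) ^ (2 * β) ≤ 1 + s * stepSize γ₁ β (n + 1) ∧
      C2 * stepSize γ₁ β (n + 1) * (1 + s * γ₁) ≤ (c - s) / 2 := by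
    refine (eventually_ratio_le hγ hβ hs0 hs1).and ?_
    have ht : Tendsto (fun n => C2 * stepSize γ₁ β (n + 1) * (1 + s * γ₁)) atTop (𝓝 0) := by
      have := (((tendsto_stepSize (γ₁ := γ₁) hβ.1).comp (tendsto_add_atTop_nat 1)).const_mul
        C2).mul_const (1 + s * γ₁)
      simpa using this
    exact ht.eventually_le_const (by linarith)
  obtain ⟨n0, hn0⟩ := eventually_atTop.1 hev
  set E : ℝ := 1 + (1 + C2 * γ₁ ^ 2) * 4 + B * γ₁ with hE
  have hE1 : 1 ≤ E := by
    have : 0 ≤ B * γ₁ := by positivity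
    have : 0 ≤ C2 * γ₁ ^ 2 := by positivity
    linarith
  refine ⟨(B + 1) * E ^ (n0 + 1) + 2 * B / (c - s), ?_, ?_⟩
  · have : 0 < c - s := by linarith
    positivity
  intro a w hw ha ha1 hrec
  have hcoef : ∀ n, 1 ≤ n →
      0 ≤ 1 - c * stepSize γ₁ β (n + 1) + C2 * stepSize γ₁ β (n + 1) ^ 2 := by
    intro n hn
    nlinarith [sq_nonneg (c * stepSize γ₁ β (n + 1) - 1 / 2), stepSize_pos hγ β
      (show 1 ≤ n + 1 by omega), sq_nonneg (stepSize γ₁ β (n + 1))]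
  have hrec' : ∀ n, 1 ≤ n → a (n + 1) ≤
        (1 - c * stepSize γ₁ β (n + 1) + C2 * stepSize γ₁ β (n + 1) ^ 2) * a n +
          B * stepSize γ₁ β (n + 1) * w (n + 1) := by
    intro n hn
    refine (hrec n hn).trans ?_
    have : 0 ≤ (C2 - C) * stepSize γ₁ β (n + 1) ^ 2 * a n :=
      mul_nonneg (mul_nonneg (by linarith) (sq_nonneg _)) (ha n)
    linarith
  have hratio : ∀ n : ℕ, 1 ≤ n → (1 + 1 / (n : ℝ)) ^ (2 * β) ≤ 4 := by
    intro n hn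
    have hn1' : (1 : ℝ) ≤ n := by exact_mod_cast hn
    have h2 : 1 + 1 / (n : ℝ) ≤ 2 := by
      have : 1 / (n : ℝ) ≤ 1 := by rw [div_le_one (by positivity)]; exact hn1'
      linarith
    calc (1 + 1 / (n : ℝ)) ^ (2 * β) ≤ (1 + 1 / (n : ℝ)) ^ (2 : ℝ) :=
            Real.rpow_le_rpow_of_exponent_le (by simp) (by nlinarith [hβ.2])
      _ ≤ 2 ^ (2 : ℝ) := Real.rpow_le_rpow (by positivity) h2 (by norm_num)
      _ = 4 := by norm_num
  -- A crude bound growing by the factor `E` per step covers the finitely many `n` before the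
  -- contraction takes over.
  have key1 : ∀ n, 1 ≤ n → a n ≤ (B + 1) * E ^ n * w n := by
    intro n hn
    induction n, hn using Nat.le_induction with
    | base =>
      have := (hw 1 le_rfl).1
      refine ha1.trans (mul_le_mul_of_nonneg_right ?_ this)
      rw [pow_one]; nlinarith
    | succ n hn ih =>
      have hγp := stepSize_pos hγ β (show 1 ≤ n + 1 by omega)
      have hγl := stepSize_le hγ hβ.1.le (show 1 ≤ n + 1 by omega)
      have hw1 := (hw (n + 1) (by omega)).1
      have hEn : 1 ≤ E ^ n := one_le_pow₀ hE1
      have hwn : w n ≤ 4 * w (n + 1) := (hw n hn).2.trans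
        (mul_le_mul_of_nonneg_right (hratio n hn) hw1)
      have hA : a n ≤ (B + 1) * E ^ n * (4 * w (n + 1)) :=
        ih.trans (mul_le_mul_of_nonneg_left hwn (by positivity))
      have hcl : 1 - c * stepSize γ₁ β (n + 1) + C2 * stepSize γ₁ β (n + 1) ^ 2 ≤
          1 + C2 * γ₁ ^ 2 := by
        have : stepSize γ₁ β (n + 1) ^ 2 ≤ γ₁ ^ 2 := pow_le_pow_left₀ hγp.le hγl 2
        nlinarith
      calc a (n + 1) ≤ _ := hrec' n hn
        _ ≤ (1 + C2 * γ₁ ^ 2) * ((B + 1) * E ^ n * (4 * w (n + 1))) +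
            B * γ₁ * ((B + 1) * E ^ n * w (n + 1)) := by
          refine add_le_add (mul_le_mul hcl hA (ha n) (by positivity)) ?_
          have h1 : B * stepSize γ₁ β (n + 1) ≤ B * γ₁ := mul_le_mul_of_nonneg_left hγl hB
          have h2 : w (n + 1) ≤ (B + 1) * E ^ n * w (n + 1) := by
            have : 1 ≤ (B + 1) * E ^ n := by nlinarith
            nlinarith
          exact mul_le_mul h1 h2 hw1 (by positivity)
        _ ≤ (B + 1) * E ^ (n + 1) * w (n + 1) := by
          have : (B + 1) * E ^ (n + 1) * w (n + 1) = E * ((B + 1) * E ^ n * w (n + 1)) := by ring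
          rw [this, hE]
          have : 0 ≤ (B + 1) * E ^ n * w (n + 1) := by positivity
          nlinarith
  intro n hn
  set C' : ℝ := (B + 1) * E ^ (n0 + 1) + 2 * B / (c - s) with hC'
  have hcs : 0 < c - s := by linarith
  have hC'0 : 0 ≤ C' := by positivity
  have hsmall : ∀ n, 1 ≤ n → n ≤ n0 + 1 → a n ≤ C' * w n := by
    intro n hn hle
    refine (key1 n hn).trans (mul_le_mul_of_nonneg_right ?_ (hw n hn).1)
    have : E ^ n ≤ E ^ (n0 + 1) := pow_le_pow_right₀ hE1 hle
    have : 0 ≤ 2 * B / (c - s) := by positivity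
    nlinarith
  induction n, hn using Nat.le_induction with
  | base => exact hsmall 1 le_rfl (by omega)
  | succ n hn ih =>
    rcases lt_or_ge n n0 with h | h
    · exact hsmall _ (by omega) (by omega)
    obtain ⟨hr, hsm⟩ := hn0 n h
    have hγp := stepSize_pos hγ β (show 1 ≤ n + 1 by omega)
    have hγl := stepSize_le hγ hβ.1.le (show 1 ≤ n + 1 by omega)
    have hw1 := (hw (n + 1) (by omega)).1
    set g := stepSize γ₁ β (n + 1) with hg
    have hcf := hcoef n hn
    rw [← hg] at hcf
    have hA : a n ≤ C' * ((1 + s * g) * w (n + 1)) :=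
      ih.trans (mul_le_mul_of_nonneg_left
        ((hw n hn).2.trans (mul_le_mul_of_nonneg_right hr hw1)) hC'0)
    have hprod : (1 - c * g + C2 * g ^ 2) * (1 + s * g) ≤ 1 - (c - s) / 2 * g := by
      have h1 : C2 * g * (1 + s * g) ≤ (c - s) / 2 := by
        refine le_trans ?_ hsm
        have : s * g ≤ s * γ₁ := mul_le_mul_of_nonneg_left hγl hs0.le
        exact mul_le_mul_of_nonneg_left (by linarith) (by positivity)
      nlinarith [mul_le_mul_of_nonneg_right h1 hγp.le, mul_pos (mul_pos hc hs0) (mul_pos hγp hγp)]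
    calc a (n + 1) ≤ (1 - c * g + C2 * g ^ 2) * a n + B * g * w (n + 1) := hrec' n hn
      _ ≤ (1 - c * g + C2 * g ^ 2) * (C' * ((1 + s * g) * w (n + 1))) + B * g * w (n + 1) := by
        gcongr
      _ = ((1 - c * g + C2 * g ^ 2) * (1 + s * g)) * (C' * w (n + 1)) + B * g * w (n + 1) := by
        ring
      _ ≤ (1 - (c - s) / 2 * g) * (C' * w (n + 1)) + B * g * w (n + 1) := by
        gcongr
      _ ≤ C' * w (n + 1) := by
        -- This is what the summand `2B/(c - s)` of `C'` is for: the margin of the contraction pays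
        -- for the forcing.
        have hBC : B ≤ (c - s) / 2 * C' := by
          have e : (c - s) / 2 * C' = (c - s) / 2 * ((B + 1) * E ^ (n0 + 1)) + B := by
            rw [hC']; field_simp
          have : 0 ≤ (c - s) / 2 * ((B + 1) * E ^ (n0 + 1)) := by positivity
          linarith
        have : 0 ≤ g * w (n + 1) := by positivity
        nlinarith

end Recursion

/-! ### The exponential Lyapunov function and its one-step contraction -/

section Lyapunov

/-- The Lyapunov function `e^{mu} - 1 - mu`. -/
def lyap (m u : ℝ) : ℝ := Real.exp (m * u) - 1 - m * u

theorem lyap_nonneg (m u : ℝ) : 0 ≤ lyap m u := by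
  unfold lyap; linarith [Real.add_one_le_exp (m * u)]

theorem lyap_mono {m u v : ℝ} (hm : 0 ≤ m) (hu : 0 ≤ u) (huv : u ≤ v) : lyap m u ≤ lyap m v := by
  unfold lyap
  have h1 : Real.exp (m * v) = Real.exp (m * u) * Real.exp (m * (v - u)) := by
    rw [← Real.exp_add]; ring_nf
  have h2 := Real.add_one_le_exp (m * (v - u))
  have h3 : 1 ≤ Real.exp (m * u) := Real.one_le_exp (by positivity)
  have h4 : 0 ≤ m * (v - u) := mul_nonneg hm (by linarith)
  nlinarith

theorem sq_le_lyap {m u : ℝ} (hm : 0 ≤ m) (hu : 0 ≤ u) : (m * u) ^ 2 / 2 ≤ lyap m u := by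
  unfold lyap
  linarith [Real.quadratic_le_exp_of_nonneg (mul_nonneg hm hu)]

theorem pow_four_le_lyap {m u : ℝ} (hm : 0 ≤ m) (hu : 0 ≤ u) : (m * u) ^ 4 / 24 ≤ lyap m u := by
  have h := Real.sum_le_exp_of_nonneg (mul_nonneg hm hu) 5
  have : 0 ≤ m * u := mul_nonneg hm hu
  simp [Finset.sum_range_succ, Nat.factorial] at h
  unfold lyap
  have : 0 ≤ (m * u) ^ 2 := by positivity
  have : 0 ≤ (m * u) ^ 3 := by positivity
  linarith

theorem measurable_lyap (m : ℝ) : Measurable (lyap m) := by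
  unfold lyap; fun_prop

/-- The difference of the two sides has derivative `eᵗ(t - 1 + e⁻ᵗ) ≥ 0`. It converts `G² ≥ (v/2) U`
into contraction at the full rate `v`. -/
theorem two_mul_exp_sub_le {t : ℝ} (ht : 0 ≤ t) :
    2 * (Real.exp t - 1 - t) ≤ t * (Real.exp t - 1) := by
  have hd : ∀ x : ℝ, HasDerivAt (fun t : ℝ => t * (Real.exp t - 1) - 2 * (Real.exp t - 1 - t))
      (1 * (Real.exp x - 1) + x * Real.exp x - 2 * (Real.exp x - 1)) x := fun x =>
    ((hasDerivAt_id x).mul ((Real.hasDerivAt_exp x).sub_const 1)).sub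
      ((((Real.hasDerivAt_exp x).sub_const 1).sub (hasDerivAt_id x)).const_mul 2)
  have hm : Monotone (fun t : ℝ => t * (Real.exp t - 1) - 2 * (Real.exp t - 1 - t)) := by
    refine monotone_of_deriv_nonneg (fun x => (hd x).differentiableAt) fun x => ?_
    rw [(hd x).deriv]
    have h1 := Real.add_one_le_exp (-x)
    have h2 : Real.exp (-x) * Real.exp x = 1 := by rw [← Real.exp_add]; simp
    nlinarith [Real.exp_pos x]
  have := hm ht
  simp at this
  linarith

theorem exp_le_quadratic {y D : ℝ} (h : |y| ≤ D) :
    Real.exp y ≤ 1 + y + y ^ 2 * Real.exp D := by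
  have h1 := Complex.norm_exp_sub_sum_le_norm_mul_exp (y : ℂ) 2
  simp only [Finset.sum_range_succ, Finset.range_zero, Finset.sum_empty, pow_zero,
    Nat.factorial, Complex.norm_real, Real.norm_eq_abs, sq_abs] at h1
  norm_num at h1
  have e : Complex.exp y - (1 + (y : ℂ)) = ((Real.exp y - (1 + y) : ℝ) : ℂ) := by push_cast; rfl
  rw [e, Complex.norm_real, Real.norm_eq_abs] at h1
  have h2 : Real.exp |y| ≤ Real.exp D := Real.exp_le_exp.2 h
  have h3 := (le_abs_self _).trans h1
  nlinarith [sq_nonneg y]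

/-- `U ≥ 0` is a potential with derivative `G`, whose second derivative is bounded by `A`, and
`G` is bounded by `k`; the Lyapunov function `lyap m ∘ U` contracts at rate `c` along the flow. -/
structure IsPotential (U G : ℝ → ℝ) (A k m c : ℝ) : Prop where
  nonneg : ∀ ξ, 0 ≤ U ξ
  measurable : Measurable U
  quad : ∀ ξ y, U (ξ + y) ≤ U ξ + G ξ * y + A / 2 * y ^ 2
  bound : ∀ ξ, |G ξ| ≤ k
  sq_le : ∀ ξ, G ξ ^ 2 ≤ 2 * A * U ξ
  contr : ∀ ξ, c * lyap m (U ξ) ≤ m * (Real.exp (m * U ξ) - 1) * G ξ ^ 2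

/-- A step raises `U` by at most `δ = -γ G h + (A/2) γ² h²`, and `mδ` is bounded because `γ ≤ γ₁`,
so `exp(mδ)` can be expanded to second order with a uniform constant. The term linear in `h` is kept
exact, since its mean is to be taken. -/
theorem IsPotential.lyap_le {U G : ℝ → ℝ} {A k m c : ℝ} (hU : IsPotential U G A k m c)
    (hA : 0 ≤ A) (hk : 0 ≤ k) (hm : 0 < m) {γ γ₁ : ℝ} (hγ : 0 < γ) (hγ1 : γ ≤ γ₁) (ξ h : ℝ)
    (hhk : |h| ≤ k) :
    lyap m (U (ξ - γ * h)) ≤ lyap m (U ξ) +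
      m * (Real.exp (m * U ξ) - 1) * (-(γ * G ξ) * h + A / 2 * γ ^ 2 * k ^ 2) +
      m ^ 2 * Real.exp (m * (γ₁ * k ^ 2 + A / 2 * γ₁ ^ 2 * k ^ 2)) * Real.exp (m * U ξ) *
        (2 * γ ^ 2 * k ^ 2 * G ξ ^ 2 + A ^ 2 / 2 * γ ^ 4 * k ^ 4) := by
  have hγ₁ : 0 ≤ γ₁ := hγ.le.trans hγ1
  have hu0 : 0 ≤ U ξ := hU.nonneg ξ
  have hq := hU.quad ξ (-(γ * h))
  have hUn := hU.nonneg (ξ - γ * h)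
  have hgk : |G ξ| ≤ k := hU.bound ξ
  generalize G ξ = g at *
  generalize U ξ = u at *
  rw [← sub_eq_add_neg] at hq
  generalize U (ξ - γ * h) = u' at *
  have hh : h ^ 2 ≤ k ^ 2 := sq_le_sq' (by linarith [(abs_le.1 hhk).1]) (abs_le.1 hhk).2
  obtain ⟨δ, hδ⟩ : ∃ δ, δ = -(γ * g) * h + A / 2 * γ ^ 2 * h ^ 2 := ⟨_, rfl⟩
  have h1 : u' ≤ u + δ := hq.trans_eq (by rw [hδ]; ring)
  have h2 := lyap_mono hm.le hUn h1
  have hgh : |g * h| ≤ k ^ 2 := by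
    rw [abs_mul, pow_two]; exact mul_le_mul hgk hhk (abs_nonneg _) hk
  have hδb : |m * δ| ≤ m * (γ₁ * k ^ 2 + A / 2 * γ₁ ^ 2 * k ^ 2) := by
    rw [abs_mul, abs_of_pos hm]
    refine mul_le_mul_of_nonneg_left ?_ hm.le
    calc |δ| ≤ |-(γ * g) * h| + |A / 2 * γ ^ 2 * h ^ 2| := by rw [hδ]; exact abs_add_le _ _
      _ = γ * |g * h| + A / 2 * γ ^ 2 * h ^ 2 := by
        rw [show -(γ * g) * h = -(γ * (g * h)) by ring, abs_neg, abs_mul, abs_of_pos hγ,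
          abs_of_nonneg (by positivity : 0 ≤ A / 2 * γ ^ 2 * h ^ 2)]
      _ ≤ γ₁ * k ^ 2 + A / 2 * γ₁ ^ 2 * k ^ 2 := by gcongr
  have h3 := exp_le_quadratic hδb
  generalize m * (γ₁ * k ^ 2 + A / 2 * γ₁ ^ 2 * k ^ 2) = D at *
  have h4 : lyap m (u + δ) = Real.exp (m * u) * Real.exp (m * δ) - 1 - m * (u + δ) := by
    rw [lyap, mul_add, Real.exp_add]
  have h5 : δ ≤ -(γ * g) * h + A / 2 * γ ^ 2 * k ^ 2 := by
    rw [hδ]; gcongr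
  have h6 : δ ^ 2 ≤ 2 * γ ^ 2 * k ^ 2 * g ^ 2 + A ^ 2 / 2 * γ ^ 4 * k ^ 4 := by
    have h7 : δ ^ 2 ≤ 2 * (-(γ * g) * h) ^ 2 + 2 * (A / 2 * γ ^ 2 * h ^ 2) ^ 2 := by
      rw [hδ]
      linarith [sq_nonneg (-(γ * g) * h - A / 2 * γ ^ 2 * h ^ 2)]
    have h8 : (h ^ 2) ^ 2 ≤ (k ^ 2) ^ 2 := pow_le_pow_left₀ (sq_nonneg _) hh 2
    calc δ ^ 2 ≤ _ := h7
      _ = 2 * γ ^ 2 * h ^ 2 * g ^ 2 + A ^ 2 / 2 * γ ^ 4 * (h ^ 2) ^ 2 := by ring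
      _ ≤ 2 * γ ^ 2 * k ^ 2 * g ^ 2 + A ^ 2 / 2 * γ ^ 4 * (k ^ 2) ^ 2 := by gcongr
      _ = _ := by ring
  have h9 : 0 ≤ m * (Real.exp (m * u) - 1) :=
    mul_nonneg hm.le (by linarith [Real.one_le_exp (by positivity : 0 ≤ m * u)])
  have h10 : 0 ≤ m ^ 2 * Real.exp D * Real.exp (m * u) := by positivity
  calc lyap m u' ≤ lyap m (u + δ) := h2
    _ ≤ Real.exp (m * u) * (1 + m * δ + (m * δ) ^ 2 * Real.exp D) - 1 - m * (u + δ) := by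
      rw [h4]; gcongr
    _ = lyap m u + m * (Real.exp (m * u) - 1) * δ +
        m ^ 2 * Real.exp D * Real.exp (m * u) * δ ^ 2 := by rw [lyap]; ring
    _ ≤ _ := add_le_add (add_le_add le_rfl (mul_le_mul_of_nonneg_left h5 h9))
      (mul_le_mul_of_nonneg_left h6 h10)

/-- Here `P` stands for `lyap m u`, so that `P + mu = exp(mu) - 1`. The contraction hypothesis turns
the first order term into `-cγP`. Second order terms proportional to `P` are harmless; those
proportional to `u` are split by Young's inequality, using `(mu)²/2 ≤ P`. This costs `η` in the rate
and a remainder of order `γ³`. -/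
theorem drift_le {A k m c η γ γ₁ E₀ P u g : ℝ} (hm : 0 < m)
    (hη : 0 < η) (hγ : 0 < γ) (hγ1 : γ ≤ γ₁) (hE₀ : 0 ≤ E₀) (hP : 0 ≤ P) (hu : 0 ≤ u)
    (hgk : g ^ 2 ≤ k ^ 2) (hg2 : g ^ 2 ≤ 2 * A * u) (hs : (m * u) ^ 2 / 2 ≤ P)
    (hc : c * P ≤ m * (P + m * u) * g ^ 2) {e : ℝ}
    (he : e = m * (A / 2) * k ^ 2 * m + E₀ * 2 * k ^ 2 * (2 * A + m * k ^ 2) +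
      E₀ * (A ^ 2 / 2) * k ^ 4 * γ₁ ^ 2 * m) :
    P + m * (P + m * u) * (-(γ * g) * g + A / 2 * γ ^ 2 * k ^ 2) +
      E₀ * (P + m * u + 1) * (2 * γ ^ 2 * k ^ 2 * g ^ 2 + A ^ 2 / 2 * γ ^ 4 * k ^ 4) ≤
    (1 - (c - η) * γ + (m * (A / 2) * k ^ 2 + E₀ * 2 * k ^ 2 * k ^ 2 +
      E₀ * (A ^ 2 / 2) * k ^ 4 * γ₁ ^ 2) * γ ^ 2) * P +
      (e ^ 2 / (2 * η * m ^ 2) + E₀ * (A ^ 2 / 2) * k ^ 4 * γ₁) * γ ^ 3 := by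
  have hmu : 0 ≤ m * u := by positivity
  have hb0 : 0 ≤ E₀ * 2 * k ^ 2 := by positivity
  have hd0 : 0 ≤ E₀ * (A ^ 2 / 2) * k ^ 4 := by positivity
  have hγ2 : γ ^ 2 ≤ γ₁ ^ 2 := pow_le_pow_left₀ hγ.le hγ1 2
  have t1 : (P + m * u + 1) * g ^ 2 ≤ k ^ 2 * P + (2 * A + m * k ^ 2) * u := by
    have := mul_le_mul_of_nonneg_left hgk (add_nonneg hP hmu)
    linarith
  have t2 : γ ^ 4 * (P + m * u + 1) ≤ γ ^ 2 * (γ₁ ^ 2 * P + γ₁ ^ 2 * m * u) + γ₁ * γ ^ 3 := by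
    have h1 : γ ^ 4 * (P + m * u) ≤ γ ^ 2 * γ₁ ^ 2 * (P + m * u) := by
      rw [show γ ^ 4 = γ ^ 2 * γ ^ 2 by ring]; gcongr
    have h2 : γ ^ 4 ≤ γ₁ * γ ^ 3 := by
      rw [show γ ^ 4 = γ * γ ^ 3 by ring]; gcongr
    linarith
  -- Young's inequality, written as a perfect square.
  have t3 : γ ^ 2 * (e * u) ≤ η * γ * P + e ^ 2 / (2 * η * m ^ 2) * γ ^ 3 := by
    have h1 : η * γ * ((m * u) ^ 2 / 2) + e ^ 2 / (2 * η * m ^ 2) * γ ^ 3 - γ ^ 2 * (e * u) =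
        γ / (2 * η * m ^ 2) * (η * m ^ 2 * u - γ * e) ^ 2 := by
      clear he
      field_simp; ring
    have h2 : 0 ≤ γ / (2 * η * m ^ 2) * (η * m ^ 2 * u - γ * e) ^ 2 := by positivity
    have h3 : η * γ * ((m * u) ^ 2 / 2) ≤ η * γ * P := by gcongr
    linarith
  have t1' := mul_le_mul_of_nonneg_left t1 (by positivity : 0 ≤ E₀ * 2 * k ^ 2 * γ ^ 2)
  have t2' := mul_le_mul_of_nonneg_left t2 hd0
  have hc' := mul_le_mul_of_nonneg_left hc hγ.le
  have he' : γ ^ 2 * (e * u) = γ ^ 2 * (m * (A / 2) * k ^ 2 * m +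
    E₀ * 2 * k ^ 2 * (2 * A + m * k ^ 2) + E₀ * (A ^ 2 / 2) * k ^ 4 * γ₁ ^ 2 * m) * u := by
    rw [he]; ring
  linarith

/-- The mean of `H` being `G ξ`, the pointwise expansion integrates to the drift estimate. The
constant depends on `A`, `k`, `m`, `η` and `γ₁` only, hence serves all biases at once. -/
theorem lyap_step {A k m c η γ₁ : ℝ} (hA : 0 ≤ A) (hk : 0 ≤ k) (hm : 0 < m) (hη : 0 < η)
    (hγ₁ : 0 < γ₁) :
    ∃ C : ℝ, 0 ≤ C ∧ ∀ (U G : ℝ → ℝ), IsPotential U G A k m c →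
      ∀ (E : Type*) [MeasurableSpace E] (ν : Measure E) [IsProbabilityMeasure ν] (H : E → ℝ) (ξ : ℝ),
        Measurable H → (∀ x, |H x| ≤ k) → ∫ x, H x ∂ν = G ξ → ∀ γ, 0 < γ → γ ≤ γ₁ →
        ∫ x, lyap m (U (ξ - γ * H x)) ∂ν ≤
          (1 - (c - η) * γ + C * γ ^ 2) * lyap m (U ξ) + C * γ ^ 3 := by
  obtain ⟨E₀, hE₀⟩ : ∃ E₀, E₀ = m ^ 2 * Real.exp (m * (γ₁ * k ^ 2 + A / 2 * γ₁ ^ 2 * k ^ 2)) :=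
    ⟨_, rfl⟩
  have hE₀0 : 0 ≤ E₀ := by rw [hE₀]; positivity
  obtain ⟨e, he⟩ : ∃ e, e = m * (A / 2) * k ^ 2 * m + E₀ * 2 * k ^ 2 * (2 * A + m * k ^ 2) +
      E₀ * (A ^ 2 / 2) * k ^ 4 * γ₁ ^ 2 * m := ⟨_, rfl⟩
  obtain ⟨C₁, hC₁, hC₁0⟩ : ∃ C₁, C₁ = m * (A / 2) * k ^ 2 + E₀ * 2 * k ^ 2 * k ^ 2 +
      E₀ * (A ^ 2 / 2) * k ^ 4 * γ₁ ^ 2 ∧ 0 ≤ C₁ := ⟨_, rfl, by positivity⟩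
  obtain ⟨C₂, hC₂, hC₂0⟩ : ∃ C₂, C₂ = e ^ 2 / (2 * η * m ^ 2) + E₀ * (A ^ 2 / 2) * k ^ 4 * γ₁ ∧
    0 ≤ C₂ := ⟨_, rfl, by positivity⟩
  refine ⟨C₁ + C₂, by positivity, ?_⟩
  intro U G hU X _ ν _ H ξ hH hHk hHG γ hγ hγ1
  have hint : Integrable H ν :=
    Integrable.of_bound hH.aestronglyMeasurable k (Eventually.of_forall hHk)
  have hpt := fun x => hU.lyap_le hA hk hm hγ hγ1 ξ (H x) (hHk x)
  rw [← hE₀] at hpt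
  have hexp : Real.exp (m * U ξ) = lyap m (U ξ) + m * U ξ + 1 := by rw [lyap]; ring
  have hc := hU.contr ξ
  have hgk : G ξ ^ 2 ≤ k ^ 2 := sq_le_sq' (by linarith [(abs_le.1 (hU.bound ξ)).1])
    (abs_le.1 (hU.bound ξ)).2
  rw [hexp, add_sub_cancel_right] at hc
  simp only [hexp, add_sub_cancel_right] at hpt
  have hd := drift_le hm hη hγ hγ1 hE₀0 (lyap_nonneg m (U ξ)) (hU.nonneg ξ) hgk (hU.sq_le ξ)
    (sq_le_lyap hm.le (hU.nonneg ξ)) hc he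
  rw [← hC₁, ← hC₂] at hd
  have hP := lyap_nonneg m (U ξ)
  have hI : ∫ x, lyap m (U (ξ - γ * H x)) ∂ν ≤ lyap m (U ξ) +
      m * (lyap m (U ξ) + m * U ξ) * (-(γ * G ξ) * G ξ + A / 2 * γ ^ 2 * k ^ 2) +
      E₀ * (lyap m (U ξ) + m * U ξ + 1) *
        (2 * γ ^ 2 * k ^ 2 * G ξ ^ 2 + A ^ 2 / 2 * γ ^ 4 * k ^ 4) := by
    have i1 : Integrable (fun x => -(γ * G ξ) * H x + A / 2 * γ ^ 2 * k ^ 2) ν :=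
      (hint.const_mul _).add (integrable_const _)
    have i2 : Integrable (fun x => m * (lyap m (U ξ) + m * U ξ) *
        (-(γ * G ξ) * H x + A / 2 * γ ^ 2 * k ^ 2)) ν := i1.const_mul _
    have i3 : Integrable (fun x => lyap m (U ξ) + m * (lyap m (U ξ) + m * U ξ) *
        (-(γ * G ξ) * H x + A / 2 * γ ^ 2 * k ^ 2)) ν := (integrable_const _).add i2
    refine (integral_mono_of_nonneg (Eventually.of_forall fun x => lyap_nonneg _ _)
      (i3.add (integrable_const _)) (Eventually.of_forall hpt)).trans_eq ?_
    rw [integral_add' i3 (integrable_const _), integral_add (integrable_const _) i2,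
      integral_const_mul, integral_add (hint.const_mul _) (integrable_const _),
      integral_const_mul, hHG]
    simp
  refine (hI.trans hd).trans ?_
  have h1 : 0 ≤ C₂ * γ ^ 2 * lyap m (U ξ) := by positivity
  have h2 : 0 ≤ C₁ * γ ^ 3 := by positivity
  linarith

end Lyapunov

/-! ### Derivatives of the objective function -/

section Objective

/-- The distribution function of `X`. -/
def distFun {Ω : Type*} [MeasurableSpace Ω] (μ : Measure Ω) (X : Ω → ℝ) (ξ : ℝ) : ℝ :=
  μ.real {ω | X ω ≤ ξ}

/-- The derivative `(F - α) / (1 - α)` of the objective function. -/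
def grad {Ω : Type*} [MeasurableSpace Ω] (μ : Measure Ω) (α : ℝ) (X : Ω → ℝ) (ξ : ℝ) : ℝ :=
  (distFun μ X ξ - α) / (1 - α)

variable {Ω : Type*} [MeasurableSpace Ω] {μ : Measure Ω} [IsProbabilityMeasure μ] {X : Ω → ℝ}
  {f : ℝ → ℝ} {α : ℝ}

theorem distFun_nonneg (ξ : ℝ) : 0 ≤ distFun μ X ξ := measureReal_nonneg

theorem distFun_le_one (ξ : ℝ) : distFun μ X ξ ≤ 1 := measureReal_le_one

theorem distFun_mono : Monotone (distFun μ X) := fun _ _ h =>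
  measureReal_mono fun _ hω => le_trans hω h

theorem grad_mono (hα : α ∈ Ioo (0 : ℝ) 1) : Monotone (grad μ α X) := fun a b h => by
  unfold grad
  have := distFun_mono (μ := μ) (X := X) h
  have : 0 < 1 - α := by linarith [hα.2]
  gcongr

theorem one_le_kAlpha (α : ℝ) : 1 ≤ kAlpha α := le_max_left _ _

theorem abs_grad_le (hα : α ∈ Ioo (0 : ℝ) 1) (ξ : ℝ) : |grad μ α X ξ| ≤ kAlpha α := by
  have h1 := distFun_nonneg (μ := μ) (X := X) ξ
  have h2 := distFun_le_one (μ := μ) (X := X) ξ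
  have h3 : 0 < 1 - α := by linarith [hα.2]
  unfold grad kAlpha
  rw [abs_le]
  constructor
  · have : -(α / (1 - α)) ≤ (distFun μ X ξ - α) / (1 - α) := by
      rw [← neg_div]; gcongr; linarith
    linarith [le_max_right 1 (α / (1 - α))]
  · refine le_trans ?_ (le_max_left _ _)
    rw [div_le_one h3]; linarith

theorem abs_H₁_le (hα : α ∈ Ioo (0 : ℝ) 1) (ξ x : ℝ) : |H₁ α ξ x| ≤ kAlpha α := by
  have h3 : 0 < 1 - α := by linarith [hα.2]
  unfold H₁ kAlpha
  split_ifs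
  · refine le_trans (le_of_eq ?_) (le_max_right _ _)
    rw [mul_one, abs_of_nonpos]
    · field_simp; ring
    · have : (1 : ℝ) ≤ (1 - α)⁻¹ := (one_le_inv₀ h3).2 (by linarith [hα.1])
      linarith
  · simp

theorem measurable_H₁ (α : ℝ) : Measurable (fun p : ℝ × ℝ => H₁ α p.1 p.2) := by
  unfold H₁
  refine measurable_const.sub (measurable_const.mul (Measurable.ite ?_ measurable_const
    measurable_const))
  exact measurableSet_le measurable_fst measurable_snd

variable (hX : Measurable X) (hf : IsContinuousPDF μ X f)
include hX hf

theorem IsContinuousPDF.integrable : Integrable f := by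
  have h1 : μ.map X univ = 1 := by
    have := Measure.isProbabilityMeasure_map (μ := μ) hX.aemeasurable
    exact measure_univ
  rw [hf.law, withDensity_apply _ MeasurableSet.univ, setLIntegral_univ] at h1
  refine ⟨hf.continuous.aestronglyMeasurable, ?_⟩
  rw [hasFiniteIntegral_iff_ofReal (Eventually.of_forall hf.nonneg), h1]
  exact ENNReal.one_lt_top

theorem IsContinuousPDF.measureReal_preimage {s : Set ℝ} (hs : MeasurableSet s) :
    μ.real (X ⁻¹' s) = ∫ x in s, f x := by
  rw [Measure.real, ← Measure.map_apply hX hs, hf.law, withDensity_apply _ hs,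
    integral_eq_lintegral_of_nonneg_ae (Eventually.of_forall hf.nonneg)
      hf.continuous.aestronglyMeasurable]

theorem IsContinuousPDF.measure_eq_zero (ξ : ℝ) : μ {ω | X ω = ξ} = 0 := by
  have h := hf.measureReal_preimage hX (measurableSet_singleton ξ)
  have h2 : ∫ x in ({ξ} : Set ℝ), f x = 0 := by
    rw [Measure.restrict_singleton]; simp
  rw [h2] at h
  exact (measureReal_eq_zero_iff).1 h

theorem IsContinuousPDF.distFun_sub {a b : ℝ} (hab : a ≤ b) :
    distFun μ X b - distFun μ X a = ∫ x in a..b, f x := by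
  have e : {ω | X ω ≤ b} = {ω | X ω ≤ a} ∪ X ⁻¹' (Ioc a b) := by
    ext ω; simp only [mem_ofPred_eq, mem_union, mem_preimage, mem_Ioc]
    constructor
    · intro h; rcases le_or_gt (X ω) a with h' | h'
      · exact Or.inl h'
      · exact Or.inr ⟨h', h⟩
    · rintro (h | h)
      · exact h.trans hab
      · exact h.2
  have hd : Disjoint {ω | X ω ≤ a} (X ⁻¹' (Ioc a b)) := by
    rw [Set.disjoint_left]; intro ω h1 h2; exact absurd h1 (not_le.2 h2.1)
  unfold distFun
  rw [e, measureReal_union hd (hX measurableSet_Ioc), add_sub_cancel_left,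
    hf.measureReal_preimage hX measurableSet_Ioc, intervalIntegral.integral_of_le hab]

theorem IsContinuousPDF.hasDerivAt_distFun (ξ : ℝ) : HasDerivAt (distFun μ X) (f ξ) ξ := by
  have h : HasDerivAt (fun x => ∫ t in (0 : ℝ)..x, f t) (f ξ) ξ :=
    intervalIntegral.integral_hasDerivAt_right (hf.continuous.intervalIntegrable _ _)
      (hf.continuous.stronglyMeasurableAtFilter _ _) hf.continuous.continuousAt
  have e : distFun μ X = fun x => (∫ t in (0 : ℝ)..x, f t) + distFun μ X 0 := by
    funext x
    rcases le_total 0 x with hx | hx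
    · rw [← hf.distFun_sub hX hx]; ring
    · rw [intervalIntegral.integral_symm, ← hf.distFun_sub hX hx]; ring
  rw [e]; exact h.add_const _

theorem IsContinuousPDF.hasDerivAt_grad (ξ : ℝ) :
    HasDerivAt (grad μ α X) (f ξ / (1 - α)) ξ :=
  ((hf.hasDerivAt_distFun hX ξ).sub_const α).div_const (1 - α)

theorem IsContinuousPDF.abs_distFun_sub_le {F : ℝ} (hF : ∀ x, f x ≤ F) (a b : ℝ) :
    |distFun μ X a - distFun μ X b| ≤ F * |a - b| := by
  wlog hab : b ≤ a generalizing a b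
  · rw [abs_sub_comm, abs_sub_comm a]; exact this b a (le_of_not_ge hab)
  rw [abs_of_nonneg (by linarith [distFun_mono (μ := μ) (X := X) hab]), hf.distFun_sub hX hab,
    abs_of_nonneg (by linarith)]
  calc ∫ x in b..a, f x ≤ ∫ x in b..a, F :=
        intervalIntegral.integral_mono_on hab (hf.continuous.intervalIntegrable _ _)
          intervalIntegrable_const fun x _ => hF x
    _ = F * (a - b) := by simp; ring

omit hf in
theorem integral_ite_le (ξ : ℝ) :
    ∫ ω, (if ξ ≤ X ω then (1 : ℝ) else 0) ∂μ = μ.real {ω | ξ ≤ X ω} := by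
  rw [← integral_indicator_one (measurableSet_le measurable_const hX)]
  congr 1

theorem IsContinuousPDF.measureReal_ge (ξ : ℝ) :
    μ.real {ω | ξ ≤ X ω} = 1 - distFun μ X ξ := by
  have h1 : μ.real {ω | ξ ≤ X ω} = μ.real {ω | X ω ≤ ξ}ᶜ := by
    refine measureReal_congr ?_
    have h0 : ∀ᵐ ω ∂μ, X ω ≠ ξ := by
      rw [ae_iff]; simpa using hf.measure_eq_zero hX ξ
    filter_upwards [h0] with ω hω
    refine propext ⟨fun h : ξ ≤ X ω => ?_, fun h => ?_⟩
    · exact not_le.2 (lt_of_le_of_ne h (Ne.symm hω))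
    · exact (not_le.1 (show ¬ X ω ≤ ξ from h)).le
  rw [h1, probReal_compl_eq_one_sub (measurableSet_le hX measurable_const)]
  rfl

theorem IsContinuousPDF.integral_H₁ (hα : α ∈ Ioo (0 : ℝ) 1) (ξ : ℝ) :
    ∫ ω, H₁ α ξ (X ω) ∂μ = grad μ α X ξ := by
  have h3 : 0 < 1 - α := by linarith [hα.2]
  have hi : Integrable (fun ω => (if ξ ≤ X ω then (1 : ℝ) else 0)) μ := by
    refine Integrable.of_bound (C := 1) ?_ (Eventually.of_forall fun ω => ?_)
    · exact (Measurable.ite (measurableSet_le measurable_const hX) measurable_const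
        measurable_const).aestronglyMeasurable
    · split_ifs <;> simp
  unfold H₁
  rw [integral_sub (integrable_const _) (hi.const_mul _), integral_const_mul, integral_ite_le hX,
    hf.measureReal_ge hX]
  simp [grad]
  field_simp; ring

omit hf in
theorem objective_integrable (hXi : Integrable X μ) (ξ : ℝ) :
    Integrable (fun ω => max (X ω - ξ) 0) μ :=
  (hXi.sub (integrable_const ξ)).pos_part

/-- Differentiation under the integral: `(X - ξ)^+` is 1-Lipschitz in `ξ` and differentiable except
at `ξ = X`, an event that is null because `X` has a density. -/
theorem IsContinuousPDF.hasDerivAt_objective (hα : α ∈ Ioo (0 : ℝ) 1) (hXi : Integrable X μ)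
    (ξ : ℝ) : HasDerivAt (objective μ α X) (grad μ α X ξ) ξ := by
  have h3 : 0 < 1 - α := by linarith [hα.2]
  have hlip : ∀ ω : Ω, ∀ a b : ℝ, |max (X ω - a) 0 - max (X ω - b) 0| ≤ 1 * |a - b| := by
    intro ω a b
    have := abs_max_sub_max_le_abs (X ω - a) (X ω - b) 0
    rw [one_mul, abs_sub_comm a b]
    simpa using this
  have key : HasDerivAt (fun ξ => ∫ ω, max (X ω - ξ) 0 ∂μ)
      (∫ ω, -(if ξ ≤ X ω then (1 : ℝ) else 0) ∂μ) ξ := by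
    refine (hasDerivAt_integral_of_dominated_loc_of_lip (bound := fun _ => (1 : ℝ))
      (s := univ) univ_mem ?_ (objective_integrable hX hXi ξ) ?_ ?_ (integrable_const _) ?_).2
    · exact Eventually.of_forall fun x => (objective_integrable hX hXi x).aestronglyMeasurable
    · exact ((Measurable.ite (measurableSet_le measurable_const hX) measurable_const
        measurable_const).neg).aestronglyMeasurable
    · refine Eventually.of_forall fun ω => LipschitzOnWith.of_dist_le_mul fun a _ b _ => ?_
      simpa [Real.dist_eq] using hlip ω a b
    · have h0 : ∀ᵐ ω ∂μ, X ω ≠ ξ := by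
        rw [ae_iff]; simpa using hf.measure_eq_zero hX ξ
      filter_upwards [h0] with ω hω
      rcases lt_or_gt_of_ne hω with h | h
      · rw [if_neg (not_le.2 h), neg_zero]
        refine (hasDerivAt_const ξ (0 : ℝ)).congr_of_eventuallyEq ?_
        filter_upwards [lt_mem_nhds h] with x hx
        exact max_eq_right (by linarith)
      · rw [if_pos h.le]
        refine ((hasDerivAt_id ξ).const_sub (X ω)).congr_of_eventuallyEq ?_
        filter_upwards [gt_mem_nhds h] with x hx
        exact max_eq_left (by simp; linarith)
  have h4 := (hasDerivAt_id ξ).add (key.const_mul (1 - α)⁻¹)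
  rw [integral_neg, integral_ite_le hX, hf.measureReal_ge hX] at h4
  refine h4.congr_deriv ?_
  rw [grad]; field_simp; ring

theorem IsContinuousPDF.iteratedDeriv_objective (hα : α ∈ Ioo (0 : ℝ) 1) (hXi : Integrable X μ) :
    iteratedDeriv 2 (objective μ α X) = fun ξ => f ξ / (1 - α) := by
  have h1 : deriv (objective μ α X) = grad μ α X :=
    funext fun ξ => (hf.hasDerivAt_objective hX hα hXi ξ).deriv
  rw [iteratedDeriv_succ, iteratedDeriv_one, h1]
  exact funext fun ξ => (hf.hasDerivAt_grad hX ξ).deriv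

theorem IsContinuousPDF.grad_eq_zero (hα : α ∈ Ioo (0 : ℝ) 1) (hXi : Integrable X μ) {ξ₀ : ℝ}
    (hmin : ∀ ξ, objective μ α X ξ₀ ≤ objective μ α X ξ) : grad μ α X ξ₀ = 0 :=
  IsLocalMin.hasDerivAt_eq_zero (Eventually.of_forall hmin) (hf.hasDerivAt_objective hX hα hXi ξ₀)

end Objective

/-! ### Growth and contraction for convex potentials -/

section Potential

theorem exists_mean_value {φ φ' : ℝ → ℝ} (hd : ∀ x, HasDerivAt φ (φ' x) x) (a y : ℝ) :
    ∃ t ∈ Ioo (0 : ℝ) 1, φ (a + y) - φ a = φ' (a + t * y) * y := by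
  have h : ∀ t : ℝ, HasDerivAt (fun t => φ (a + t * y)) (φ' (a + t * y) * y) t := fun t => by
    have h1 : HasDerivAt (fun t : ℝ => a + t * y) y t := by
      simpa using ((hasDerivAt_id t).mul_const y).const_add a
    exact (hd (a + t * y)).comp t h1
  obtain ⟨t, ht, h2⟩ := exists_hasDerivAt_eq_slope (fun t => φ (a + t * y)) _ zero_lt_one
    (fun t _ => (h t).continuousAt.continuousWithinAt) (fun t _ => h t)
  refine ⟨t, ht, ?_⟩
  simp at h2; linarith

variable {U G g : ℝ → ℝ} {ξ₀ : ℝ}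

theorem quadratic_upper_bound {A : ℝ} (hU : ∀ x, HasDerivAt U (G x) x)
    (hA : ∀ x y, |G x - G y| ≤ A * |x - y|) (ξ y : ℝ) :
    U (ξ + y) ≤ U ξ + G ξ * y + A / 2 * y ^ 2 := by
  have hd : ∀ s, HasDerivAt (fun s => U (ξ + s) - G ξ * s - A / 2 * s ^ 2)
      (G (ξ + s) - G ξ - A * s) s := fun s => by
    have h1 : HasDerivAt (fun s : ℝ => U (ξ + s)) (G (ξ + s)) s := by
      exact (hU (ξ + s)).comp_const_add ξ s
    refine ((h1.sub ((hasDerivAt_id s).const_mul (G ξ))).sub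
      ((hasDerivAt_pow 2 s).const_mul (A / 2))).congr_deriv ?_
    simp; ring
  obtain ⟨t, ht, h⟩ := exists_mean_value hd 0 y
  simp only [zero_add, mul_zero, add_zero] at h
  have h1 := hA (ξ + t * y) ξ
  rw [add_sub_cancel_left] at h1
  have h2 : (G (ξ + t * y) - G ξ - A * (t * y)) * y ≤ 0 := by
    have h3 : (G (ξ + t * y) - G ξ) * y ≤ A * |t * y| * |y| := by
      refine (le_abs_self _).trans ?_
      rw [abs_mul]; gcongr
    have h4 : A * |t * y| * |y| = A * (t * y) * y := by
      rw [abs_mul, abs_of_pos ht.1, mul_assoc A, mul_assoc t, ← abs_mul, abs_mul_self]; ring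
    linarith
  norm_num at h
  linarith

theorem grad_mul_mono (hG : Monotone G) {s s' : ℝ} (h : s ≤ s') (y : ℝ) :
    G (ξ₀ + s * y) * y ≤ G (ξ₀ + s' * y) * y := by
  rcases le_total 0 y with hy | hy
  · exact mul_le_mul_of_nonneg_right (hG (by nlinarith)) hy
  · exact mul_le_mul_of_nonpos_right (hG (by nlinarith)) hy

/-- Within radius `r` this is the mean value theorem; beyond it, monotonicity keeps the derivative
at least as large in modulus as at distance `r`, so the growth is only linear. -/
theorem le_grad_mul {c r : ℝ} (hG : Monotone G) (hd : ∀ x, HasDerivAt G (g x) x) (h0 : G ξ₀ = 0)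
    (hr : 0 < r) (hc : ∀ x, |x - ξ₀| ≤ r → c ≤ g x) (hc0 : 0 ≤ c) (y : ℝ) :
    c * (min |y| r * |y|) ≤ G (ξ₀ + y) * y := by
  rcases le_total |y| r with h | h
  · obtain ⟨t, ht, e⟩ := exists_mean_value hd ξ₀ y
    rw [h0, sub_zero] at e
    rw [e, min_eq_left h, mul_assoc, ← abs_mul, abs_mul_self]
    refine mul_le_mul_of_nonneg_right (hc _ ?_) (mul_self_nonneg y)
    rw [add_sub_cancel_left, abs_mul, abs_of_pos ht.1]
    nlinarith [abs_nonneg y, ht.2]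
  · have hy : 0 < |y| := hr.trans_le h
    have h1 : r / |y| ≤ 1 := (div_le_one hy).2 h
    have h2 := grad_mul_mono (ξ₀ := ξ₀) hG h1 y
    rw [one_mul] at h2
    refine le_trans ?_ h2
    obtain ⟨t, ht, e⟩ := exists_mean_value hd ξ₀ (r / |y| * y)
    rw [h0, sub_zero] at e
    have h3 : c ≤ g (ξ₀ + t * (r / |y| * y)) := by
      apply hc
      rw [add_sub_cancel_left, abs_mul, abs_mul, abs_div, abs_abs, abs_of_pos ht.1, abs_of_pos hr,
        div_mul_cancel₀ _ hy.ne']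
      nlinarith [ht.2]
    rw [e, min_eq_right h]
    have h4 : r / |y| * y * y = r * |y| := by
      have : y * y = |y| * |y| := (abs_mul_abs_self y).symm
      rw [mul_assoc, this]; field_simp
    calc c * (r * |y|) ≤ g (ξ₀ + t * (r / |y| * y)) * (r * |y|) := by gcongr
      _ = _ := by rw [← h4]; ring

theorem potential_le (hG : Monotone G) (hU : ∀ x, HasDerivAt U (G x) x) (hU0 : U ξ₀ = 0) (y : ℝ) :
    U (ξ₀ + y) ≤ G (ξ₀ + y) * y := by
  obtain ⟨t, ht, e⟩ := exists_mean_value hU ξ₀ y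
  rw [hU0, sub_zero] at e
  rw [e]
  simpa using grad_mul_mono (ξ₀ := ξ₀) hG ht.2.le y

/-- The mean value theorem on the outer half of the segment from `ξ₀` to `ξ₀ + y`, where the slope
is at least that at the midpoint. -/
theorem le_potential {c r : ℝ} (hG : Monotone G) (hU : ∀ x, HasDerivAt U (G x) x)
    (hUn : ∀ x, 0 ≤ U x) (hd : ∀ x, HasDerivAt G (g x) x)
    (h0 : G ξ₀ = 0) (hr : 0 < r) (hc : ∀ x, |x - ξ₀| ≤ r → c ≤ g x) (hc0 : 0 ≤ c) (y : ℝ) :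
    c / 4 * (min |y| r * |y|) ≤ U (ξ₀ + y) := by
  obtain ⟨t, ht, e⟩ := exists_mean_value hU (ξ₀ + y / 2) (y / 2)
  have h1 := grad_mul_mono (ξ₀ := ξ₀) hG (show (1 / 2 : ℝ) ≤ (1 + t) / 2 by linarith [ht.1]) y
  have h2 := le_grad_mul hG hd h0 hr hc hc0 (y / 2)
  rw [show ξ₀ + y / 2 + y / 2 = ξ₀ + y by ring,
    show ξ₀ + y / 2 + t * (y / 2) = ξ₀ + (1 + t) / 2 * y by ring] at e
  rw [show ξ₀ + 1 / 2 * y = ξ₀ + y / 2 by ring] at h1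
  have h3 : min |y| r / 2 ≤ min |y / 2| r := by
    rw [abs_div, abs_two]
    refine le_min ?_ ?_
    · linarith [min_le_left |y| r]
    · linarith [min_le_right |y| r]
  have h5 : 0 ≤ min |y| r := le_min (abs_nonneg _) hr.le
  have h4 : c * (min |y| r / 2 * (|y| / 2)) ≤ c * (min |y / 2| r * |y / 2|) := by
    rw [abs_div y 2, abs_two] at *
    gcongr
  linarith [hUn (ξ₀ + y / 2)]

/-- Where `u` is quadratic in `y`, the term `(mu)²/2` of the exponential series suffices; where `u`
is only linear, `(mu)⁴/24` does. Covering both regimes is the reason for an exponential Lyapunov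
function. -/
theorem pow_four_le_of_growth {c r m : ℝ} (hc : 0 < c) (hr : 0 < r) (hm : 0 < m) :
    ∃ C : ℝ, 0 < C ∧ ∀ u y : ℝ, c / 4 * (min |y| r * |y|) ≤ u → y ^ 4 ≤ C * lyap m u := by
  refine ⟨2 / (m * (c / 4)) ^ 2 + 24 / (m * (c / 4 * r)) ^ 4, by positivity, fun u y h => ?_⟩
  have hm0 : 0 ≤ min |y| r := le_min (abs_nonneg _) hr.le
  have hu : 0 ≤ u := le_trans (by positivity) h
  have hL := lyap_nonneg m u
  rcases le_total |y| r with h1 | h1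
  · rw [min_eq_left h1, abs_mul_abs_self] at h
    have h2 : (m * (c / 4) * (y * y)) ^ 2 ≤ (m * u) ^ 2 := by
      apply pow_le_pow_left₀ (by have := mul_self_nonneg y; positivity)
      rw [mul_assoc]; gcongr
    have h3 := sq_le_lyap hm.le hu
    have h4 : y ^ 4 ≤ 2 / (m * (c / 4)) ^ 2 * lyap m u := by
      rw [div_mul_eq_mul_div, le_div_iff₀ (by positivity)]
      linarith
    have : 0 ≤ 24 / (m * (c / 4 * r)) ^ 4 * lyap m u := by positivity
    linarith
  · rw [min_eq_right h1] at h
    have h2 : (m * (c / 4 * r) * |y|) ^ 4 ≤ (m * u) ^ 4 := by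
      apply pow_le_pow_left₀ (by positivity)
      rw [mul_assoc, mul_assoc (c / 4)]; gcongr
    have h3 := pow_four_le_lyap hm.le hu
    have h5 : |y| ^ 4 = y ^ 4 := by rw [show (4 : ℕ) = 2 * 2 by rfl, pow_mul, pow_mul, sq_abs]
    rw [mul_pow, h5] at h2
    have h4 : y ^ 4 ≤ 24 / (m * (c / 4 * r)) ^ 4 * lyap m u := by
      rw [div_mul_eq_mul_div, le_div_iff₀ (by positivity)]
      linarith
    have : 0 ≤ 2 / (m * (c / 4)) ^ 2 * lyap m u := by positivity
    linarith

/-- Convex potentials with Lipschitz second derivative satisfy the Lyapunov inequality. -/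
theorem isPotential_of_lipschitz {A k v Λ c : ℝ} (hG : Monotone G)
    (hU : ∀ x, HasDerivAt U (G x) x)
    (hUn : ∀ x, 0 ≤ U x) (hU0 : U ξ₀ = 0) (hd : ∀ x, HasDerivAt G (g x) x) (h0 : G ξ₀ = 0)
    (hA : 0 < A) (hgA : ∀ x, |g x| ≤ A) (hk : ∀ x, |G x| ≤ k) (hv : g ξ₀ = v) (hv0 : 0 < v)
    (hΛ : 0 < Λ) (hgΛ : ∀ x y, |g x - g y| ≤ Λ * |x - y|)
    (hc1 : c ≤ v) (hc2 : c ≤ A * v ^ 4 / Λ ^ 2) : IsPotential U G A k (16 * A) c := by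
  have hLip : ∀ x y, |G x - G y| ≤ A * |x - y| := fun x y => by
    obtain ⟨t, -, e⟩ := exists_mean_value hd y (x - y)
    rw [add_sub_cancel] at e
    rw [e, abs_mul]
    gcongr
    exact hgA _
  have hquad := quadratic_upper_bound hU hLip
  refine ⟨hUn, ?_, hquad, hk, fun ξ => ?_, fun ξ => ?_⟩
  · exact (continuous_iff_continuousAt.2 fun x => (hU x).continuousAt).measurable
  -- The displacement `-G/A` minimises the quadratic upper bound, and `U` is nonnegative there.
  · have h1 := hquad ξ (-(G ξ / A))
    have h2 := hUn (ξ + -(G ξ / A))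
    have e : U ξ + G ξ * -(G ξ / A) + A / 2 * (-(G ξ / A)) ^ 2 = U ξ - G ξ ^ 2 / (2 * A) := by
      field_simp; ring
    rw [e] at h1
    have h3 : G ξ ^ 2 / (2 * A) ≤ U ξ := by linarith
    rw [div_le_iff₀ (by positivity)] at h3
    linarith
  · obtain ⟨y, rfl⟩ : ∃ y, ξ = ξ₀ + y := ⟨ξ - ξ₀, by ring⟩
    -- On the ball of radius `v/(2Λ)` the second derivative stays above `v/2`.
    have hr : 0 < v / (2 * Λ) := by positivity
    have h1 := le_grad_mul (c := v / 2) hG hd h0 hr (fun x hx => by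
      have := hgΛ ξ₀ x
      rw [hv, abs_sub_comm ξ₀ x] at this
      have h2 : Λ * |x - ξ₀| ≤ v / 2 := by
        calc Λ * |x - ξ₀| ≤ Λ * (v / (2 * Λ)) := by gcongr
          _ = v / 2 := by field_simp
      linarith [(abs_le.1 this).2]) (by positivity) y
    have hu := hUn (ξ₀ + y)
    have hGy : G (ξ₀ + y) * y ≤ |G (ξ₀ + y)| * |y| := by rw [← abs_mul]; exact le_abs_self _
    have hUy := potential_le hG hU hU0 y
    generalize U (ξ₀ + y) = u at *
    rw [← sq_abs (G (ξ₀ + y))]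
    generalize G (ξ₀ + y) = a at *
    have hmu : 0 ≤ 16 * A * u := by positivity
    have hE : 0 ≤ Real.exp (16 * A * u) - 1 := by linarith [Real.one_le_exp hmu]
    have hL := lyap_nonneg (16 * A) u
    rcases eq_or_lt_of_le (abs_nonneg y) with hy | hy
    · have hu0 : u ≤ 0 := by
        have : y = 0 := abs_eq_zero.1 hy.symm
        rw [this, mul_zero] at hUy; exact hUy
      have : u = 0 := le_antisymm hu0 hu
      subst this
      simp [lyap]
    · have h2 : v / 2 * min |y| (v / (2 * Λ)) ≤ |a| := by
        have h3 : v / 2 * min |y| (v / (2 * Λ)) * |y| ≤ |a| * |y| := by linarith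
        exact le_of_mul_le_mul_right h3 hy
      rcases le_total |y| (v / (2 * Λ)) with h3 | h3
      -- Near the minimiser, `|G| ≥ (v/2)|y|` and `U ≤ |G||y|` give `(v/2) U ≤ G²`.
      · rw [min_eq_left h3] at h2
        have h4 : v / 2 * u ≤ |a| ^ 2 := by
          have h5 : v / 2 * u ≤ |a| * (v / 2 * |y|) := by
            calc v / 2 * u ≤ v / 2 * (|a| * |y|) := by gcongr; linarith
              _ = _ := by ring
          have h6 : |a| * (v / 2 * |y|) ≤ |a| * |a| := by gcongr
          rw [pow_two]; linarith
        have h7 := two_mul_exp_sub_le hmu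
        calc c * lyap (16 * A) u ≤ v * lyap (16 * A) u := by gcongr
          _ = v / 2 * (2 * (Real.exp (16 * A * u) - 1 - 16 * A * u)) := by rw [lyap]; ring
          _ ≤ v / 2 * (16 * A * u * (Real.exp (16 * A * u) - 1)) := by gcongr
          _ = 16 * A * (Real.exp (16 * A * u) - 1) * (v / 2 * u) := by ring
          _ ≤ _ := by gcongr
      -- Far away `|G| ≥ v²/(4Λ)`, and the choice `m = 16A` cancels the resulting factor `1/16`.
      · rw [min_eq_right h3] at h2
        have h4 : (v / 2 * (v / (2 * Λ))) ^ 2 ≤ |a| ^ 2 := pow_le_pow_left₀ (by positivity) h2 2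
        have h5 : lyap (16 * A) u ≤ Real.exp (16 * A * u) - 1 := by rw [lyap]; linarith
        calc c * lyap (16 * A) u ≤ A * v ^ 4 / Λ ^ 2 * lyap (16 * A) u := by gcongr
          _ = 16 * A * lyap (16 * A) u * (v / 2 * (v / (2 * Λ))) ^ 2 := by field_simp; ring
          _ ≤ _ := by gcongr

end Potential

/-! ### Supremum norms, Lipschitz constants and `lambdaBar` -/

section Constants

theorem abs_le_supNorm {f : ℝ → ℝ} {C : ℝ} (h : ∀ x, |f x| ≤ C) (x : ℝ) : |f x| ≤ supNorm f :=
  le_ciSup (f := fun x => |f x|) ⟨C, by rintro _ ⟨x, rfl⟩; exact h x⟩ x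

theorem supNorm_le {f : ℝ → ℝ} {C : ℝ} (h : ∀ x, |f x| ≤ C) : supNorm f ≤ C := ciSup_le h

theorem lipConst_le {f : ℝ → ℝ} {C : ℝ} (hC : 0 ≤ C) (h : ∀ x y, |f x - f y| ≤ C * |x - y|) :
    lipConst f ≤ C := ciSup_le fun _ => div_le_of_le_mul₀ (abs_nonneg _) hC (h _ _)

theorem abs_sub_le_lipConst {f : ℝ → ℝ} {C : ℝ} (hC : 0 ≤ C)
    (h : ∀ x y, |f x - f y| ≤ C * |x - y|) (x y : ℝ) :
    |f x - f y| ≤ lipConst f * |x - y| := by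
  rcases eq_or_ne x y with rfl | hxy
  · simp
  rw [← div_le_iff₀ (abs_pos.2 (sub_ne_zero.2 hxy))]
  exact le_ciSup (f := fun p : ℝ × ℝ => |f p.1 - f p.2| / |p.1 - p.2|)
    ⟨C, by rintro _ ⟨p, rfl⟩; exact div_le_of_le_mul₀ (abs_nonneg _) hC (h _ _)⟩ (x, y)

theorem lipConst_nonneg (f : ℝ → ℝ) : 0 ≤ lipConst f :=
  Real.iSup_nonneg fun _ => by positivity

theorem supNorm_nonneg (f : ℝ → ℝ) : 0 ≤ supNorm f := Real.iSup_nonneg fun _ => abs_nonneg _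

theorem lambdaBar_le {q : ℕ} {V : ℕ → ℝ → ℝ} {ξs : ℕ → ℝ}
    (h : ∀ K, 0 ≤ iteratedDeriv 2 (V K) (ξs K)) (K : ℕ) :
    lambdaBar q V ξs ≤ lyapunovRate q (V K) (ξs K) := by
  refine ciInf_le ⟨0, ?_⟩ K
  rintro _ ⟨K, rfl⟩
  have := h K
  have := supNorm_nonneg (iteratedDeriv 2 (V K))
  exact le_min (by positivity) (by positivity)

end Constants

/-! ### The nested losses: independence, integrability, centred inner simulations -/

section Generic

variable {Ω : Type*} [MeasurableSpace Ω] {μ : Measure Ω} [IsProbabilityMeasure μ] {d q : ℕ}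
  {Y Y' : Ω → Fin d → ℝ} {Z Z' : ℕ → Ω → Fin q → ℝ}

theorem IsGeneric.iIndepFun_Z (h : IsGeneric μ Y Z) : iIndepFun Z μ := by
  rw [iIndepFun_iff_iIndep]
  exact h.indep.precomp (g := some) (Option.some_injective ℕ)

/-- The σ-algebras generated by `Y` and by the `Z k`. -/
@[reducible]
def genericSigma (Y : Ω → Fin d → ℝ) (Z : ℕ → Ω → Fin q → ℝ) : Option ℕ → MeasurableSpace Ω
  | none => MeasurableSpace.comap Y inferInstance
  | some k => MeasurableSpace.comap (Z k) inferInstance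

theorem IsGeneric.indepFun_of_disjoint (h : IsGeneric μ Y Z) {S T : Set (Option ℕ)}
    (hST : Disjoint S T) {β γ : Type*} [MeasurableSpace β] [MeasurableSpace γ] {A : Ω → β}
    {B : Ω → γ} (hA : Measurable[⨆ i ∈ S, genericSigma Y Z i] A)
    (hB : Measurable[⨆ i ∈ T, genericSigma Y Z i] B) :
    IndepFun A B μ := by
  have hi : iIndep (genericSigma Y Z) μ := by
    refine (congrArg (iIndep · μ) (funext fun i => ?_)).mpr h.indep
    cases i <;> rfl
  have h1 := indep_iSup_of_disjoint (fun i => ?_) hi hST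
  · exact indep_of_indep_of_le_left (indep_of_indep_of_le_right h1 hB.comap_le) hA.comap_le
  · match i with
    | none => exact h.measurable_Y.comap_le
    | some k => exact (h.measurable_Z k).comap_le

theorem measurable_Y_genericSigma {S : Set (Option ℕ)} (hS : none ∈ S) :
    Measurable[⨆ i ∈ S, genericSigma Y Z i] Y :=
  (comap_measurable Y).mono (le_iSup₂_of_le (f := fun i (_ : i ∈ S) => genericSigma Y Z i)
    none hS le_rfl) le_rfl

theorem measurable_Z_genericSigma {S : Set (Option ℕ)} {k : ℕ} (hS : some k ∈ S) :
    Measurable[⨆ i ∈ S, genericSigma Y Z i] (Z k) :=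
  (comap_measurable (Z k)).mono (le_iSup₂_of_le (f := fun i (_ : i ∈ S) => genericSigma Y Z i)
    (some k) hS le_rfl) le_rfl

theorem measurable_pi_of_sigma {ι E β : Type*} [MeasurableSpace β] {m : MeasurableSpace E}
    {f : ι → E → β} (h : ∀ i, Measurable[m] (f i)) : Measurable[m] (fun x i => f i x) :=
  measurable_pi_iff.2 h

theorem measurable_prodMk_of_sigma {E β γ : Type*} [MeasurableSpace β] [MeasurableSpace γ]
    {m : MeasurableSpace E} {f : E → β} {g : E → γ} (hf : Measurable[m] f) (hg : Measurable[m] g) :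
    Measurable[m] (fun x => (f x, g x)) :=
  hf.prodMk hg

theorem IsGeneric.indepFun_Y_Z (h : IsGeneric μ Y Z) :
    IndepFun Y (fun ω k => Z k ω) μ :=
  h.indepFun_of_disjoint (S := {none}) (T := range some) (by simp)
    (measurable_Y_genericSigma rfl)
    (measurable_pi_of_sigma fun k => measurable_Z_genericSigma ⟨k, rfl⟩)

/-- `Z k` is independent of `Y` and the first `k` inner variables. -/
theorem IsGeneric.indepFun_prefix (h : IsGeneric μ Y Z) (k : ℕ) :
    IndepFun (fun ω => (Y ω, fun i : Fin k => Z i ω)) (Z k) μ :=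
  h.indepFun_of_disjoint (S := {some k}ᶜ) (T := {some k}) disjoint_compl_left
    (measurable_prodMk_of_sigma (measurable_Y_genericSigma (by simp))
      (measurable_pi_of_sigma fun i => measurable_Z_genericSigma (by simp [i.2.ne])))
    (measurable_Z_genericSigma rfl)

theorem IsGeneric.identDistrib (h : IsGeneric μ Y Z) (h' : IsGeneric μ Y' Z')
    (hY : IdentDistrib Y Y' μ μ) (hZ : IdentDistrib (Z 0) (Z' 0) μ μ) :
    IdentDistrib (fun ω => (Y ω, fun k => Z k ω)) (fun ω => (Y' ω, fun k => Z' k ω)) μ μ :=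
  hY.prodMk (IdentDistrib.pi (fun k => ((h.ident_Z k).trans hZ).trans (h'.ident_Z k).symm)
    h.iIndepFun_Z h'.iIndepFun_Z) h.indepFun_Y_Z h'.indepFun_Y_Z

theorem IsGeneric.identDistrib_pair (h : IsGeneric μ Y Z) (k : ℕ) :
    IdentDistrib (fun ω => (Y ω, Z k ω)) (fun ω => (Y ω, Z 0 ω)) μ μ :=
  (IdentDistrib.refl h.measurable_Y.aemeasurable).prodMk (h.ident_Z k)
    (h.indepFun_Y_Z.comp measurable_id (measurable_pi_apply k))
    (h.indepFun_Y_Z.comp measurable_id (measurable_pi_apply 0))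

variable {φ : (Fin d → ℝ) → (Fin q → ℝ) → ℝ}

theorem measurable_innerMean (hφ : Measurable (fun p : (Fin d → ℝ) × (Fin q → ℝ) => φ p.1 p.2))
    (K : ℕ) : Measurable (fun e : (Fin d → ℝ) × (ℕ → Fin q → ℝ) => innerMean φ K e.1 e.2) := by
  unfold innerMean
  refine Measurable.div_const (Finset.measurable_fun_sum _ fun k _ => ?_) _
  exact hφ.comp (measurable_fst.prodMk ((measurable_pi_apply k).comp measurable_snd))

theorem IsGeneric.memLp_term {p : ENNReal}
    (hφ : Measurable (fun p : (Fin d → ℝ) × (Fin q → ℝ) => φ p.1 p.2))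
    (h : IsGeneric μ Y Z) (hL : MemLp (fun ω => φ (Y ω) (Z 0 ω)) p μ) (k : ℕ) :
    MemLp (fun ω => φ (Y ω) (Z k ω)) p μ :=
  ((h.identDistrib_pair k).comp hφ).memLp_iff.2 hL

theorem IsGeneric.measurable_loss
    (hφ : Measurable (fun p : (Fin d → ℝ) × (Fin q → ℝ) => φ p.1 p.2))
    (h : IsGeneric μ Y Z) (K : ℕ) : Measurable (loss μ φ Y Z K) := by
  unfold loss
  split_ifs
  · exact stronglyMeasurable_condExp.measurable.mono h.measurable_Y.comap_le le_rfl
  · exact (measurable_innerMean hφ K).comp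
      (h.measurable_Y.prodMk (measurable_pi_iff.2 fun k => h.measurable_Z k))

theorem IsGeneric.memLp_loss
    (hφ : Measurable (fun p : (Fin d → ℝ) × (Fin q → ℝ) => φ p.1 p.2))
    (h : IsGeneric μ Y Z) (hL : MemLp (fun ω => φ (Y ω) (Z 0 ω)) 2 μ) (K : ℕ) :
    MemLp (loss μ φ Y Z K) 2 μ := by
  unfold loss
  split_ifs
  · exact hL.condExp one_le_two
  · unfold innerMean
    simp_rw [div_eq_mul_inv]
    exact (memLp_finsetSum _ fun k _ => h.memLp_term hφ hL k).mul_const _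

/-- The regression function `y ↦ E[φ(y, Z)]`. -/
def regression (μ : Measure Ω) (φ : (Fin d → ℝ) → (Fin q → ℝ) → ℝ) (Z : ℕ → Ω → Fin q → ℝ)
    (y : Fin d → ℝ) : ℝ := ∫ z, φ y z ∂(μ.map (Z 0))

/-- The centred loss `φ(y, z) - E[φ(y, Z)]`. -/
def centred (μ : Measure Ω) (φ : (Fin d → ℝ) → (Fin q → ℝ) → ℝ) (Z : ℕ → Ω → Fin q → ℝ)
    (p : (Fin d → ℝ) × (Fin q → ℝ)) : ℝ := φ p.1 p.2 - regression μ φ Z p.1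

theorem measurable_regression (hZ : Measurable (Z 0))
    (hφ : Measurable (fun p : (Fin d → ℝ) × (Fin q → ℝ) => φ p.1 p.2)) :
    Measurable (regression μ φ Z) := by
  have := Measure.isProbabilityMeasure_map (μ := μ) hZ.aemeasurable
  exact (hφ.stronglyMeasurable.integral_prod_right' (ν := μ.map (Z 0))).measurable

theorem measurable_centred (hZ : Measurable (Z 0))
    (hφ : Measurable (fun p : (Fin d → ℝ) × (Fin q → ℝ) => φ p.1 p.2)) :
    Measurable (centred μ φ Z) :=
  hφ.sub ((measurable_regression hZ hφ).comp measurable_fst)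

/-- Valid for every `y`: where `φ y` is not integrable, both its integral and the regression
function take the default value `0`. -/
theorem integral_centred (hZ : Measurable (Z 0)) (y : Fin d → ℝ) :
    ∫ z, centred μ φ Z (y, z) ∂(μ.map (Z 0)) = 0 := by
  have := Measure.isProbabilityMeasure_map (μ := μ) hZ.aemeasurable
  unfold centred
  by_cases hi : Integrable (fun z => φ y z) (μ.map (Z 0))
  · simp only
    rw [integral_sub hi (integrable_const _)]; simp [regression]
  · simp only [regression, integral_undef hi, sub_zero]

theorem IsGeneric.loss_zero (hφ : Measurable (fun p : (Fin d → ℝ) × (Fin q → ℝ) => φ p.1 p.2))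
    (h : IsGeneric μ Y Z) (hL : Integrable (fun ω => φ (Y ω) (Z 0 ω)) μ) :
    loss μ φ Y Z 0 =ᵐ[μ] fun ω => regression μ φ Z (Y ω) := by
  have := condExp_comap_of_indepFun h.measurable_Y (h.measurable_Z 0)
    (h.indepFun_Y_Z.comp measurable_id (measurable_pi_apply 0)) hφ hL
  unfold loss
  rw [if_pos rfl]
  exact this

theorem IsGeneric.loss_sub_loss_zero
    (hφ : Measurable (fun p : (Fin d → ℝ) × (Fin q → ℝ) => φ p.1 p.2))
    (h : IsGeneric μ Y Z) (hL : Integrable (fun ω => φ (Y ω) (Z 0 ω)) μ) {K : ℕ} (hK : 1 ≤ K) :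
    (fun ω => loss μ φ Y Z K ω - loss μ φ Y Z 0 ω) =ᵐ[μ]
      fun ω => (∑ k ∈ Finset.range K, centred μ φ Z (Y ω, Z k ω)) / K := by
  filter_upwards [h.loss_zero hφ hL] with ω hω
  rw [hω, loss, if_neg (by omega), innerMean]
  have : (K : ℝ) ≠ 0 := by positivity
  simp only [centred, Finset.sum_sub_distrib, Finset.sum_const, Finset.card_range, nsmul_eq_mul]
  field_simp

end Generic

/-! ### Regularity of the objective functions, uniformly in the bias -/

section Regularity

variable {Ω : Type*} [MeasurableSpace Ω] {μ : Measure Ω} [IsProbabilityMeasure μ]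

/-- Quantitative regularity of the family of objective functions, uniform in the bias parameter. -/
structure Regularity (μ : Measure Ω) (α : ℝ) (X : ℕ → Ω → ℝ) (V : ℕ → ℝ → ℝ) (ξs : ℕ → ℝ)
    (A c lam C δ : ℝ) : Prop where
  A_pos : 0 < A
  c_pos : 0 < c
  C_pos : 0 < C
  δ_pos : 0 < δ
  c_le : c ≤ 3 / 4 * lam
  measurable : ∀ K, Measurable (X K)
  potential : ∀ K, IsPotential (fun ξ => V K ξ - V K (ξs K)) (grad μ α (X K)) A (kAlpha α)
    (16 * A) c
  integral_H₁ : ∀ K ξ, ∫ ω, H₁ α ξ (X K ω) ∂μ = grad μ α (X K) ξ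
  growth : ∀ K y, y ^ 4 ≤ C * lyap (16 * A) (V K (ξs K + y) - V K (ξs K))
  potential_le_sq : ∀ K y, V K (ξs K + y) - V K (ξs K) ≤ A / 2 * y ^ 2
  potential_le_abs : ∀ K y, V K (ξs K + y) - V K (ξs K) ≤ kAlpha α * |y|
  minimizer_sub : ∀ K, 1 ≤ K → |ξs K - ξs 0| ≤ C * bias K
  minimizer_le : ∀ K, |ξs K| ≤ C
  linearization : ∀ K, 1 ≤ K → ∀ y,
    |grad μ α (X K) (ξs K + y) - lam * y| ≤ C * (y ^ 2 + bias K ^ (1 / 4 + δ) * |y|)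
  distFun_lip : ∀ K a b, |distFun μ (X K) a - distFun μ (X K) b| ≤ C * |a - b|
  measureReal_ge : ∀ K ξ, μ.real {ω | ξ ≤ X K ω} = 1 - distFun μ (X K) ξ

theorem bias_pos {K : ℕ} (hK : 1 ≤ K) : 0 < bias K := by
  have : (0 : ℝ) < K := by exact_mod_cast hK
  unfold bias; positivity

theorem bias_le_one (K : ℕ) : bias K ≤ 1 := Nat.cast_inv_le_one K

/-- At `ξs 0` the derivative of `V K` is the difference of the two distribution functions divided by
`1 - α`, which is `O(h)` by the weak expansion. The densities are bounded below around `ξs 0`, so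
the zero of this derivative lies at distance `O(h)`. -/
theorem minimizer_sub_le {α : ℝ} (hα : α ∈ Ioo (0 : ℝ) 1) {X : ℕ → Ω → ℝ}
    (hXm : ∀ K, Measurable (X K)) (hXi : ∀ K, Integrable (X K) μ) {V : ℕ → ℝ → ℝ}
    (hV : ∀ K, V K = objective μ α (X K)) {ξs : ℕ → ℝ} (hξs : ∀ K ξ, V K (ξs K) ≤ V K ξ)
    {f : ℕ → ℝ → ℝ} (hf : ∀ K, IsContinuousPDF μ (X K) (f K)) (hexp : WeakExpansion μ X V)
    (hpos : UniformlyPositive f (ξs 0)) :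
    ∃ D : ℝ, 0 ≤ D ∧ ∀ K, 1 ≤ K → |ξs K - ξs 0| ≤ D * bias K := by
  have h1α : 0 < 1 - α := by linarith [hα.2]
  obtain ⟨v, w, hvw, hlim⟩ := hexp
  obtain ⟨-, hw, -⟩ := hlim (ξs 0) (hξs 0)
  have hg0 : ∀ K, grad μ α (X K) (ξs K) = 0 := fun K =>
    (hf K).grad_eq_zero (hXm K) hα (hXi K) (by rw [← hV K]; exact hξs K)
  obtain ⟨c, hc, hcf⟩ := hpos 2 two_pos
  -- the gradient of `V K` at `ξs 0`
  have hgK : ∀ K, 1 ≤ K →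
      grad μ α (X K) (ξs 0) = (v (ξs 0) + w (ξs 0) K) / (1 - α) * bias K := by
    intro K hK
    have h1 := hvw K hK (ξs 0)
    have h2 := hg0 0
    unfold grad at h2 ⊢
    rw [div_eq_zero_iff] at h2
    have h3 : distFun μ (X 0) (ξs 0) = α := by
      rcases h2 with h | h
      · linarith
      · linarith
    change distFun μ (X K) (ξs 0) - distFun μ (X 0) (ξs 0) = _ at h1
    rw [h3] at h1
    rw [h1]; ring
  obtain ⟨B, hB⟩ : ∃ B, ∀ K, |(v (ξs 0) + w (ξs 0) K) / (1 - α)| ≤ B := by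
    have ht : Tendsto (fun K => |(v (ξs 0) + w (ξs 0) K) / (1 - α)|) atTop
      (𝓝 |(v (ξs 0) + 0) / (1 - α)|) := ((hw.const_add _).div_const _).abs
    obtain ⟨B, hB⟩ := ht.bddAbove_range
    exact ⟨B, fun K => hB ⟨K, rfl⟩⟩
  have hB0 : 0 ≤ B := (abs_nonneg _).trans (hB 0)
  -- The truncation at `1` appears because the lower bound on the densities is used only within
  -- distance `1` of `ξs 0`.
  have key : ∀ K, 1 ≤ K → c / (1 - α) * min |ξs K - ξs 0| 1 ≤ B * bias K := by
    intro K hK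
    have hm : Monotone (fun x => grad μ α (X K) x - grad μ α (X K) (ξs 0)) :=
      fun a b h => sub_le_sub_right (grad_mono hα h) _
    have h1 := le_grad_mul (ξ₀ := ξs 0) (r := 1) (c := c / (1 - α)) hm
      (fun x => ((hf K).hasDerivAt_grad (hXm K) x).sub_const _) (by simp) one_pos
      (fun x hx => div_le_div_of_nonneg_right (hcf K x (by
        rw [Metric.mem_ball, Real.dist_eq]; linarith)) h1α.le) (by positivity) (ξs K - ξs 0)
    rw [add_sub_cancel, hg0 K, zero_sub] at h1
    rcases eq_or_lt_of_le (abs_nonneg (ξs K - ξs 0)) with h0 | h0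
    · rw [← h0]; simp; have := bias_pos hK; positivity
    · have h2 : -grad μ α (X K) (ξs 0) * (ξs K - ξs 0) ≤ B * bias K * |ξs K - ξs 0| := by
        refine (le_abs_self _).trans ?_
        rw [abs_mul, abs_neg, hgK K hK, abs_mul, abs_of_pos (bias_pos hK)]
        have := bias_pos hK
        gcongr
        exact hB K
      refine le_of_mul_le_mul_right ?_ h0
      linarith
  set b := c / (1 - α) with hb
  have hb0 : 0 < b := by positivity
  have hev : ∀ᶠ K : ℕ in atTop, |ξs K - ξs 0| * K ≤ B / b := by
    have h1 : Tendsto (fun K : ℕ => B / b * bias K) atTop (𝓝 (B / b * 0)) :=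
      (tendsto_inv_atTop_nhds_zero_nat).const_mul _
    rw [mul_zero] at h1
    filter_upwards [h1.eventually_lt_const one_pos, eventually_ge_atTop 1] with K hK hK1
    have h2 := key K hK1
    have hKp : (0 : ℝ) < K := by exact_mod_cast hK1
    have h3 : min |ξs K - ξs 0| 1 ≤ B / b * bias K := by
      rw [div_mul_eq_mul_div, le_div_iff₀ hb0]; linarith
    have h4 : |ξs K - ξs 0| ≤ B / b * bias K := by
      rcases min_le_iff.1 h3 with h | h
      · exact h
      · linarith
    unfold bias at h4
    rwa [← div_eq_mul_inv, le_div_iff₀ hKp] at h4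
  -- Once `B/b · h < 1` the truncation is inactive; the finitely many remaining `K` only enlarge
  -- `D`.
  obtain ⟨D, hD⟩ := (isBoundedUnder_of_eventually_le hev).bddAbove_range
  refine ⟨D, ?_, fun K hK => ?_⟩
  · have := hD ⟨0, rfl⟩
    simpa using this
  · have hKp : (0 : ℝ) < K := by exact_mod_cast hK
    unfold bias
    rw [← div_eq_mul_inv, le_div_iff₀ hKp]
    exact hD ⟨K, rfl⟩

/-- Every constant is extracted from bounds that hold for all `K` simultaneously. The slope `lam` is
`V_0''(ξ⋆_0)`, the same for all levels, so that the difference of a fine and a coarse scheme obeys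
one linear recursion. -/
theorem exists_regularity {α : ℝ} (hα : α ∈ Ioo (0 : ℝ) 1) {X : ℕ → Ω → ℝ}
    (hXm : ∀ K, Measurable (X K)) (hXi : ∀ K, Integrable (X K) μ) {V : ℕ → ℝ → ℝ}
    (hV : ∀ K, V K = objective μ α (X K)) {ξs : ℕ → ℝ} (hξs : ∀ K ξ, V K (ξs K) ≤ V K ξ)
    {f : ℕ → ℝ → ℝ} (hf : ∀ K, IsContinuousPDF μ (X K) (f K)) (hexp : WeakExpansion μ X V)
    (hpos : UniformlyPositive f (ξs 0)) (hlip : UniformlyBoundedLipschitz f)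
    (hrate : DensityRate f) :
    ∃ lam C δ : ℝ,
      Regularity μ α X V ξs ((⨆ K, supNorm (f K)) / (1 - α)) (lambdaBar 2 V ξs) lam C δ := by
  have h1α : 0 < 1 - α := by linarith [hα.2]
  obtain ⟨D, hD0, hD⟩ := minimizer_sub_le hα hXm hXi hV hξs hf hexp hpos
  obtain ⟨B, hB⟩ := hlip
  obtain ⟨R₀, δ₀, hR₀, hδ₀, hR⟩ := hrate
  have hDall : ∀ K, |ξs K - ξs 0| ≤ D := by
    intro K
    rcases Nat.eq_zero_or_pos K with rfl | hK
    · simpa using hD0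
    · exact (hD K hK).trans (mul_le_of_le_one_right hD0 (bias_le_one K))
  obtain ⟨c₀, hc₀, hcf⟩ := hpos (D + 2) (by linarith)
  have hcf' : ∀ K x, |x - ξs K| ≤ 1 → c₀ ≤ f K x := by
    intro K x hx
    refine hcf K x ?_
    rw [Metric.mem_ball, Real.dist_eq]
    calc |x - ξs 0| = |(x - ξs K) + (ξs K - ξs 0)| := by ring_nf
      _ ≤ |x - ξs K| + |ξs K - ξs 0| := abs_add_le _ _
      _ < D + 2 := by linarith [hDall K]
  have hB0 : 0 < B := by
    have h1 := hcf' 0 (ξs 0) (by simp)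
    have h2 := (le_abs_self _).trans ((hB 0).1 (ξs 0))
    linarith
  -- second derivative
  set F := ⨆ K, supNorm (f K) with hF
  set A := F / (1 - α) with hA
  have hFK : ∀ K x, |f K x| ≤ F := fun K x => (abs_le_supNorm (hB K).1 x).trans
    (le_ciSup (f := fun K => supNorm (f K)) ⟨B, by rintro _ ⟨K, rfl⟩; exact supNorm_le (hB K).1⟩ K)
  have hF0 : 0 < F := by
    have h1 := hcf' 0 (ξs 0) (by simp)
    have h2 := (le_abs_self _).trans (hFK 0 (ξs 0))
    linarith
  have hA0 : 0 < A := by positivity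
  set g : ℕ → ℝ → ℝ := fun K x => f K x / (1 - α) with hg
  have hV2 : ∀ K, iteratedDeriv 2 (V K) = g K := fun K => by
    rw [hV K, (hf K).iteratedDeriv_objective (hXm K) hα (hXi K)]
  have hgA : ∀ K x, |g K x| ≤ A := fun K x => by
    simp only [hg, abs_div, abs_of_pos h1α]
    exact div_le_div_of_nonneg_right (hFK K x) h1α.le
  set b := B / (1 - α) with hb
  have hb0 : 0 < b := by positivity
  have hgL : ∀ K x y, |g K x - g K y| ≤ b * |x - y| := fun K x y => by
    simp only [hg, ← sub_div, abs_div, abs_of_pos h1α, hb]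
    rw [div_mul_eq_mul_div]
    exact div_le_div_of_nonneg_right ((hB K).2 x y) h1α.le
  have hgc : ∀ K x, |x - ξs K| ≤ 1 → c₀ / (1 - α) ≤ g K x := fun K x hx =>
    div_le_div_of_nonneg_right (hcf' K x hx) h1α.le
  set e := c₀ / (1 - α) with he
  have he0 : 0 < e := by positivity
  have hgv : ∀ K, e ≤ g K (ξs K) := fun K => hgc K _ (by simp)
  -- A vanishing Lipschitz constant would make the density a positive constant, which is not
  -- integrable on the line.
  have hΛ : ∀ K, 0 < lipConst (g K) := by
    intro K
    refine lt_of_le_of_ne (lipConst_nonneg _) fun h0 => ?_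
    have hconst : ∀ x, f K x = f K (ξs K) := by
      intro x
      have h1 := abs_sub_le_lipConst hb0.le (hgL K) x (ξs K)
      rw [← h0, zero_mul] at h1
      have h2 := sub_eq_zero.1 (abs_nonpos_iff.1 h1)
      simp only [hg] at h2
      field_simp at h2
      exact h2
    have h3 := (hf K).integrable (hXm K)
    rw [show f K = fun _ => f K (ξs K) from funext hconst, integrable_const_iff] at h3
    rcases h3 with h | h
    · have := hcf' K (ξs K) (by simp); linarith
    · have := h.measure_univ_lt_top; simp at this
  have hbar : ∀ K, lambdaBar 2 V ξs ≤ lyapunovRate 2 (V K) (ξs K) := fun K =>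
    lambdaBar_le (fun K => by rw [hV2]; exact he0.le.trans (hgv K)) K
  have hbar1 : ∀ K, lambdaBar 2 V ξs ≤ 3 / 4 * g K (ξs K) := fun K => by
    have := (hbar K).trans (min_le_left _ _)
    rw [hV2] at this; push_cast at this; linarith
  have hbar2 : ∀ K, lambdaBar 2 V ξs ≤ A * g K (ξs K) ^ 4 / lipConst (g K) ^ 2 := fun K => by
    have h1 := (hbar K).trans (min_le_right _ _)
    rw [hV2] at h1
    refine h1.trans ?_
    have hl := hΛ K
    have hS : supNorm (g K) ≤ A := supNorm_le (hgA K)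
    have h2 : ((2 : ℕ) : ℝ) ^ 2 * supNorm (g K) * (g K (ξs K) ^ 4 / (4 * lipConst (g K) ^ 2)) =
        supNorm (g K) * g K (ξs K) ^ 4 / lipConst (g K) ^ 2 := by
      push_cast; field_simp; ring
    rw [h2]
    gcongr
  -- The rates are bounded below uniformly in `K`, by the common lower bound of the densities at the
  -- minimisers and their common Lipschitz constant.
  have hbarpos : 0 < lambdaBar 2 V ξs := by
    refine lt_of_lt_of_le (b := min (3 / 4 * e) (e * e ^ 4 / b ^ 2)) (by positivity)
      (le_ciInf fun K => le_min ?_ ?_)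
    · refine (min_le_left _ _).trans ?_
      rw [hV2]; push_cast; linarith [hgv K]
    · refine (min_le_right _ _).trans ?_
      rw [hV2]
      have hl := hΛ K
      have hl2 : lipConst (g K) ≤ b := lipConst_le hb0.le (hgL K)
      have hS : e ≤ supNorm (g K) :=
        (hgv K).trans ((le_abs_self _).trans (abs_le_supNorm (hgA K) _))
      have h2 : ((2 : ℕ) : ℝ) ^ 2 * supNorm (g K) * (g K (ξs K) ^ 4 / (4 * lipConst (g K) ^ 2)) =
        supNorm (g K) * g K (ξs K) ^ 4 / lipConst (g K) ^ 2 := by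
        push_cast; field_simp; ring
      rw [h2]
      have := hgv K
      have hS0 := he0.le.trans hS
      have hp : 0 ≤ g K (ξs K) := he0.le.trans this
      have hSp : 0 ≤ supNorm (g K) * g K (ξs K) ^ 4 := by positivity
      gcongr
  have hg0 : ∀ K, grad μ α (X K) (ξs K) = 0 := fun K =>
    (hf K).grad_eq_zero (hXm K) hα (hXi K) (by rw [← hV K]; exact hξs K)
  have hdV : ∀ K x, HasDerivAt (V K) (grad μ α (X K) x) x := fun K x => by
    rw [hV K]; exact (hf K).hasDerivAt_objective (hXm K) hα (hXi K) x
  have hdG : ∀ K x, HasDerivAt (grad μ α (X K)) (g K x) x := fun K x =>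
    (hf K).hasDerivAt_grad (hXm K) x
  have hdU : ∀ K x, HasDerivAt (fun ξ => V K ξ - V K (ξs K)) (grad μ α (X K) x) x := fun K x =>
    (hdV K x).sub_const _
  have hUn : ∀ K x, 0 ≤ V K x - V K (ξs K) := fun K x => sub_nonneg.2 (hξs K x)
  have hpot : ∀ K, IsPotential (fun ξ => V K ξ - V K (ξs K)) (grad μ α (X K)) A (kAlpha α)
    (16 * A) (lambdaBar 2 V ξs) := fun K =>
    isPotential_of_lipschitz (ξ₀ := ξs K) (grad_mono hα) (hdU K) (hUn K) (sub_self _) (hdG K)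
      (hg0 K) hA0 (hgA K) (abs_grad_le hα) rfl (he0.trans_le (hgv K)) (hΛ K)
      (abs_sub_le_lipConst hb0.le (hgL K))
      ((hbar1 K).trans (by linarith [he0.trans_le (hgv K)])) (hbar2 K)
  obtain ⟨C₁, hC₁, hgrow⟩ := pow_four_le_of_growth (c := e) (r := 1) (m := 16 * A) he0 one_pos
    (by positivity)
  -- The cap gives `1/4 + δ ≤ 1`, so that the shift `O(h)` of the minimiser is also `O(h^{1/4+δ})`.
  set δ := min δ₀ (3 / 4) with hδ
  have hδ0 : 0 < δ := lt_min hδ₀ (by norm_num)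
  set C₂ := b + R₀ / (1 - α) + b * D with hC₂
  have hR0' : 0 ≤ R₀ / (1 - α) := by positivity
  have hbD : 0 ≤ b * D := by positivity
  -- The slope at an intermediate point is compared with `lam` in three moves: to `ξs K` (Lipschitz
  -- density), from bias `h` to bias `0` (density rate on the compact set `{ξs K}`), and from `ξs K`
  -- to `ξs 0`.
  have hlin : ∀ K, 1 ≤ K → ∀ y, |grad μ α (X K) (ξs K + y) - g 0 (ξs 0) * y| ≤
      C₂ * (y ^ 2 + bias K ^ (1 / 4 + δ) * |y|) := by
    intro K hK y
    obtain ⟨t, ht, h1⟩ := exists_mean_value (hdG K) (ξs K) y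
    rw [hg0 K, sub_zero] at h1
    have hh := bias_pos hK
    have hh1 := bias_le_one K
    set h := bias K ^ (1 / 4 + δ) with hh'
    have hp1 : bias K ≤ h := by
      have := Real.rpow_le_rpow_of_exponent_ge hh hh1 (show 1 / 4 + δ ≤ 1 by
        have := min_le_right δ₀ (3 / 4); linarith)
      rwa [Real.rpow_one] at this
    have hp2 : bias K ^ (1 / 4 + δ₀) ≤ h :=
      Real.rpow_le_rpow_of_exponent_ge hh hh1 (by have := min_le_left δ₀ (3 / 4); linarith)
    have hh0 : 0 ≤ h := hh.le.trans hp1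
    have e1 : |g K (ξs K + t * y) - g K (ξs K)| ≤ b * |y| := by
      refine (hgL K _ _).trans ?_
      rw [add_sub_cancel_left, abs_mul, abs_of_pos ht.1]
      have := ht.2
      gcongr
      nlinarith [abs_nonneg y]
    have e2 : |g K (ξs K) - g 0 (ξs K)| ≤ R₀ / (1 - α) * h := by
      have := hR K hK {ξs K} isCompact_singleton (ξs K) rfl
      simp only [hg, ← sub_div, abs_div, abs_of_pos h1α]
      rw [div_mul_eq_mul_div]
      refine div_le_div_of_nonneg_right (this.trans ?_) h1α.le
      gcongr
    have e3 : |g 0 (ξs K) - g 0 (ξs 0)| ≤ b * D * h := by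
      refine (hgL 0 _ _).trans ?_
      rw [mul_assoc]
      gcongr
      exact (hD K hK).trans (by gcongr)
    have e4 : |g K (ξs K + t * y) - g 0 (ξs 0)| ≤ b * |y| + (R₀ / (1 - α) + b * D) * h := by
      calc |g K (ξs K + t * y) - g 0 (ξs 0)| =
          |(g K (ξs K + t * y) - g K (ξs K)) + (g K (ξs K) - g 0 (ξs K)) +
            (g 0 (ξs K) - g 0 (ξs 0))| := by ring_nf
        _ ≤ _ := abs_add_three _ _ _
        _ ≤ _ := by linarith
    rw [h1, ← sub_mul, abs_mul]
    calc _ ≤ (b * |y| + (R₀ / (1 - α) + b * D) * h) * |y| := by gcongr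
      _ = b * y ^ 2 + (R₀ / (1 - α) + b * D) * (h * |y|) := by rw [← sq_abs y]; ring
      _ ≤ C₂ * y ^ 2 + C₂ * (h * |y|) := by
        have : 0 ≤ h * |y| := by positivity
        gcongr <;> linarith
      _ = _ := by ring
  refine ⟨g 0 (ξs 0), C₁ + C₂ + D + (|ξs 0| + D) + F, δ, ?_⟩
  have hξ0 := abs_nonneg (ξs 0)
  have hC20 : 0 ≤ C₂ := by positivity
  refine ⟨hA0, hbarpos, by positivity, hδ0, hbar1 0, hXm, hpot,
    fun K ξ => (hf K).integral_H₁ (hXm K) hα ξ, fun K y => ?_, fun K y => ?_, fun K y => ?_,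
    fun K hK => ?_, fun K => ?_, fun K hK y => ?_, fun K a b => ?_,
    fun K ξ => (hf K).measureReal_ge (hXm K) ξ⟩
  · have h1 := le_potential (ξ₀ := ξs K) (grad_mono hα) (hdU K) (hUn K) (hdG K) (hg0 K) one_pos
      (hgc K) he0.le y
    refine (hgrow _ _ h1).trans ?_
    have := lyap_nonneg (16 * A) (V K (ξs K + y) - V K (ξs K))
    gcongr
    linarith
  · have := (hpot K).quad (ξs K) y
    rw [hg0 K] at this
    linarith
  · have h1 := potential_le (ξ₀ := ξs K) (grad_mono hα) (hdU K) (sub_self _) y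
    refine h1.trans ((le_abs_self _).trans ?_)
    rw [abs_mul]
    gcongr
    exact abs_grad_le hα _
  · refine (hD K hK).trans ?_
    have := bias_pos hK
    gcongr
    linarith
  · calc |ξs K| = |(ξs K - ξs 0) + ξs 0| := by ring_nf
      _ ≤ |ξs K - ξs 0| + |ξs 0| := abs_add_le _ _
      _ ≤ _ := by linarith [hDall K]
  · refine (hlin K hK y).trans ?_
    have := bias_pos hK
    gcongr
    linarith
  · refine ((hf K).abs_distFun_sub_le (hXm K) (fun x => (le_abs_self _).trans (hFK K x)) a b).trans ?_
    gcongr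
    linarith

end Regularity

/-! ### Independence of the samples of one iteration from all other sources -/

section Simulation

variable {Ω : Type*} {d q : ℕ}

/-- The sources of randomness used in iteration `n` at level `ℓ`. -/
def sampleSources (ℓ n : ℕ) : Set Source := {Source.outer ℓ n} ∪ range (Source.inner ℓ n)

/-- The σ-algebra generated by all sources but those of iteration `n` at level `ℓ`. -/
@[reducible]
def otherSigma (Ys : ℕ → ℕ → Ω → Fin d → ℝ) (Zs : ℕ → ℕ → ℕ → Ω → Fin q → ℝ)
    (θ₀ : ℕ → Bool → Ω → ℝ × ℝ) (ℓ n : ℕ) : MeasurableSpace Ω :=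
  ⨆ s ∈ (sampleSources ℓ n)ᶜ, Source.sigma Ys Zs θ₀ s

/-- The simulations of iteration `n` at level `ℓ`. -/
def sample (Ys : ℕ → ℕ → Ω → Fin d → ℝ) (Zs : ℕ → ℕ → ℕ → Ω → Fin q → ℝ) (ℓ n : ℕ) (ω : Ω) :
    (Fin d → ℝ) × (ℕ → Fin q → ℝ) := (Ys ℓ n ω, fun k => Zs ℓ n k ω)

variable [mΩ : MeasurableSpace Ω] {μ : Measure Ω} {Y : Ω → Fin d → ℝ} {Z : ℕ → Ω → Fin q → ℝ}
  {Ys : ℕ → ℕ → Ω → Fin d → ℝ} {Zs : ℕ → ℕ → ℕ → Ω → Fin q → ℝ} {θ₀ : ℕ → Bool → Ω → ℝ × ℝ}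

theorem IsSimulation.sigma_le (h : IsSimulation μ Y (Z 0) Ys Zs θ₀) (s : Source) :
    Source.sigma Ys Zs θ₀ s ≤ mΩ := by
  match s with
  | .init => exact iSup₂_le fun ℓ j => (h.measurable_init ℓ j).comap_le
  | .outer ℓ n => exact (h.measurable_Ys ℓ n).comap_le
  | .inner ℓ n k => exact (h.measurable_Zs ℓ n k).comap_le

theorem IsSimulation.otherSigma_le (h : IsSimulation μ Y (Z 0) Ys Zs θ₀) (ℓ n : ℕ) :
    otherSigma Ys Zs θ₀ ℓ n ≤ mΩ := iSup₂_le fun s _ => h.sigma_le s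

theorem IsSimulation.measurable_sample (h : IsSimulation μ Y (Z 0) Ys Zs θ₀) (ℓ n : ℕ) :
    Measurable (sample Ys Zs ℓ n) :=
  (h.measurable_Ys ℓ n).prodMk (measurable_pi_iff.2 fun k => h.measurable_Zs ℓ n k)

theorem measurable_of_sigma_le {E : Type*} [MeasurableSpace E] {A : Ω → E} {S : Set Source}
    {s : Source} (hs : s ∈ S) (hA : Measurable[Source.sigma Ys Zs θ₀ s] A) :
    Measurable[⨆ s ∈ S, Source.sigma Ys Zs θ₀ s] A :=
  hA.mono (le_iSup₂_of_le (f := fun s (_ : s ∈ S) => Source.sigma Ys Zs θ₀ s) s hs le_rfl) le_rfl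

theorem measurable_sample_iSup {S : Set Source} {ℓ n : ℕ} (hS : sampleSources ℓ n ⊆ S) :
    Measurable[⨆ s ∈ S, Source.sigma Ys Zs θ₀ s] (sample Ys Zs ℓ n) :=
  measurable_prodMk_of_sigma
    (measurable_of_sigma_le (s := .outer ℓ n) (hS (Or.inl rfl)) (comap_measurable _))
    (measurable_pi_of_sigma fun k => measurable_of_sigma_le (s := .inner ℓ n k)
      (hS (Or.inr ⟨k, rfl⟩)) (comap_measurable _))

theorem measurable_sample_otherSigma {ℓ n ℓ' n' : ℕ} (h : (ℓ', n') ≠ (ℓ, n)) :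
    Measurable[otherSigma Ys Zs θ₀ ℓ n] (sample Ys Zs ℓ' n') := by
  refine measurable_sample_iSup fun s hs hs' => h ?_
  rcases hs with rfl | ⟨k, rfl⟩ <;> rcases hs' with h' | ⟨k', h'⟩
  · cases h'; rfl
  · cases h'
  · cases h'
  · cases h'; rfl

theorem measurable_init_otherSigma (ℓ n ℓ' : ℕ) (j : Bool) :
    Measurable[otherSigma Ys Zs θ₀ ℓ n] (θ₀ ℓ' j) := by
  refine measurable_of_sigma_le (s := .init) ?_ ?_
  · rintro (h | ⟨k, h⟩) <;> cases h
  · exact (comap_measurable _).mono (le_iSup₂_of_le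
      (f := fun ℓ j => MeasurableSpace.comap (θ₀ ℓ j) inferInstance) ℓ' j le_rfl) le_rfl

/-- Conditioning is on all sources other than the samples of one iteration rather than on a past.
One σ-algebra then serves for orthogonality in time and across levels, with no independence among
the initializations. -/
theorem IsSimulation.indepFun_sample (h : IsSimulation μ Y (Z 0) Ys Zs θ₀) {ℓ n : ℕ}
    {E : Type*} [MeasurableSpace E] {A : Ω → E} (hA : Measurable[otherSigma Ys Zs θ₀ ℓ n] A) :
    IndepFun A (sample Ys Zs ℓ n) μ := by
  have h1 := indep_iSup_of_disjoint h.sigma_le h.indep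
    (disjoint_compl_left (a := sampleSources ℓ n))
  exact indep_of_indep_of_le_left (indep_of_indep_of_le_right h1
    (measurable_sample_iSup (S := sampleSources ℓ n) subset_rfl).comap_le) hA.comap_le

/-- The labels of the simulations of one iteration. -/
def sampleLabel (ℓ n : ℕ) : Option ℕ → Source
  | none => Source.outer ℓ n
  | some k => Source.inner ℓ n k

theorem sampleLabel_injective (ℓ n : ℕ) : Function.Injective (sampleLabel ℓ n) := by
  intro i j h
  match i, j with
  | none, none => rfl
  | none, some _ => cases h
  | some _, none => cases h
  | some _, some _ => cases h; rfl

theorem IsSimulation.isGeneric (h : IsSimulation μ Y (Z 0) Ys Zs θ₀) (ℓ n : ℕ) :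
    IsGeneric μ (Ys ℓ n) (Zs ℓ n) where
  measurable_Y := h.measurable_Ys ℓ n
  measurable_Z := h.measurable_Zs ℓ n
  ident_Z k := (h.ident_Zs ℓ n k).trans (h.ident_Zs ℓ n 0).symm
  indep := by
    have := h.indep.precomp (sampleLabel_injective ℓ n)
    convert this using 2 with i
    cases i <;> rfl

variable [IsProbabilityMeasure μ] {φ : (Fin d → ℝ) → (Fin q → ℝ) → ℝ} {α : ℝ} {γ : ℕ → ℝ}

theorem IsSimulation.identDistrib_sample (h : IsSimulation μ Y (Z 0) Ys Zs θ₀)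
    (hYZ : IsGeneric μ Y Z) (ℓ n : ℕ) :
    IdentDistrib (sample Ys Zs ℓ n) (fun ω => (Y ω, fun k => Z k ω)) μ μ :=
  (h.isGeneric ℓ n).identDistrib hYZ (h.ident_Ys ℓ n) (h.ident_Zs ℓ n 0)

/-- Expectations over one iteration: condition on all other sources. -/
theorem IsSimulation.integral_sample (h : IsSimulation μ Y (Z 0) Ys Zs θ₀)
    (hYZ : IsGeneric μ Y Z) {ℓ n : ℕ} {E : Type*} [MeasurableSpace E] {A : Ω → E}
    (hA : Measurable[otherSigma Ys Zs θ₀ ℓ n] A)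
    {Ψ : E × ((Fin d → ℝ) × (ℕ → Fin q → ℝ)) → ℝ} (hΨ : Measurable Ψ)
    (hint : Integrable (fun ω => Ψ (A ω, sample Ys Zs ℓ n ω)) μ) :
    ∫ ω, Ψ (A ω, sample Ys Zs ℓ n ω) ∂μ =
      ∫ ω, ∫ ω', Ψ (A ω, (Y ω', fun k => Z k ω')) ∂μ ∂μ := by
  rw [integral_comp_indepFun (hA.mono (h.otherSigma_le ℓ n) le_rfl) (h.measurable_sample ℓ n)
    (h.indepFun_sample hA) hΨ hint]
  congr 1 with ω
  rw [(h.identDistrib_sample hYZ ℓ n).map_eq,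
    integral_map (h.identDistrib_sample hYZ ℓ n).aemeasurable_snd]
  exact (hΨ.comp measurable_prodMk_left).aestronglyMeasurable

theorem IsSimulation.integrable_sample (h : IsSimulation μ Y (Z 0) Ys Zs θ₀)
    (hYZ : IsGeneric μ Y Z) {ℓ n : ℕ} {E : Type*} [MeasurableSpace E] {A : Ω → E}
    (hA : Measurable[otherSigma Ys Zs θ₀ ℓ n] A)
    {Ψ : E × ((Fin d → ℝ) × (ℕ → Fin q → ℝ)) → ℝ} (hΨ : Measurable Ψ)
    (hint : Integrable (fun ω => Ψ (A ω, sample Ys Zs ℓ n ω)) μ) :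
    Integrable (fun ω => ∫ ω', Ψ (A ω, (Y ω', fun k => Z k ω')) ∂μ) μ := by
  have h1 := integrable_comp_indepFun (hA.mono (h.otherSigma_le ℓ n) le_rfl)
    (h.measurable_sample ℓ n) (h.indepFun_sample hA) hΨ hint
  refine h1.congr (Eventually.of_forall fun ω => ?_)
  simp only
  rw [(h.identDistrib_sample hYZ ℓ n).map_eq,
    integral_map (h.identDistrib_sample hYZ ℓ n).aemeasurable_snd]
  exact (hΨ.comp measurable_prodMk_left).aestronglyMeasurable

theorem loss_eq {K : ℕ} (hK : 1 ≤ K) (ω : Ω) :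
    loss μ φ Y Z K ω = innerMean φ K (Y ω) (fun k => Z k ω) := by
  rw [loss, if_neg (by omega)]

theorem levelIterate_succ (ℓ K : ℕ) (θ : Ω → ℝ × ℝ) (n : ℕ) (ω : Ω) :
    levelIterate α γ φ Ys Zs ℓ K θ (n + 1) ω =
      ((levelIterate α γ φ Ys Zs ℓ K θ n ω).1 - γ (n + 1) *
        H₁ α (levelIterate α γ φ Ys Zs ℓ K θ n ω).1
          (innerMean φ K (sample Ys Zs ℓ n ω).1 (sample Ys Zs ℓ n ω).2),
      (levelIterate α γ φ Ys Zs ℓ K θ n ω).2 - 1 / ((n : ℝ) + 1) *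
        H₂ α (levelIterate α γ φ Ys Zs ℓ K θ n ω).1 (levelIterate α γ φ Ys Zs ℓ K θ n ω).2
          (innerMean φ K (sample Ys Zs ℓ n ω).1 (sample Ys Zs ℓ n ω).2)) := rfl

theorem measurable_iterate_of_sigma {m : MeasurableSpace Ω} {θ : Ω → ℝ × ℝ}
    {x : ℕ → Ω → ℝ} {n : ℕ} (hθ : Measurable[m] θ)
    (hx : ∀ i < n, Measurable[m] (x i)) :
    Measurable[m] (fun ω => iterate α γ (θ ω) (fun i => x i ω) n) := by
  induction n with
  | zero => exact hθ
  | succ n ih =>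
    have h1 := ih fun i hi => hx i (hi.trans n.lt_succ_self)
    have h2 := hx n n.lt_succ_self
    have h3 : Measurable[m] (fun ω => ((iterate α γ (θ ω) (fun i => x i ω) n).1, x n ω)) :=
      (measurable_fst.comp h1).prodMk h2
    refine Measurable.prodMk ?_ ?_
    · exact (measurable_fst.comp h1).sub (((measurable_H₁ α).comp h3).const_mul _)
    · refine (measurable_snd.comp h1).sub (Measurable.const_mul ?_ _)
      unfold H₂
      exact (measurable_snd.comp h1).sub ((measurable_fst.comp h1).add
        (((h2.sub (measurable_fst.comp h1)).max measurable_const).const_mul _))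

theorem measurable_levelIterate_otherSigma
    (hφ : Measurable (fun p : (Fin d → ℝ) × (Fin q → ℝ) => φ p.1 p.2)) {ℓ n ℓ' n' : ℕ} (K : ℕ)
    (j : Bool) (h : ∀ i < n', (ℓ', i) ≠ (ℓ, n)) :
    Measurable[otherSigma Ys Zs θ₀ ℓ n] (levelIterate α γ φ Ys Zs ℓ' K (θ₀ ℓ' j) n') :=
  measurable_iterate_of_sigma (measurable_init_otherSigma ℓ n ℓ' j)
    fun i hi => (measurable_innerMean hφ K).comp (measurable_sample_otherSigma (h i hi))

theorem IsSimulation.measurable_levelIterate (hs : IsSimulation μ Y (Z 0) Ys Zs θ₀)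
    (hφ : Measurable (fun p : (Fin d → ℝ) × (Fin q → ℝ) => φ p.1 p.2)) (ℓ K : ℕ)
    (j : Bool) (n : ℕ) : Measurable (levelIterate α γ φ Ys Zs ℓ K (θ₀ ℓ j) n) :=
  (measurable_levelIterate_otherSigma (ℓ := ℓ + 1) (n := 0) hφ K j (fun i _ => by simp)).mono
    (hs.otherSigma_le _ _) le_rfl

end Simulation

/-! ### Fourth moments of a single scheme -/

section Moments

variable {Ω : Type*} {d q : ℕ}

/-- The standing assumptions, with quantitative constants. -/
structure Setup [MeasurableSpace Ω] (μ : Measure Ω) (φ : (Fin d → ℝ) → (Fin q → ℝ) → ℝ)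
    (Y : Ω → Fin d → ℝ) (Z : ℕ → Ω → Fin q → ℝ) (α : ℝ) (V : ℕ → ℝ → ℝ) (ξs : ℕ → ℝ)
    (Ys : ℕ → ℕ → Ω → Fin d → ℝ) (Zs : ℕ → ℕ → ℕ → Ω → Fin q → ℝ) (θ₀ : ℕ → Bool → Ω → ℝ × ℝ)
    (A c lam C δ B : ℝ) : Prop where
  measurable_φ : Measurable (fun p : (Fin d → ℝ) × (Fin q → ℝ) => φ p.1 p.2)
  generic : IsGeneric μ Y Z
  memLp : MemLp (fun ω => φ (Y ω) (Z 0 ω)) 2 μ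
  α_mem : α ∈ Ioo (0 : ℝ) 1
  reg : Regularity μ α (loss μ φ Y Z) V ξs A c lam C δ
  sim : IsSimulation μ Y (Z 0) Ys Zs θ₀
  init : ∀ ℓ j, Integrable (fun ω => Real.exp (16 * A * kAlpha α * |(θ₀ ℓ j ω).1|)) μ ∧
    ∫ ω, Real.exp (16 * A * kAlpha α * |(θ₀ ℓ j ω).1|) ∂μ ≤ B

/-- The error `ξ_n - ξ⋆` of the first component of a scheme. -/
def err (α : ℝ) (γ : ℕ → ℝ) (φ : (Fin d → ℝ) → (Fin q → ℝ) → ℝ)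
    (Ys : ℕ → ℕ → Ω → Fin d → ℝ) (Zs : ℕ → ℕ → ℕ → Ω → Fin q → ℝ) (θ₀ : ℕ → Bool → Ω → ℝ × ℝ)
    (ξs : ℕ → ℝ) (ℓ K : ℕ) (j : Bool) (n : ℕ) (ω : Ω) : ℝ :=
  (levelIterate α γ φ Ys Zs ℓ K (θ₀ ℓ j) n ω).1 - ξs K

/-- The increments of the scheme are bounded by `k_α γ_i`, so exponential integrability at time `n`
is inherited from the initialization. -/
theorem abs_iterate_sub_le {α : ℝ} (hα : α ∈ Ioo (0 : ℝ) 1) (γ : ℕ → ℝ) (θ : ℝ × ℝ) (x : ℕ → ℝ)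
    (n : ℕ) : |(iterate α γ θ x n).1 - θ.1| ≤ kAlpha α * ∑ i ∈ Finset.range n, |γ (i + 1)| := by
  induction n with
  | zero => simp [iterate]
  | succ n ih =>
    rw [Finset.sum_range_succ, mul_add]
    have h1 : (iterate α γ θ x (n + 1)).1 - θ.1 = ((iterate α γ θ x n).1 - θ.1) -
        γ (n + 1) * H₁ α (iterate α γ θ x n).1 (x n) := by simp only [iterate]; ring
    rw [h1]
    refine (abs_sub _ _).trans (add_le_add ih ?_)
    rw [abs_mul, mul_comm]
    gcongr
    exact abs_H₁_le hα _ _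

variable [MeasurableSpace Ω] {μ : Measure Ω} [IsProbabilityMeasure μ]
  {φ : (Fin d → ℝ) → (Fin q → ℝ) → ℝ}
  {Y : Ω → Fin d → ℝ} {Z : ℕ → Ω → Fin q → ℝ} {α : ℝ} {V : ℕ → ℝ → ℝ} {ξs : ℕ → ℝ}
  {Ys : ℕ → ℕ → Ω → Fin d → ℝ} {Zs : ℕ → ℕ → ℕ → Ω → Fin q → ℝ} {θ₀ : ℕ → Bool → Ω → ℝ × ℝ}
  {A c lam C δ B : ℝ} {γ : ℕ → ℝ}

theorem Setup.measurable_err (S : Setup μ φ Y Z α V ξs Ys Zs θ₀ A c lam C δ B) (ℓ K : ℕ) (j : Bool)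
    (n : ℕ) : Measurable (err α γ φ Ys Zs θ₀ ξs ℓ K j n) :=
  (measurable_fst.comp (S.sim.measurable_levelIterate S.measurable_φ ℓ K j n)).sub_const _

theorem Setup.measurable_err_otherSigma
    (S : Setup μ φ Y Z α V ξs Ys Zs θ₀ A c lam C δ B) {ℓ n ℓ' n' : ℕ} (K : ℕ) (j : Bool)
    (h : ∀ i < n', (ℓ', i) ≠ (ℓ, n)) :
    Measurable[otherSigma Ys Zs θ₀ ℓ n] (err α γ φ Ys Zs θ₀ ξs ℓ' K j n') :=
  (measurable_fst.comp (measurable_levelIterate_otherSigma S.measurable_φ K j h)).sub_const _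

theorem err_succ (ℓ K : ℕ) (j : Bool) (n : ℕ) (ω : Ω) :
    err α γ φ Ys Zs θ₀ ξs ℓ K j (n + 1) ω = err α γ φ Ys Zs θ₀ ξs ℓ K j n ω - γ (n + 1) *
      H₁ α (ξs K + err α γ φ Ys Zs θ₀ ξs ℓ K j n ω)
        (innerMean φ K (sample Ys Zs ℓ n ω).1 (sample Ys Zs ℓ n ω).2) := by
  simp only [err, levelIterate_succ, add_sub_cancel]; ring

/-- A bound of the Lyapunov function along the iterates by the initial exponential. -/
theorem Setup.lyap_err_le (S : Setup μ φ Y Z α V ξs Ys Zs θ₀ A c lam C δ B) (ℓ K : ℕ) (j : Bool)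
    (n : ℕ) (ω : Ω) :
    lyap (16 * A) (V K (ξs K + err α γ φ Ys Zs θ₀ ξs ℓ K j n ω) - V K (ξs K)) ≤
      Real.exp (16 * A * kAlpha α * (C + kAlpha α * ∑ i ∈ Finset.range n, |γ (i + 1)|)) *
        Real.exp (16 * A * kAlpha α * |(θ₀ ℓ j ω).1|) := by
  have hA := S.reg.A_pos
  have hk := one_le_kAlpha α
  set y := err α γ φ Ys Zs θ₀ ξs ℓ K j n ω with hy
  have h1 := S.reg.potential_le_abs K y
  have h2 := (S.reg.potential K).nonneg (ξs K + y)
  have h3 : |y| ≤ C + kAlpha α * ∑ i ∈ Finset.range n, |γ (i + 1)| + |(θ₀ ℓ j ω).1| := by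
    have h4 := abs_iterate_sub_le S.α_mem γ (θ₀ ℓ j ω)
      (fun i => innerMean φ K (Ys ℓ i ω) (fun k => Zs ℓ i k ω)) n
    have h5 := S.reg.minimizer_le K
    have h6 : y = ((levelIterate α γ φ Ys Zs ℓ K (θ₀ ℓ j) n ω).1 - (θ₀ ℓ j ω).1) +
        ((θ₀ ℓ j ω).1 - ξs K) := by rw [hy, err]; ring
    rw [h6]
    have h7 := abs_sub (θ₀ ℓ j ω).1 (ξs K)
    have h8 := abs_add_le ((levelIterate α γ φ Ys Zs ℓ K (θ₀ ℓ j) n ω).1 - (θ₀ ℓ j ω).1)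
      ((θ₀ ℓ j ω).1 - ξs K)
    unfold levelIterate at h8 ⊢
    linarith
  rw [← Real.exp_add]
  refine le_trans (b := Real.exp (16 * A * (V K (ξs K + y) - V K (ξs K)))) ?_ ?_
  · have : 0 ≤ 16 * A * (V K (ξs K + y) - V K (ξs K)) := by positivity
    unfold lyap; linarith
  · apply Real.exp_le_exp.2
    calc 16 * A * (V K (ξs K + y) - V K (ξs K)) ≤ 16 * A * (kAlpha α *
          (C + kAlpha α * ∑ i ∈ Finset.range n, |γ (i + 1)| + |(θ₀ ℓ j ω).1|)) := by
          gcongr; exact h1.trans (by gcongr)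
      _ = _ := by ring

theorem Setup.measurable_lyap_err (S : Setup μ φ Y Z α V ξs Ys Zs θ₀ A c lam C δ B) (ℓ K : ℕ)
    (j : Bool) (n : ℕ) : Measurable (fun ω =>
      lyap (16 * A) (V K (ξs K + err α γ φ Ys Zs θ₀ ξs ℓ K j n ω) - V K (ξs K))) :=
  (measurable_lyap _).comp ((S.reg.potential K).measurable.comp
    ((S.measurable_err ℓ K j n).const_add _))

theorem Setup.integrable_lyap_err (S : Setup μ φ Y Z α V ξs Ys Zs θ₀ A c lam C δ B) (ℓ K : ℕ)
    (j : Bool) (n : ℕ) : Integrable (fun ω =>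
      lyap (16 * A) (V K (ξs K + err α γ φ Ys Zs θ₀ ξs ℓ K j n ω) - V K (ξs K))) μ := by
  refine ((S.init ℓ j).1.const_mul (Real.exp (16 * A * kAlpha α * (C + kAlpha α *
    ∑ i ∈ Finset.range n, |γ (i + 1)|)))).mono'
    (S.measurable_lyap_err ℓ K j n).aestronglyMeasurable (Eventually.of_forall fun ω => ?_)
  rw [Real.norm_of_nonneg (lyap_nonneg _ _)]
  exact S.lyap_err_le ℓ K j n ω

theorem Setup.integrable_err_pow_four (S : Setup μ φ Y Z α V ξs Ys Zs θ₀ A c lam C δ B) (ℓ K : ℕ)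
    (j : Bool) (n : ℕ) : Integrable (fun ω => err α γ φ Ys Zs θ₀ ξs ℓ K j n ω ^ 4) μ := by
  refine ((S.integrable_lyap_err (γ := γ) ℓ K j n).const_mul C).mono'
    ((S.measurable_err ℓ K j n).pow_const 4).aestronglyMeasurable
    (Eventually.of_forall fun ω => ?_)
  rw [Real.norm_of_nonneg (by positivity)]
  exact S.reg.growth K _

theorem Setup.measurable_sample_H₁ (S : Setup μ φ Y Z α V ξs Ys Zs θ₀ A c lam C δ B) (K : ℕ) :
    Measurable (fun p : ℝ × ((Fin d → ℝ) × (ℕ → Fin q → ℝ)) =>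
      H₁ α (ξs K + p.1) (innerMean φ K p.2.1 p.2.2)) :=
  (measurable_H₁ α).comp ((measurable_fst.const_add _).prodMk
    ((measurable_innerMean S.measurable_φ K).comp measurable_snd))

/-- Conditionally on the other sources the next error is one step of the gradient scheme from a
frozen point, to which `lyap_step` applies. -/
theorem Setup.integral_lyap_err_succ {η γ₁ : ℝ}
    (S : Setup μ φ Y Z α V ξs Ys Zs θ₀ A c lam C δ B) (hη : 0 < η) (hγ₁ : 0 < γ₁) :
    ∃ D : ℝ, 0 ≤ D ∧ ∀ (γ : ℕ → ℝ), (∀ n, 1 ≤ n → 0 < γ n ∧ γ n ≤ γ₁) →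
      ∀ (ℓ K : ℕ) (j : Bool), 1 ≤ K → ∀ n,
      ∫ ω, lyap (16 * A) (V K (ξs K + err α γ φ Ys Zs θ₀ ξs ℓ K j (n + 1) ω) - V K (ξs K)) ∂μ ≤
        (1 - (c - η) * γ (n + 1) + D * γ (n + 1) ^ 2) *
          ∫ ω, lyap (16 * A) (V K (ξs K + err α γ φ Ys Zs θ₀ ξs ℓ K j n ω) - V K (ξs K)) ∂μ +
        D * γ (n + 1) ^ 3 := by
  have hA := S.reg.A_pos
  have hk := one_le_kAlpha α
  obtain ⟨D, hD0, hD⟩ := lyap_step (A := A) (k := kAlpha α) (m := 16 * A) (c := c) hA.le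
    (by linarith) (by positivity) hη hγ₁
  refine ⟨D, hD0, fun γ hγ ℓ K j hK n => ?_⟩
  have hpot := S.reg.potential K
  set Ψ : ℝ × ((Fin d → ℝ) × (ℕ → Fin q → ℝ)) → ℝ := fun p =>
    lyap (16 * A) (V K (ξs K + p.1 - γ (n + 1) *
      H₁ α (ξs K + p.1) (innerMean φ K p.2.1 p.2.2)) - V K (ξs K)) with hΨ
  have hΨm : Measurable Ψ := (measurable_lyap _).comp (hpot.measurable.comp
    ((measurable_fst.const_add _).sub ((S.measurable_sample_H₁ K).const_mul _)))
  have he : ∀ ω, lyap (16 * A) (V K (ξs K + err α γ φ Ys Zs θ₀ ξs ℓ K j (n + 1) ω) - V K (ξs K)) =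
      Ψ (err α γ φ Ys Zs θ₀ ξs ℓ K j n ω, sample Ys Zs ℓ n ω) := fun ω => by
    rw [hΨ, err_succ]; ring_nf
  have hAm := S.measurable_err_otherSigma (γ := γ) (ℓ := ℓ) (n := n) (ℓ' := ℓ) (n' := n) K j
    (fun i hi h => by simp at h; omega)
  have hint := S.integrable_lyap_err (γ := γ) ℓ K j (n + 1)
  simp_rw [he] at hint ⊢
  rw [S.sim.integral_sample S.generic hAm hΨm hint]
  have hint' := S.integrable_lyap_err (γ := γ) ℓ K j n
  calc _ ≤ ∫ ω, ((1 - (c - η) * γ (n + 1) + D * γ (n + 1) ^ 2) *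
        lyap (16 * A) (V K (ξs K + err α γ φ Ys Zs θ₀ ξs ℓ K j n ω) - V K (ξs K)) +
        D * γ (n + 1) ^ 3) ∂μ := by
        refine integral_mono (S.sim.integrable_sample S.generic hAm hΨm hint)
          ((hint'.const_mul _).add (integrable_const _)) fun ω => ?_
        have h1 := S.reg.integral_H₁ K (ξs K + err α γ φ Ys Zs θ₀ ξs ℓ K j n ω)
        simp_rw [loss_eq hK] at h1
        refine hD _ _ hpot Ω μ (fun ω' => H₁ α (ξs K + err α γ φ Ys Zs θ₀ ξs ℓ K j n ω)
          (innerMean φ K (Y ω') (fun k => Z k ω'))) _ ?_ (fun ω' => abs_H₁_le S.α_mem _ _) h1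
          _ (hγ (n + 1) (by omega)).1 (hγ (n + 1) (by omega)).2
        exact (S.measurable_sample_H₁ K).comp (measurable_const.prodMk
          (S.generic.measurable_Y.prodMk (measurable_pi_iff.2 S.generic.measurable_Z)))
    _ = _ := by
        rw [integral_add (hint'.const_mul _) (integrable_const _), integral_const_mul]
        simp

/-- The Lyapunov function satisfies the hypotheses of `recursion_le` with `w = γ²`, the remainder
`γ³` being `γ · γ²`, and it dominates the fourth power of the error. -/
theorem Setup.moment_four {γ₁ β : ℝ} (S : Setup μ φ Y Z α V ξs Ys Zs θ₀ A c lam C δ B)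
    (hβ : β ∈ Ioc (0 : ℝ) 1) (hγ₁ : 0 < γ₁) (h1 : β = 1 → 2 < c * γ₁) :
    ∃ D : ℝ, 0 < D ∧ ∀ (ℓ K : ℕ) (j : Bool), 1 ≤ K →
      ∫ ω, err α (stepSize γ₁ β) φ Ys Zs θ₀ ξs ℓ K j 0 ω ^ 4 ∂μ ≤ D ∧ ∀ n, 1 ≤ n →
      ∫ ω, err α (stepSize γ₁ β) φ Ys Zs θ₀ ξs ℓ K j n ω ^ 4 ∂μ ≤ D * stepSize γ₁ β n ^ 2 := by
  have hA := S.reg.A_pos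
  have hk := one_le_kAlpha α
  have hc := S.reg.c_pos
  have hC := S.reg.C_pos
  -- For `β = 1` only half of the gap `c - 2/γ₁` is given up, so that `(c - η) γ₁ > 2` still holds.
  obtain ⟨η, hη0, hηc, hη1⟩ : ∃ η, 0 < η ∧ 0 < c - η ∧ (β = 1 → 2 < (c - η) * γ₁) := by
    by_cases h : β = 1
    · have h2 : 0 < c - 2 / γ₁ := by
        have := (div_lt_iff₀ hγ₁).2 (h1 h); linarith
      have h3 : 0 < 2 / γ₁ := by positivity
      refine ⟨(c - 2 / γ₁) / 2, by linarith, by linarith, fun _ => ?_⟩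
      have := h1 h
      have e : (c - (c - 2 / γ₁) / 2) * γ₁ = (c * γ₁ + 2) / 2 := by field_simp; ring
      linarith
    · exact ⟨c / 2, by linarith, by linarith, fun h' => absurd h' h⟩
  set γ := stepSize γ₁ β with hγdef
  have hγ : ∀ n, 1 ≤ n → 0 < γ n ∧ γ n ≤ γ₁ := fun n hn =>
    ⟨stepSize_pos hγ₁ β hn, stepSize_le hγ₁ hβ.1.le hn⟩
  obtain ⟨D, hD0, hD⟩ := S.integral_lyap_err_succ hη0 hγ₁
  have hB0 : 0 ≤ B := (integral_nonneg fun ω => (Real.exp_pos _).le).trans (S.init 0 true).2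
  obtain ⟨B₁, hB₁⟩ : ∃ B₁, B₁ = Real.exp (16 * A * kAlpha α * C) * B := ⟨_, rfl⟩
  have hB₁0 : 0 ≤ B₁ := by rw [hB₁]; positivity
  have ha0 : ∀ ℓ K j, ∫ ω, lyap (16 * A) (V K (ξs K + err α γ φ Ys Zs θ₀ ξs ℓ K j 0 ω) -
      V K (ξs K)) ∂μ ≤ B₁ := by
    intro ℓ K j
    calc _ ≤ ∫ ω, Real.exp (16 * A * kAlpha α * C) *
          Real.exp (16 * A * kAlpha α * |(θ₀ ℓ j ω).1|) ∂μ := by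
          refine integral_mono (S.integrable_lyap_err ℓ K j 0) ((S.init ℓ j).1.const_mul _)
            fun ω => ?_
          simpa using S.lyap_err_le (γ := γ) ℓ K j 0 ω
      _ ≤ _ := by
          rw [integral_const_mul, hB₁]
          exact mul_le_mul_of_nonneg_left (S.init ℓ j).2 (Real.exp_pos _).le
  -- The second summand pays for the step from time `0` to time `1`, where the recursion starts.
  obtain ⟨B₂, hB₂⟩ : ∃ B₂, B₂ = D + ((1 + D * γ₁ ^ 2) * B₁ + D * γ₁ ^ 3) / γ₁ ^ 2 := ⟨_, rfl⟩
  have hB₂0 : 0 ≤ B₂ := by rw [hB₂]; positivity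
  obtain ⟨D', hD'0, hD'⟩ := recursion_le (γ₁ := γ₁) (β := β) (c := c - η) (C := D) (B := B₂) hγ₁ hβ
    hηc hη1 hD0 hB₂0
  refine ⟨C * (B₁ + D'), by positivity, fun ℓ K j hK => ⟨?_, fun n hn => ?_⟩⟩
  · calc _ ≤ ∫ ω, C * lyap (16 * A) (V K (ξs K + err α γ φ Ys Zs θ₀ ξs ℓ K j 0 ω) -
          V K (ξs K)) ∂μ := integral_mono (S.integrable_err_pow_four ℓ K j 0)
            ((S.integrable_lyap_err ℓ K j 0).const_mul C) fun ω => S.reg.growth K _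
      _ ≤ C * (B₁ + D') := by
          rw [integral_const_mul]
          have := ha0 ℓ K j
          gcongr; linarith
  · have h2 := hD' (fun n => ∫ ω, lyap (16 * A) (V K (ξs K + err α γ φ Ys Zs θ₀ ξs ℓ K j n ω) -
      V K (ξs K)) ∂μ) (fun n => γ n ^ (2 : ℝ))
      (slowlyDecreasing_stepSize_rpow hγ₁ hβ.1.le le_rfl)
      (fun n => integral_nonneg fun ω => lyap_nonneg _ _) ?_ ?_ n hn
    · rw [Real.rpow_two] at h2
      calc _ ≤ ∫ ω, C * lyap (16 * A) (V K (ξs K + err α γ φ Ys Zs θ₀ ξs ℓ K j n ω) -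
          V K (ξs K)) ∂μ := integral_mono (S.integrable_err_pow_four ℓ K j n)
            ((S.integrable_lyap_err ℓ K j n).const_mul C) fun ω => S.reg.growth K _
        _ ≤ C * (D' * γ n ^ 2) := by
          rw [integral_const_mul]; gcongr
        _ ≤ C * (B₁ + D') * γ n ^ 2 := by
          rw [← mul_assoc]; gcongr; linarith
    · have h3 := hD γ hγ ℓ K j hK 0
      have hg1 : γ 1 = γ₁ := by simp [hγdef, stepSize]
      rw [zero_add, hg1] at h3
      simp only [Real.rpow_two, hg1]
      have h4 : B₂ * γ₁ ^ 2 = D * γ₁ ^ 2 + ((1 + D * γ₁ ^ 2) * B₁ + D * γ₁ ^ 3) := by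
        rw [hB₂]; field_simp
      have h5 := ha0 ℓ K j
      have h6 : 0 ≤ ∫ ω, lyap (16 * A) (V K (ξs K + err α γ φ Ys Zs θ₀ ξs ℓ K j 0 ω) -
        V K (ξs K)) ∂μ := integral_nonneg fun ω => lyap_nonneg _ _
      rw [h4]
      refine h3.trans ?_
      have h7 : (1 - (c - η) * γ₁ + D * γ₁ ^ 2) * ∫ ω, lyap (16 * A) (V K (ξs K +
          err α γ φ Ys Zs θ₀ ξs ℓ K j 0 ω) - V K (ξs K)) ∂μ ≤ (1 + D * γ₁ ^ 2) * B₁ := by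
        refine mul_le_mul ?_ h5 h6 (by positivity)
        have : 0 < (c - η) * γ₁ := by positivity
        linarith
      have : 0 ≤ D * γ₁ ^ 2 := by positivity
      linarith
    · intro n hn
      refine (hD γ hγ ℓ K j hK n).trans ?_
      have h3 : D * γ (n + 1) ^ 3 ≤ B₂ * γ (n + 1) * γ (n + 1) ^ (2 : ℝ) := by
        rw [Real.rpow_two, mul_assoc, show γ (n + 1) * γ (n + 1) ^ 2 = γ (n + 1) ^ 3 by ring]
        have := (hγ (n + 1) (by omega)).1
        have : D ≤ B₂ := by
          rw [hB₂]; exact le_add_of_nonneg_right (by positivity)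
        gcongr
      linarith

end Moments

/-! ### Products and squares in `L²` -/

section SquareIntegrable

variable {Ω : Type*} [MeasurableSpace Ω] {μ : Measure Ω} {f g : Ω → ℝ}

theorem integrable_mul_of_memLp (hf : MemLp f 2 μ) (hg : MemLp g 2 μ) :
    Integrable (fun ω => f ω * g ω) μ := hf.integrable_mul hg

theorem integral_add_sq (hf : MemLp f 2 μ) (hg : MemLp g 2 μ) :
    ∫ ω, (f ω + g ω) ^ 2 ∂μ = ∫ ω, f ω ^ 2 ∂μ + 2 * ∫ ω, f ω * g ω ∂μ + ∫ ω, g ω ^ 2 ∂μ := by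
  have e : ∀ ω, (f ω + g ω) ^ 2 = f ω ^ 2 + 2 * (f ω * g ω) + g ω ^ 2 := fun ω => by ring
  have h1 : Integrable (fun ω => f ω ^ 2) μ := hf.integrable_sq
  have h2 : Integrable (fun ω => 2 * (f ω * g ω)) μ := (integrable_mul_of_memLp hf hg).const_mul 2
  have h3 : Integrable (fun ω => f ω ^ 2 + 2 * (f ω * g ω)) μ := h1.add h2
  simp_rw [e]
  rw [integral_add h3 hg.integrable_sq, integral_add h1 h2, integral_const_mul]

end SquareIntegrable

/-! ### Linear recursions driven by orthogonal noise -/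

section LinearRecursion

/-- The solution of `m_{n+1} = a_n m_n + b_n e_n`, `m_0 = 0`. -/
def linRec (a b e : ℕ → ℝ) : ℕ → ℝ
  | 0 => 0
  | n + 1 => a n * linRec a b e n + b n * e n

variable {Ω : Type*} [MeasurableSpace Ω] {μ : Measure Ω} {a b : ℕ → ℝ}

theorem memLp_linRec {e : ℕ → Ω → ℝ} (he : ∀ n, MemLp (e n) 2 μ) (n : ℕ) :
    MemLp (fun ω => linRec a b (fun i => e i ω) n) 2 μ := by
  induction n with
  | zero => exact MemLp.zero
  | succ n ih => exact (ih.const_mul (a n)).add ((he n).const_mul (b n))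

theorem integral_linRec_mul {e : ℕ → Ω → ℝ} (he : ∀ n, MemLp (e n) 2 μ) {G : Ω → ℝ}
    (hG : MemLp G 2 μ) {n : ℕ} (h : ∀ i < n, ∫ ω, e i ω * G ω ∂μ = 0) :
    ∫ ω, linRec a b (fun i => e i ω) n * G ω ∂μ = 0 := by
  induction n with
  | zero => simp [linRec]
  | succ n ih =>
    have e1 : ∀ ω, linRec a b (fun i => e i ω) (n + 1) * G ω =
        a n * (linRec a b (fun i => e i ω) n * G ω) + b n * (e n ω * G ω) := fun ω => by
      simp only [linRec]; ring
    have h1 := (integrable_mul_of_memLp (memLp_linRec (a := a) (b := b) he n) hG).const_mul (a n)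
    simp_rw [e1]
    rw [integral_add h1 ((integrable_mul_of_memLp (he n) hG).const_mul _), integral_const_mul,
      integral_const_mul, ih fun i hi => h i (by omega), h n (by omega)]
    simp

/-- At time `n` the solution is a combination of the `e i` with `i < n`, so the cross term with `e
n` vanishes. -/
theorem integral_linRec_sq {e : ℕ → Ω → ℝ} (he : ∀ n, MemLp (e n) 2 μ)
    (h : ∀ n m, n ≠ m → ∫ ω, e n ω * e m ω ∂μ = 0) (n : ℕ) :
    ∫ ω, linRec a b (fun i => e i ω) (n + 1) ^ 2 ∂μ =
      a n ^ 2 * ∫ ω, linRec a b (fun i => e i ω) n ^ 2 ∂μ + b n ^ 2 * ∫ ω, e n ω ^ 2 ∂μ := by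
  have h1 := memLp_linRec (a := a) (b := b) he n
  have h2 := integral_linRec_mul (a := a) (b := b) he (he n) (n := n) fun i hi => h i n hi.ne
  have h3 := integral_add_sq (h1.const_mul (a n)) ((he n).const_mul (b n))
  have e1 : ∀ ω, a n * linRec a b (fun i => e i ω) n * (b n * e n ω) =
      a n * b n * (linRec a b (fun i => e i ω) n * e n ω) := fun ω => by ring
  simp_rw [e1, integral_const_mul, h2, mul_pow, integral_const_mul] at h3
  simp only [linRec]
  rw [h3]; ring

theorem integral_sum_sq {ι : Type*} {s : Finset ι} {D : ι → Ω → ℝ}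
    (hD : ∀ i, MemLp (D i) 2 μ) (h : ∀ i j, i ≠ j → ∫ ω, D i ω * D j ω ∂μ = 0) :
    ∫ ω, (∑ i ∈ s, D i ω) ^ 2 ∂μ = ∑ i ∈ s, ∫ ω, D i ω ^ 2 ∂μ := by
  classical
  induction s using Finset.induction_on with
  | empty => simp
  | insert i s hi ih =>
    have hs : MemLp (fun ω => ∑ j ∈ s, D j ω) 2 μ := memLp_finsetSum _ fun j _ => hD j
    have h0 : ∫ ω, D i ω * ∑ j ∈ s, D j ω ∂μ = 0 := by
      simp_rw [Finset.mul_sum]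
      rw [integral_finsetSum _ fun j _ => integrable_mul_of_memLp (hD i) (hD j)]
      exact Finset.sum_eq_zero fun j hj => h i j fun hij => hi (hij ▸ hj)
    simp_rw [Finset.sum_insert hi]
    rw [integral_add_sq (hD i) hs, h0, ih]
    ring

/-- Solutions of linear recursions driven by disjoint parts of an orthogonal family are
orthogonal. -/
theorem integral_linRec_mul_linRec {a b : ℕ → ℕ → ℝ} {e : ℕ → ℕ → Ω → ℝ}
    (he : ∀ ℓ n, MemLp (e ℓ n) 2 μ)
    (h : ∀ ℓ n ℓ' n', (ℓ, n) ≠ (ℓ', n') → ∫ ω, e ℓ n ω * e ℓ' n' ω ∂μ = 0) {ℓ ℓ' : ℕ}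
    (hℓ : ℓ ≠ ℓ') (n n' : ℕ) :
    ∫ ω, linRec (a ℓ) (b ℓ) (fun i => e ℓ i ω) n *
      linRec (a ℓ') (b ℓ') (fun i => e ℓ' i ω) n' ∂μ = 0 := by
  refine integral_linRec_mul (he ℓ) (memLp_linRec (he ℓ') n') fun i _ => ?_
  simp_rw [mul_comm (e ℓ i _)]
  refine integral_linRec_mul (he ℓ') (he ℓ i) fun i' _ => h _ _ _ _ ?_
  simp [hℓ.symm]

end LinearRecursion

/-! ### The centred noise of one iteration -/

section CentredNoise

variable {Ω : Type*} [MeasurableSpace Ω] {μ : Measure Ω} [IsProbabilityMeasure μ] {d q : ℕ}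
  {Y : Ω → Fin d → ℝ} {Z : ℕ → Ω → Fin q → ℝ}
  {Ys : ℕ → ℕ → Ω → Fin d → ℝ} {Zs : ℕ → ℕ → ℕ → Ω → Fin q → ℝ} {θ₀ : ℕ → Bool → Ω → ℝ × ℝ}
  {E : Type*}

/-- The fluctuation of `F (A, sample)` around its mean given `A`. -/
def fluctuation (μ : Measure Ω) (Y : Ω → Fin d → ℝ) (Z : ℕ → Ω → Fin q → ℝ)
    (Ys : ℕ → ℕ → Ω → Fin d → ℝ) (Zs : ℕ → ℕ → ℕ → Ω → Fin q → ℝ)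
    (F : E × ((Fin d → ℝ) × (ℕ → Fin q → ℝ)) → ℝ) (A : Ω → E) (ℓ n : ℕ) (ω : Ω) : ℝ :=
  F (A ω, sample Ys Zs ℓ n ω) - ∫ ω', F (A ω, (Y ω', fun k => Z k ω')) ∂μ

theorem sq_integral_le {f : Ω → ℝ} (hf : AEStronglyMeasurable f μ)
    (hi : Integrable (fun ω => f ω ^ 2) μ) :
    (∫ ω, f ω ∂μ) ^ 2 ≤ ∫ ω, f ω ^ 2 ∂μ := by
  have hL : MemLp f 2 μ := (memLp_two_iff_integrable_sq hf).2 hi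
  have h1 := integral_add_sq hL (memLp_const (-(∫ ω, f ω ∂μ)))
  have h2 : 0 ≤ ∫ ω, (f ω + -(∫ ω, f ω ∂μ)) ^ 2 ∂μ := integral_nonneg fun ω => sq_nonneg _
  rw [h1, integral_mul_const] at h2
  simp at h2
  linarith

variable [MeasurableSpace E] {F : E × ((Fin d → ℝ) × (ℕ → Fin q → ℝ)) → ℝ} {A : Ω → E}

theorem IsGeneric.measurable_pair (h : IsGeneric μ Y Z) :
    Measurable (fun ω => (Y ω, fun k => Z k ω)) :=
  h.measurable_Y.prodMk (measurable_pi_iff.2 h.measurable_Z)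

theorem IsGeneric.measurable_mean (h : IsGeneric μ Y Z) (hF : Measurable F) :
    Measurable (fun a => ∫ ω', F (a, (Y ω', fun k => Z k ω')) ∂μ) := by
  have h1 : ∀ a, ∫ ω', F (a, (Y ω', fun k => Z k ω')) ∂μ =
      ∫ s, F (a, s) ∂(μ.map (fun ω' => (Y ω', fun k => Z k ω'))) := fun a =>
    (integral_map h.measurable_pair.aemeasurable
      (hF.comp measurable_prodMk_left).aestronglyMeasurable).symm
  simp_rw [h1]
  have := Measure.isProbabilityMeasure_map (μ := μ) h.measurable_pair.aemeasurable
  exact (hF.stronglyMeasurable.integral_prod_right'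
    (ν := μ.map (fun ω' => (Y ω', fun k => Z k ω')))).measurable

theorem IsSimulation.memLp_mean (h : IsSimulation μ Y (Z 0) Ys Zs θ₀)
    (hYZ : IsGeneric μ Y Z) {ℓ n : ℕ} (hA : Measurable[otherSigma Ys Zs θ₀ ℓ n] A)
    (hF : Measurable F) (hF2 : ∀ a, Integrable (fun ω' => F (a, (Y ω', fun k => Z k ω')) ^ 2) μ)
    (hint : MemLp (fun ω => F (A ω, sample Ys Zs ℓ n ω)) 2 μ) :
    MemLp (fun ω => ∫ ω', F (A ω, (Y ω', fun k => Z k ω')) ∂μ) 2 μ := by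
  have hA' := hA.mono (h.otherSigma_le ℓ n) le_rfl
  have hm : Measurable (fun ω => ∫ ω', F (A ω, (Y ω', fun k => Z k ω')) ∂μ) :=
    (hYZ.measurable_mean hF).comp hA'
  refine (memLp_two_iff_integrable_sq hm.aestronglyMeasurable).2 ?_
  refine (h.integrable_sample hYZ hA (hF.pow_const 2) hint.integrable_sq).mono'
    (hm.pow_const 2).aestronglyMeasurable (Eventually.of_forall fun ω => ?_)
  rw [Real.norm_of_nonneg (sq_nonneg _)]
  exact sq_integral_le (hF.comp (measurable_const.prodMk hYZ.measurable_pair)).aestronglyMeasurable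
    (hF2 _)

theorem IsSimulation.memLp_fluctuation (h : IsSimulation μ Y (Z 0) Ys Zs θ₀)
    (hYZ : IsGeneric μ Y Z) {ℓ n : ℕ} (hA : Measurable[otherSigma Ys Zs θ₀ ℓ n] A)
    (hF : Measurable F) (hF2 : ∀ a, Integrable (fun ω' => F (a, (Y ω', fun k => Z k ω')) ^ 2) μ)
    (hint : MemLp (fun ω => F (A ω, sample Ys Zs ℓ n ω)) 2 μ) :
    MemLp (fluctuation μ Y Z Ys Zs F A ℓ n) 2 μ :=
  hint.sub (h.memLp_mean hYZ hA hF hF2 hint)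

/-- `G` is a function of the other sources, given which the fluctuation has mean zero; formally, the
samples are integrated out given the pair `(A, G)`. -/
theorem IsSimulation.integral_fluctuation_mul (h : IsSimulation μ Y (Z 0) Ys Zs θ₀)
    (hYZ : IsGeneric μ Y Z) {ℓ n : ℕ} (hA : Measurable[otherSigma Ys Zs θ₀ ℓ n] A)
    (hF : Measurable F) (hF2 : ∀ a, Integrable (fun ω' => F (a, (Y ω', fun k => Z k ω')) ^ 2) μ)
    (hint : MemLp (fun ω => F (A ω, sample Ys Zs ℓ n ω)) 2 μ) {G : Ω → ℝ}
    (hG : Measurable[otherSigma Ys Zs θ₀ ℓ n] G) (hG2 : MemLp G 2 μ) :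
    ∫ ω, fluctuation μ Y Z Ys Zs F A ℓ n ω * G ω ∂μ = 0 := by
  have h1 := integrable_mul_of_memLp hint hG2
  have h2 := integrable_mul_of_memLp (h.memLp_mean hYZ hA hF hF2 hint) hG2
  simp_rw [fluctuation, sub_mul]
  rw [integral_sub h1 h2]
  have h3 := h.integral_sample hYZ (A := fun ω => (A ω, G ω))
    (Ψ := fun p => F (p.1.1, p.2) * p.1.2) (measurable_prodMk_of_sigma hA hG)
    ((hF.comp ((measurable_fst.comp measurable_fst).prodMk measurable_snd)).mul
      (measurable_snd.comp measurable_fst)) h1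
  simp only [integral_mul_const] at h3
  rw [h3, sub_self]

/-- Pythagoras: `F(A, sample)` is the orthogonal sum of the fluctuation and of its mean given `A`.
-/
theorem IsSimulation.integral_fluctuation_sq_le (h : IsSimulation μ Y (Z 0) Ys Zs θ₀)
    (hYZ : IsGeneric μ Y Z) {ℓ n : ℕ} (hA : Measurable[otherSigma Ys Zs θ₀ ℓ n] A)
    (hF : Measurable F) (hF2 : ∀ a, Integrable (fun ω' => F (a, (Y ω', fun k => Z k ω')) ^ 2) μ)
    (hint : MemLp (fun ω => F (A ω, sample Ys Zs ℓ n ω)) 2 μ) :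
    ∫ ω, fluctuation μ Y Z Ys Zs F A ℓ n ω ^ 2 ∂μ ≤
      ∫ ω, ∫ ω', F (A ω, (Y ω', fun k => Z k ω')) ^ 2 ∂μ ∂μ := by
  have hm := h.memLp_mean hYZ hA hF hF2 hint
  have h1 := integral_add_sq (h.memLp_fluctuation hYZ hA hF hF2 hint) hm
  have h2 := h.integral_fluctuation_mul hYZ hA hF hF2 hint
    ((hYZ.measurable_mean hF).comp hA) hm
  have h3 := h.integral_sample hYZ hA (hF.pow_const 2) hint.integrable_sq
  simp only [Function.comp_def] at h2
  rw [h2] at h1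
  simp only [fluctuation, sub_add_cancel] at h1 h3 ⊢
  rw [h3] at h1
  have h4 : 0 ≤ ∫ ω, (∫ ω', F (A ω, (Y ω', fun k => Z k ω')) ∂μ) ^ 2 ∂μ :=
    integral_nonneg fun ω => sq_nonneg _
  linarith

end CentredNoise

/-! ### The Gronwall lemma started at time zero -/

section Recursion

theorem ratio_le_four {β : ℝ} (hβ : β ∈ Ioc (0 : ℝ) 1) {n : ℕ} (hn : 1 ≤ n) :
    (1 + 1 / (n : ℝ)) ^ (2 * β) ≤ 4 := by
  have hn1' : (1 : ℝ) ≤ n := by exact_mod_cast hn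
  have h2 : 1 + 1 / (n : ℝ) ≤ 2 := by
    have : 1 / (n : ℝ) ≤ 1 := by rw [div_le_one (by positivity)]; exact hn1'
    linarith
  calc (1 + 1 / (n : ℝ)) ^ (2 * β) ≤ (1 + 1 / (n : ℝ)) ^ (2 : ℝ) :=
        Real.rpow_le_rpow_of_exponent_le (by simp) (by nlinarith [hβ.2])
    _ ≤ 2 ^ (2 : ℝ) := Real.rpow_le_rpow (by positivity) h2 (by norm_num)
    _ = 4 := by norm_num

/-- Moment bounds at time `n` give a forcing in `w n`, not `w (n + 1)`; the ratio of the two is at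
most `4`. The index `max n 1` is there because `w 0` carries no information: `stepSize` at `0` has
the default value `0`. -/
theorem recursion_le_of_init {γ₁ β c C B : ℝ} (hγ : 0 < γ₁) (hβ : β ∈ Ioc (0 : ℝ) 1) (hc : 0 < c)
    (hc1 : β = 1 → 2 < c * γ₁) (hC : 0 ≤ C) (hB : 0 ≤ B) :
    ∃ C' : ℝ, 0 < C' ∧ ∀ a w : ℕ → ℝ, SlowlyDecreasing β w → (∀ n, 0 ≤ a n) → a 0 ≤ B * w 1 →
      (∀ n, a (n + 1) ≤
        (1 - c * stepSize γ₁ β (n + 1) + C * stepSize γ₁ β (n + 1) ^ 2) * a n +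
          B * stepSize γ₁ β (n + 1) * w (max n 1)) →
      ∀ n, 1 ≤ n → a n ≤ C' * w n := by
  obtain ⟨C', hC', h⟩ := recursion_le hγ hβ hc hc1 hC
    (B := (1 + C * γ₁ ^ 2) * B + 4 * B * γ₁ + 4 * B) (by positivity)
  refine ⟨C', hC', fun a w hw ha ha0 hrec => h a w hw ha ?_ fun n hn => ?_⟩
  · have h1 := hrec 0
    have hg : stepSize γ₁ β 1 = γ₁ := by simp [stepSize]
    rw [zero_add, hg, max_eq_right zero_le_one] at h1
    have hw1 := (hw 1 le_rfl).1
    have h2 : (1 - c * γ₁ + C * γ₁ ^ 2) * a 0 ≤ (1 + C * γ₁ ^ 2) * (B * w 1) := by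
      refine mul_le_mul ?_ ha0 (ha 0) (by positivity)
      have : 0 < c * γ₁ := by positivity
      linarith
    have h3 : 0 ≤ B * γ₁ * w 1 := by positivity
    have h4 : 0 ≤ B * w 1 := by positivity
    linarith
  · refine (hrec n).trans ?_
    rw [max_eq_left hn]
    have hs := stepSize_pos hγ β (show 1 ≤ n + 1 by omega)
    have hw1 := (hw (n + 1) (by omega)).1
    have hwn : w n ≤ 4 * w (n + 1) := (hw n hn).2.trans
      (mul_le_mul_of_nonneg_right (ratio_le_four hβ hn) hw1)
    have h1 : B * stepSize γ₁ β (n + 1) * w n ≤ B * stepSize γ₁ β (n + 1) * (4 * w (n + 1)) := by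
      gcongr
    have h2 : 0 ≤ ((1 + C * γ₁ ^ 2) * B + 4 * B * γ₁) * (stepSize γ₁ β (n + 1) * w (n + 1)) := by
      positivity
    linarith

theorem stepSize_succ_le {γ₁ β : ℝ} (hγ : 0 < γ₁) (hβ : 0 ≤ β) (n : ℕ) :
    stepSize γ₁ β (n + 1) ≤ stepSize γ₁ β (max n 1) := by
  unfold stepSize
  refine mul_le_mul_of_nonneg_left (Real.rpow_le_rpow_of_nonpos ?_ ?_ (by linarith)) hγ.le
  · exact_mod_cast le_max_right n 1
  · exact_mod_cast max_le (by omega) (by omega)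

end Recursion

/-! ### Difference of a fine and a coarse scheme: the noise part -/

section LevelBounds

variable {Ω : Type*} {d q : ℕ} [MeasurableSpace Ω] {μ : Measure Ω} [IsProbabilityMeasure μ]
  {φ : (Fin d → ℝ) → (Fin q → ℝ) → ℝ}
  {Y : Ω → Fin d → ℝ} {Z : ℕ → Ω → Fin q → ℝ} {α : ℝ} {V : ℕ → ℝ → ℝ} {ξs : ℕ → ℝ}
  {Ys : ℕ → ℕ → Ω → Fin d → ℝ} {Zs : ℕ → ℕ → ℕ → Ω → Fin q → ℝ} {θ₀ : ℕ → Bool → Ω → ℝ × ℝ}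
  {A c lam C δ B : ℝ} {γ : ℕ → ℝ}

theorem Setup.memLp_err_sq (S : Setup μ φ Y Z α V ξs Ys Zs θ₀ A c lam C δ B) (ℓ K : ℕ)
    (j : Bool) (n : ℕ) : MemLp (fun ω => err α γ φ Ys Zs θ₀ ξs ℓ K j n ω ^ 2) 2 μ := by
  refine (memLp_two_iff_integrable_sq
    ((S.measurable_err ℓ K j n).pow_const 2).aestronglyMeasurable).2 ?_
  simp_rw [← pow_mul]
  exact S.integrable_err_pow_four ℓ K j n

theorem Setup.memLp_err (S : Setup μ φ Y Z α V ξs Ys Zs θ₀ A c lam C δ B) (ℓ K : ℕ)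
    (j : Bool) (n : ℕ) : MemLp (err α γ φ Ys Zs θ₀ ξs ℓ K j n) 2 μ :=
  (memLp_two_iff_integrable_sq (S.measurable_err ℓ K j n).aestronglyMeasurable).2
    ((S.memLp_err_sq ℓ K j n).integrable one_le_two)

/-- The lower moments follow from the fourth by two applications of Cauchy–Schwarz. Time `0` is
included through `max n 1`, with the constant enlarged by `D/γ₁²`. -/
theorem Setup.moments {γ₁ β : ℝ} (S : Setup μ φ Y Z α V ξs Ys Zs θ₀ A c lam C δ B)
    (hβ : β ∈ Ioc (0 : ℝ) 1) (hγ₁ : 0 < γ₁) (h1 : β = 1 → 2 < c * γ₁) :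
    ∃ D : ℝ, 0 < D ∧ ∀ (ℓ K : ℕ) (j : Bool), 1 ≤ K → ∀ n,
      ∫ ω, err α (stepSize γ₁ β) φ Ys Zs θ₀ ξs ℓ K j n ω ^ 4 ∂μ ≤
        D * stepSize γ₁ β (max n 1) ^ 2 ∧
      ∫ ω, err α (stepSize γ₁ β) φ Ys Zs θ₀ ξs ℓ K j n ω ^ 2 ∂μ ≤
        D * stepSize γ₁ β (max n 1) ∧
      ∫ ω, |err α (stepSize γ₁ β) φ Ys Zs θ₀ ξs ℓ K j n ω| ∂μ ≤
        D * stepSize γ₁ β (max n 1) ^ (1 / 2 : ℝ) := by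
  obtain ⟨D, hD0, hD⟩ := S.moment_four hβ hγ₁ h1
  obtain ⟨D₁, hD₁⟩ : ∃ D₁, D₁ = D + D / γ₁ ^ 2 + 1 := ⟨_, rfl⟩
  have hD₁1 : 1 ≤ D₁ := by
    have : 0 < D / γ₁ ^ 2 := by positivity
    rw [hD₁]; linarith
  refine ⟨D₁, by linarith, fun ℓ K j hK n => ?_⟩
  set t := stepSize γ₁ β (max n 1) with ht
  have ht0 : 0 < t := stepSize_pos hγ₁ β (le_max_right _ _)
  have h4 : ∫ ω, err α (stepSize γ₁ β) φ Ys Zs θ₀ ξs ℓ K j n ω ^ 4 ∂μ ≤ D₁ * t ^ 2 := by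
    rcases Nat.eq_zero_or_pos n with rfl | hn
    · refine (hD ℓ K j hK).1.trans ?_
      have hg : t = γ₁ := by simp [ht, stepSize]
      rw [hg, hD₁, add_mul, add_mul, div_mul_cancel₀ _ (by positivity)]
      have : 0 ≤ D * γ₁ ^ 2 := by positivity
      have : 0 ≤ 1 * γ₁ ^ 2 := by positivity
      linarith
    · have := (hD ℓ K j hK).2 n hn
      rw [ht, max_eq_left hn]
      refine this.trans ?_
      gcongr
      have : 0 < D / γ₁ ^ 2 := by positivity
      rw [hD₁]; linarith
  have hD₁sq : D₁ ≤ D₁ ^ 2 := by nlinarith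
  have h2 : ∫ ω, err α (stepSize γ₁ β) φ Ys Zs θ₀ ξs ℓ K j n ω ^ 2 ∂μ ≤ D₁ * t := by
    refine abs_le_of_sq_le_sq' ?_ (by positivity) |>.2
    have h6 := S.memLp_err_sq (γ := stepSize γ₁ β) ℓ K j n
    have h7 := sq_integral_le h6.1 h6.integrable_sq
    have e : ∀ ω, (err α (stepSize γ₁ β) φ Ys Zs θ₀ ξs ℓ K j n ω ^ 2) ^ 2 =
        err α (stepSize γ₁ β) φ Ys Zs θ₀ ξs ℓ K j n ω ^ 4 := fun ω => by ring
    rw [integral_congr_ae (Eventually.of_forall e)] at h7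
    refine h7.trans (h4.trans ?_)
    rw [mul_pow]
    gcongr
  refine ⟨h4, h2, ?_⟩
  refine abs_le_of_sq_le_sq' ?_ (by positivity) |>.2
  have h5 := (S.memLp_err (γ := stepSize γ₁ β) ℓ K j n).abs
  have h7 : (∫ ω, |err α (stepSize γ₁ β) φ Ys Zs θ₀ ξs ℓ K j n ω| ∂μ) ^ 2 ≤
      ∫ ω, |err α (stepSize γ₁ β) φ Ys Zs θ₀ ξs ℓ K j n ω| ^ 2 ∂μ :=
    sq_integral_le h5.1 h5.integrable_sq
  simp only [sq_abs] at h7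
  refine h7.trans (h2.trans ?_)
  have e : (t ^ (1 / 2 : ℝ)) ^ 2 = t := by
    rw [← Real.rpow_natCast, ← Real.rpow_mul ht0.le]; norm_num
  rw [mul_pow, e]
  gcongr

/-- The pair of errors of a fine and a coarse scheme. -/
def errPair (α : ℝ) (γ : ℕ → ℝ) (φ : (Fin d → ℝ) → (Fin q → ℝ) → ℝ)
    (Ys : ℕ → ℕ → Ω → Fin d → ℝ) (Zs : ℕ → ℕ → ℕ → Ω → Fin q → ℝ) (θ₀ : ℕ → Bool → Ω → ℝ × ℝ)
    (ξs : ℕ → ℝ) (ℓ Kf Kc n : ℕ) (ω : Ω) : ℝ × ℝ :=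
  (err α γ φ Ys Zs θ₀ ξs ℓ Kf true n ω, err α γ φ Ys Zs θ₀ ξs ℓ Kc false n ω)

/-- The difference of `f (ξ, x)` between a fine and a coarse scheme. -/
def pairFun (φ : (Fin d → ℝ) → (Fin q → ℝ) → ℝ) (ξs : ℕ → ℝ) (f : ℝ → ℝ → ℝ) (Kf Kc : ℕ)
    (p : (ℝ × ℝ) × ((Fin d → ℝ) × (ℕ → Fin q → ℝ))) : ℝ :=
  f (ξs Kf + p.1.1) (innerMean φ Kf p.2.1 p.2.2) - f (ξs Kc + p.1.2) (innerMean φ Kc p.2.1 p.2.2)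

theorem Setup.measurable_errPair (S : Setup μ φ Y Z α V ξs Ys Zs θ₀ A c lam C δ B)
    {ℓ n ℓ' n' : ℕ} (Kf Kc : ℕ) (h : ∀ i < n', (ℓ', i) ≠ (ℓ, n)) :
    Measurable[otherSigma Ys Zs θ₀ ℓ n] (errPair α γ φ Ys Zs θ₀ ξs ℓ' Kf Kc n') :=
  measurable_prodMk_of_sigma (S.measurable_err_otherSigma Kf true h)
    (S.measurable_err_otherSigma Kc false h)

theorem Setup.measurable_pairFun (S : Setup μ φ Y Z α V ξs Ys Zs θ₀ A c lam C δ B) {f : ℝ → ℝ → ℝ}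
    (hf : Measurable (fun p : ℝ × ℝ => f p.1 p.2)) (Kf Kc : ℕ) :
    Measurable (pairFun φ ξs f Kf Kc) := by
  have h1 : ∀ K, Measurable (fun p : (ℝ × ℝ) × ((Fin d → ℝ) × (ℕ → Fin q → ℝ)) =>
      innerMean φ K p.2.1 p.2.2) := fun K =>
    (measurable_innerMean S.measurable_φ K).comp measurable_snd
  exact (hf.comp (((measurable_fst.comp measurable_fst).const_add _).prodMk (h1 Kf))).sub
    (hf.comp (((measurable_snd.comp measurable_fst).const_add _).prodMk (h1 Kc)))

theorem Setup.measurable_fluctuation (S : Setup μ φ Y Z α V ξs Ys Zs θ₀ A c lam C δ B)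
    {F : (ℝ × ℝ) × ((Fin d → ℝ) × (ℕ → Fin q → ℝ)) → ℝ} (hF : Measurable F) {ℓ n ℓ' n' : ℕ}
    (Kf Kc : ℕ) (h : ∀ i ≤ n', (ℓ', i) ≠ (ℓ, n)) :
    Measurable[otherSigma Ys Zs θ₀ ℓ n] (fluctuation μ Y Z Ys Zs F
      (errPair α γ φ Ys Zs θ₀ ξs ℓ' Kf Kc n') ℓ' n') := by
  have h1 := S.measurable_errPair (γ := γ) Kf Kc (fun i hi => h i hi.le)
  have h2 := measurable_sample_otherSigma (Ys := Ys) (Zs := Zs) (θ₀ := θ₀) (h n' le_rfl)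
  exact (hF.comp (measurable_prodMk_of_sigma h1 h2)).sub
    ((S.generic.measurable_mean hF).comp h1)

/-- Fluctuations at different iterations or levels are orthogonal. -/
theorem Setup.fluctuation_orthogonal (S : Setup μ φ Y Z α V ξs Ys Zs θ₀ A c lam C δ B)
    {F : ℕ → (ℝ × ℝ) × ((Fin d → ℝ) × (ℕ → Fin q → ℝ)) → ℝ} (hF : ∀ ℓ, Measurable (F ℓ))
    {Kf Kc : ℕ → ℕ}
    (hF2 : ∀ ℓ a, Integrable (fun ω' => F ℓ (a, (Y ω', fun k => Z k ω')) ^ 2) μ)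
    (hint : ∀ ℓ n, MemLp (fun ω => F ℓ
      (errPair α γ φ Ys Zs θ₀ ξs ℓ (Kf ℓ) (Kc ℓ) n ω, sample Ys Zs ℓ n ω)) 2 μ)
    (ℓ n ℓ' n' : ℕ) (h : (ℓ, n) ≠ (ℓ', n')) :
    ∫ ω, fluctuation μ Y Z Ys Zs (F ℓ) (errPair α γ φ Ys Zs θ₀ ξs ℓ (Kf ℓ) (Kc ℓ) n) ℓ n ω *
      fluctuation μ Y Z Ys Zs (F ℓ')
        (errPair α γ φ Ys Zs θ₀ ξs ℓ' (Kf ℓ') (Kc ℓ') n') ℓ' n' ω ∂μ = 0 := by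
  have hA : ∀ ℓ n, Measurable[otherSigma Ys Zs θ₀ ℓ n]
      (errPair α γ φ Ys Zs θ₀ ξs ℓ (Kf ℓ) (Kc ℓ) n) := fun ℓ n =>
    S.measurable_errPair _ _ fun i hi => by simp [hi.ne]
  have key : ∀ ℓ n ℓ' n', (∀ i ≤ n', (ℓ', i) ≠ (ℓ, n)) →
      ∫ ω, fluctuation μ Y Z Ys Zs (F ℓ) (errPair α γ φ Ys Zs θ₀ ξs ℓ (Kf ℓ) (Kc ℓ) n) ℓ n ω *
      fluctuation μ Y Z Ys Zs (F ℓ')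
        (errPair α γ φ Ys Zs θ₀ ξs ℓ' (Kf ℓ') (Kc ℓ') n') ℓ' n' ω ∂μ = 0 := fun ℓ n ℓ' n' h =>
    S.sim.integral_fluctuation_mul S.generic (hA ℓ n) (hF ℓ) (hF2 ℓ)
      (hint ℓ n) (S.measurable_fluctuation (hF ℓ') _ _ h)
      (S.sim.memLp_fluctuation S.generic (hA ℓ' n') (hF ℓ') (hF2 ℓ') (hint ℓ' n'))
  -- Unless the second noise belongs to the same level and a later iteration, it is a function of
  -- the sources other than the sample of the first one; in the remaining case the roles are
  -- exchanged.
  by_cases h1 : ∀ i ≤ n', (ℓ', i) ≠ (ℓ, n)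
  · exact key ℓ n ℓ' n' h1
  · push Not at h1
    obtain ⟨i, hi, hi2⟩ := h1
    simp_rw [mul_comm (fluctuation μ Y Z Ys Zs (F ℓ)
        (errPair α γ φ Ys Zs θ₀ ξs ℓ (Kf ℓ) (Kc ℓ) n) ℓ n _)]
    refine key ℓ' n' ℓ n fun i' hi' h2 => h ?_
    simp only [Prod.mk.injEq] at hi2 h2 ⊢
    exact ⟨h2.1, by omega⟩

/-- The indicator of `a ≤ x`. -/
def indGe (a x : ℝ) : ℝ := if a ≤ x then 1 else 0

theorem measurable_indGe : Measurable (fun p : ℝ × ℝ => indGe p.1 p.2) :=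
  Measurable.ite (measurableSet_le measurable_fst measurable_snd) measurable_const measurable_const

theorem indGe_mem (a x : ℝ) : 0 ≤ indGe a x ∧ indGe a x ≤ 1 := by
  unfold indGe; split_ifs <;> simp

theorem abs_indGe_sub_le (a x b y : ℝ) : |indGe a x - indGe b y| ≤ 1 := by
  have h1 := indGe_mem a x
  have h2 := indGe_mem b y
  rw [abs_le]; constructor <;> linarith

theorem sq_indGe_sub (a x b y : ℝ) : (indGe a x - indGe b y) ^ 2 = |indGe a x - indGe b y| := by
  unfold indGe; split_ifs <;> simp

theorem integrable_indGe_sub {X X' : Ω → ℝ} (hX : Measurable X) (hX' : Measurable X') (a b : ℝ) :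
    Integrable (fun ω => |indGe a (X ω) - indGe b (X' ω)|) μ := by
  refine Integrable.of_bound (C := 1) ?_ (Eventually.of_forall fun ω => ?_)
  · exact (measurable_norm.comp ((measurable_indGe.comp (measurable_const.prodMk hX)).sub
      (measurable_indGe.comp (measurable_const.prodMk hX')))).aestronglyMeasurable
  · rw [Real.norm_eq_abs, abs_abs]; exact abs_indGe_sub_le _ _ _ _

theorem Setup.integral_indGe_sub_le (S : Setup μ φ Y Z α V ξs Ys Zs θ₀ A c lam C δ B) (K : ℕ)
    (a b : ℝ) : ∫ ω, |indGe a (loss μ φ Y Z K ω) - indGe b (loss μ φ Y Z K ω)| ∂μ ≤ C * |a - b| := by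
  wlog h : a ≤ b generalizing a b
  · have := this b a (le_of_not_ge h)
    rw [abs_sub_comm a b]
    simpa only [abs_sub_comm (indGe a _)] using this
  have hm := S.reg.measurable K
  have hi : ∀ a, Integrable (fun ω => indGe a (loss μ φ Y Z K ω)) μ := fun a => by
    refine Integrable.of_bound (C := 1) ?_ (Eventually.of_forall fun ω => ?_)
    · exact (measurable_indGe.comp (measurable_const.prodMk hm)).aestronglyMeasurable
    · rw [Real.norm_of_nonneg (indGe_mem _ _).1]; exact (indGe_mem _ _).2
  have e : ∀ ω, |indGe a (loss μ φ Y Z K ω) - indGe b (loss μ φ Y Z K ω)| =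
      indGe a (loss μ φ Y Z K ω) - indGe b (loss μ φ Y Z K ω) := fun ω => by
    refine abs_of_nonneg ?_
    unfold indGe
    split_ifs with h1 h2 h2
    · simp
    · simp
    · linarith
    · simp
  simp_rw [e]
  rw [integral_sub (hi a) (hi b)]
  unfold indGe
  rw [integral_ite_le hm, integral_ite_le hm, S.reg.measureReal_ge, S.reg.measureReal_ge]
  have := (le_abs_self _).trans (S.reg.distFun_lip K b a)
  rw [abs_sub_comm] at this
  linarith

theorem H₁_eq_indGe (a x : ℝ) : H₁ α a x = 1 - (1 - α)⁻¹ * indGe a x := rfl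

theorem pairFun_H₁ {Kf Kc : ℕ} (hKf : 1 ≤ Kf) (hKc : 1 ≤ Kc) (a : ℝ × ℝ) (ω : Ω) :
    pairFun φ ξs (H₁ α) Kf Kc (a, (Y ω, fun k => Z k ω)) ^ 2 = ((1 - α)⁻¹) ^ 2 *
      |indGe (ξs Kf + a.1) (loss μ φ Y Z Kf ω) - indGe (ξs Kc + a.2) (loss μ φ Y Z Kc ω)| := by
  rw [← sq_indGe_sub, loss_eq hKf, loss_eq hKc, pairFun, H₁_eq_indGe, H₁_eq_indGe]
  ring

theorem abs_pairFun_H₁_le (hα : α ∈ Ioo (0 : ℝ) 1) (Kf Kc : ℕ)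
    (p : (ℝ × ℝ) × ((Fin d → ℝ) × (ℕ → Fin q → ℝ))) :
    |pairFun φ ξs (H₁ α) Kf Kc p| ≤ 2 * kAlpha α := by
  unfold pairFun
  refine (abs_sub _ _).trans ?_
  have h1 := abs_H₁_le hα (ξs Kf + p.1.1) (innerMean φ Kf p.2.1 p.2.2)
  have h2 := abs_H₁_le hα (ξs Kc + p.1.2) (innerMean φ Kc p.2.1 p.2.2)
  linarith

theorem Setup.integrable_pairFun_H₁ (S : Setup μ φ Y Z α V ξs Ys Zs θ₀ A c lam C δ B)
    (Kf Kc : ℕ) (a : ℝ × ℝ) : Integrable (fun ω' =>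
      pairFun φ ξs (H₁ α) Kf Kc (a, (Y ω', fun k => Z k ω')) ^ 2) μ := by
  refine Integrable.of_bound (C := (2 * kAlpha α) ^ 2) ?_ (Eventually.of_forall fun ω => ?_)
  · exact (((S.measurable_pairFun (measurable_H₁ α) Kf Kc).comp
      (measurable_const.prodMk S.generic.measurable_pair)).pow_const 2).aestronglyMeasurable
  · rw [Real.norm_of_nonneg (sq_nonneg _)]
    exact sq_le_sq' (abs_le.1 (abs_pairFun_H₁_le S.α_mem _ _ _)).1
      (abs_le.1 (abs_pairFun_H₁_le S.α_mem _ _ _)).2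

theorem Setup.memLp_pairFun_H₁ (S : Setup μ φ Y Z α V ξs Ys Zs θ₀ A c lam C δ B)
    (Kf Kc ℓ n : ℕ) : MemLp (fun ω => pairFun φ ξs (H₁ α) Kf Kc
      (errPair α γ φ Ys Zs θ₀ ξs ℓ Kf Kc n ω, sample Ys Zs ℓ n ω)) 2 μ := by
  refine MemLp.of_bound (C := 2 * kAlpha α) ?_
    (Eventually.of_forall fun ω => abs_pairFun_H₁_le S.α_mem _ _ _)
  exact ((S.measurable_pairFun (measurable_H₁ α) Kf Kc).comp
    (((S.measurable_err ℓ Kf true n).prodMk (S.measurable_err ℓ Kc false n)).prodMk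
      (S.sim.measurable_sample ℓ n))).aestronglyMeasurable

/-- The square of a difference of indicators is its absolute value, so the rate is linear. Both
thresholds are moved to `ξs 0`, at the price `C · |shift|` by the Lipschitz distribution functions;
what remains is the mismatch `ρ` of the two losses at one common threshold. -/
theorem Setup.integral_pairFun_H₁_sq_le (S : Setup μ φ Y Z α V ξs Ys Zs θ₀ A c lam C δ B)
    {Kf Kc : ℕ} (hKf : 1 ≤ Kf) (hKc : 1 ≤ Kc) {ρ : ℝ}
    (hρ : ∫ ω, |indGe (ξs 0) (loss μ φ Y Z Kf ω) - indGe (ξs 0) (loss μ φ Y Z Kc ω)| ∂μ ≤ ρ)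
    (a : ℝ × ℝ) :
    ∫ ω, pairFun φ ξs (H₁ α) Kf Kc (a, (Y ω, fun k => Z k ω)) ^ 2 ∂μ ≤
      ((1 - α)⁻¹) ^ 2 * (C * |a.1| + C * |a.2| + (ρ + C * C * (bias Kf + bias Kc))) := by
  have hmf := S.reg.measurable Kf
  have hmc := S.reg.measurable Kc
  have hC := S.reg.C_pos
  simp_rw [pairFun_H₁ (μ := μ) hKf hKc]
  rw [integral_const_mul]
  refine mul_le_mul_of_nonneg_left ?_ (by positivity)
  have i1 := integrable_indGe_sub (μ := μ) hmf hmf (ξs Kf + a.1) (ξs 0)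
  have i2 := integrable_indGe_sub (μ := μ) hmf hmc (ξs 0) (ξs 0)
  have i3 := integrable_indGe_sub (μ := μ) hmc hmc (ξs 0) (ξs Kc + a.2)
  have h12 := i1.add i2
  calc _ ≤ ∫ ω, (|indGe (ξs Kf + a.1) (loss μ φ Y Z Kf ω) - indGe (ξs 0) (loss μ φ Y Z Kf ω)| +
        |indGe (ξs 0) (loss μ φ Y Z Kf ω) - indGe (ξs 0) (loss μ φ Y Z Kc ω)| +
        |indGe (ξs 0) (loss μ φ Y Z Kc ω) - indGe (ξs Kc + a.2) (loss μ φ Y Z Kc ω)|) ∂μ := by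
        refine integral_mono (integrable_indGe_sub hmf hmc _ _) (h12.add i3) fun ω => ?_
        refine le_trans (le_of_eq ?_) (abs_add_three _ _ _)
        congr 1; ring
    _ = ∫ ω, |indGe (ξs Kf + a.1) (loss μ φ Y Z Kf ω) - indGe (ξs 0) (loss μ φ Y Z Kf ω)| ∂μ +
        ∫ ω, |indGe (ξs 0) (loss μ φ Y Z Kf ω) - indGe (ξs 0) (loss μ φ Y Z Kc ω)| ∂μ +
        ∫ ω, |indGe (ξs 0) (loss μ φ Y Z Kc ω) - indGe (ξs Kc + a.2) (loss μ φ Y Z Kc ω)| ∂μ := by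
        rw [← integral_add i1 i2, ← integral_add _ i3]
        exact h12
    _ ≤ C * |ξs Kf + a.1 - ξs 0| + ρ + C * |ξs 0 - (ξs Kc + a.2)| := by
        gcongr
        · exact S.integral_indGe_sub_le _ _ _
        · exact S.integral_indGe_sub_le _ _ _
    _ ≤ C * (C * bias Kf + |a.1|) + ρ + C * (C * bias Kc + |a.2|) := by
        have h1 : |ξs Kf + a.1 - ξs 0| ≤ C * bias Kf + |a.1| := by
          have := abs_add_le (ξs Kf - ξs 0) a.1
          rw [show ξs Kf - ξs 0 + a.1 = ξs Kf + a.1 - ξs 0 by ring] at this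
          linarith [S.reg.minimizer_sub Kf hKf]
        have h2 : |ξs 0 - (ξs Kc + a.2)| ≤ C * bias Kc + |a.2| := by
          have := abs_add_le (ξs Kc - ξs 0) a.2
          rw [show ξs Kc - ξs 0 + a.2 = -(ξs 0 - (ξs Kc + a.2)) by ring, abs_neg] at this
          linarith [S.reg.minimizer_sub Kc hKc]
        gcongr
    _ = _ := by ring

/-- The noise driving the difference of a fine and a coarse scheme. -/
def noise (μ : Measure Ω) (Y : Ω → Fin d → ℝ) (Z : ℕ → Ω → Fin q → ℝ) (α : ℝ) (γ : ℕ → ℝ)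
    (φ : (Fin d → ℝ) → (Fin q → ℝ) → ℝ)
    (Ys : ℕ → ℕ → Ω → Fin d → ℝ) (Zs : ℕ → ℕ → ℕ → Ω → Fin q → ℝ) (θ₀ : ℕ → Bool → Ω → ℝ × ℝ)
    (ξs : ℕ → ℝ) (f : ℝ → ℝ → ℝ) (Kf Kc ℓ n : ℕ) (ω : Ω) : ℝ :=
  fluctuation μ Y Z Ys Zs (pairFun φ ξs f Kf Kc) (errPair α γ φ Ys Zs θ₀ ξs ℓ Kf Kc n) ℓ n ω

theorem Setup.memLp_noise (S : Setup μ φ Y Z α V ξs Ys Zs θ₀ A c lam C δ B) (Kf Kc ℓ n : ℕ) :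
    MemLp (noise μ Y Z α γ φ Ys Zs θ₀ ξs (H₁ α) Kf Kc ℓ n) 2 μ :=
  S.sim.memLp_fluctuation S.generic (S.measurable_errPair _ _ fun i hi => by simp [hi.ne])
    (S.measurable_pairFun (measurable_H₁ α) _ _) (S.integrable_pairFun_H₁ Kf Kc)
    (S.memLp_pairFun_H₁ Kf Kc ℓ n)

theorem Setup.noise_orthogonal (S : Setup μ φ Y Z α V ξs Ys Zs θ₀ A c lam C δ B) (Kf Kc : ℕ → ℕ)
    (ℓ n ℓ' n' : ℕ) (h : (ℓ, n) ≠ (ℓ', n')) :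
    ∫ ω, noise μ Y Z α γ φ Ys Zs θ₀ ξs (H₁ α) (Kf ℓ) (Kc ℓ) ℓ n ω *
      noise μ Y Z α γ φ Ys Zs θ₀ ξs (H₁ α) (Kf ℓ') (Kc ℓ') ℓ' n' ω ∂μ = 0 :=
  S.fluctuation_orthogonal (F := fun ℓ => pairFun φ ξs (H₁ α) (Kf ℓ) (Kc ℓ))
    (fun _ => S.measurable_pairFun (measurable_H₁ α) _ _)
    (fun ℓ => S.integrable_pairFun_H₁ (Kf ℓ) (Kc ℓ))
    (fun ℓ n => S.memLp_pairFun_H₁ (Kf ℓ) (Kc ℓ) ℓ n) ℓ n ℓ' n' h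

/-- The linear part of the difference of a fine and a coarse scheme. -/
def noisePart (μ : Measure Ω) (Y : Ω → Fin d → ℝ) (Z : ℕ → Ω → Fin q → ℝ) (α : ℝ) (γ : ℕ → ℝ)
    (φ : (Fin d → ℝ) → (Fin q → ℝ) → ℝ)
    (Ys : ℕ → ℕ → Ω → Fin d → ℝ) (Zs : ℕ → ℕ → ℕ → Ω → Fin q → ℝ) (θ₀ : ℕ → Bool → Ω → ℝ × ℝ)
    (ξs : ℕ → ℝ) (lam : ℝ) (Kf Kc ℓ n : ℕ) (ω : Ω) : ℝ :=
  linRec (fun n => 1 - lam * γ (n + 1)) (fun n => -γ (n + 1))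
    (fun i => noise μ Y Z α γ φ Ys Zs θ₀ ξs (H₁ α) Kf Kc ℓ i ω) n

theorem Setup.memLp_noisePart (S : Setup μ φ Y Z α V ξs Ys Zs θ₀ A c lam C δ B) (Kf Kc ℓ n : ℕ) :
    MemLp (noisePart μ Y Z α γ φ Ys Zs θ₀ ξs lam Kf Kc ℓ n) 2 μ :=
  memLp_linRec (fun n => S.memLp_noise Kf Kc ℓ n) n

/-- Since `E|err| = O(γ^{1/2})`, the noise variance is `O(γ^{1/2} + ρ + h)`. By orthogonality the
second moment contracts by `(1 - λγ)²` and is forced by `γ²` times this variance, that is by `γ · w`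
with `w = γ^{3/2} + (ρ + h) γ`. -/
theorem Setup.noisePart_sq_le {γ₁ β : ℝ} (S : Setup μ φ Y Z α V ξs Ys Zs θ₀ A c lam C δ B)
    (hβ : β ∈ Ioc (0 : ℝ) 1) (hγ₁ : 0 < γ₁) (h1 : β = 1 → 2 < c * γ₁) :
    ∃ D : ℝ, 0 < D ∧ ∀ (Kf Kc ℓ : ℕ), 1 ≤ Kf → 1 ≤ Kc → ∀ ρ : ℝ,
      ∫ ω, |indGe (ξs 0) (loss μ φ Y Z Kf ω) - indGe (ξs 0) (loss μ φ Y Z Kc ω)| ∂μ ≤ ρ →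
      ∀ n, 1 ≤ n →
      ∫ ω, noisePart μ Y Z α (stepSize γ₁ β) φ Ys Zs θ₀ ξs lam Kf Kc ℓ n ω ^ 2 ∂μ ≤
        D * (stepSize γ₁ β n ^ (3 / 2 : ℝ) + (ρ + bias Kf + bias Kc) * stepSize γ₁ β n) := by
  obtain ⟨D, hD0, hD⟩ := S.moments hβ hγ₁ h1
  have hC := S.reg.C_pos
  have hc := S.reg.c_pos
  have hlam : 0 < lam := by linarith [S.reg.c_le]
  set a : ℝ := ((1 - α)⁻¹) ^ 2 with ha
  have ha0 : 0 ≤ a := by positivity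
  obtain ⟨B₁, hB₁, hB₁0⟩ : ∃ B₁, B₁ = a * (2 * C * D + 1 + C * C) ∧ 0 ≤ B₁ :=
    ⟨_, rfl, by positivity⟩
  obtain ⟨D', hD'0, hD'⟩ := recursion_le_of_init (γ₁ := γ₁) (β := β) (c := 2 * lam)
    (C := lam ^ 2) (B := B₁) hγ₁ hβ (by positivity) (fun h => by
      have h2 := h1 h
      have h3 := S.reg.c_le
      nlinarith) (by positivity) hB₁0
  refine ⟨D', hD'0, fun Kf Kc ℓ hKf hKc ρ hρ => ?_⟩
  have hρ0 : 0 ≤ ρ := (integral_nonneg fun ω => abs_nonneg _).trans hρ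
  have hbf := bias_pos hKf
  have hbc := bias_pos hKc
  set γ := stepSize γ₁ β with hγ
  set ρ' := ρ + bias Kf + bias Kc with hρ'
  have hρ'0 : 0 ≤ ρ' := by positivity
  refine hD' (fun n => ∫ ω, noisePart μ Y Z α γ φ Ys Zs θ₀ ξs lam Kf Kc ℓ n ω ^ 2 ∂μ)
    (fun n => γ n ^ (3 / 2 : ℝ) + ρ' * γ n) ?_ (fun n => integral_nonneg fun ω => sq_nonneg _)
    ?_ ?_
  · refine (slowlyDecreasing_stepSize_rpow hγ₁ hβ.1.le (by norm_num)).add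
      (SlowlyDecreasing.const_mul ?_ hρ'0)
    simpa using slowlyDecreasing_stepSize_rpow (p := 1) hγ₁ hβ.1.le (by norm_num)
  · simp only [noisePart, linRec]
    have := stepSize_pos hγ₁ β (le_refl 1)
    simp
    positivity
  · intro n
    have hs := stepSize_pos hγ₁ β (show 1 ≤ n + 1 by omega)
    have hT := stepSize_pos hγ₁ β (le_max_right n 1)
    have hsT := stepSize_succ_le hγ₁ hβ.1.le n
    rw [← hγ] at hs hT hsT
    have e1 := integral_linRec_sq (a := fun n => 1 - lam * γ (n + 1)) (b := fun n => -γ (n + 1))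
      (fun n => S.memLp_noise (γ := γ) Kf Kc ℓ n)
      (fun n m hnm => S.noise_orthogonal (γ := γ) (fun _ => Kf) (fun _ => Kc) ℓ n ℓ m (by simpa)) n
    simp only [noisePart]
    rw [e1]
    have e2 : ∫ ω, noise μ Y Z α γ φ Ys Zs θ₀ ξs (H₁ α) Kf Kc ℓ n ω ^ 2 ∂μ ≤
        B₁ * (γ (max n 1) ^ (1 / 2 : ℝ) + ρ') := by
      refine (S.sim.integral_fluctuation_sq_le S.generic
        (S.measurable_errPair _ _ fun i hi => by simp [hi.ne])
        (S.measurable_pairFun (measurable_H₁ α) _ _) (S.integrable_pairFun_H₁ Kf Kc)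
        (S.memLp_pairFun_H₁ Kf Kc ℓ n)).trans ?_
      have if1 := ((S.memLp_err (γ := γ) ℓ Kf true n).integrable one_le_two).abs.const_mul C
      have ic1 := ((S.memLp_err (γ := γ) ℓ Kc false n).integrable one_le_two).abs.const_mul C
      have ifc : Integrable (fun ω => C * |err α γ φ Ys Zs θ₀ ξs ℓ Kf true n ω| +
        C * |err α γ φ Ys Zs θ₀ ξs ℓ Kc false n ω|) μ := if1.add ic1
      calc _ ≤ ∫ ω, a * (C * |err α γ φ Ys Zs θ₀ ξs ℓ Kf true n ω| +
            C * |err α γ φ Ys Zs θ₀ ξs ℓ Kc false n ω| +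
            (ρ + C * C * (bias Kf + bias Kc))) ∂μ := by
            refine integral_mono (S.sim.integrable_sample S.generic
              (Ψ := fun p => pairFun φ ξs (H₁ α) Kf Kc p ^ 2)
              (S.measurable_errPair _ _ fun i hi => by simp [hi.ne])
              ((S.measurable_pairFun (measurable_H₁ α) _ _).pow_const 2)
              (S.memLp_pairFun_H₁ Kf Kc ℓ n).integrable_sq)
              ((ifc.add (integrable_const _)).const_mul _) fun ω => ?_
            exact S.integral_pairFun_H₁_sq_le hKf hKc hρ _
        _ = a * (C * ∫ ω, |err α γ φ Ys Zs θ₀ ξs ℓ Kf true n ω| ∂μ +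
            C * ∫ ω, |err α γ φ Ys Zs θ₀ ξs ℓ Kc false n ω| ∂μ +
            (ρ + C * C * (bias Kf + bias Kc))) := by
            rw [integral_const_mul, integral_add ifc (integrable_const _), integral_add if1 ic1,
              integral_const_mul, integral_const_mul]
            simp
        _ ≤ a * (C * (D * γ (max n 1) ^ (1 / 2 : ℝ)) + C * (D * γ (max n 1) ^ (1 / 2 : ℝ)) +
            (ρ' + C * C * ρ')) := by
            have h3 := (hD ℓ Kf true hKf n).2.2
            have h4 := (hD ℓ Kc false hKc n).2.2
            gcongr
            · linarith
            · linarith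
        _ ≤ _ := by
            have h5 : 0 ≤ γ (max n 1) ^ (1 / 2 : ℝ) := by positivity
            rw [hB₁, mul_assoc a (2 * C * D + 1 + C * C)]
            refine mul_le_mul_of_nonneg_left ?_ ha0
            have h6 : 0 ≤ 2 * C * D * ρ' := by positivity
            have h7 : 0 ≤ (1 + C * C) * γ (max n 1) ^ (1 / 2 : ℝ) := by positivity
            linarith
    have e3 : γ (n + 1) ^ 2 * ∫ ω, noise μ Y Z α γ φ Ys Zs θ₀ ξs (H₁ α) Kf Kc ℓ n ω ^ 2 ∂μ ≤
        B₁ * γ (n + 1) * (γ (max n 1) ^ (3 / 2 : ℝ) + ρ' * γ (max n 1)) := by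
      have e4 : γ (max n 1) ^ (3 / 2 : ℝ) = γ (max n 1) * γ (max n 1) ^ (1 / 2 : ℝ) := by
        rw [← Real.rpow_one_add' hT.le (by norm_num)]; norm_num
      calc _ ≤ γ (n + 1) ^ 2 * (B₁ * (γ (max n 1) ^ (1 / 2 : ℝ) + ρ')) := by gcongr
        _ = B₁ * γ (n + 1) * (γ (n + 1) * (γ (max n 1) ^ (1 / 2 : ℝ) + ρ')) := by ring
        _ ≤ B₁ * γ (n + 1) * (γ (max n 1) * (γ (max n 1) ^ (1 / 2 : ℝ) + ρ')) := by gcongr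
        _ = _ := by rw [e4]; ring
    rw [neg_sq]
    linarith

end LevelBounds

/-! ### Difference of a fine and a coarse scheme: the nonlinear part -/

section BiasPart

variable {Ω : Type*} {d q : ℕ} [MeasurableSpace Ω] {μ : Measure Ω} [IsProbabilityMeasure μ]
  {φ : (Fin d → ℝ) → (Fin q → ℝ) → ℝ}
  {Y : Ω → Fin d → ℝ} {Z : ℕ → Ω → Fin q → ℝ} {α : ℝ} {V : ℕ → ℝ → ℝ} {ξs : ℕ → ℝ}
  {Ys : ℕ → ℕ → Ω → Fin d → ℝ} {Zs : ℕ → ℕ → ℕ → Ω → Fin q → ℝ} {θ₀ : ℕ → Bool → Ω → ℝ × ℝ}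
  {A c lam C δ B : ℝ} {γ : ℕ → ℝ}

/-- The nonlinear part of the difference of the errors of a fine and a coarse scheme. -/
def biasPart (μ : Measure Ω) (Y : Ω → Fin d → ℝ) (Z : ℕ → Ω → Fin q → ℝ) (α : ℝ) (γ : ℕ → ℝ)
    (φ : (Fin d → ℝ) → (Fin q → ℝ) → ℝ)
    (Ys : ℕ → ℕ → Ω → Fin d → ℝ) (Zs : ℕ → ℕ → ℕ → Ω → Fin q → ℝ) (θ₀ : ℕ → Bool → Ω → ℝ × ℝ)
    (ξs : ℕ → ℝ) (lam : ℝ) (Kf Kc ℓ n : ℕ) (ω : Ω) : ℝ :=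
  err α γ φ Ys Zs θ₀ ξs ℓ Kf true n ω - err α γ φ Ys Zs θ₀ ξs ℓ Kc false n ω -
    noisePart μ Y Z α γ φ Ys Zs θ₀ ξs lam Kf Kc ℓ n ω

theorem Setup.memLp_biasPart (S : Setup μ φ Y Z α V ξs Ys Zs θ₀ A c lam C δ B) (Kf Kc ℓ n : ℕ) :
    MemLp (biasPart μ Y Z α γ φ Ys Zs θ₀ ξs lam Kf Kc ℓ n) 2 μ :=
  ((S.memLp_err ℓ Kf true n).sub (S.memLp_err ℓ Kc false n)).sub (S.memLp_noisePart Kf Kc ℓ n)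

theorem Setup.mean_pairFun_H₁ (S : Setup μ φ Y Z α V ξs Ys Zs θ₀ A c lam C δ B) {Kf Kc : ℕ}
    (hKf : 1 ≤ Kf) (hKc : 1 ≤ Kc) (a : ℝ × ℝ) :
    ∫ ω, pairFun φ ξs (H₁ α) Kf Kc (a, (Y ω, fun k => Z k ω)) ∂μ =
      grad μ α (loss μ φ Y Z Kf) (ξs Kf + a.1) - grad μ α (loss μ φ Y Z Kc) (ξs Kc + a.2) := by
  have hi : ∀ K ξ, Integrable (fun ω => H₁ α ξ (loss μ φ Y Z K ω)) μ := fun K ξ => by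
    refine Integrable.of_bound (C := kAlpha α) ?_ (Eventually.of_forall fun ω => ?_)
    · exact ((measurable_H₁ α).comp
        (measurable_const.prodMk (S.reg.measurable K))).aestronglyMeasurable
    · exact abs_H₁_le S.α_mem _ _
  rw [← S.reg.integral_H₁, ← S.reg.integral_H₁, ← integral_sub (hi _ _) (hi _ _)]
  refine integral_congr_ae (Eventually.of_forall fun ω => ?_)
  simp only [pairFun, loss_eq hKf, loss_eq hKc]

/-- The noise cancels exactly, leaving a linear recursion forced by the difference of the two
linearization errors. -/
theorem Setup.biasPart_succ (S : Setup μ φ Y Z α V ξs Ys Zs θ₀ A c lam C δ B) {Kf Kc : ℕ}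
    (hKf : 1 ≤ Kf) (hKc : 1 ≤ Kc) (ℓ n : ℕ) (ω : Ω) :
    biasPart μ Y Z α γ φ Ys Zs θ₀ ξs lam Kf Kc ℓ (n + 1) ω =
      (1 - lam * γ (n + 1)) * biasPart μ Y Z α γ φ Ys Zs θ₀ ξs lam Kf Kc ℓ n ω - γ (n + 1) *
        ((grad μ α (loss μ φ Y Z Kf) (ξs Kf + err α γ φ Ys Zs θ₀ ξs ℓ Kf true n ω) -
            lam * err α γ φ Ys Zs θ₀ ξs ℓ Kf true n ω) -
          (grad μ α (loss μ φ Y Z Kc) (ξs Kc + err α γ φ Ys Zs θ₀ ξs ℓ Kc false n ω) -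
            lam * err α γ φ Ys Zs θ₀ ξs ℓ Kc false n ω)) := by
  have h1 : noise μ Y Z α γ φ Ys Zs θ₀ ξs (H₁ α) Kf Kc ℓ n ω =
      pairFun φ ξs (H₁ α) Kf Kc (errPair α γ φ Ys Zs θ₀ ξs ℓ Kf Kc n ω, sample Ys Zs ℓ n ω) -
      (grad μ α (loss μ φ Y Z Kf) (ξs Kf + err α γ φ Ys Zs θ₀ ξs ℓ Kf true n ω) -
        grad μ α (loss μ φ Y Z Kc) (ξs Kc + err α γ φ Ys Zs θ₀ ξs ℓ Kc false n ω)) := by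
    rw [noise, fluctuation, S.mean_pairFun_H₁ hKf hKc]; rfl
  have h2 : noisePart μ Y Z α γ φ Ys Zs θ₀ ξs lam Kf Kc ℓ (n + 1) ω =
      (1 - lam * γ (n + 1)) * noisePart μ Y Z α γ φ Ys Zs θ₀ ξs lam Kf Kc ℓ n ω +
        -γ (n + 1) * noise μ Y Z α γ φ Ys Zs θ₀ ξs (H₁ α) Kf Kc ℓ n ω := rfl
  rw [biasPart, biasPart, err_succ, err_succ, h2, h1]
  simp only [pairFun, errPair]
  ring

/-- Young's inequality with weight `λ/2` costs a quarter of the contraction rate `2λ`. In `(1 -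
λg)²(1 + λg/2)` the quadratic terms cancel, hence the remainder `λ³g³/2`. -/
theorem sq_sub_le {lam g b s : ℝ} (hlam : 0 < lam) (hg : 0 ≤ g) {g₁ : ℝ} (hg₁ : g ≤ g₁) :
    ((1 - lam * g) * b - g * s) ^ 2 ≤
      (1 - 3 / 2 * lam * g + lam ^ 3 * g₁ / 2 * g ^ 2) * b ^ 2 + (2 / lam + g₁) * g * s ^ 2 := by
  have h1 : -2 * g * ((1 - lam * g) * b) * s ≤
      g * (lam / 2 * ((1 - lam * g) * b) ^ 2 + 2 / lam * s ^ 2) := by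
    have : 0 ≤ g * (lam / 2) * ((1 - lam * g) * b + 2 / lam * s) ^ 2 := by positivity
    have e : g * (lam / 2) * ((1 - lam * g) * b + 2 / lam * s) ^ 2 =
        g * (lam / 2 * ((1 - lam * g) * b) ^ 2 + 2 / lam * s ^ 2) +
          2 * g * ((1 - lam * g) * b) * s := by
      field_simp; ring
    linarith
  have h2 : g * (g * s ^ 2) ≤ g₁ * (g * s ^ 2) :=
    mul_le_mul_of_nonneg_right hg₁ (by positivity)
  have h3 : g * (lam ^ 3 / 2 * g ^ 2 * b ^ 2) ≤ g₁ * (lam ^ 3 / 2 * g ^ 2 * b ^ 2) :=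
    mul_le_mul_of_nonneg_right hg₁ (by positivity)
  nlinarith

theorem sq_sub_le_of_abs_le {C s t y z H H' : ℝ} (hs : |s| ≤ C * (y ^ 2 + H * |y|))
    (ht : |t| ≤ C * (z ^ 2 + H' * |z|)) :
    (s - t) ^ 2 ≤ 4 * C ^ 2 * (y ^ 4 + H ^ 2 * y ^ 2 + (z ^ 4 + H' ^ 2 * z ^ 2)) := by
  have key : ∀ {s y H : ℝ}, |s| ≤ C * (y ^ 2 + H * |y|) →
      s ^ 2 ≤ 2 * C ^ 2 * (y ^ 4 + H ^ 2 * y ^ 2) := fun {s y H} h => by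
    have h1 : s ^ 2 ≤ (C * (y ^ 2 + H * |y|)) ^ 2 := by
      rw [← sq_abs s]; exact pow_le_pow_left₀ (abs_nonneg _) h 2
    have h2 : 0 ≤ C ^ 2 * (y ^ 2 - H * |y|) ^ 2 := by positivity
    have h3 := sq_abs y
    calc s ^ 2 ≤ (C * (y ^ 2 + H * |y|)) ^ 2 + C ^ 2 * (y ^ 2 - H * |y|) ^ 2 := by linarith
      _ = 2 * C ^ 2 * (y ^ 4 + H ^ 2 * |y| ^ 2) := by ring
      _ = _ := by rw [h3]
  have h1 := key hs
  have h2 := key ht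
  nlinarith [sq_nonneg (s + t)]

/-- The squared forcing involves `err⁴` and `h^{2(1/4+δ)} err²`, which the moment bounds turn into
`w = γ² + H² γ`, where `H` is the sum of the fine and coarse `h^{1/4+δ}`. No independence is used:
the part is treated pathwise and in mean, initial errors included. -/
theorem Setup.biasPart_sq_le {γ₁ β : ℝ} (S : Setup μ φ Y Z α V ξs Ys Zs θ₀ A c lam C δ B)
    (hβ : β ∈ Ioc (0 : ℝ) 1) (hγ₁ : 0 < γ₁) (h1 : β = 1 → 2 < c * γ₁) :
    ∃ D : ℝ, 0 < D ∧ ∀ (Kf Kc ℓ : ℕ), 1 ≤ Kf → 1 ≤ Kc → ∀ n, 1 ≤ n →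
      ∫ ω, biasPart μ Y Z α (stepSize γ₁ β) φ Ys Zs θ₀ ξs lam Kf Kc ℓ n ω ^ 2 ∂μ ≤
        D * (stepSize γ₁ β n ^ 2 +
          (bias Kf ^ (1 / 4 + δ) + bias Kc ^ (1 / 4 + δ)) ^ 2 * stepSize γ₁ β n) := by
  obtain ⟨D, hD0, hD⟩ := S.moments hβ hγ₁ h1
  have hC := S.reg.C_pos
  have hc := S.reg.c_pos
  have hlam : 0 < lam := by linarith [S.reg.c_le]
  obtain ⟨B₁, hB₁, hB₁0⟩ : ∃ B₁, B₁ = (2 / lam + γ₁) * (8 * C ^ 2 * D) ∧ 0 ≤ B₁ :=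
    ⟨_, rfl, by positivity⟩
  -- The initial value has second moment at most `4Dγ₁ = (4D/γ₁) γ₁²`.
  obtain ⟨B₂, hB₂, hB₂0⟩ : ∃ B₂, B₂ = B₁ + 4 * D / γ₁ ∧ 0 ≤ B₂ := ⟨_, rfl, by positivity⟩
  obtain ⟨D', hD'0, hD'⟩ := recursion_le_of_init (γ₁ := γ₁) (β := β) (c := 3 / 2 * lam)
    (C := lam ^ 3 * γ₁ / 2) (B := B₂) hγ₁ hβ (by positivity) (fun h => by
      have h2 := h1 h
      have h3 := S.reg.c_le
      nlinarith) (by positivity) hB₂0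
  refine ⟨D', hD'0, fun Kf Kc ℓ hKf hKc => ?_⟩
  have hbf := bias_pos hKf
  have hbc := bias_pos hKc
  set γ := stepSize γ₁ β with hγ
  obtain ⟨Hf, hHf, hHf0⟩ : ∃ H, H = bias Kf ^ (1 / 4 + δ) ∧ 0 < H := ⟨_, rfl, by positivity⟩
  obtain ⟨Hc, hHc, hHc0⟩ : ∃ H, H = bias Kc ^ (1 / 4 + δ) ∧ 0 < H := ⟨_, rfl, by positivity⟩
  rw [← hHf, ← hHc]
  refine hD' (fun n => ∫ ω, biasPart μ Y Z α γ φ Ys Zs θ₀ ξs lam Kf Kc ℓ n ω ^ 2 ∂μ)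
    (fun n => γ n ^ 2 + (Hf + Hc) ^ 2 * γ n) ?_ (fun n => integral_nonneg fun ω => sq_nonneg _)
    ?_ ?_
  · refine SlowlyDecreasing.add ?_ (SlowlyDecreasing.const_mul ?_ (by positivity))
    · simpa using slowlyDecreasing_stepSize_rpow (p := 2) hγ₁ hβ.1.le (by norm_num)
    · simpa using slowlyDecreasing_stepSize_rpow (p := 1) hγ₁ hβ.1.le (by norm_num)
  · have hg : γ 1 = γ₁ := by simp [hγ, stepSize]
    have e0 : ∀ ω, biasPart μ Y Z α γ φ Ys Zs θ₀ ξs lam Kf Kc ℓ 0 ω =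
        err α γ φ Ys Zs θ₀ ξs ℓ Kf true 0 ω - err α γ φ Ys Zs θ₀ ξs ℓ Kc false 0 ω := fun ω => by
      simp [biasPart, noisePart, linRec]
    have i1 := ((S.memLp_err (γ := γ) ℓ Kf true 0).integrable_sq).const_mul 2
    have i2 := ((S.memLp_err (γ := γ) ℓ Kc false 0).integrable_sq).const_mul 2
    have h3 := (hD ℓ Kf true hKf 0).2.1
    have h4 := (hD ℓ Kc false hKc 0).2.1
    rw [max_eq_right zero_le_one, hg] at h3 h4
    calc _ ≤ ∫ ω, (2 * err α γ φ Ys Zs θ₀ ξs ℓ Kf true 0 ω ^ 2 +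
          2 * err α γ φ Ys Zs θ₀ ξs ℓ Kc false 0 ω ^ 2) ∂μ := by
          refine integral_mono (S.memLp_biasPart (γ := γ) Kf Kc ℓ 0).integrable_sq (i1.add i2)
            fun ω => ?_
          simp only [e0]
          nlinarith [sq_nonneg (err α γ φ Ys Zs θ₀ ξs ℓ Kf true 0 ω +
            err α γ φ Ys Zs θ₀ ξs ℓ Kc false 0 ω)]
      _ = 2 * ∫ ω, err α γ φ Ys Zs θ₀ ξs ℓ Kf true 0 ω ^ 2 ∂μ +
          2 * ∫ ω, err α γ φ Ys Zs θ₀ ξs ℓ Kc false 0 ω ^ 2 ∂μ := by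
          rw [integral_add i1 i2, integral_const_mul, integral_const_mul]
      _ ≤ 4 * D * γ₁ := by linarith
      _ = 4 * D / γ₁ * γ₁ ^ 2 := by field_simp
      _ ≤ B₂ * (γ 1 ^ 2 + (Hf + Hc) ^ 2 * γ 1) := by
          rw [hg]
          have : 0 ≤ (Hf + Hc) ^ 2 * γ₁ := by positivity
          refine mul_le_mul (by linarith) (by linarith) (by positivity) hB₂0
  · intro n
    have hs := stepSize_pos hγ₁ β (show 1 ≤ n + 1 by omega)
    have hT := stepSize_pos hγ₁ β (le_max_right n 1)
    have hle : stepSize γ₁ β (n + 1) ≤ γ₁ := stepSize_le hγ₁ hβ.1.le (by omega)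
    rw [← hγ] at hs hT hle
    have f4 := S.integrable_err_pow_four (γ := γ) ℓ Kf true n
    have c4 := S.integrable_err_pow_four (γ := γ) ℓ Kc false n
    have f2 := (S.memLp_err (γ := γ) ℓ Kf true n).integrable_sq.const_mul (Hf ^ 2)
    have c2 := (S.memLp_err (γ := γ) ℓ Kc false n).integrable_sq.const_mul (Hc ^ 2)
    have if1 : Integrable (fun ω => err α γ φ Ys Zs θ₀ ξs ℓ Kf true n ω ^ 4 +
      Hf ^ 2 * err α γ φ Ys Zs θ₀ ξs ℓ Kf true n ω ^ 2) μ := f4.add f2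
    have ic1 : Integrable (fun ω => err α γ φ Ys Zs θ₀ ξs ℓ Kc false n ω ^ 4 +
      Hc ^ 2 * err α γ φ Ys Zs θ₀ ξs ℓ Kc false n ω ^ 2) μ := c4.add c2
    have ib := (S.memLp_biasPart (γ := γ) Kf Kc ℓ n).integrable_sq.const_mul
      (1 - 3 / 2 * lam * γ (n + 1) + lam ^ 3 * γ₁ / 2 * γ (n + 1) ^ 2)
    have ifc : Integrable (fun ω => err α γ φ Ys Zs θ₀ ξs ℓ Kf true n ω ^ 4 +
      Hf ^ 2 * err α γ φ Ys Zs θ₀ ξs ℓ Kf true n ω ^ 2 +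
      (err α γ φ Ys Zs θ₀ ξs ℓ Kc false n ω ^ 4 +
      Hc ^ 2 * err α γ φ Ys Zs θ₀ ξs ℓ Kc false n ω ^ 2)) μ := if1.add ic1
    have is := ifc.const_mul ((2 / lam + γ₁) * γ (n + 1) * (4 * C ^ 2))
    have m4 := (hD ℓ Kf true hKf n).1
    have m2 := (hD ℓ Kf true hKf n).2.1
    have m4' := (hD ℓ Kc false hKc n).1
    have m2' := (hD ℓ Kc false hKc n).2.1
    calc _ ≤ ∫ ω, ((1 - 3 / 2 * lam * γ (n + 1) + lam ^ 3 * γ₁ / 2 * γ (n + 1) ^ 2) *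
            biasPart μ Y Z α γ φ Ys Zs θ₀ ξs lam Kf Kc ℓ n ω ^ 2 +
          (2 / lam + γ₁) * γ (n + 1) * (4 * C ^ 2) *
            (err α γ φ Ys Zs θ₀ ξs ℓ Kf true n ω ^ 4 +
              Hf ^ 2 * err α γ φ Ys Zs θ₀ ξs ℓ Kf true n ω ^ 2 +
            (err α γ φ Ys Zs θ₀ ξs ℓ Kc false n ω ^ 4 +
              Hc ^ 2 * err α γ φ Ys Zs θ₀ ξs ℓ Kc false n ω ^ 2))) ∂μ := by
          refine integral_mono (S.memLp_biasPart (γ := γ) Kf Kc ℓ (n + 1)).integrable_sq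
            (ib.add is) fun ω => ?_
          have h5 := S.reg.linearization Kf hKf (err α γ φ Ys Zs θ₀ ξs ℓ Kf true n ω)
          have h6 := S.reg.linearization Kc hKc (err α γ φ Ys Zs θ₀ ξs ℓ Kc false n ω)
          rw [← hHf] at h5
          rw [← hHc] at h6
          have h7 := sq_sub_le_of_abs_le h5 h6
          beta_reduce
          rw [S.biasPart_succ hKf hKc]
          refine (sq_sub_le hlam hs.le hle).trans (add_le_add le_rfl ?_)
          rw [mul_assoc _ (4 * C ^ 2)]
          exact mul_le_mul_of_nonneg_left h7 (by positivity)
      _ = (1 - 3 / 2 * lam * γ (n + 1) + lam ^ 3 * γ₁ / 2 * γ (n + 1) ^ 2) *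
            ∫ ω, biasPart μ Y Z α γ φ Ys Zs θ₀ ξs lam Kf Kc ℓ n ω ^ 2 ∂μ +
          (2 / lam + γ₁) * γ (n + 1) * (4 * C ^ 2) *
            (∫ ω, err α γ φ Ys Zs θ₀ ξs ℓ Kf true n ω ^ 4 ∂μ +
              Hf ^ 2 * ∫ ω, err α γ φ Ys Zs θ₀ ξs ℓ Kf true n ω ^ 2 ∂μ +
            (∫ ω, err α γ φ Ys Zs θ₀ ξs ℓ Kc false n ω ^ 4 ∂μ +
              Hc ^ 2 * ∫ ω, err α γ φ Ys Zs θ₀ ξs ℓ Kc false n ω ^ 2 ∂μ)) := by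
          rw [integral_add ib is, integral_const_mul, integral_const_mul,
            integral_add if1 ic1, integral_add f4 f2, integral_add c4 c2, integral_const_mul,
            integral_const_mul]
      _ ≤ (1 - 3 / 2 * lam * γ (n + 1) + lam ^ 3 * γ₁ / 2 * γ (n + 1) ^ 2) *
            ∫ ω, biasPart μ Y Z α γ φ Ys Zs θ₀ ξs lam Kf Kc ℓ n ω ^ 2 ∂μ +
          (2 / lam + γ₁) * γ (n + 1) * (4 * C ^ 2) *
            (D * γ (max n 1) ^ 2 + Hf ^ 2 * (D * γ (max n 1)) +
              (D * γ (max n 1) ^ 2 + Hc ^ 2 * (D * γ (max n 1)))) := by gcongr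
      _ ≤ _ := by
          refine add_le_add le_rfl ?_
          have h8 : 0 ≤ 2 * Hf * Hc * D * γ (max n 1) := by positivity
          have h9 : 0 ≤ (Hf + Hc) ^ 2 * D * γ (max n 1) := by positivity
          calc _ ≤ (2 / lam + γ₁) * γ (n + 1) * (4 * C ^ 2) *
                (2 * D * (γ (max n 1) ^ 2 + (Hf + Hc) ^ 2 * γ (max n 1))) := by
                refine mul_le_mul_of_nonneg_left ?_ (by positivity)
                nlinarith
            _ = B₁ * γ (n + 1) * (γ (max n 1) ^ 2 + (Hf + Hc) ^ 2 * γ (max n 1)) := by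
                rw [hB₁]; ring
            _ ≤ _ := by
                have : B₁ ≤ B₂ := by rw [hB₂]; linarith [show 0 ≤ 4 * D / γ₁ by positivity]
                gcongr

end BiasPart

/-! ### A second order expansion of `|a + b|^p` -/

section PowerInequality

theorem exp_le_one_add_add_sq (x : ℝ) : Real.exp x ≤ 1 + x + x ^ 2 * Real.exp |x| := by
  have h1 : Real.exp x - 1 - x ≤ x * (Real.exp x - 1) := by
    have h2 := Real.add_one_le_exp (-x)
    have h3 : (-x + 1) * Real.exp x ≤ 1 := by
      have := mul_le_mul_of_nonneg_right h2 (Real.exp_pos x).le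
      rwa [← Real.exp_add, neg_add_cancel, Real.exp_zero] at this
    linarith
  have h4 : x * (Real.exp x - 1) ≤ x ^ 2 * Real.exp |x| := by
    rcases le_total 0 x with hx | hx
    · rw [abs_of_nonneg hx]
      have h2 := Real.add_one_le_exp (-x)
      have h3 : (-x + 1) * Real.exp x ≤ 1 := by
        have := mul_le_mul_of_nonneg_right h2 (Real.exp_pos x).le
        rwa [← Real.exp_add, neg_add_cancel, Real.exp_zero] at this
      nlinarith
    · have h2 := Real.add_one_le_exp x
      have h5 : 1 ≤ Real.exp |x| := Real.one_le_exp (abs_nonneg x)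
      nlinarith [sq_nonneg x]
  linarith

/-- For `|t| ≤ 1/2`, `(1 + t)^p ≤ e^{pt}` is expanded to second order. For larger `t`, `|1 + t| ≤
3|t|`, and a negative `pt` is compensated by `2pt²` because `|t| ≤ 2t²`. -/
theorem abs_one_add_rpow_le {p : ℝ} (hp : 2 ≤ p) (t : ℝ) :
    |1 + t| ^ p ≤ 1 + p * t + (3 ^ p + 2 * p + p ^ 2 * Real.exp p) * (t ^ 2 + |t| ^ p) := by
  have hc1 : (0 : ℝ) ≤ 3 ^ p := by positivity
  have hc3 : 0 ≤ p ^ 2 * Real.exp p := by positivity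
  have ht0 : 0 ≤ |t| ^ p := by positivity
  rcases le_or_gt |t| (1 / 2) with ht | ht
  · have h1 := abs_le.1 ht
    have h2 : 0 < 1 + t := by linarith
    have h3 : |1 + t| ^ p ≤ Real.exp (p * t) := by
      rw [abs_of_pos h2, mul_comm, Real.exp_mul]
      exact Real.rpow_le_rpow h2.le (by linarith [Real.add_one_le_exp t]) (by linarith)
    have h4 := exp_le_one_add_add_sq (p * t)
    have h5 : Real.exp |p * t| ≤ Real.exp p := by
      rw [Real.exp_le_exp, abs_mul, abs_of_nonneg (by linarith)]; nlinarith
    have h6 : (p * t) ^ 2 * Real.exp |p * t| ≤ (p * t) ^ 2 * Real.exp p := by gcongr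
    have h7 : 0 ≤ (3 ^ p + 2 * p) * (t ^ 2 + |t| ^ p) := by positivity
    have h8 : 0 ≤ p ^ 2 * Real.exp p * |t| ^ p := by positivity
    nlinarith
  · have h1 : |1 + t| ≤ 3 * |t| := by
      have := abs_add_le 1 t
      rw [abs_one] at this; linarith
    have h2 : |1 + t| ^ p ≤ 3 ^ p * |t| ^ p := by
      rw [← Real.mul_rpow (by norm_num) (abs_nonneg _)]
      exact Real.rpow_le_rpow (abs_nonneg _) h1 (by linarith)
    have h3 : |t| ≤ 2 * t ^ 2 := by rw [← sq_abs]; nlinarith [abs_nonneg t]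
    have h4 : 0 ≤ 1 + p * t + 2 * p * t ^ 2 := by
      have := neg_abs_le t
      nlinarith
    have h5 : 0 ≤ 3 ^ p * t ^ 2 := by positivity
    have h6 : 0 ≤ p ^ 2 * Real.exp p * (t ^ 2 + |t| ^ p) := by positivity
    have h7 : 0 ≤ 2 * p * |t| ^ p := by positivity
    nlinarith

theorem abs_add_rpow_le {p : ℝ} (hp : 2 ≤ p) (a b : ℝ) :
    |a + b| ^ p ≤ |a| ^ p + p * (|a| ^ (p - 2) * a * b) +
      (3 ^ p + 2 * p + p ^ 2 * Real.exp p) * (|a| ^ (p - 2) * b ^ 2 + |b| ^ p) := by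
  have hc1 : (1 : ℝ) ≤ 3 ^ p + 2 * p + p ^ 2 * Real.exp p := by
    have : (0 : ℝ) ≤ 3 ^ p := by positivity
    have : 0 ≤ p ^ 2 * Real.exp p := by positivity
    linarith
  rcases eq_or_ne a 0 with rfl | ha
  · have h1 : 0 ≤ |b| ^ p := by positivity
    have h2 : 0 ≤ |(0 : ℝ)| ^ (p - 2) * b ^ 2 := by positivity
    have h3 : (0 : ℝ) ≤ |0| ^ p := by positivity
    rw [zero_add, mul_zero, zero_mul, mul_zero]
    nlinarith
  · have ha' : 0 < |a| := abs_pos.2 ha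
    have h1 := mul_le_mul_of_nonneg_left (abs_one_add_rpow_le hp (b / a))
      (show 0 ≤ |a| ^ p by positivity)
    have e1 : |a| ^ p * |1 + b / a| ^ p = |a + b| ^ p := by
      rw [← Real.mul_rpow (abs_nonneg _) (abs_nonneg _), ← abs_mul, mul_add, mul_one,
        mul_div_cancel₀ _ ha]
    have e2 : |a| ^ p = |a| ^ (p - 2) * a ^ 2 := by
      rw [← sq_abs a, ← Real.rpow_natCast, ← Real.rpow_add ha']; norm_num
    have e3 : |a| ^ p * |b / a| ^ p = |b| ^ p := by
      rw [← Real.mul_rpow (abs_nonneg _) (abs_nonneg _), ← abs_mul, mul_div_cancel₀ _ ha]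
    rw [e1] at h1
    refine h1.trans (le_of_eq ?_)
    rw [mul_add, mul_add, mul_one]
    congr 1
    · congr 1
      rw [e2]; field_simp
    · rw [mul_left_comm, mul_add, e3, e2]
      congr 2
      field_simp

/-- A second order bound of `|a + b|^p`, with a free parameter balancing the two powers. -/
theorem abs_add_rpow_le_of_pos {p : ℝ} (hp : 2 ≤ p) : ∃ D : ℝ, 1 ≤ D ∧ ∀ (n : ℕ), 1 ≤ n →
    ∀ a b : ℝ, |a + b| ^ p ≤ (1 + 1 / (2 * n)) * |a| ^ p + p * (|a| ^ (p - 2) * a * b) +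
      D * n ^ (p / 2 - 1) * |b| ^ p := by
  obtain ⟨C, hC, hC1⟩ : ∃ C : ℝ, C = 3 ^ p + 2 * p + p ^ 2 * Real.exp p ∧ 1 ≤ C :=
    ⟨_, rfl, by
      have : (0 : ℝ) ≤ 3 ^ p := by positivity
      have : 0 ≤ p ^ 2 * Real.exp p := by positivity
      linarith⟩
  have hC0 : 0 < C := by linarith
  refine ⟨C * ((2 * C) ^ (p / 2 - 1) + 1), ?_, fun n hn a b => ?_⟩
  · have : (0 : ℝ) ≤ (2 * C) ^ (p / 2 - 1) := by positivity
    nlinarith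
  have hn1 : (1 : ℝ) ≤ n := by exact_mod_cast hn
  have hn0 : (0 : ℝ) < n := by linarith
  have h1 := abs_add_rpow_le hp a b
  rw [← hC] at h1
  have h2 : C * (|a| ^ (p - 2) * b ^ 2) ≤
      1 / (2 * n) * |a| ^ p + C * ((2 * C) ^ (p / 2 - 1) * (n : ℝ) ^ (p / 2 - 1)) * |b| ^ p := by
    rcases eq_or_ne b 0 with rfl | hb
    · have : 0 ≤ 1 / (2 * (n : ℝ)) * |a| ^ p := by positivity
      have : 0 ≤ C * ((2 * C) ^ (p / 2 - 1) * (n : ℝ) ^ (p / 2 - 1)) * |(0 : ℝ)| ^ p := by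
        positivity
      simp only [ne_eq, OfNat.ofNat_ne_zero, not_false_eq_true, zero_pow, mul_zero]
      linarith
    have hb' : 0 < |b| := abs_pos.2 hb
    have eb : |b| ^ p = |b| ^ (p - 2) * b ^ 2 := by
      rw [← sq_abs b, ← Real.rpow_natCast, ← Real.rpow_add hb']; norm_num
    -- If `b² ≤ a²/(2Cn)` the mixed term is at most `|a|^p/(2n)`; otherwise `|a|^{p-2}` is at most
    -- `(2Cn)^{p/2-1} |b|^{p-2}`.
    rcases le_or_gt (2 * C * n * b ^ 2) (a ^ 2) with h | h
    · have ha : a ≠ 0 := by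
        rintro rfl
        have : 0 < 2 * C * n * b ^ 2 := by positivity
        norm_num at h; linarith
      have ha' : 0 < |a| := abs_pos.2 ha
      have ea : |a| ^ p = |a| ^ (p - 2) * a ^ 2 := by
        rw [← sq_abs a, ← Real.rpow_natCast, ← Real.rpow_add ha']; norm_num
      have h3 : C * (|a| ^ (p - 2) * b ^ 2) ≤ 1 / (2 * n) * |a| ^ p := by
        rw [ea]
        have : C * b ^ 2 ≤ 1 / (2 * n) * a ^ 2 := by
          rw [div_mul_eq_mul_div, le_div_iff₀ (by positivity)]; linarith
        calc _ = |a| ^ (p - 2) * (C * b ^ 2) := by ring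
          _ ≤ |a| ^ (p - 2) * (1 / (2 * n) * a ^ 2) := by gcongr
          _ = _ := by ring
      have : 0 ≤ C * ((2 * C) ^ (p / 2 - 1) * (n : ℝ) ^ (p / 2 - 1)) * |b| ^ p := by positivity
      linarith
    · have h3 : |a| ^ (p - 2) ≤ (2 * C) ^ (p / 2 - 1) * (n : ℝ) ^ (p / 2 - 1) * |b| ^ (p - 2) := by
        have e1 : ∀ x : ℝ, |x| ^ (p - 2) = (x ^ 2) ^ (p / 2 - 1) := fun x => by
          rw [← sq_abs, ← Real.rpow_natCast, ← Real.rpow_mul (abs_nonneg _)]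
          congr 1; push_cast; ring
        rw [e1, e1, ← Real.mul_rpow (by positivity) (by positivity),
          ← Real.mul_rpow (by positivity) (by positivity)]
        exact Real.rpow_le_rpow (by positivity) h.le (by linarith)
      have h4 : 0 ≤ 1 / (2 * (n : ℝ)) * |a| ^ p := by positivity
      calc C * (|a| ^ (p - 2) * b ^ 2) ≤ C * ((2 * C) ^ (p / 2 - 1) * (n : ℝ) ^ (p / 2 - 1) *
            |b| ^ (p - 2) * b ^ 2) := by gcongr
        _ = C * ((2 * C) ^ (p / 2 - 1) * (n : ℝ) ^ (p / 2 - 1)) * |b| ^ p := by rw [eb]; ring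
        _ ≤ _ := by linarith
  have h5 : C * |b| ^ p ≤ C * (n : ℝ) ^ (p / 2 - 1) * |b| ^ p := by
    have : 1 ≤ (n : ℝ) ^ (p / 2 - 1) := Real.one_le_rpow hn1 (by linarith)
    have h0 : 0 ≤ C * |b| ^ p := by positivity
    nlinarith
  linarith

end PowerInequality

/-! ### Moments of the centred inner sums -/

section PartialSums

variable {Ω : Type*} {d q : ℕ} [MeasurableSpace Ω] {μ : Measure Ω} [IsProbabilityMeasure μ]
  {φ : (Fin d → ℝ) → (Fin q → ℝ) → ℝ} {Y : Ω → Fin d → ℝ} {Z : ℕ → Ω → Fin q → ℝ}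

/-- The sum of the centred losses of `n` inner simulations. -/
def centredSum (μ : Measure Ω) (φ : (Fin d → ℝ) → (Fin q → ℝ) → ℝ) (Z : ℕ → Ω → Fin q → ℝ)
    (n : ℕ) (p : (Fin d → ℝ) × (Fin n → Fin q → ℝ)) : ℝ :=
  ∑ i, centred μ φ Z (p.1, p.2 i)

theorem measurable_centredSum (hZ : Measurable (Z 0))
    (hφ : Measurable (fun p : (Fin d → ℝ) × (Fin q → ℝ) => φ p.1 p.2)) (n : ℕ) :
    Measurable (centredSum μ φ Z n) := by
  unfold centredSum
  exact Finset.measurable_fun_sum _ fun i _ => (measurable_centred hZ hφ).comp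
    (measurable_fst.prodMk ((measurable_pi_apply i).comp measurable_snd))

/-- The pair of `Y` and the first `n` inner simulations. -/
def pre (Y : Ω → Fin d → ℝ) (Z : ℕ → Ω → Fin q → ℝ) (n : ℕ) (ω : Ω) :
    (Fin d → ℝ) × (Fin n → Fin q → ℝ) := (Y ω, fun i => Z i ω)

theorem IsGeneric.measurable_pre (h : IsGeneric μ Y Z) (n : ℕ) : Measurable (pre Y Z n) :=
  h.measurable_Y.prodMk (measurable_pi_iff.2 fun i => h.measurable_Z i)

theorem centredSum_pre_succ (n : ℕ) (ω : Ω) :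
    centredSum μ φ Z (n + 1) (pre Y Z (n + 1) ω) =
      centredSum μ φ Z n (pre Y Z n ω) + centred μ φ Z (Y ω, Z n ω) := by
  simp [centredSum, pre, Fin.sum_univ_castSucc]

theorem IsGeneric.loss_sub_eq_centredSum
    (hφ : Measurable (fun p : (Fin d → ℝ) × (Fin q → ℝ) => φ p.1 p.2))
    (h : IsGeneric μ Y Z) (hL : Integrable (fun ω => φ (Y ω) (Z 0 ω)) μ) {K : ℕ} (hK : 1 ≤ K) :
    (fun ω => loss μ φ Y Z K ω - loss μ φ Y Z 0 ω) =ᵐ[μ]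
      fun ω => centredSum μ φ Z K (pre Y Z K ω) / K := by
  filter_upwards [h.loss_sub_loss_zero hφ hL hK] with ω hω
  rw [hω, centredSum, Finset.sum_range]; rfl

theorem IsGeneric.identDistrib_centred
    (hφ : Measurable (fun p : (Fin d → ℝ) × (Fin q → ℝ) => φ p.1 p.2))
    (h : IsGeneric μ Y Z) (k : ℕ) :
    IdentDistrib (fun ω => centred μ φ Z (Y ω, Z k ω)) (fun ω => centred μ φ Z (Y ω, Z 0 ω)) μ μ :=
  (h.identDistrib_pair k).comp (measurable_centred (h.measurable_Z 0) hφ)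

/-- `Z n` is independent of `Y` and the earlier inner variables, and the centred loss integrates to
zero in `z` for each fixed `y`. -/
theorem IsGeneric.integral_mul_centred
    (hφ : Measurable (fun p : (Fin d → ℝ) × (Fin q → ℝ) => φ p.1 p.2))
    (h : IsGeneric μ Y Z) (n : ℕ) {g : ℝ → ℝ} (hg : Measurable g)
    (hi : Integrable (fun ω => g (centredSum μ φ Z n (pre Y Z n ω)) *
      centred μ φ Z (Y ω, Z n ω)) μ) :
    ∫ ω, g (centredSum μ φ Z n (pre Y Z n ω)) * centred μ φ Z (Y ω, Z n ω) ∂μ = 0 := by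
  have hm : Measurable (fun p : ((Fin d → ℝ) × (Fin n → Fin q → ℝ)) × (Fin q → ℝ) =>
      g (centredSum μ φ Z n p.1) * centred μ φ Z (p.1.1, p.2)) :=
    (hg.comp ((measurable_centredSum (h.measurable_Z 0) hφ n).comp measurable_fst)).mul
      ((measurable_centred (h.measurable_Z 0) hφ).comp
        ((measurable_fst.comp measurable_fst).prodMk measurable_snd))
  have h1 := integral_comp_indepFun (h.measurable_pre n) (h.measurable_Z n) (h.indepFun_prefix n)
    hm hi
  refine h1.trans ?_
  simp_rw [integral_const_mul, (h.ident_Z n).map_eq, integral_centred (h.measurable_Z 0)]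
  simp

/-- A Marcinkiewicz–Zygmund type bound for the moments of the inner simulation error. -/
theorem IsGeneric.integral_centredSum_rpow_le
    (hφ : Measurable (fun p : (Fin d → ℝ) × (Fin q → ℝ) => φ p.1 p.2))
    (h : IsGeneric μ Y Z) {p : ℝ} (hp : 2 ≤ p)
    (hi : Integrable (fun ω => |centred μ φ Z (Y ω, Z 0 ω)| ^ p) μ) :
    ∃ D : ℝ, 0 < D ∧ ∀ n, 1 ≤ n →
      Integrable (fun ω => |centredSum μ φ Z n (pre Y Z n ω)| ^ p) μ ∧
      ∫ ω, |centredSum μ φ Z n (pre Y Z n ω)| ^ p ∂μ ≤ D * (n : ℝ) ^ (p / 2) := by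
  obtain ⟨C, hC1, hC⟩ := abs_add_rpow_le_of_pos hp
  obtain ⟨m, hm⟩ : ∃ m, m = ∫ ω, |centred μ φ Z (Y ω, Z 0 ω)| ^ p ∂μ := ⟨_, rfl⟩
  have hm0 : 0 ≤ m := hm ▸ integral_nonneg fun ω => by positivity
  have hik : ∀ k, Integrable (fun ω => |centred μ φ Z (Y ω, Z k ω)| ^ p) μ ∧
      ∫ ω, |centred μ φ Z (Y ω, Z k ω)| ^ p ∂μ = m := fun k => by
    have h1 := (h.identDistrib_centred hφ k).comp
      (u := fun x : ℝ => |x| ^ p) (measurable_norm.pow_const p)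
    exact ⟨h1.integrable_iff.2 hi, hm ▸ h1.integral_eq⟩
  refine ⟨2 * C * m + 1, by positivity, fun n hn => ?_⟩
  suffices H : Integrable (fun ω => |centredSum μ φ Z n (pre Y Z n ω)| ^ p) μ ∧
      ∫ ω, |centredSum μ φ Z n (pre Y Z n ω)| ^ p ∂μ ≤ 2 * C * m * (n : ℝ) ^ (p / 2) by
    refine ⟨H.1, H.2.trans ?_⟩
    gcongr
    linarith
  induction n, hn using Nat.le_induction with
  | base =>
    have e : ∀ ω, centredSum μ φ Z 1 (pre Y Z 1 ω) = centred μ φ Z (Y ω, Z 0 ω) := fun ω => by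
      simp [centredSum, pre]
    simp_rw [e]
    refine ⟨hi, ?_⟩
    rw [← hm]
    simp
    nlinarith
  | succ n hn ih =>
    obtain ⟨ih1, ih2⟩ := ih
    have hn0 : (0 : ℝ) < n := by exact_mod_cast hn
    obtain ⟨hz1, hz2⟩ := hik n
    have hSm : Measurable (fun ω => centredSum μ φ Z n (pre Y Z n ω)) :=
      (measurable_centredSum (h.measurable_Z 0) hφ n).comp (h.measurable_pre n)
    have hSm' : Measurable (fun ω => centredSum μ φ Z (n + 1) (pre Y Z (n + 1) ω)) :=
      (measurable_centredSum (h.measurable_Z 0) hφ (n + 1)).comp (h.measurable_pre (n + 1))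
    have hζm : Measurable (fun ω => centred μ φ Z (Y ω, Z n ω)) :=
      (measurable_centred (h.measurable_Z 0) hφ).comp (h.measurable_Y.prodMk (h.measurable_Z n))
    have hgm : Measurable (fun x : ℝ => |x| ^ (p - 2) * x) :=
      (measurable_norm.pow_const (p - 2)).mul measurable_id
    -- The mixed product is dominated by the larger of `|x|^p` and `|y|^p`.
    have ic : Integrable (fun ω => (|centredSum μ φ Z n (pre Y Z n ω)| ^ (p - 2) *
        centredSum μ φ Z n (pre Y Z n ω)) * centred μ φ Z (Y ω, Z n ω)) μ := by
      refine (ih1.add hz1).mono' ((hgm.comp hSm).mul hζm).aestronglyMeasurable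
        (Eventually.of_forall fun ω => ?_)
      simp only [Pi.add_apply]
      generalize centredSum μ φ Z n (pre Y Z n ω) = x
      generalize centred μ φ Z (Y ω, Z n ω) = y
      rw [Real.norm_eq_abs, abs_mul, abs_mul, abs_of_nonneg (show 0 ≤ |x| ^ (p - 2) by positivity)]
      have key : ∀ z : ℝ, 0 ≤ z → z ^ (p - 2) * z * z = z ^ p := fun z hz => by
        rw [mul_assoc, ← sq, ← Real.rpow_natCast, ← Real.rpow_add' hz (by norm_num; linarith)]
        norm_num
      rcases le_total |x| |y| with hxy | hxy
      · calc |x| ^ (p - 2) * |x| * |y| ≤ |y| ^ (p - 2) * |y| * |y| := by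
              gcongr
          _ = |y| ^ p := key _ (abs_nonneg _)
          _ ≤ _ := by linarith [show 0 ≤ |x| ^ p by positivity]
      · calc |x| ^ (p - 2) * |x| * |y| ≤ |x| ^ (p - 2) * |x| * |x| := by gcongr
          _ = |x| ^ p := key _ (abs_nonneg _)
          _ ≤ _ := by linarith [show 0 ≤ |y| ^ p by positivity]
    have i12 : Integrable (fun ω =>
        (1 + 1 / (2 * (n : ℝ))) * |centredSum μ φ Z n (pre Y Z n ω)| ^ p +
        p * (|centredSum μ φ Z n (pre Y Z n ω)| ^ (p - 2) *
        centredSum μ φ Z n (pre Y Z n ω) * centred μ φ Z (Y ω, Z n ω))) μ :=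
      (ih1.const_mul _).add (ic.const_mul p)
    have i3 := hz1.const_mul (C * (n : ℝ) ^ (p / 2 - 1))
    have hle : ∀ ω, |centredSum μ φ Z (n + 1) (pre Y Z (n + 1) ω)| ^ p ≤
        (1 + 1 / (2 * (n : ℝ))) * |centredSum μ φ Z n (pre Y Z n ω)| ^ p +
        p * (|centredSum μ φ Z n (pre Y Z n ω)| ^ (p - 2) *
        centredSum μ φ Z n (pre Y Z n ω) * centred μ φ Z (Y ω, Z n ω)) +
        C * (n : ℝ) ^ (p / 2 - 1) * |centred μ φ Z (Y ω, Z n ω)| ^ p := fun ω => by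
      rw [centredSum_pre_succ]; exact hC n hn _ _
    have hI : Integrable (fun ω => |centredSum μ φ Z (n + 1) (pre Y Z (n + 1) ω)| ^ p) μ := by
      refine (i12.add i3).mono' ((measurable_norm.comp hSm').pow_const p).aestronglyMeasurable
        (Eventually.of_forall fun ω => ?_)
      rw [Real.norm_of_nonneg (by positivity)]
      exact hle ω
    refine ⟨hI, (integral_mono hI (i12.add i3) hle).trans ?_⟩
    have e := integral_add i12 i3
    rw [integral_add (ih1.const_mul _) (ic.const_mul p), integral_const_mul, integral_const_mul,
      integral_const_mul, hz2, h.integral_mul_centred hφ n hgm ic] at e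
    refine e.le.trans ?_
    have e1 : (n : ℝ) ^ (p / 2) = n * (n : ℝ) ^ (p / 2 - 1) := by
      rw [← Real.rpow_one_add' hn0.le (by linarith)]; congr 1; ring
    have e2 : ((n : ℝ) + 1) * (n : ℝ) ^ (p / 2 - 1) ≤ ((n + 1 : ℕ) : ℝ) ^ (p / 2) := by
      have : ((n + 1 : ℕ) : ℝ) ^ (p / 2) = ((n : ℝ) + 1) * ((n : ℝ) + 1) ^ (p / 2 - 1) := by
        rw [← Real.rpow_one_add' (by positivity) (by linarith)]; push_cast; congr 1; ring
      rw [this]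
      gcongr
      · linarith
      · linarith
    -- The constant `2Cm` is fixed by this identity: the factor `1 + 1/(2n)` and the new term each
    -- contribute half of the increase from `n` to `n + 1`.
    have e3 : (1 + 1 / (2 * (n : ℝ))) * (2 * C * m * (n : ℝ) ^ (p / 2)) +
        C * (n : ℝ) ^ (p / 2 - 1) * m = 2 * C * m * (((n : ℝ) + 1) * (n : ℝ) ^ (p / 2 - 1)) := by
      rw [e1]; field_simp; ring
    calc _ ≤ (1 + 1 / (2 * (n : ℝ))) * (2 * C * m * (n : ℝ) ^ (p / 2)) +
        C * (n : ℝ) ^ (p / 2 - 1) * m := by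
          rw [mul_zero, add_zero]; gcongr
      _ = _ := e3
      _ ≤ _ := by gcongr

end PartialSums

/-! ### Tails of the inner simulation error -/

section Rates

variable {Ω : Type*} {d q : ℕ} [MeasurableSpace Ω] {μ : Measure Ω} [IsProbabilityMeasure μ]
  {φ : (Fin d → ℝ) → (Fin q → ℝ) → ℝ} {Y : Ω → Fin d → ℝ} {Z : ℕ → Ω → Fin q → ℝ}

theorem IsGeneric.centred_ae_eq
    (hφ : Measurable (fun p : (Fin d → ℝ) × (Fin q → ℝ) => φ p.1 p.2))
    (h : IsGeneric μ Y Z) (hL : Integrable (fun ω => φ (Y ω) (Z 0 ω)) μ) :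
    (fun ω => φ (Y ω) (Z 0 ω) - loss μ φ Y Z 0 ω) =ᵐ[μ] fun ω => centred μ φ Z (Y ω, Z 0 ω) := by
  filter_upwards [h.loss_zero hφ hL] with ω hω
  rw [hω, centred]

theorem IsGeneric.integral_loss_sub_rpow_le
    (hφ : Measurable (fun p : (Fin d → ℝ) × (Fin q → ℝ) => φ p.1 p.2))
    (h : IsGeneric μ Y Z) (hL : Integrable (fun ω => φ (Y ω) (Z 0 ω)) μ) {p : ℝ} (hp : 2 ≤ p)
    (hi : Integrable (fun ω => |φ (Y ω) (Z 0 ω) - loss μ φ Y Z 0 ω| ^ p) μ) :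
    ∃ D : ℝ, 0 < D ∧ ∀ K, 1 ≤ K →
      Integrable (fun ω => |loss μ φ Y Z K ω - loss μ φ Y Z 0 ω| ^ p) μ ∧
      ∫ ω, |loss μ φ Y Z K ω - loss μ φ Y Z 0 ω| ^ p ∂μ ≤ D * bias K ^ (p / 2) := by
  have hi' : Integrable (fun ω => |centred μ φ Z (Y ω, Z 0 ω)| ^ p) μ := by
    refine hi.congr ?_
    filter_upwards [h.centred_ae_eq hφ hL] with ω hω
    rw [hω]
  obtain ⟨D, hD0, hD⟩ := h.integral_centredSum_rpow_le hφ hp hi'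
  refine ⟨D, hD0, fun K hK => ?_⟩
  have hK0 : (0 : ℝ) < K := by exact_mod_cast hK
  have e : (fun ω => |loss μ φ Y Z K ω - loss μ φ Y Z 0 ω| ^ p) =ᵐ[μ]
      fun ω => |centredSum μ φ Z K (pre Y Z K ω)| ^ p * ((K : ℝ) ^ p)⁻¹ := by
    filter_upwards [h.loss_sub_eq_centredSum hφ hL hK] with ω hω
    rw [hω, abs_div, Real.div_rpow (abs_nonneg _) (abs_nonneg _), abs_of_pos hK0, div_eq_mul_inv]
  obtain ⟨h1, h2⟩ := hD K hK
  refine ⟨(h1.mul_const _).congr e.symm, ?_⟩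
  rw [integral_congr_ae e, integral_mul_const, bias, Real.inv_rpow hK0.le]
  calc _ ≤ D * (K : ℝ) ^ (p / 2) * ((K : ℝ) ^ p)⁻¹ := by gcongr
    _ = D * ((K : ℝ) ^ (p / 2))⁻¹ := by
      have : (K : ℝ) ^ p = (K : ℝ) ^ (p / 2) * (K : ℝ) ^ (p / 2) := by
        rw [← Real.rpow_add hK0]; congr 1; ring
      rw [this]
      have : (K : ℝ) ^ (p / 2) ≠ 0 := by positivity
      field_simp

theorem IsGeneric.integral_loss_sub_sq_le
    (hφ : Measurable (fun p : (Fin d → ℝ) × (Fin q → ℝ) => φ p.1 p.2))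
    (h : IsGeneric μ Y Z) (hL : MemLp (fun ω => φ (Y ω) (Z 0 ω)) 2 μ) :
    ∃ D : ℝ, 0 < D ∧ ∀ K, 1 ≤ K →
      ∫ ω, (loss μ φ Y Z K ω - loss μ φ Y Z 0 ω) ^ 2 ∂μ ≤ D * bias K := by
  have h1 : Integrable (fun ω => |φ (Y ω) (Z 0 ω) - loss μ φ Y Z 0 ω| ^ (2 : ℝ)) μ := by
    simp only [Real.rpow_ofNat, sq_abs]
    exact (hL.sub (h.memLp_loss hφ hL 0)).integrable_sq
  obtain ⟨D, hD0, hD⟩ := h.integral_loss_sub_rpow_le hφ (hL.integrable one_le_two) le_rfl h1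
  refine ⟨D, hD0, fun K hK => ?_⟩
  simpa using (hD K hK).2

theorem measureReal_le_of_integral_rpow {X : Ω → ℝ} {p η : ℝ} (hp : 0 ≤ p) (hη : 0 < η)
    (hi : Integrable (fun ω => |X ω| ^ p) μ) :
    μ.real {ω | η ≤ |X ω|} ≤ (∫ ω, |X ω| ^ p ∂μ) / η ^ p := by
  have h1 := mul_meas_ge_le_integral_of_nonneg (μ := μ) (f := fun ω => |X ω| ^ p)
    (Eventually.of_forall fun ω => by positivity) hi (η ^ p)
  rw [le_div_iff₀ (by positivity), mul_comm]
  exact (mul_le_mul_of_nonneg_left (measureReal_mono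
    (fun ω hω => Real.rpow_le_rpow hη.le hω hp) (measure_ne_top _ _)) (by positivity)).trans h1

/-- The tails of the inner simulation error at the threshold given by the moment scenario. -/
theorem IsGeneric.tail_moment
    (hφ : Measurable (fun p : (Fin d → ℝ) × (Fin q → ℝ) => φ p.1 p.2))
    (h : IsGeneric μ Y Z) (hL : MemLp (fun ω => φ (Y ω) (Z 0 ω)) 2 μ) {p : ℝ} (hp : 1 < p)
    (hi : Integrable (fun ω => |φ (Y ω) (Z 0 ω) - loss μ φ Y Z 0 ω| ^ p) μ) :
    ∃ D : ℝ, 0 < D ∧ ∀ K, 1 ≤ K →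
      μ.real {ω | bias K ^ (p / (2 * (1 + p))) ≤ |loss μ φ Y Z K ω - loss μ φ Y Z 0 ω|} ≤
        D * bias K ^ (p / (2 * (1 + p))) := by
  -- The exponent is raised to `max p 2`: the partial sum bound needs at least `2`, and second
  -- moments are available anyway.
  have hq : ∃ q : ℝ, 2 ≤ q ∧ p ≤ q ∧ (q = 2 ∨ q = p) := by
    rcases le_total p 2 with h1 | h1
    · exact ⟨2, le_rfl, h1, Or.inl rfl⟩
    · exact ⟨p, h1, le_rfl, Or.inr rfl⟩
  obtain ⟨r, hr2, hpr, hr⟩ := hq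
  have hi' : Integrable (fun ω => |φ (Y ω) (Z 0 ω) - loss μ φ Y Z 0 ω| ^ r) μ := by
    rcases hr with rfl | rfl
    · simp only [Real.rpow_ofNat, sq_abs]
      exact (hL.sub (h.memLp_loss hφ hL 0)).integrable_sq
    · exact hi
  obtain ⟨D, hD0, hD⟩ := h.integral_loss_sub_rpow_le hφ (hL.integrable one_le_two) hr2 hi'
  refine ⟨D, hD0, fun K hK => ?_⟩
  have hb := bias_pos hK
  obtain ⟨h1, h2⟩ := hD K hK
  refine (measureReal_le_of_integral_rpow (by linarith) (by positivity) h1).trans ?_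
  rw [div_le_iff₀ (by positivity)]
  refine h2.trans ?_
  rw [mul_assoc, ← Real.rpow_mul hb.le, ← Real.rpow_add hb]
  refine mul_le_mul_of_nonneg_left ?_ hD0.le
  -- With `θ = p/(2(1 + p))`, Markov's bound is of order `h^{r/2 - θr}`, and `θ(1 + r) ≤ r/2` is
  -- equivalent to `p ≤ r`.
  refine Real.rpow_le_rpow_of_exponent_ge hb (bias_le_one K) ?_
  have : p / (2 * (1 + p)) + p / (2 * (1 + p)) * r = p * (1 + r) / (2 * (1 + p)) := by
    field_simp
  rw [this, div_le_div_iff₀ (by positivity) (by positivity)]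
  nlinarith

/-- Integrating out the inner variables one at a time, each contributes a factor `e^v`, uniformly in
the value of `Y`. -/
theorem IsGeneric.lintegral_exp_centredSum_le
    (hφ : Measurable (fun p : (Fin d → ℝ) × (Fin q → ℝ) => φ p.1 p.2))
    (h : IsGeneric μ Y Z) {u v : ℝ}
    (hu : ∀ᵐ ω ∂μ, ∫⁻ z, ENNReal.ofReal (Real.exp (u * centred μ φ Z (Y ω, z))) ∂(μ.map (Z 0)) ≤
      ENNReal.ofReal (Real.exp v)) (n : ℕ) :
    ∫⁻ ω, ENNReal.ofReal (Real.exp (u * centredSum μ φ Z n (pre Y Z n ω))) ∂μ ≤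
      ENNReal.ofReal (Real.exp (n * v)) := by
  induction n with
  | zero => simp [centredSum]
  | succ n ih =>
    have hm1 : Measurable (fun p : ((Fin d → ℝ) × (Fin n → Fin q → ℝ)) =>
        ENNReal.ofReal (Real.exp (u * centredSum μ φ Z n p))) :=
      ENNReal.measurable_ofReal.comp (Real.measurable_exp.comp
        ((measurable_centredSum (h.measurable_Z 0) hφ n).const_mul u))
    have hm2 : Measurable (fun p : (Fin d → ℝ) × (Fin q → ℝ) =>
        ENNReal.ofReal (Real.exp (u * centred μ φ Z p))) :=
      ENNReal.measurable_ofReal.comp (Real.measurable_exp.comp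
        ((measurable_centred (h.measurable_Z 0) hφ).const_mul u))
    have e : ∀ ω, ENNReal.ofReal (Real.exp (u * centredSum μ φ Z (n + 1) (pre Y Z (n + 1) ω))) =
        ENNReal.ofReal (Real.exp (u * centredSum μ φ Z n (pre Y Z n ω))) *
        ENNReal.ofReal (Real.exp (u * centred μ φ Z ((pre Y Z n ω).1, Z n ω))) := fun ω => by
      rw [centredSum_pre_succ, mul_add, Real.exp_add, ENNReal.ofReal_mul (Real.exp_pos _).le]; rfl
    simp_rw [e]
    have h1 := lintegral_comp_indepFun (h.measurable_pre n) (h.measurable_Z n)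
      (h.indepFun_prefix n) (Ψ := fun p => ENNReal.ofReal (Real.exp (u * centredSum μ φ Z n p.1)) *
        ENNReal.ofReal (Real.exp (u * centred μ φ Z (p.1.1, p.2))))
      ((hm1.comp measurable_fst).mul
        (hm2.comp ((measurable_fst.comp measurable_fst).prodMk measurable_snd)))
    refine h1.le.trans ?_
    rw [(h.ident_Z n).map_eq]
    calc _ = ∫⁻ ω, ENNReal.ofReal (Real.exp (u * centredSum μ φ Z n (pre Y Z n ω))) *
          ∫⁻ z, ENNReal.ofReal (Real.exp (u * centred μ φ Z (Y ω, z))) ∂(μ.map (Z 0)) ∂μ :=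
          lintegral_congr fun ω => lintegral_const_mul _ (hm2.comp measurable_prodMk_left)
      _ ≤ ∫⁻ ω, ENNReal.ofReal (Real.exp (u * centredSum μ φ Z n (pre Y Z n ω))) *
          ENNReal.ofReal (Real.exp v) ∂μ := by
          refine lintegral_mono_ae ?_
          filter_upwards [hu] with ω hω
          gcongr
      _ ≤ ENNReal.ofReal (Real.exp (n * v)) * ENNReal.ofReal (Real.exp v) := by
          rw [lintegral_mul_const' _ _ ENNReal.ofReal_ne_top]
          gcongr
      _ = _ := by
          rw [← ENNReal.ofReal_mul (Real.exp_pos _).le, ← Real.exp_add]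
          push_cast; congr 2; ring

theorem IsGeneric.lintegral_exp_centred_le
    (hφ : Measurable (fun p : (Fin d → ℝ) × (Fin q → ℝ) => φ p.1 p.2))
    (h : IsGeneric μ Y Z) (hL : Integrable (fun ω => φ (Y ω) (Z 0 ω)) μ) {u v : ℝ}
    (hi : Integrable (fun ω => Real.exp (u * (φ (Y ω) (Z 0 ω) - loss μ φ Y Z 0 ω))) μ)
    (hu : ∀ᵐ ω ∂μ, condExp (MeasurableSpace.comap Y inferInstance) μ
        (fun ω => Real.exp (u * (φ (Y ω) (Z 0 ω) - loss μ φ Y Z 0 ω))) ω ≤ Real.exp v) :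
    ∀ᵐ ω ∂μ, ∫⁻ z, ENNReal.ofReal (Real.exp (u * centred μ φ Z (Y ω, z))) ∂(μ.map (Z 0)) ≤
      ENNReal.ofReal (Real.exp v) := by
  have := Measure.isProbabilityMeasure_map (μ := μ) (h.measurable_Z 0).aemeasurable
  have e : (fun ω => Real.exp (u * (φ (Y ω) (Z 0 ω) - loss μ φ Y Z 0 ω))) =ᵐ[μ]
      fun ω => Real.exp (u * centred μ φ Z (Y ω, Z 0 ω)) := by
    filter_upwards [h.centred_ae_eq hφ hL] with ω hω
    rw [hω]
  have hm : Measurable (fun p => Real.exp (u * centred μ φ Z p)) :=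
    Real.measurable_exp.comp ((measurable_centred (h.measurable_Z 0) hφ).const_mul u)
  have hi' := hi.congr e
  have hind : IndepFun Y (Z 0) μ := h.indepFun_Y_Z.comp measurable_id (measurable_pi_apply 0)
  have h1 := condExp_comap_of_indepFun h.measurable_Y (h.measurable_Z 0) hind hm hi'
  have h2 := condExp_congr_ae (m := MeasurableSpace.comap Y inferInstance) e
  have h3 := (integrable_prod_of_indepFun h.measurable_Y (h.measurable_Z 0) hind hm hi').prod_right_ae
  have h4 := ae_of_ae_map h.measurable_Y.aemeasurable h3
  filter_upwards [hu, h1, h2, h4] with ω g1 g2 g3 g4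
  rw [← ofReal_integral_eq_lintegral_ofReal g4 (Eventually.of_forall fun z => (Real.exp_pos _).le)]
  refine ENNReal.ofReal_le_ofReal ?_
  rw [← g2, ← g3]
  exact g1

/-- The Chernoff bound for the sum of `K` inner variables. -/
theorem IsGeneric.measureReal_exp_le
    (hφ : Measurable (fun p : (Fin d → ℝ) × (Fin q → ℝ) => φ p.1 p.2))
    (h : IsGeneric μ Y Z) (hL : Integrable (fun ω => φ (Y ω) (Z 0 ω)) μ) {u v : ℝ}
    (hu : ∀ᵐ ω ∂μ, ∫⁻ z, ENNReal.ofReal (Real.exp (u * centred μ φ Z (Y ω, z))) ∂(μ.map (Z 0)) ≤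
      ENNReal.ofReal (Real.exp v)) {K : ℕ} (hK : 1 ≤ K) (t : ℝ) :
    μ.real {ω | t ≤ u * (loss μ φ Y Z K ω - loss μ φ Y Z 0 ω)} ≤ Real.exp (K * (v - t)) := by
  have hK0 : (0 : ℝ) < K := by exact_mod_cast hK
  have h1 := h.lintegral_exp_centredSum_le hφ hu K
  have hm : Measurable (fun ω => ENNReal.ofReal (Real.exp (u * centredSum μ φ Z K (pre Y Z K ω)))) :=
    ENNReal.measurable_ofReal.comp (Real.measurable_exp.comp
        (((measurable_centredSum (h.measurable_Z 0) hφ K).comp (h.measurable_pre K)).const_mul u))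
  have h2 := mul_meas_ge_le_lintegral (μ := μ) hm (ENNReal.ofReal (Real.exp (K * t)))
  have h3 : μ {ω | t ≤ u * (loss μ φ Y Z K ω - loss μ φ Y Z 0 ω)} ≤
      μ {ω | ENNReal.ofReal (Real.exp (K * t)) ≤
        ENNReal.ofReal (Real.exp (u * centredSum μ φ Z K (pre Y Z K ω)))} := by
    refine measure_mono_ae ?_
    filter_upwards [h.loss_sub_eq_centredSum hφ hL hK] with ω hω
    intro (h4 : t ≤ u * (loss μ φ Y Z K ω - loss μ φ Y Z 0 ω))
    rw [hω] at h4
    refine ENNReal.ofReal_le_ofReal (Real.exp_le_exp.2 ?_)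
    rw [← mul_div_assoc, le_div_iff₀ hK0] at h4
    linarith
  have h5 : ENNReal.ofReal (Real.exp (K * t)) *
      μ {ω | t ≤ u * (loss μ φ Y Z K ω - loss μ φ Y Z 0 ω)} ≤ ENNReal.ofReal (Real.exp (K * v)) :=
    (mul_le_mul_right h3 _).trans (h2.trans h1)
  have h6 := ENNReal.toReal_mono ENNReal.ofReal_ne_top h5
  rw [ENNReal.toReal_mul, ENNReal.toReal_ofReal (Real.exp_pos _).le,
    ENNReal.toReal_ofReal (Real.exp_pos _).le] at h6
  rw [mul_sub, Real.exp_sub, le_div_iff₀ (Real.exp_pos _), mul_comm]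
  exact h6

/-- The tails of the inner simulation error at the threshold given by the Gaussian scenario. -/
theorem IsGeneric.tail_gaussian
    (hφ : Measurable (fun p : (Fin d → ℝ) × (Fin q → ℝ) => φ p.1 p.2))
    (h : IsGeneric μ Y Z) (hL : Integrable (fun ω => φ (Y ω) (Z 0 ω)) μ) {Cg : ℝ} (hCg : 0 ≤ Cg)
    (hg : ∀ u : ℝ, Integrable (fun ω => Real.exp (u * (φ (Y ω) (Z 0 ω) - loss μ φ Y Z 0 ω))) μ ∧
      ∀ᵐ ω ∂μ, condExp (MeasurableSpace.comap Y inferInstance) μ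
        (fun ω => Real.exp (u * (φ (Y ω) (Z 0 ω) - loss μ φ Y Z 0 ω))) ω ≤ Real.exp (Cg * u ^ 2))
    {K : ℕ} (hK : 1 ≤ K) :
      μ.real {ω | (2 * (Cg + 1) * (bias K * |Real.log (bias K)|)) ^ (1 / 2 : ℝ) ≤
        |loss μ φ Y Z K ω - loss μ φ Y Z 0 ω|} ≤ 2 * bias K ^ (1 / 2 : ℝ) := by
  have hb := bias_pos hK
  have hlog : Real.log (bias K) ≤ 0 := Real.log_nonpos hb.le (bias_le_one K)
  obtain ⟨D, hD, hD0⟩ : ∃ D, D = Cg + 1 ∧ 0 < D := ⟨_, rfl, by linarith⟩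
  obtain ⟨η, hη⟩ : ∃ η, η = (2 * (Cg + 1) * (bias K * |Real.log (bias K)|)) ^ (1 / 2 : ℝ) :=
    ⟨_, rfl⟩
  have hη0 : 0 ≤ η := by rw [hη]; positivity
  have hηsq : η ^ 2 = 2 * D * (bias K * |Real.log (bias K)|) := by
    rw [hη, hD, ← Real.rpow_natCast, ← Real.rpow_mul (by positivity)]; norm_num
  rw [← hη]
  -- `|u| = η/(2D)` optimises the Chernoff exponent for the variance proxy `D = Cg + 1`, which is
  -- positive even if `Cg = 0`. The exponent becomes `-Kη²/(4D) = (ln h)/2`, hence a tail of at most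
  -- `h^{1/2}`.
  have key : ∀ u : ℝ, |u| = η / (2 * D) →
      μ.real {ω | |u| * η ≤ u * (loss μ φ Y Z K ω - loss μ φ Y Z 0 ω)} ≤
        bias K ^ (1 / 2 : ℝ) := by
    intro u hu
    refine (h.measureReal_exp_le hφ hL (h.lintegral_exp_centred_le hφ hL (hg u).1 (hg u).2) hK
      _).trans ?_
    rw [Real.rpow_def_of_pos hb, Real.exp_le_exp]
    have hKb : (K : ℝ) * bias K = 1 := by
      rw [bias, mul_inv_cancel₀]; positivity
    have h1 : Cg * u ^ 2 - |u| * η ≤ -(bias K * |Real.log (bias K)|) / 2 := by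
      rw [← sq_abs u, hu]
      have h3 : Cg * (η / (2 * D)) ^ 2 ≤ D * (η / (2 * D)) ^ 2 := by gcongr; linarith
      have h4 : D * (η / (2 * D)) ^ 2 - η / (2 * D) * η = -(η ^ 2) / (4 * D) := by
        field_simp; ring
      have h5 : -(η ^ 2) / (4 * D) = -(bias K * |Real.log (bias K)|) / 2 := by
        rw [hηsq]; field_simp; ring
      linarith
    have h2 := mul_le_mul_of_nonneg_left h1 (Nat.cast_nonneg (α := ℝ) K)
    rw [abs_of_nonpos hlog] at h2
    have h3 : (K : ℝ) * (-(bias K * -Real.log (bias K)) / 2) =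
        (K * bias K) * (Real.log (bias K) * (1 / 2)) := by ring
    rw [h3, hKb, one_mul] at h2
    exact h2
  have hu0 : 0 ≤ η / (2 * D) := by positivity
  calc _ ≤ μ.real ({ω | |η / (2 * D)| * η ≤
          η / (2 * D) * (loss μ φ Y Z K ω - loss μ φ Y Z 0 ω)} ∪
        {ω | |-(η / (2 * D))| * η ≤
          -(η / (2 * D)) * (loss μ φ Y Z K ω - loss μ φ Y Z 0 ω)}) := by
        refine measureReal_mono (fun ω hω => ?_) (measure_ne_top _ _)
        have hω' : η ≤ |loss μ φ Y Z K ω - loss μ φ Y Z 0 ω| := hω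
        rw [mem_union, mem_ofPred_eq, mem_ofPred_eq, abs_neg, abs_of_nonneg hu0]
        rcases le_total 0 (loss μ φ Y Z K ω - loss μ φ Y Z 0 ω) with h1 | h1
        · rw [abs_of_nonneg h1] at hω'
          exact Or.inl (mul_le_mul_of_nonneg_left hω' hu0)
        · rw [abs_of_nonpos h1] at hω'
          refine Or.inr ((mul_le_mul_of_nonneg_left hω' hu0).trans (by linarith))
    _ ≤ _ := measureReal_union_le _ _
    _ ≤ bias K ^ (1 / 2 : ℝ) + bias K ^ (1 / 2 : ℝ) :=
        add_le_add (key _ (abs_of_nonneg hu0)) (key _ (by rw [abs_neg, abs_of_nonneg hu0]))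
    _ = _ := by ring

/-- If `x` and `y` are closer than `η`, the indicators can only differ when `y` is within `η` of
`a`. -/
theorem abs_indGe_sub_le_add {a x y η : ℝ} (hη : 0 ≤ η) :
    |indGe a x - indGe a y| ≤
      {x : ℝ | η ≤ |x|}.indicator 1 (x - y) + |indGe (a - η) y - indGe (a + η) y| := by
  by_cases h : η ≤ |x - y|
  · have e : {x : ℝ | η ≤ |x|}.indicator 1 (x - y) = (1 : ℝ) :=
      indicator_of_mem (s := {x : ℝ | η ≤ |x|}) h 1
    rw [e]
    have := abs_indGe_sub_le a x a y
    linarith [abs_nonneg (indGe (a - η) y - indGe (a + η) y)]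
  · have e : {x : ℝ | η ≤ |x|}.indicator 1 (x - y) = (0 : ℝ) :=
      indicator_of_notMem (s := {x : ℝ | η ≤ |x|}) h 1
    rw [e, zero_add]
    rw [not_le, abs_lt] at h
    unfold indGe
    split_ifs <;> first | (exfalso; linarith) | norm_num

theorem integral_indGe_sub_le_tail {X X' : Ω → ℝ} (hX : Measurable X) (hX' : Measurable X')
    {a η : ℝ} (hη : 0 ≤ η) :
    ∫ ω, |indGe a (X ω) - indGe a (X' ω)| ∂μ ≤ μ.real {ω | η ≤ |X ω - X' ω|} +
      ∫ ω, |indGe (a - η) (X' ω) - indGe (a + η) (X' ω)| ∂μ := by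
  have hms : MeasurableSet {x : ℝ | η ≤ |x|} := measurableSet_le measurable_const measurable_norm
  have hms' : MeasurableSet {ω | η ≤ |X ω - X' ω|} := hms.preimage (hX.sub hX')
  have i1 : Integrable ({ω | η ≤ |X ω - X' ω|}.indicator (1 : Ω → ℝ)) μ :=
    (integrable_const (1 : ℝ)).indicator hms'
  have i2 := integrable_indGe_sub (μ := μ) hX' hX' (a - η) (a + η)
  rw [← integral_indicator_one hms', ← integral_add i1 i2]
  exact integral_mono (integrable_indGe_sub hX hX' a a) (i1.add i2)
    fun ω => abs_indGe_sub_le_add hη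

end Rates

/-! ### Mismatch with the exact loss in the moment and Gaussian scenarios -/

section Scenarios

variable {Ω : Type*} {d q : ℕ} [MeasurableSpace Ω] {μ : Measure Ω} [IsProbabilityMeasure μ]
  {φ : (Fin d → ℝ) → (Fin q → ℝ) → ℝ}
  {Y : Ω → Fin d → ℝ} {Z : ℕ → Ω → Fin q → ℝ} {α : ℝ} {V : ℕ → ℝ → ℝ} {ξs : ℕ → ℝ}
  {Ys : ℕ → ℕ → Ω → Fin d → ℝ} {Zs : ℕ → ℕ → ℕ → Ω → Fin q → ℝ} {θ₀ : ℕ → Bool → Ω → ℝ × ℝ}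
  {A c lam C δ B : ℝ}

theorem Setup.integral_indGe_sub_zero_le (S : Setup μ φ Y Z α V ξs Ys Zs θ₀ A c lam C δ B) (K : ℕ)
    {a η : ℝ} (hη : 0 ≤ η) :
    ∫ ω, |indGe a (loss μ φ Y Z K ω) - indGe a (loss μ φ Y Z 0 ω)| ∂μ ≤
      μ.real {ω | η ≤ |loss μ φ Y Z K ω - loss μ φ Y Z 0 ω|} + C * (2 * η) := by
  refine (integral_indGe_sub_le_tail (S.reg.measurable K) (S.reg.measurable 0) hη).trans ?_
  have := S.integral_indGe_sub_le 0 (a - η) (a + η)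
  rw [show a - η - (a + η) = -(2 * η) by ring, abs_neg, abs_of_nonneg (by linarith)] at this
  linarith

theorem Setup.indGe_moment (S : Setup μ φ Y Z α V ξs Ys Zs θ₀ A c lam C δ B) {p : ℝ} {K₀ M : ℕ}
    (hs : (Scenario.moment p).Holds μ φ Y Z K₀ M) :
    ∃ D : ℝ, 0 < D ∧ ∀ K, 1 ≤ K → ∀ a,
      ∫ ω, |indGe a (loss μ φ Y Z K ω) - indGe a (loss μ φ Y Z 0 ω)| ∂μ ≤
        D * (Scenario.moment p).rate (bias K) := by
  obtain ⟨D, hD0, hD⟩ := S.generic.tail_moment S.measurable_φ S.memLp hs.1 hs.2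
  have hC := S.reg.C_pos
  refine ⟨D + 2 * C, by positivity, fun K hK a => ?_⟩
  have hb := bias_pos hK
  refine (S.integral_indGe_sub_zero_le K (η := bias K ^ (p / (2 * (1 + p))))
    (by positivity)).trans ?_
  have := hD K hK
  simp only [Scenario.rate]
  linarith

theorem half_log_le_abs_log {K : ℕ} (hK : 2 ≤ K) : Real.log 2 ≤ |Real.log (bias K)| := by
  have h2 : (2 : ℝ) ≤ K := by exact_mod_cast hK
  rw [bias, Real.log_inv, abs_neg]
  exact (Real.log_le_log two_pos h2).trans (le_abs_self _)

/-- The tail `2h^{1/2}` must be dominated by the rate `h^{1/2}|ln h|^{1/2}`, which vanishes at `h =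
1`; for `K ≥ 2` the logarithm is at least `ln 2`. -/
theorem Setup.indGe_gaussian (S : Setup μ φ Y Z α V ξs Ys Zs θ₀ A c lam C δ B) {K₀ M : ℕ}
    (hs : Scenario.gaussian.Holds μ φ Y Z K₀ M) :
    ∃ D : ℝ, 0 < D ∧ ∀ K, 2 ≤ K → ∀ a,
      ∫ ω, |indGe a (loss μ φ Y Z K ω) - indGe a (loss μ φ Y Z 0 ω)| ∂μ ≤
        D * Scenario.gaussian.rate (bias K) := by
  obtain ⟨Cg, hCg, hg⟩ := hs
  have hC := S.reg.C_pos
  have hl2 : 0 < Real.log 2 := Real.log_pos one_lt_two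
  refine ⟨2 / Real.log 2 ^ (1 / 2 : ℝ) + 2 * C * (2 * (Cg + 1)) ^ (1 / 2 : ℝ), by positivity,
    fun K hK a => ?_⟩
  have hb := bias_pos (show 1 ≤ K by omega)
  have h1 := S.generic.tail_gaussian S.measurable_φ (S.memLp.integrable one_le_two) hCg hg
    (show 1 ≤ K by omega)
  refine (S.integral_indGe_sub_zero_le K (by positivity)).trans ((add_le_add_left h1 _).trans ?_)
  rw [Real.mul_rpow (x := 2 * (Cg + 1)) (by positivity) (by positivity),
    Real.mul_rpow (x := bias K) hb.le (abs_nonneg _)]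
  simp only [Scenario.rate]
  have h2 : 2 * bias K ^ (1 / 2 : ℝ) ≤ 2 / Real.log 2 ^ (1 / 2 : ℝ) *
      (bias K ^ (1 / 2 : ℝ) * |Real.log (bias K)| ^ (1 / 2 : ℝ)) := by
    have h3 : Real.log 2 ^ (1 / 2 : ℝ) ≤ |Real.log (bias K)| ^ (1 / 2 : ℝ) :=
      Real.rpow_le_rpow hl2.le (half_log_le_abs_log hK) (by norm_num)
    rw [div_mul_eq_mul_div, le_div_iff₀ (by positivity), mul_assoc]
    gcongr
  rw [add_mul]
  refine add_le_add h2 (le_of_eq (by ring))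

end Scenarios

/-! ### Mismatch of consecutive losses in the Lipschitz scenario -/

section LipschitzScenario

open Scenario

variable {Ω : Type*} {d q : ℕ} [MeasurableSpace Ω] {μ : Measure Ω} [IsProbabilityMeasure μ]

/-- Distribution functions measure half-open intervals; starting slightly to the left of `a`
includes the endpoint at an arbitrarily small cost. -/
theorem measure_Icc_le_condLip {X : ℕ → Ω → ℝ} {K₀ M ℓ : ℕ} {g a b : ℝ} (hab : a < b)
    (hg : condLip μ X K₀ M ℓ g ≠ ⊤) :
    condDistrib (X (K₀ * M ^ ℓ)) (increment X K₀ M ℓ) μ g (Icc a b) ≤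
      ENNReal.ofReal (b - a) * condLip μ X K₀ M ℓ g := by
  set κ := condDistrib (X (K₀ * M ^ ℓ)) (increment X K₀ M ℓ) μ g with hκ
  obtain ⟨k, hk, hk0⟩ : ∃ k : ℝ, condLip μ X K₀ M ℓ g = ENNReal.ofReal k ∧ 0 ≤ k :=
    ⟨_, (ENNReal.ofReal_toReal hg).symm, ENNReal.toReal_nonneg⟩
  have h1 : ∀ x y, x ≠ y → |κ.real (Iic x) - κ.real (Iic y)| ≤ k * |x - y| := fun x y hxy => by
    have h2 : ENNReal.ofReal (|κ.real (Iic x) - κ.real (Iic y)| / |x - y|) ≤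
        condLip μ X K₀ M ℓ g :=
      le_iSup_of_le x (le_iSup_of_le y (le_iSup_of_le hxy le_rfl))
    rw [hk, ENNReal.ofReal_le_ofReal_iff hk0, div_le_iff₀ (abs_pos.2 (sub_ne_zero.2 hxy))] at h2
    exact h2
  have h3 : κ.real (Icc a b) ≤ k * (b - a) := by
    refine le_of_forall_pos_le_add fun ε hε => ?_
    have hη : 0 < ε / (k + 1) := by positivity
    have h4 := (le_abs_self _).trans (h1 b (a - ε / (k + 1)) (by linarith))
    rw [abs_of_pos (by linarith)] at h4
    have h5 : κ.real (Icc a b) + κ.real (Iic (a - ε / (k + 1))) ≤ κ.real (Iic b) := by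
      rw [← measureReal_union ?_ measurableSet_Iic]
      · refine measureReal_mono (union_subset (fun x hx => hx.2) fun x (hx : x ≤ _) => ?_)
        exact le_trans hx (by linarith)
      · refine disjoint_left.2 fun x hx (hx2 : x ≤ _) => ?_
        linarith [hx.1]
    have h6 : k * (ε / (k + 1)) ≤ ε := by
      rw [mul_div_assoc', div_le_iff₀ (by positivity)]; nlinarith
    nlinarith
  rw [hk, ← ENNReal.ofReal_mul (by linarith), ← ofReal_measureReal (measure_ne_top _ _)]
  refine ENNReal.ofReal_le_ofReal (by linarith)

/-- The fine loss is the coarse one plus `√h · G`. Given `G = g`, the indicators differ only if the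
coarse loss lies in an interval of length `√h |g|` next to `a`, whose conditional probability is
controlled by the conditional Lipschitz constant. -/
theorem lintegral_indGe_sub_le {X : ℕ → Ω → ℝ} (hX : ∀ K, Measurable (X K)) {K₀ M : ℕ}
    (hK₀ : 1 ≤ K₀) (hM : 1 ≤ M) (ℓ : ℕ) (a : ℝ) :
    ∫⁻ ω, ENNReal.ofReal |indGe a (X (K₀ * M ^ (ℓ + 1)) ω) - indGe a (X (K₀ * M ^ ℓ) ω)| ∂μ ≤
      ENNReal.ofReal (bias (K₀ * M ^ (ℓ + 1)) ^ (1 / 2 : ℝ)) *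
        ∫⁻ ω, ENNReal.ofReal |increment X K₀ M ℓ ω| *
          condLip μ X K₀ M ℓ (increment X K₀ M ℓ ω) ∂μ := by
  have hb : 0 < bias (K₀ * M ^ (ℓ + 1)) := bias_pos (Nat.mul_pos hK₀ (Nat.pow_pos hM))
  obtain ⟨r, hr, hr0⟩ : ∃ r, r = bias (K₀ * M ^ (ℓ + 1)) ^ (1 / 2 : ℝ) ∧ 0 < r :=
    ⟨_, rfl, by positivity⟩
  have hG : Measurable (increment X K₀ M ℓ) := ((hX _).sub (hX _)).const_mul _
  have hXf : ∀ ω, X (K₀ * M ^ (ℓ + 1)) ω = X (K₀ * M ^ ℓ) ω + r * increment X K₀ M ℓ ω := fun ω => by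
    rw [increment, ← mul_assoc, hr, ← Real.rpow_add hb]; norm_num
  have hm : Measurable (fun p : ℝ × ℝ => ENNReal.ofReal
      |indGe a (p.2 + r * p.1) - indGe a p.2|) := by
    have h1 : Measurable (fun p : ℝ × ℝ => indGe a (p.2 + r * p.1) - indGe a p.2) :=
      (measurable_indGe.comp (measurable_const.prodMk
        (measurable_snd.add (measurable_fst.const_mul r)))).sub
        (measurable_indGe.comp (measurable_const.prodMk measurable_snd))
    exact ENNReal.measurable_ofReal.comp (measurable_norm.comp h1)
  rw [← hr, ← lintegral_const_mul' _ _ ENNReal.ofReal_ne_top]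
  calc _ = ∫⁻ ω, ENNReal.ofReal |indGe a (X (K₀ * M ^ ℓ) ω + r * increment X K₀ M ℓ ω) -
        indGe a (X (K₀ * M ^ ℓ) ω)| ∂μ := by simp_rw [hXf]
    _ = ∫⁻ p, ENNReal.ofReal |indGe a (p.2 + r * p.1) - indGe a p.2|
        ∂(μ.map (fun ω => (increment X K₀ M ℓ ω, X (K₀ * M ^ ℓ) ω))) :=
        (lintegral_map hm (hG.prodMk (hX _))).symm
    _ = ∫⁻ g, ∫⁻ x, ENNReal.ofReal |indGe a (x + r * g) - indGe a x|
        ∂(condDistrib (X (K₀ * M ^ ℓ)) (increment X K₀ M ℓ) μ g)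
          ∂(μ.map (increment X K₀ M ℓ)) := by
        rw [← compProd_map_condDistrib (hX _).aemeasurable, Measure.lintegral_compProd hm]
    _ = ∫⁻ ω, ∫⁻ x, ENNReal.ofReal |indGe a (x + r * increment X K₀ M ℓ ω) - indGe a x|
        ∂(condDistrib (X (K₀ * M ^ ℓ)) (increment X K₀ M ℓ) μ (increment X K₀ M ℓ ω)) ∂μ :=
        lintegral_map hm.lintegral_kernel_prod_right' hG
    _ ≤ _ := by
      refine lintegral_mono fun ω => ?_
      generalize increment X K₀ M ℓ ω = g
      -- Treated apart because `0 · ∞ = 0`: for `g = 0` the two losses coincide, whatever the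
      -- Lipschitz constant.
      rcases eq_or_ne g 0 with rfl | hg0
      · simp
      rw [← mul_assoc, ← ENNReal.ofReal_mul hr0.le]
      have hrg : 0 < r * |g| := mul_pos hr0 (abs_pos.2 hg0)
      by_cases htop : condLip μ X K₀ M ℓ g = ⊤
      · rw [htop, ENNReal.mul_top (by simpa using hrg)]; exact le_top
      have key : ∀ s t : ℝ, s < t → t - s = r * |g| →
          (∀ x, ENNReal.ofReal |indGe a (x + r * g) - indGe a x| ≤ (Icc s t).indicator 1 x) →
          ∫⁻ x, ENNReal.ofReal |indGe a (x + r * g) - indGe a x|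
            ∂(condDistrib (X (K₀ * M ^ ℓ)) (increment X K₀ M ℓ) μ g) ≤
            ENNReal.ofReal (r * |g|) * condLip μ X K₀ M ℓ g := fun s t hst e h => by
        refine (lintegral_mono h).trans ?_
        rw [lintegral_indicator_one measurableSet_Icc, ← e]
        exact measure_Icc_le_condLip hst htop
      have h0 : ∀ s t x, (x ∉ Icc s t → indGe a (x + r * g) = indGe a x) →
          ENNReal.ofReal |indGe a (x + r * g) - indGe a x| ≤ (Icc s t).indicator 1 x := by
        intro s t x h
        by_cases hx : x ∈ Icc s t
        · rw [indicator_of_mem hx, Pi.one_apply, ENNReal.ofReal_le_one]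
          exact abs_indGe_sub_le _ _ _ _
        · rw [h hx]; simp
      rcases lt_or_gt_of_ne hg0 with hg | hg
      · rw [abs_of_neg hg] at key hrg ⊢
        refine key a (a - r * g) (by linarith) (by ring) fun x => h0 _ _ _ fun hx => ?_
        rw [mem_Icc, not_and_or, not_le, not_le] at hx
        unfold indGe
        rcases hx with hx | hx
        · rw [if_neg (by linarith), if_neg (by linarith)]
        · rw [if_pos (by linarith), if_pos (by linarith)]
      · rw [abs_of_pos hg] at key hrg ⊢
        refine key (a - r * g) a (by linarith) (by ring) fun x => h0 _ _ _ fun hx => ?_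
        rw [mem_Icc, not_and_or, not_le, not_le] at hx
        unfold indGe
        rcases hx with hx | hx
        · rw [if_neg (by linarith), if_neg (by linarith)]
        · rw [if_pos (by linarith), if_pos (by linarith)]

theorem exists_indGe_lipschitz {φ : (Fin d → ℝ) → (Fin q → ℝ) → ℝ} {Y : Ω → Fin d → ℝ}
    {Z : ℕ → Ω → Fin q → ℝ} (hX : ∀ K, Measurable (loss μ φ Y Z K)) {K₀ M : ℕ}
    (hK₀ : 1 ≤ K₀) (hM : 1 ≤ M) (hs : Scenario.lipschitz.Holds μ φ Y Z K₀ M) :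
    ∃ D : ℝ, 0 < D ∧ ∀ ℓ a,
      ∫ ω, |indGe a (loss μ φ Y Z (K₀ * M ^ (ℓ + 1)) ω) -
        indGe a (loss μ φ Y Z (K₀ * M ^ ℓ) ω)| ∂μ ≤
        D * Scenario.lipschitz.rate (levelBias K₀ M (ℓ + 1)) := by
  simp only [Scenario.Holds] at hs
  obtain ⟨D, hD⟩ : ∃ D, D = (⨆ ℓ : ℕ, ∫⁻ ω, ENNReal.ofReal |increment (loss μ φ Y Z) K₀ M ℓ ω| *
      condLip μ (loss μ φ Y Z) K₀ M ℓ (increment (loss μ φ Y Z) K₀ M ℓ ω) ∂μ) := ⟨_, rfl⟩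
  rw [← hD] at hs
  refine ⟨D.toReal + 1, by positivity, fun ℓ a => ?_⟩
  have hb : 0 < bias (K₀ * M ^ (ℓ + 1)) := bias_pos (Nat.mul_pos hK₀ (Nat.pow_pos hM))
  have h1 := lintegral_indGe_sub_le (μ := μ) hX hK₀ hM ℓ a
  have h2 : ∫⁻ ω, ENNReal.ofReal |indGe a (loss μ φ Y Z (K₀ * M ^ (ℓ + 1)) ω) -
      indGe a (loss μ φ Y Z (K₀ * M ^ ℓ) ω)| ∂μ ≤
      ENNReal.ofReal (bias (K₀ * M ^ (ℓ + 1)) ^ (1 / 2 : ℝ)) * D := by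
    refine h1.trans ?_
    gcongr
    rw [hD]
    exact le_iSup (fun ℓ => ∫⁻ ω, ENNReal.ofReal |increment (loss μ φ Y Z) K₀ M ℓ ω| *
      condLip μ (loss μ φ Y Z) K₀ M ℓ (increment (loss μ φ Y Z) K₀ M ℓ ω) ∂μ) ℓ
  have h3 := ENNReal.toReal_mono (ENNReal.mul_ne_top ENNReal.ofReal_ne_top hs.ne) h2
  rw [ENNReal.toReal_mul, ENNReal.toReal_ofReal (by positivity)] at h3
  rw [integral_eq_lintegral_of_nonneg_ae (Eventually.of_forall fun ω => abs_nonneg _)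
    (integrable_indGe_sub (hX _) (hX _) a a).aestronglyMeasurable]
  refine h3.trans ?_
  simp only [Scenario.rate, levelBias]
  have : 0 ≤ bias (K₀ * M ^ (ℓ + 1)) ^ (1 / 2 : ℝ) := by positivity
  linarith

end LipschitzScenario

/-! ### The rates along the geometric sequence of biases -/

section LevelBias

theorem levelBias_pos {K₀ M : ℕ} (hK₀ : 1 ≤ K₀) (hM : 1 ≤ M) (ℓ : ℕ) : 0 < levelBias K₀ M ℓ :=
  bias_pos (Nat.mul_pos hK₀ (Nat.pow_pos hM))

theorem levelBias_le_one (K₀ M ℓ : ℕ) : levelBias K₀ M ℓ ≤ 1 := bias_le_one _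

theorem levelBias_eq (K₀ M ℓ : ℕ) : levelBias K₀ M ℓ = bias K₀ * ((M : ℝ) ^ ℓ)⁻¹ := by
  simp only [levelBias, bias]; push_cast; rw [mul_inv]

theorem levelBias_succ {M : ℕ} (hM : 1 ≤ M) (K₀ ℓ : ℕ) :
    levelBias K₀ M ℓ = M * levelBias K₀ M (ℓ + 1) := by
  have : (M : ℝ) ≠ 0 := by positivity
  rw [levelBias_eq, levelBias_eq, pow_succ]; field_simp

/-- The scenarios in which the rate is meaningful. -/
def Scenario.Valid (s : Scenario) (K₀ : ℕ) : Prop :=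
  (∀ p, s = moment p → 1 < p) ∧ (s = gaussian → 2 ≤ K₀)

theorem Scenario.rate_levelBias_le {s : Scenario} {K₀ M : ℕ} (hK₀ : 1 ≤ K₀) (hM : 1 ≤ M)
    (hs : s.Valid K₀) (ℓ : ℕ) :
    s.rate (levelBias K₀ M ℓ) ≤ M * s.rate (levelBias K₀ M (ℓ + 1)) := by
  have hb := levelBias_pos hK₀ hM (ℓ + 1)
  have hM1 : (1 : ℝ) ≤ M := by exact_mod_cast hM
  have hpow : ∀ ρ : ℝ, ρ ≤ 1 → levelBias K₀ M ℓ ^ ρ ≤ M * levelBias K₀ M (ℓ + 1) ^ ρ :=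
    fun ρ hρ => by
      rw [levelBias_succ hM, Real.mul_rpow (by linarith) hb.le]
      gcongr
      calc (M : ℝ) ^ ρ ≤ (M : ℝ) ^ (1 : ℝ) := Real.rpow_le_rpow_of_exponent_le hM1 hρ
        _ = M := Real.rpow_one _
  cases s with
  | moment p =>
    have hp := hs.1 p rfl
    refine hpow _ ?_
    rw [div_le_one (by linarith)]; linarith
  | gaussian =>
    simp only [Scenario.rate]
    have h1 := hpow (1 / 2) (by norm_num)
    have h2 : |Real.log (levelBias K₀ M ℓ)| ≤ |Real.log (levelBias K₀ M (ℓ + 1))| := by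
      have h0 := levelBias_pos hK₀ hM ℓ
      rw [abs_of_nonpos (Real.log_nonpos h0.le (levelBias_le_one _ _ _)),
        abs_of_nonpos (Real.log_nonpos hb.le (levelBias_le_one _ _ _)), neg_le_neg_iff]
      refine Real.log_le_log hb ?_
      rw [levelBias_succ hM K₀ ℓ]; nlinarith
    rw [← mul_assoc]
    gcongr
  | lipschitz => exact hpow (1 / 2) (by norm_num)

/-- The moment exponent is below `1/2` and the Gaussian logarithm at least `ln 2`. Terms of order
`h` can therefore be absorbed into the rate. -/
theorem Scenario.le_rate_levelBias {s : Scenario} {K₀ M : ℕ} (hK₀ : 1 ≤ K₀) (hM : 1 ≤ M)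
    (hs : s.Valid K₀) (ℓ : ℕ) :
    Real.log 2 ^ (1 / 2 : ℝ) * levelBias K₀ M ℓ ^ (1 / 2 : ℝ) ≤ s.rate (levelBias K₀ M ℓ) := by
  have hb := levelBias_pos hK₀ hM ℓ
  have hl : 0 ≤ Real.log 2 := Real.log_nonneg one_le_two
  have h1 : Real.log 2 ^ (1 / 2 : ℝ) ≤ 1 :=
    Real.rpow_le_one hl (by linarith [Real.log_two_lt_d9]) (by norm_num)
  have hx : 0 ≤ levelBias K₀ M ℓ ^ (1 / 2 : ℝ) := by positivity
  have h2 : Real.log 2 ^ (1 / 2 : ℝ) * levelBias K₀ M ℓ ^ (1 / 2 : ℝ) ≤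
      levelBias K₀ M ℓ ^ (1 / 2 : ℝ) := by nlinarith
  cases s with
  | moment p =>
    have hp := hs.1 p rfl
    refine h2.trans (Real.rpow_le_rpow_of_exponent_ge hb (levelBias_le_one _ _ _) ?_)
    rw [div_le_div_iff₀ (by linarith) two_pos]; linarith
  | gaussian =>
    simp only [Scenario.rate]
    rw [mul_comm]
    gcongr
    refine half_log_le_abs_log ?_
    exact (hs.2 rfl).trans (Nat.le_mul_of_pos_right _ (Nat.pow_pos hM))
  | lipschitz => exact h2

theorem Scenario.rate_pos {s : Scenario} {K₀ M : ℕ} (hK₀ : 1 ≤ K₀) (hM : 1 ≤ M)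
    (hs : s.Valid K₀) (ℓ : ℕ) : 0 < s.rate (levelBias K₀ M ℓ) := by
  have hb := levelBias_pos hK₀ hM ℓ
  have hl : 0 < Real.log 2 := Real.log_pos one_lt_two
  exact lt_of_lt_of_le (by positivity) (le_rate_levelBias hK₀ hM hs ℓ)

end LevelBias

/-! ### Mismatch of consecutive losses in all scenarios -/

section Scenarios

variable {Ω : Type*} {d q : ℕ} [MeasurableSpace Ω] {μ : Measure Ω} [IsProbabilityMeasure μ]
  {φ : (Fin d → ℝ) → (Fin q → ℝ) → ℝ}
  {Y : Ω → Fin d → ℝ} {Z : ℕ → Ω → Fin q → ℝ} {α : ℝ} {V : ℕ → ℝ → ℝ} {ξs : ℕ → ℝ}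
  {Ys : ℕ → ℕ → Ω → Fin d → ℝ} {Zs : ℕ → ℕ → ℕ → Ω → Fin q → ℝ} {θ₀ : ℕ → Bool → Ω → ℝ × ℝ}
  {A c lam C δ B : ℝ}

/-- In each scenario, the probability that consecutive losses lie on different sides of a
threshold is of the order of the rate. -/
theorem Setup.exists_rate (S : Setup μ φ Y Z α V ξs Ys Zs θ₀ A c lam C δ B) {s : Scenario}
    {K₀ M : ℕ} (hK₀ : 1 ≤ K₀) (hM : 1 ≤ M) (hs : s.Holds μ φ Y Z K₀ M) (hv : s.Valid K₀) :
    ∃ D : ℝ, 0 < D ∧ ∀ ℓ a,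
      ∫ ω, |indGe a (loss μ φ Y Z (K₀ * M ^ (ℓ + 1)) ω) -
        indGe a (loss μ φ Y Z (K₀ * M ^ ℓ) ω)| ∂μ ≤ D * s.rate (levelBias K₀ M (ℓ + 1)) := by
  -- In the first two scenarios both losses are compared with `X_0`, and the coarse rate is at most
  -- `M` times the fine one.
  have key : (∃ D : ℝ, 0 < D ∧ ∀ ℓ a, ∫ ω, |indGe a (loss μ φ Y Z (K₀ * M ^ ℓ) ω) -
        indGe a (loss μ φ Y Z 0 ω)| ∂μ ≤ D * s.rate (levelBias K₀ M ℓ)) →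
      ∃ D : ℝ, 0 < D ∧ ∀ ℓ a,
      ∫ ω, |indGe a (loss μ φ Y Z (K₀ * M ^ (ℓ + 1)) ω) -
        indGe a (loss μ φ Y Z (K₀ * M ^ ℓ) ω)| ∂μ ≤ D * s.rate (levelBias K₀ M (ℓ + 1)) := by
    rintro ⟨D, hD0, hD⟩
    refine ⟨D * (1 + M), by positivity, fun ℓ a => ?_⟩
    have hm := S.reg.measurable
    have i1 := integrable_indGe_sub (μ := μ) (hm (K₀ * M ^ (ℓ + 1))) (hm 0) a a
    have i2 := integrable_indGe_sub (μ := μ) (hm (K₀ * M ^ ℓ)) (hm 0) a a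
    have h1 := hD (ℓ + 1) a
    have h2 := (hD ℓ a).trans (mul_le_mul_of_nonneg_left
      (Scenario.rate_levelBias_le hK₀ hM hv ℓ) hD0.le)
    refine (integral_mono (integrable_indGe_sub (hm _) (hm _) a a) (i1.add i2) fun ω => ?_).trans ?_
    · exact (abs_sub_le _ (indGe a (loss μ φ Y Z 0 ω)) _).trans
        (by rw [abs_sub_comm (indGe a (loss μ φ Y Z 0 ω))]; rfl)
    · refine (integral_add i1 i2).le.trans ?_
      linarith
  cases s with
  | moment p =>
    obtain ⟨D, hD0, hD⟩ := S.indGe_moment hs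
    exact key ⟨D, hD0, fun ℓ a => hD _ (Nat.mul_pos hK₀ (Nat.pow_pos hM)) a⟩
  | gaussian =>
    obtain ⟨D, hD0, hD⟩ := S.indGe_gaussian hs
    exact key ⟨D, hD0, fun ℓ a => hD _
      ((hv.2 rfl).trans (Nat.le_mul_of_pos_right _ (Nat.pow_pos hM))) a⟩
  | lipschitz => exact exists_indGe_lipschitz S.reg.measurable hK₀ hM hs

end Scenarios

/-! ### The expected shortfall iterates as empirical means -/

section ExpectedShortfall

/-- The integrand `ξ + (x - ξ)^+ / (1 - α)` of the objective function. -/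
def esFun (α ξ x : ℝ) : ℝ := ξ + (1 - α)⁻¹ * max (x - ξ) 0

theorem measurable_esFun (α : ℝ) : Measurable (fun p : ℝ × ℝ => esFun α p.1 p.2) :=
  measurable_fst.add (((measurable_snd.sub measurable_fst).max measurable_const).const_mul _)

theorem abs_esFun_sub_le {α : ℝ} (hα : α ∈ Ioo (0 : ℝ) 1) (ξ x ξ' x' : ℝ) :
    |esFun α ξ x - esFun α ξ' x'| ≤ (1 + (1 - α)⁻¹) * (|ξ - ξ'| + |x - x'|) := by
  have h1 : 0 < (1 - α)⁻¹ := inv_pos.2 (by linarith [hα.2])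
  have h2 : |max (x - ξ) 0 - max (x' - ξ') 0| ≤ |x - x'| + |ξ - ξ'| := by
    refine (abs_max_sub_max_le_abs _ _ _).trans ?_
    rw [show x - ξ - (x' - ξ') = (x - x') - (ξ - ξ') by ring]
    exact abs_sub _ _
  have e : esFun α ξ x - esFun α ξ' x' =
      (ξ - ξ') + (1 - α)⁻¹ * (max (x - ξ) 0 - max (x' - ξ') 0) := by unfold esFun; ring
  rw [e]
  refine (abs_add_le _ _).trans ?_
  rw [abs_mul, abs_of_pos h1]
  have h3 := mul_le_mul_of_nonneg_left h2 h1.le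
  have := abs_nonneg (x - x')
  linarith

theorem abs_esFun_le {α : ℝ} (hα : α ∈ Ioo (0 : ℝ) 1) (ξ x : ℝ) :
    |esFun α ξ x| ≤ (1 + (1 - α)⁻¹) * (|ξ| + |x|) := by
  have := abs_esFun_sub_le hα ξ x 0 0
  simpa [esFun] using this

/-- With steps `1/(n + 1)` the recursion is exact averaging; the first step has size `1` and erases
the initial value. -/
theorem mul_iterate_snd (α : ℝ) (γ : ℕ → ℝ) (θ : ℝ × ℝ) (x : ℕ → ℝ) (n : ℕ) :
    n * (iterate α γ θ x n).2 =
      ∑ k ∈ Finset.range n, esFun α (iterate α γ θ x k).1 (x k) := by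
  induction n with
  | zero => simp
  | succ n ih =>
    rw [Finset.sum_range_succ, ← ih]
    simp only [iterate, H₂, esFun]
    push_cast
    field_simp
    ring

theorem linRec_one_eq_sum (e : ℕ → ℝ) (n : ℕ) :
    linRec (fun _ => 1) (fun _ => 1) e n = ∑ k ∈ Finset.range n, e k := by
  induction n with
  | zero => simp [linRec]
  | succ n ih => rw [Finset.sum_range_succ, ← ih]; simp [linRec]

variable {Ω : Type*} {d q : ℕ} [MeasurableSpace Ω] {μ : Measure Ω} [IsProbabilityMeasure μ]
  {φ : (Fin d → ℝ) → (Fin q → ℝ) → ℝ}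
  {Y : Ω → Fin d → ℝ} {Z : ℕ → Ω → Fin q → ℝ} {α : ℝ} {V : ℕ → ℝ → ℝ} {ξs : ℕ → ℝ}
  {Ys : ℕ → ℕ → Ω → Fin d → ℝ} {Zs : ℕ → ℕ → ℕ → Ω → Fin q → ℝ} {θ₀ : ℕ → Bool → Ω → ℝ × ℝ}
  {A c lam C δ B : ℝ} {γ : ℕ → ℝ}

/-- The difference of the integrands of a fine scheme and of `w` times a coarse scheme. -/
def esPair (φ : (Fin d → ℝ) → (Fin q → ℝ) → ℝ) (ξs : ℕ → ℝ) (α w : ℝ) (Kf Kc : ℕ)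
    (p : (ℝ × ℝ) × ((Fin d → ℝ) × (ℕ → Fin q → ℝ))) : ℝ :=
  esFun α (ξs Kf + p.1.1) (innerMean φ Kf p.2.1 p.2.2) -
    w * esFun α (ξs Kc + p.1.2) (innerMean φ Kc p.2.1 p.2.2)

theorem Setup.measurable_esPair (S : Setup μ φ Y Z α V ξs Ys Zs θ₀ A c lam C δ B) (w : ℝ)
    (Kf Kc : ℕ) : Measurable (esPair φ ξs α w Kf Kc) := by
  have h1 : ∀ K, Measurable (fun p : (ℝ × ℝ) × ((Fin d → ℝ) × (ℕ → Fin q → ℝ)) =>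
      innerMean φ K p.2.1 p.2.2) := fun K =>
    (measurable_innerMean S.measurable_φ K).comp measurable_snd
  have h2 := measurable_esFun α
  exact (h2.comp (((measurable_fst.comp measurable_fst).const_add _).prodMk (h1 Kf))).sub
    ((h2.comp (((measurable_snd.comp measurable_fst).const_add _).prodMk (h1 Kc))).const_mul w)

theorem memLp_esFun (hα : α ∈ Ioo (0 : ℝ) 1) {f g : Ω → ℝ} (hf : MemLp f 2 μ) (hg : MemLp g 2 μ) :
    MemLp (fun ω => esFun α (f ω) (g ω)) 2 μ := by
  have h1 : MemLp (fun ω => (1 + (1 - α)⁻¹) * (|f ω| + |g ω|)) 2 μ :=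
    (hf.abs.add hg.abs).const_mul _
  refine h1.mono' ?_ (Eventually.of_forall fun ω => abs_esFun_le hα _ _)
  exact ((measurable_esFun α).comp_aemeasurable
    (hf.1.aemeasurable.prodMk hg.1.aemeasurable)).aestronglyMeasurable

theorem Setup.memLp_loss (S : Setup μ φ Y Z α V ξs Ys Zs θ₀ A c lam C δ B) (K : ℕ) :
    MemLp (loss μ φ Y Z K) 2 μ := S.generic.memLp_loss S.measurable_φ S.memLp K

theorem Setup.memLp_innerMean (S : Setup μ φ Y Z α V ξs Ys Zs θ₀ A c lam C δ B) {K : ℕ}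
    (hK : 1 ≤ K) : MemLp (fun ω => innerMean φ K (Y ω) (fun k => Z k ω)) 2 μ := by
  have h : loss μ φ Y Z K = fun ω => innerMean φ K (Y ω) (fun k => Z k ω) :=
    funext fun ω => loss_eq hK ω
  rw [← h]
  exact S.memLp_loss K

theorem Setup.memLp_esPair (S : Setup μ φ Y Z α V ξs Ys Zs θ₀ A c lam C δ B) (w : ℝ) {Kf Kc : ℕ}
    (hKf : 1 ≤ Kf) (hKc : 1 ≤ Kc) (a : ℝ × ℝ) :
    MemLp (fun ω => esPair φ ξs α w Kf Kc (a, (Y ω, fun k => Z k ω))) 2 μ := by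
  simp only [esPair]
  exact (memLp_esFun S.α_mem (memLp_const (ξs Kf + a.1)) (S.memLp_innerMean hKf)).sub
    ((memLp_esFun S.α_mem (memLp_const (ξs Kc + a.2)) (S.memLp_innerMean hKc)).const_mul w)

theorem Setup.memLp_esPair_sample (S : Setup μ φ Y Z α V ξs Ys Zs θ₀ A c lam C δ B) (w : ℝ)
    {Kf Kc : ℕ} (hKf : 1 ≤ Kf) (hKc : 1 ≤ Kc) (ℓ n : ℕ) :
    MemLp (fun ω => esPair φ ξs α w Kf Kc
      (errPair α γ φ Ys Zs θ₀ ξs ℓ Kf Kc n ω, sample Ys Zs ℓ n ω)) 2 μ := by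
  have h1 : ∀ K, 1 ≤ K →
      MemLp (fun ω => innerMean φ K (sample Ys Zs ℓ n ω).1 (sample Ys Zs ℓ n ω).2) 2 μ :=
    fun K hK => ((S.sim.identDistrib_sample S.generic ℓ n).comp
      (measurable_innerMean S.measurable_φ K)).memLp_iff.2 (S.memLp_innerMean hK)
  have h2 : ∀ K j, MemLp (fun ω => ξs K + err α γ φ Ys Zs θ₀ ξs ℓ K j n ω) 2 μ := fun K j =>
    (memLp_const (ξs K)).add (S.memLp_err ℓ K j n)
  simp only [esPair, errPair]
  exact (memLp_esFun S.α_mem (h2 Kf true) (h1 Kf hKf)).sub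
    ((memLp_esFun S.α_mem (h2 Kc false) (h1 Kc hKc)).const_mul w)

theorem integral_esFun {X : Ω → ℝ} (hX : Integrable X μ) (ξ : ℝ) :
    ∫ ω, esFun α ξ (X ω) ∂μ = objective μ α X ξ := by
  have h1 : Integrable (fun ω => max (X ω - ξ) 0) μ :=
    (hX.sub (integrable_const ξ)).pos_part
  unfold esFun objective
  rw [integral_add (integrable_const _) (h1.const_mul _), integral_const_mul]
  simp

/-- The weight of the coarse scheme and the order of the variance of one iteration. -/
def WeightRate (w r : ℝ) (Kf Kc : ℕ) : Prop := (w = 0 ∧ r = 1) ∨ (w = 1 ∧ r = bias Kf + bias Kc)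

/-- The integrand is Lipschitz in `(ξ, x)`. For the pair, its square is controlled by the squared
differences of thresholds and of losses, the latter being `O(h)` in mean; for weight `0` a bound of
order one suffices. -/
theorem Setup.integral_esPair_sq_le (S : Setup μ φ Y Z α V ξs Ys Zs θ₀ A c lam C δ B) :
    ∃ D : ℝ, 0 < D ∧ ∀ (Kf Kc : ℕ) (w r : ℝ), 1 ≤ Kf → 1 ≤ Kc → WeightRate w r Kf Kc →
      ∀ a : ℝ × ℝ, ∫ ω, esPair φ ξs α w Kf Kc (a, (Y ω, fun k => Z k ω)) ^ 2 ∂μ ≤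
        D * (a.1 ^ 2 + a.2 ^ 2 + r) := by
  obtain ⟨D, hD0, hD⟩ := S.generic.integral_loss_sub_sq_le S.measurable_φ S.memLp
  have hC := S.reg.C_pos
  obtain ⟨k, hk, hk1⟩ : ∃ k, k = 1 + (1 - α)⁻¹ ∧ 1 ≤ k :=
    ⟨_, rfl, by have := inv_pos.2 (show 0 < 1 - α by linarith [S.α_mem.2]); linarith⟩
  obtain ⟨E, hE, hE0⟩ : ∃ E, E = ∫ ω, loss μ φ Y Z 0 ω ^ 2 ∂μ ∧ 0 ≤ E :=
    ⟨_, rfl, integral_nonneg fun ω => sq_nonneg _⟩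
  refine ⟨2 * k ^ 2 * (4 + 4 * C ^ 2 + 2 * D + 2 * E), by positivity,
    fun Kf Kc w r hKf hKc hw a => ?_⟩
  have hm := fun K => S.memLp_loss K
  have is : ∀ K, Integrable (fun ω => (loss μ φ Y Z K ω - loss μ φ Y Z 0 ω) ^ 2) μ :=
    fun K => ((hm K).sub (hm 0)).integrable_sq
  have hmem := (S.memLp_esPair w hKf hKc a).integrable_sq
  have hbf := bias_pos hKf
  have hbc := bias_pos hKc
  have hbf1 := bias_le_one Kf
  have hbc1 := bias_le_one Kc
  have hr0 : 0 < r := by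
    rcases hw with ⟨-, rfl⟩ | ⟨-, rfl⟩ <;> positivity
  rcases hw with ⟨rfl, rfl⟩ | ⟨rfl, rfl⟩
  · have i0 := (hm 0).integrable_sq.const_mul (2 * (2 * k ^ 2))
    have i1 := (is Kf).const_mul (2 * (2 * k ^ 2))
    have i01 : Integrable (fun ω => 2 * (2 * k ^ 2) * loss μ φ Y Z 0 ω ^ 2 +
      2 * (2 * k ^ 2) * (loss μ φ Y Z Kf ω - loss μ φ Y Z 0 ω) ^ 2) μ := i0.add i1
    calc _ ≤ ∫ ω, (2 * (2 * k ^ 2) * loss μ φ Y Z 0 ω ^ 2 +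
          2 * (2 * k ^ 2) * (loss μ φ Y Z Kf ω - loss μ φ Y Z 0 ω) ^ 2 +
          2 * k ^ 2 * (2 * C ^ 2 + 2 * a.1 ^ 2)) ∂μ := by
          refine integral_mono hmem (i01.add (integrable_const _)) fun ω => ?_
          simp only [esPair, zero_mul, sub_zero]
          rw [← loss_eq (μ := μ) hKf]
          have h1 := abs_esFun_le S.α_mem (ξs Kf + a.1) (loss μ φ Y Z Kf ω)
          rw [← hk] at h1
          have h2 := S.reg.minimizer_le Kf
          have h3 : esFun α (ξs Kf + a.1) (loss μ φ Y Z Kf ω) ^ 2 ≤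
              (k * (|ξs Kf + a.1| + |loss μ φ Y Z Kf ω|)) ^ 2 := by
            rw [← sq_abs (esFun _ _ _)]; exact pow_le_pow_left₀ (abs_nonneg _) h1 2
          have h4 : (|ξs Kf + a.1| + |loss μ φ Y Z Kf ω|) ^ 2 ≤
              2 * ((ξs Kf + a.1) ^ 2 + loss μ φ Y Z Kf ω ^ 2) := by
            rw [← sq_abs (ξs Kf + a.1), ← sq_abs (loss μ φ Y Z Kf ω)]
            nlinarith [sq_nonneg (|ξs Kf + a.1| - |loss μ φ Y Z Kf ω|)]
          have h5 : (ξs Kf + a.1) ^ 2 ≤ 2 * C ^ 2 + 2 * a.1 ^ 2 := by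
            have : ξs Kf ^ 2 ≤ C ^ 2 := sq_le_sq' (abs_le.1 h2).1 (abs_le.1 h2).2
            nlinarith [sq_nonneg (ξs Kf - a.1)]
          have h6 : loss μ φ Y Z Kf ω ^ 2 ≤ 2 * loss μ φ Y Z 0 ω ^ 2 +
              2 * (loss μ φ Y Z Kf ω - loss μ φ Y Z 0 ω) ^ 2 := by
            nlinarith [sq_nonneg (loss μ φ Y Z Kf ω - 2 * loss μ φ Y Z 0 ω)]
          calc _ ≤ (k * (|ξs Kf + a.1| + |loss μ φ Y Z Kf ω|)) ^ 2 := h3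
            _ = k ^ 2 * (|ξs Kf + a.1| + |loss μ φ Y Z Kf ω|) ^ 2 := by ring
            _ ≤ k ^ 2 * (2 * ((2 * C ^ 2 + 2 * a.1 ^ 2) + (2 * loss μ φ Y Z 0 ω ^ 2 +
              2 * (loss μ φ Y Z Kf ω - loss μ φ Y Z 0 ω) ^ 2))) := by
                gcongr
                linarith
            _ = _ := by ring
      _ = 2 * (2 * k ^ 2) * E + 2 * (2 * k ^ 2) *
            ∫ ω, (loss μ φ Y Z Kf ω - loss μ φ Y Z 0 ω) ^ 2 ∂μ +
          2 * k ^ 2 * (2 * C ^ 2 + 2 * a.1 ^ 2) := by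
          rw [integral_add i01 (integrable_const _), integral_add i0 i1, integral_const_mul,
            integral_const_mul, hE]
          simp
      _ ≤ 2 * (2 * k ^ 2) * E + 2 * (2 * k ^ 2) * (D * 1) +
          2 * k ^ 2 * (2 * C ^ 2 + 2 * a.1 ^ 2) := by
          have := (hD Kf hKf).trans (mul_le_mul_of_nonneg_left hbf1 hD0.le)
          gcongr
      _ = 2 * k ^ 2 * (2 * E + 2 * D + 2 * C ^ 2 + 2 * a.1 ^ 2) := by ring
      _ ≤ 2 * k ^ 2 * ((4 + 4 * C ^ 2 + 2 * D + 2 * E) * (a.1 ^ 2 + a.2 ^ 2 + 1)) := by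
          refine mul_le_mul_of_nonneg_left ?_ (by positivity)
          have h7 : 0 ≤ (4 * C ^ 2 + 2 * D + 2 * E) * (a.1 ^ 2 + a.2 ^ 2) := by positivity
          nlinarith [sq_nonneg a.1, sq_nonneg a.2, sq_nonneg C]
      _ = _ := by ring
  · have i1 := (is Kf).const_mul (2 * (2 * k ^ 2))
    have i2 := (is Kc).const_mul (2 * (2 * k ^ 2))
    have i12 : Integrable (fun ω => 2 * (2 * k ^ 2) * (loss μ φ Y Z Kf ω - loss μ φ Y Z 0 ω) ^ 2 +
      2 * (2 * k ^ 2) * (loss μ φ Y Z Kc ω - loss μ φ Y Z 0 ω) ^ 2) μ := i1.add i2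
    have hmin : (ξs Kf + a.1 - (ξs Kc + a.2)) ^ 2 ≤
        4 * (C ^ 2 * (bias Kf + bias Kc) + a.1 ^ 2 + a.2 ^ 2) := by
      have key : ∀ K, 1 ≤ K → (ξs K - ξs 0) ^ 2 ≤ C ^ 2 * bias K := fun K hK => by
        have h1 := S.reg.minimizer_sub K hK
        have h2 : (ξs K - ξs 0) ^ 2 ≤ (C * bias K) ^ 2 := by
          rw [← sq_abs]; exact pow_le_pow_left₀ (abs_nonneg _) h1 2
        refine h2.trans ?_
        rw [mul_pow]
        have := bias_pos hK
        have := bias_le_one K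
        gcongr
        nlinarith
      have h1 := key Kf hKf
      have h2 := key Kc hKc
      generalize ξs Kf - ξs 0 = x at h1
      have e : ξs Kf + a.1 - (ξs Kc + a.2) =
        (ξs Kf - ξs 0) - (ξs Kc - ξs 0) + a.1 - a.2 := by ring
      have h1 := key Kf hKf
      rw [e]
      generalize ξs Kf - ξs 0 = x at h1 ⊢
      generalize ξs Kc - ξs 0 = y at h2 ⊢
      have e2 : (x - y + a.1 - a.2) ^ 2 + (x + y) ^ 2 + (x - y - a.1 + a.2) ^ 2 +
        (a.1 + a.2) ^ 2 * 2 + (x + y) ^ 2 = 4 * (x ^ 2 + y ^ 2 + a.1 ^ 2 + a.2 ^ 2) := by ring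
      nlinarith [sq_nonneg (x + y), sq_nonneg (x - y - a.1 + a.2), sq_nonneg (a.1 + a.2)]
    calc _ ≤ ∫ ω, (2 * (2 * k ^ 2) * (loss μ φ Y Z Kf ω - loss μ φ Y Z 0 ω) ^ 2 +
          2 * (2 * k ^ 2) * (loss μ φ Y Z Kc ω - loss μ φ Y Z 0 ω) ^ 2 +
          2 * k ^ 2 * (4 * (C ^ 2 * (bias Kf + bias Kc) + a.1 ^ 2 + a.2 ^ 2))) ∂μ := by
          refine integral_mono hmem (i12.add (integrable_const _)) fun ω => ?_
          simp only [esPair, one_mul]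
          rw [← loss_eq (μ := μ) hKf, ← loss_eq (μ := μ) hKc]
          have h1 := abs_esFun_sub_le S.α_mem (ξs Kf + a.1) (loss μ φ Y Z Kf ω)
            (ξs Kc + a.2) (loss μ φ Y Z Kc ω)
          rw [← hk] at h1
          generalize esFun α (ξs Kf + a.1) (loss μ φ Y Z Kf ω) -
            esFun α (ξs Kc + a.2) (loss μ φ Y Z Kc ω) = t at h1 ⊢
          generalize ξs Kf + a.1 - (ξs Kc + a.2) = x at h1 hmin
          have e : loss μ φ Y Z Kf ω - loss μ φ Y Z Kc ω = (loss μ φ Y Z Kf ω - loss μ φ Y Z 0 ω) -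
            (loss μ φ Y Z Kc ω - loss μ φ Y Z 0 ω) := by ring
          rw [e] at h1
          generalize loss μ φ Y Z Kf ω - loss μ φ Y Z 0 ω = y at h1 ⊢
          generalize loss μ φ Y Z Kc ω - loss μ φ Y Z 0 ω = z at h1 ⊢
          have h3 : t ^ 2 ≤ (k * (|x| + |y - z|)) ^ 2 := by
            rw [← sq_abs t]; exact pow_le_pow_left₀ (abs_nonneg _) h1 2
          have h4 : (|x| + |y - z|) ^ 2 ≤ 2 * (x ^ 2 + (y - z) ^ 2) := by
            rw [← sq_abs x, ← sq_abs (y - z)]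
            nlinarith [sq_nonneg (|x| - |y - z|)]
          have h6 : (y - z) ^ 2 ≤ 2 * y ^ 2 + 2 * z ^ 2 := by nlinarith [sq_nonneg (y + z)]
          calc t ^ 2 ≤ (k * (|x| + |y - z|)) ^ 2 := h3
            _ = k ^ 2 * (|x| + |y - z|) ^ 2 := by ring
            _ ≤ k ^ 2 * (2 * (4 * (C ^ 2 * (bias Kf + bias Kc) + a.1 ^ 2 + a.2 ^ 2) +
                (2 * y ^ 2 + 2 * z ^ 2))) := by
                gcongr
                linarith
            _ = _ := by ring
      _ = 2 * (2 * k ^ 2) * ∫ ω, (loss μ φ Y Z Kf ω - loss μ φ Y Z 0 ω) ^ 2 ∂μ +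
          2 * (2 * k ^ 2) * ∫ ω, (loss μ φ Y Z Kc ω - loss μ φ Y Z 0 ω) ^ 2 ∂μ +
          2 * k ^ 2 * (4 * (C ^ 2 * (bias Kf + bias Kc) + a.1 ^ 2 + a.2 ^ 2)) := by
          rw [integral_add i12 (integrable_const _), integral_add i1 i2, integral_const_mul,
            integral_const_mul]
          simp
      _ ≤ 2 * (2 * k ^ 2) * (D * bias Kf) + 2 * (2 * k ^ 2) * (D * bias Kc) +
          2 * k ^ 2 * (4 * (C ^ 2 * (bias Kf + bias Kc) + a.1 ^ 2 + a.2 ^ 2)) := by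
          have h1 := hD Kf hKf
          have h2 := hD Kc hKc
          gcongr
      _ = 2 * k ^ 2 * ((4 * C ^ 2 + 2 * D) * (bias Kf + bias Kc) + 4 * (a.1 ^ 2 + a.2 ^ 2)) := by
          ring
      _ ≤ 2 * k ^ 2 * ((4 + 4 * C ^ 2 + 2 * D + 2 * E) *
            (a.1 ^ 2 + a.2 ^ 2 + (bias Kf + bias Kc))) := by
          refine mul_le_mul_of_nonneg_left ?_ (by positivity)
          have h7 : 0 ≤ (4 * C ^ 2 + 2 * D + 2 * E) * (a.1 ^ 2 + a.2 ^ 2) := by positivity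
          have h8 : 0 ≤ (4 + 2 * E) * (bias Kf + bias Kc) := by positivity
          linarith
      _ = _ := by ring

end ExpectedShortfall

/-! ### Noise and drift of the expected shortfall at one level -/

section LevelES

theorem sum_inv_max_le (n : ℕ) :
    ∑ k ∈ Finset.range n, ((max k 1 : ℕ) : ℝ)⁻¹ ≤ 2 + Real.log n := by
  have h1 : ∀ n : ℕ, ∑ k ∈ Finset.range (n + 1), ((max k 1 : ℕ) : ℝ)⁻¹ = 1 + (harmonic n : ℝ) := by
    intro n
    induction n with
    | zero => simp
    | succ n ih =>
      rw [Finset.sum_range_succ, ih, harmonic_succ, max_eq_left (by omega)]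
      push_cast; ring
  have h2 : ∑ k ∈ Finset.range n, ((max k 1 : ℕ) : ℝ)⁻¹ ≤
      ∑ k ∈ Finset.range (n + 1), ((max k 1 : ℕ) : ℝ)⁻¹ := by
    rw [Finset.sum_range_succ]
    linarith [show (0 : ℝ) ≤ ((max n 1 : ℕ) : ℝ)⁻¹ by positivity]
  have h3 := harmonic_le_one_add_log n
  rw [h1] at h2
  linarith

variable {Ω : Type*} {d q : ℕ} [MeasurableSpace Ω] {μ : Measure Ω}

theorem eLpNorm_two_le {f : Ω → ℝ} (hf : MemLp f 2 μ) {b : ℝ} (hb : 0 ≤ b)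
    (h : ∫ ω, f ω ^ 2 ∂μ ≤ b ^ 2) : eLpNorm f 2 μ ≤ ENNReal.ofReal b := by
  rw [hf.eLpNorm_eq_integral_rpow_norm two_ne_zero ENNReal.ofNat_ne_top]
  refine ENNReal.ofReal_le_ofReal ?_
  simp only [ENNReal.toReal_ofNat, Real.rpow_ofNat, Real.norm_eq_abs, sq_abs]
  refine (Real.rpow_le_rpow (integral_nonneg fun ω => sq_nonneg _) h (by norm_num)).trans ?_
  rw [← Real.rpow_natCast, ← Real.rpow_mul hb]; norm_num

theorem eLpNorm_sum_le_ofReal {ι : Type*} {s : Finset ι} {f : ι → Ω → ℝ} {b : ι → ℝ}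
    (hf : ∀ i ∈ s, AEStronglyMeasurable (f i) μ) (hb : ∀ i ∈ s, 0 ≤ b i)
    (h : ∀ i ∈ s, eLpNorm (f i) 2 μ ≤ ENNReal.ofReal (b i)) :
    eLpNorm (fun ω => ∑ i ∈ s, f i ω) 2 μ ≤ ENNReal.ofReal (∑ i ∈ s, b i) := by
  have e : (fun ω => ∑ i ∈ s, f i ω) = ∑ i ∈ s, f i := by ext ω; simp
  rw [e, ENNReal.ofReal_sum_of_nonneg hb]
  exact (eLpNorm_sum_le hf one_le_two).trans (Finset.sum_le_sum h)

theorem eLpNorm_add_le_ofReal {f g : Ω → ℝ} {b c : ℝ} (hf : AEStronglyMeasurable f μ)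
    (hg : AEStronglyMeasurable g μ) (hb : 0 ≤ b) (hc : 0 ≤ c)
    (h1 : eLpNorm f 2 μ ≤ ENNReal.ofReal b) (h2 : eLpNorm g 2 μ ≤ ENNReal.ofReal c) :
    eLpNorm (fun ω => f ω + g ω) 2 μ ≤ ENNReal.ofReal (b + c) := by
  rw [ENNReal.ofReal_add hb hc]
  exact (eLpNorm_add_le hf hg one_le_two).trans (add_le_add h1 h2)

variable [IsProbabilityMeasure μ] {φ : (Fin d → ℝ) → (Fin q → ℝ) → ℝ}
  {Y : Ω → Fin d → ℝ} {Z : ℕ → Ω → Fin q → ℝ} {α : ℝ} {V : ℕ → ℝ → ℝ} {ξs : ℕ → ℝ}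
  {Ys : ℕ → ℕ → Ω → Fin d → ℝ} {Zs : ℕ → ℕ → ℕ → Ω → Fin q → ℝ} {θ₀ : ℕ → Bool → Ω → ℝ × ℝ}
  {A c lam C δ B : ℝ} {γ : ℕ → ℝ}

/-- The martingale increments of the expected shortfall iterates at one level. -/
def esNoise (μ : Measure Ω) (Y : Ω → Fin d → ℝ) (Z : ℕ → Ω → Fin q → ℝ) (α : ℝ) (γ : ℕ → ℝ)
    (φ : (Fin d → ℝ) → (Fin q → ℝ) → ℝ)
    (Ys : ℕ → ℕ → Ω → Fin d → ℝ) (Zs : ℕ → ℕ → ℕ → Ω → Fin q → ℝ) (θ₀ : ℕ → Bool → Ω → ℝ × ℝ)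
    (ξs : ℕ → ℝ) (w : ℝ) (Kf Kc ℓ n : ℕ) (ω : Ω) : ℝ :=
  fluctuation μ Y Z Ys Zs (esPair φ ξs α w Kf Kc) (errPair α γ φ Ys Zs θ₀ ξs ℓ Kf Kc n) ℓ n ω

/-- The drift increments of the expected shortfall iterates at one level. -/
def esDrift (α : ℝ) (γ : ℕ → ℝ) (φ : (Fin d → ℝ) → (Fin q → ℝ) → ℝ)
    (Ys : ℕ → ℕ → Ω → Fin d → ℝ) (Zs : ℕ → ℕ → ℕ → Ω → Fin q → ℝ) (θ₀ : ℕ → Bool → Ω → ℝ × ℝ)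
    (V : ℕ → ℝ → ℝ) (ξs : ℕ → ℝ) (w : ℝ) (Kf Kc ℓ n : ℕ) (ω : Ω) : ℝ :=
  (V Kf (ξs Kf + err α γ φ Ys Zs θ₀ ξs ℓ Kf true n ω) - V Kf (ξs Kf)) -
    w * (V Kc (ξs Kc + err α γ φ Ys Zs θ₀ ξs ℓ Kc false n ω) - V Kc (ξs Kc))

theorem Setup.memLp_esNoise (S : Setup μ φ Y Z α V ξs Ys Zs θ₀ A c lam C δ B) (w : ℝ)
    {Kf Kc : ℕ} (hKf : 1 ≤ Kf) (hKc : 1 ≤ Kc) (ℓ n : ℕ) :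
    MemLp (esNoise μ Y Z α γ φ Ys Zs θ₀ ξs w Kf Kc ℓ n) 2 μ :=
  S.sim.memLp_fluctuation S.generic (S.measurable_errPair _ _ fun i hi => by simp [hi.ne])
    (S.measurable_esPair w Kf Kc) (fun a => (S.memLp_esPair w hKf hKc a).integrable_sq)
    (S.memLp_esPair_sample w hKf hKc ℓ n)

theorem Setup.esNoise_orthogonal (S : Setup μ φ Y Z α V ξs Ys Zs θ₀ A c lam C δ B) (w : ℕ → ℝ)
    {Kf Kc : ℕ → ℕ} (hKf : ∀ ℓ, 1 ≤ Kf ℓ) (hKc : ∀ ℓ, 1 ≤ Kc ℓ)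
    (ℓ n ℓ' n' : ℕ) (h : (ℓ, n) ≠ (ℓ', n')) :
    ∫ ω, esNoise μ Y Z α γ φ Ys Zs θ₀ ξs (w ℓ) (Kf ℓ) (Kc ℓ) ℓ n ω *
      esNoise μ Y Z α γ φ Ys Zs θ₀ ξs (w ℓ') (Kf ℓ') (Kc ℓ') ℓ' n' ω ∂μ = 0 :=
  S.fluctuation_orthogonal (F := fun ℓ => esPair φ ξs α (w ℓ) (Kf ℓ) (Kc ℓ))
    (fun _ => S.measurable_esPair _ _ _)
    (fun ℓ a => (S.memLp_esPair (w ℓ) (hKf ℓ) (hKc ℓ) a).integrable_sq)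
    (fun ℓ n => S.memLp_esPair_sample (w ℓ) (hKf ℓ) (hKc ℓ) ℓ n) ℓ n ℓ' n' h

theorem Setup.mean_esPair (S : Setup μ φ Y Z α V ξs Ys Zs θ₀ A c lam C δ B)
    (hV : ∀ K, V K = objective μ α (loss μ φ Y Z K)) (w : ℝ) {Kf Kc : ℕ}
    (hKf : 1 ≤ Kf) (hKc : 1 ≤ Kc) (a : ℝ × ℝ) :
    ∫ ω, esPair φ ξs α w Kf Kc (a, (Y ω, fun k => Z k ω)) ∂μ =
      V Kf (ξs Kf + a.1) - w * V Kc (ξs Kc + a.2) := by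
  have h1 : ∀ K ξ, Integrable (fun ω => esFun α ξ (loss μ φ Y Z K ω)) μ := fun K ξ =>
    (memLp_esFun S.α_mem (memLp_const ξ) (S.memLp_loss K)).integrable one_le_two
  rw [hV, hV, ← integral_esFun ((S.memLp_loss Kf).integrable one_le_two),
    ← integral_esFun ((S.memLp_loss Kc).integrable one_le_two), ← integral_const_mul,
    ← integral_sub (h1 _ _) ((h1 _ _).const_mul w)]
  refine integral_congr_ae (Eventually.of_forall fun ω => ?_)
  simp only [esPair, loss_eq hKf, loss_eq hKc]

/-- The error of the expected shortfall iterates splits into noise and drift. -/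
theorem Setup.mul_es_error (S : Setup μ φ Y Z α V ξs Ys Zs θ₀ A c lam C δ B)
    (hV : ∀ K, V K = objective μ α (loss μ φ Y Z K)) (w : ℝ) {Kf Kc : ℕ}
    (hKf : 1 ≤ Kf) (hKc : 1 ≤ Kc) (ℓ n : ℕ) (ω : Ω) :
    n * (((levelIterate α γ φ Ys Zs ℓ Kf (θ₀ ℓ true) n ω).2 - V Kf (ξs Kf)) -
      w * ((levelIterate α γ φ Ys Zs ℓ Kc (θ₀ ℓ false) n ω).2 - V Kc (ξs Kc))) =
      ∑ k ∈ Finset.range n, esNoise μ Y Z α γ φ Ys Zs θ₀ ξs w Kf Kc ℓ k ω +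
      ∑ k ∈ Finset.range n, esDrift α γ φ Ys Zs θ₀ V ξs w Kf Kc ℓ k ω := by
  have h1 : ∀ K j, n * (levelIterate α γ φ Ys Zs ℓ K (θ₀ ℓ j) n ω).2 =
      ∑ k ∈ Finset.range n, esFun α (ξs K + err α γ φ Ys Zs θ₀ ξs ℓ K j k ω)
        (innerMean φ K (sample Ys Zs ℓ k ω).1 (sample Ys Zs ℓ k ω).2) := fun K j => by
    rw [levelIterate, mul_iterate_snd]
    refine Finset.sum_congr rfl fun k _ => ?_
    rw [err, add_sub_cancel]; rfl
  have h2 : ∀ k, esNoise μ Y Z α γ φ Ys Zs θ₀ ξs w Kf Kc ℓ k ω =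
      esFun α (ξs Kf + err α γ φ Ys Zs θ₀ ξs ℓ Kf true k ω)
        (innerMean φ Kf (sample Ys Zs ℓ k ω).1 (sample Ys Zs ℓ k ω).2) -
      w * esFun α (ξs Kc + err α γ φ Ys Zs θ₀ ξs ℓ Kc false k ω)
        (innerMean φ Kc (sample Ys Zs ℓ k ω).1 (sample Ys Zs ℓ k ω).2) -
      (V Kf (ξs Kf + err α γ φ Ys Zs θ₀ ξs ℓ Kf true k ω) -
        w * V Kc (ξs Kc + err α γ φ Ys Zs θ₀ ξs ℓ Kc false k ω)) := fun k => by
    rw [esNoise, fluctuation, S.mean_esPair hV w hKf hKc]; rfl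
  rw [mul_sub, mul_sub, mul_left_comm, mul_sub, h1, h1, ← Finset.sum_add_distrib]
  simp_rw [h2, esDrift]
  have e : ∀ a b x y u v : ℝ, a - w * b - (x - w * y) + (x - u - w * (y - v)) =
      (a - w * b) - (u - w * v) := fun a b x y u v => by ring
  simp_rw [e]
  rw [Finset.sum_sub_distrib, Finset.sum_sub_distrib, Finset.sum_const, Finset.card_range,
    ← Finset.mul_sum, nsmul_eq_mul]
  ring

/-- Orthogonal increments, the `k`-th of variance `O(γ_k + r)`; the sum of the `γ_k` gives the
logarithm. -/
theorem Setup.esNoise_sum_sq_le {γ₁ : ℝ} (S : Setup μ φ Y Z α V ξs Ys Zs θ₀ A c lam C δ B)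
    (hγ₁ : 0 < γ₁) (h1 : 2 < c * γ₁) :
    ∃ D : ℝ, 0 < D ∧ ∀ (Kf Kc ℓ : ℕ) (w r : ℝ), 1 ≤ Kf → 1 ≤ Kc → WeightRate w r Kf Kc → ∀ n,
      ∫ ω, (∑ k ∈ Finset.range n,
        esNoise μ Y Z α (stepSize γ₁ 1) φ Ys Zs θ₀ ξs w Kf Kc ℓ k ω) ^ 2 ∂μ ≤
        D * (2 + Real.log n + n * r) := by
  obtain ⟨D, hD0, hD⟩ := S.moments (γ₁ := γ₁) (β := 1) (by simp) hγ₁ fun _ => h1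
  obtain ⟨E, hE0, hE⟩ := S.integral_esPair_sq_le
  refine ⟨E * (2 * D * γ₁ + 1), by positivity, fun Kf Kc ℓ w r hKf hKc hw n => ?_⟩
  have hr0 : 0 < r := by
    have hbf := bias_pos hKf
    have hbc := bias_pos hKc
    rcases hw with ⟨-, rfl⟩ | ⟨-, rfl⟩ <;> positivity
  have hstep : ∀ k, stepSize γ₁ 1 (max k 1) = γ₁ * ((max k 1 : ℕ) : ℝ)⁻¹ := fun k => by
    rw [stepSize, Real.rpow_neg_one]
  rw [integral_sum_sq (fun k => S.memLp_esNoise w hKf hKc ℓ k) fun i j hij =>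
    S.esNoise_orthogonal (fun _ => w) (Kf := fun _ => Kf) (Kc := fun _ => Kc)
      (fun _ => hKf) (fun _ => hKc) ℓ i ℓ j (by simpa)]
  have h2 : ∀ k, ∫ ω, esNoise μ Y Z α (stepSize γ₁ 1) φ Ys Zs θ₀ ξs w Kf Kc ℓ k ω ^ 2 ∂μ ≤
      E * (2 * D * γ₁ * ((max k 1 : ℕ) : ℝ)⁻¹ + r) := fun k => by
    refine (S.sim.integral_fluctuation_sq_le S.generic
      (S.measurable_errPair _ _ fun i hi => by simp [hi.ne])
      (S.measurable_esPair w Kf Kc) (fun a => (S.memLp_esPair w hKf hKc a).integrable_sq)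
      (S.memLp_esPair_sample w hKf hKc ℓ k)).trans ?_
    have i1 := (S.memLp_err (γ := stepSize γ₁ 1) ℓ Kf true k).integrable_sq
    have i2 := (S.memLp_err (γ := stepSize γ₁ 1) ℓ Kc false k).integrable_sq
    have i12 : Integrable (fun ω => err α (stepSize γ₁ 1) φ Ys Zs θ₀ ξs ℓ Kf true k ω ^ 2 +
      err α (stepSize γ₁ 1) φ Ys Zs θ₀ ξs ℓ Kc false k ω ^ 2) μ := i1.add i2
    calc _ ≤ ∫ ω, E * (err α (stepSize γ₁ 1) φ Ys Zs θ₀ ξs ℓ Kf true k ω ^ 2 +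
          err α (stepSize γ₁ 1) φ Ys Zs θ₀ ξs ℓ Kc false k ω ^ 2 + r) ∂μ := by
          refine integral_mono (S.sim.integrable_sample S.generic
            (Ψ := fun p => esPair φ ξs α w Kf Kc p ^ 2)
            (S.measurable_errPair _ _ fun i hi => by simp [hi.ne])
            ((S.measurable_esPair w Kf Kc).pow_const 2)
            (S.memLp_esPair_sample w hKf hKc ℓ k).integrable_sq)
            ((i12.add (integrable_const _)).const_mul _) fun ω => ?_
          exact hE Kf Kc w r hKf hKc hw _
      _ = E * (∫ ω, err α (stepSize γ₁ 1) φ Ys Zs θ₀ ξs ℓ Kf true k ω ^ 2 ∂μ +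
          ∫ ω, err α (stepSize γ₁ 1) φ Ys Zs θ₀ ξs ℓ Kc false k ω ^ 2 ∂μ + r) := by
          rw [integral_const_mul, integral_add i12 (integrable_const _), integral_add i1 i2]
          simp
      _ ≤ E * (D * (γ₁ * ((max k 1 : ℕ) : ℝ)⁻¹) + D * (γ₁ * ((max k 1 : ℕ) : ℝ)⁻¹) + r) := by
          have h3 := (hD ℓ Kf true hKf k).2.1
          have h4 := (hD ℓ Kc false hKc k).2.1
          rw [hstep] at h3 h4
          gcongr
      _ = _ := by ring
  calc _ ≤ ∑ k ∈ Finset.range n, E * (2 * D * γ₁ * ((max k 1 : ℕ) : ℝ)⁻¹ + r) :=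
        Finset.sum_le_sum fun k _ => h2 k
    _ = E * (2 * D * γ₁ * ∑ k ∈ Finset.range n, ((max k 1 : ℕ) : ℝ)⁻¹ + n * r) := by
        rw [← Finset.mul_sum, Finset.sum_add_distrib, ← Finset.mul_sum]; simp
    _ ≤ E * (2 * D * γ₁ * (2 + Real.log n) + n * r) := by
        have := sum_inv_max_le n
        gcongr
    _ ≤ _ := by
        rw [mul_assoc E (2 * D * γ₁ + 1)]
        refine mul_le_mul_of_nonneg_left ?_ hE0.le
        have h5 : 0 ≤ Real.log n := Real.log_natCast_nonneg n
        have h6 : 0 ≤ 2 * D * γ₁ * (n * r) := by positivity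
        linarith

theorem Setup.memLp_esDrift (S : Setup μ φ Y Z α V ξs Ys Zs θ₀ A c lam C δ B) (w : ℝ)
    (Kf Kc ℓ n : ℕ) : MemLp (esDrift α γ φ Ys Zs θ₀ V ξs w Kf Kc ℓ n) 2 μ := by
  have key : ∀ K j, MemLp (fun ω => V K (ξs K + err α γ φ Ys Zs θ₀ ξs ℓ K j n ω) - V K (ξs K))
      2 μ := fun K j => by
    refine ((S.memLp_err_sq (γ := γ) ℓ K j n).const_mul (A / 2)).mono' ?_
      (Eventually.of_forall fun ω => ?_)
    · exact ((S.reg.potential K).measurable.comp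
        ((S.measurable_err ℓ K j n).const_add _)).aestronglyMeasurable
    · rw [Real.norm_of_nonneg ((S.reg.potential K).nonneg _)]
      exact S.reg.potential_le_sq K _
  exact (key Kf true).sub ((key Kc false).const_mul w)

/-- The drift is second order in the error, since `V - V(ξ⋆) ≤ (A/2) err²`. Its `L²` norm is
`O(γ_k)` by the fourth moments, and the triangle inequality adds up the `γ_k`. -/
theorem Setup.esDrift_sum_le {γ₁ : ℝ} (S : Setup μ φ Y Z α V ξs Ys Zs θ₀ A c lam C δ B)
    (hγ₁ : 0 < γ₁) (h1 : 2 < c * γ₁) :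
    ∃ D : ℝ, 0 < D ∧ ∀ (Kf Kc ℓ : ℕ) (w : ℝ), 1 ≤ Kf → 1 ≤ Kc → |w| ≤ 1 → ∀ n,
      eLpNorm (fun ω => ∑ k ∈ Finset.range n,
        esDrift α (stepSize γ₁ 1) φ Ys Zs θ₀ V ξs w Kf Kc ℓ k ω) 2 μ ≤
        ENNReal.ofReal (D * (2 + Real.log n)) := by
  obtain ⟨D, hD0, hD⟩ := S.moments (γ₁ := γ₁) (β := 1) (by simp) hγ₁ fun _ => h1
  have hA := S.reg.A_pos
  refine ⟨A * (D + 1) * γ₁, by positivity, fun Kf Kc ℓ w hKf hKc hw n => ?_⟩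
  have hstep : ∀ k, stepSize γ₁ 1 (max k 1) = γ₁ * ((max k 1 : ℕ) : ℝ)⁻¹ := fun k => by
    rw [stepSize, Real.rpow_neg_one]
  have h2 : ∀ k ∈ Finset.range n,
      eLpNorm (esDrift α (stepSize γ₁ 1) φ Ys Zs θ₀ V ξs w Kf Kc ℓ k) 2 μ ≤
      ENNReal.ofReal (A * (D + 1) * (γ₁ * ((max k 1 : ℕ) : ℝ)⁻¹)) := fun k _ => by
    have hT : 0 < γ₁ * ((max k 1 : ℕ) : ℝ)⁻¹ := by positivity
    refine eLpNorm_two_le (S.memLp_esDrift w Kf Kc ℓ k) (by positivity) ?_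
    have i1 := (S.integrable_err_pow_four (γ := stepSize γ₁ 1) ℓ Kf true k).const_mul (A ^ 2 / 2)
    have i2 := (S.integrable_err_pow_four (γ := stepSize γ₁ 1) ℓ Kc false k).const_mul (A ^ 2 / 2)
    have h3 := (hD ℓ Kf true hKf k).1
    have h4 := (hD ℓ Kc false hKc k).1
    rw [hstep] at h3 h4
    calc _ ≤ ∫ ω, (A ^ 2 / 2 * err α (stepSize γ₁ 1) φ Ys Zs θ₀ ξs ℓ Kf true k ω ^ 4 +
          A ^ 2 / 2 * err α (stepSize γ₁ 1) φ Ys Zs θ₀ ξs ℓ Kc false k ω ^ 4) ∂μ := by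
          refine integral_mono (S.memLp_esDrift w Kf Kc ℓ k).integrable_sq (i1.add i2) fun ω => ?_
          simp only [esDrift]
          have key : ∀ K j, (V K (ξs K + err α (stepSize γ₁ 1) φ Ys Zs θ₀ ξs ℓ K j k ω) -
              V K (ξs K)) ^ 2 ≤ A ^ 2 / 4 * err α (stepSize γ₁ 1) φ Ys Zs θ₀ ξs ℓ K j k ω ^ 4 :=
            fun K j => by
            have h5 := S.reg.potential_le_sq K (err α (stepSize γ₁ 1) φ Ys Zs θ₀ ξs ℓ K j k ω)
            refine (pow_le_pow_left₀ ((S.reg.potential K).nonneg _) h5 2).trans (le_of_eq ?_)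
            ring
          have k1 := key Kf true
          have k2 := key Kc false
          generalize V Kf (ξs Kf + err α (stepSize γ₁ 1) φ Ys Zs θ₀ ξs ℓ Kf true k ω) -
              V Kf (ξs Kf) = x at k1 ⊢
          generalize V Kc (ξs Kc + err α (stepSize γ₁ 1) φ Ys Zs θ₀ ξs ℓ Kc false k ω) -
              V Kc (ξs Kc) = y at k2 ⊢
          have hw2 : w ^ 2 ≤ 1 := by rw [← sq_abs]; exact pow_le_one₀ (abs_nonneg _) hw
          nlinarith [sq_nonneg (x + w * y), mul_le_mul_of_nonneg_right hw2 (sq_nonneg y)]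
      _ = A ^ 2 / 2 * ∫ ω, err α (stepSize γ₁ 1) φ Ys Zs θ₀ ξs ℓ Kf true k ω ^ 4 ∂μ +
          A ^ 2 / 2 * ∫ ω, err α (stepSize γ₁ 1) φ Ys Zs θ₀ ξs ℓ Kc false k ω ^ 4 ∂μ := by
          rw [integral_add i1 i2, integral_const_mul, integral_const_mul]
      _ ≤ A ^ 2 / 2 * (D * (γ₁ * ((max k 1 : ℕ) : ℝ)⁻¹) ^ 2) +
          A ^ 2 / 2 * (D * (γ₁ * ((max k 1 : ℕ) : ℝ)⁻¹) ^ 2) := by gcongr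
      _ = A ^ 2 * D * (γ₁ * ((max k 1 : ℕ) : ℝ)⁻¹) ^ 2 := by ring
      _ ≤ A ^ 2 * (D + 1) ^ 2 * (γ₁ * ((max k 1 : ℕ) : ℝ)⁻¹) ^ 2 := by
          gcongr
          nlinarith
      _ = _ := by ring
  refine (eLpNorm_sum_le_ofReal (fun k _ => (S.memLp_esDrift w Kf Kc ℓ k).1)
    (fun k _ => by positivity) h2).trans (ENNReal.ofReal_le_ofReal ?_)
  rw [← Finset.mul_sum, ← Finset.mul_sum, ← mul_assoc]
  exact mul_le_mul_of_nonneg_left (sum_inv_max_le n) (by positivity)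

end LevelES

/-! ### The multilevel error as a sum over levels -/

section Multilevel

theorem sum_Icc_one_eq {G : Type*} [AddCommMonoid G] (f : ℕ → G) (L : ℕ) :
    ∑ ℓ ∈ Finset.Icc 1 L, f ℓ = ∑ ℓ ∈ Finset.range L, f (ℓ + 1) := by
  induction L with
  | zero => simp
  | succ L ih => rw [Finset.sum_range_succ, ← ih, Finset.sum_Icc_succ_top (by omega)]

theorem sum_Icc_one_le {f : ℕ → ℝ} (hf : ∀ ℓ, 0 ≤ f ℓ) (L : ℕ) :
    ∑ ℓ ∈ Finset.Icc 1 L, f ℓ ≤ ∑ ℓ ∈ Finset.range (L + 1), f ℓ := by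
  rw [sum_Icc_one_eq, Finset.sum_range_succ']
  linarith [hf 0]

variable {Ω : Type*} {d q : ℕ} [MeasurableSpace Ω] {μ : Measure Ω} [IsProbabilityMeasure μ]
  {φ : (Fin d → ℝ) → (Fin q → ℝ) → ℝ}
  {Y : Ω → Fin d → ℝ} {Z : ℕ → Ω → Fin q → ℝ} {α : ℝ} {V : ℕ → ℝ → ℝ} {ξs : ℕ → ℝ}
  {Ys : ℕ → ℕ → Ω → Fin d → ℝ} {Zs : ℕ → ℕ → ℕ → Ω → Fin q → ℝ} {θ₀ : ℕ → Bool → Ω → ℝ × ℝ}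
  {A c lam C δ B : ℝ} {γ : ℕ → ℝ}

/-- The weight of the coarse scheme at level `ℓ`. -/
def levelWeight (ℓ : ℕ) : ℝ := if ℓ = 0 then 0 else 1

/-- The centring constants telescope. Weight `0` removes the coarse scheme at level `0`, where the
natural subtraction `ℓ - 1` is `0`. -/
theorem estimator_snd_sub (v : ℕ → ℝ) (K₀ M L : ℕ) (N : ℕ → ℕ) (ω : Ω) :
    (estimator α γ φ Ys Zs θ₀ K₀ M L N ω).2 - v (K₀ * M ^ L) =
      ∑ ℓ ∈ Finset.range (L + 1),
        (((levelIterate α γ φ Ys Zs ℓ (K₀ * M ^ ℓ) (θ₀ ℓ true) (N ℓ) ω).2 - v (K₀ * M ^ ℓ)) -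
          levelWeight ℓ *
          ((levelIterate α γ φ Ys Zs ℓ (K₀ * M ^ (ℓ - 1)) (θ₀ ℓ false) (N ℓ) ω).2 -
            v (K₀ * M ^ (ℓ - 1)))) := by
  rw [estimator, Prod.snd_add, Prod.snd_sum, sum_Icc_one_eq, Finset.sum_range_succ']
  simp only [levelWeight, Nat.add_sub_cancel, Prod.snd_sub, Nat.add_eq_zero_iff, one_ne_zero,
    and_false, if_false, one_mul, if_true, zero_mul, sub_zero, pow_zero, mul_one]
  have h1 : ∑ ℓ ∈ Finset.range L, (v (K₀ * M ^ (ℓ + 1)) - v (K₀ * M ^ ℓ)) =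
      v (K₀ * M ^ L) - v (K₀ * M ^ 0) := Finset.sum_range_sub (fun ℓ => v (K₀ * M ^ ℓ)) L
  rw [pow_zero, mul_one] at h1
  simp only [Finset.sum_sub_distrib] at h1 ⊢
  linarith

theorem estimator_fst_sub (K₀ M L : ℕ) (N : ℕ → ℕ) (ω : Ω) :
    (estimator α γ φ Ys Zs θ₀ K₀ M L N ω).1 - ξs (K₀ * M ^ L) =
      err α γ φ Ys Zs θ₀ ξs 0 K₀ true (N 0) ω +
      (∑ ℓ ∈ Finset.Icc 1 L,
        noisePart μ Y Z α γ φ Ys Zs θ₀ ξs lam (K₀ * M ^ ℓ) (K₀ * M ^ (ℓ - 1)) ℓ (N ℓ) ω +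
      ∑ ℓ ∈ Finset.Icc 1 L,
        biasPart μ Y Z α γ φ Ys Zs θ₀ ξs lam (K₀ * M ^ ℓ) (K₀ * M ^ (ℓ - 1)) ℓ (N ℓ) ω) := by
  rw [← Finset.sum_add_distrib, estimator, Prod.fst_add, Prod.fst_sum]
  have e : ∀ ℓ, noisePart μ Y Z α γ φ Ys Zs θ₀ ξs lam (K₀ * M ^ ℓ) (K₀ * M ^ (ℓ - 1)) ℓ (N ℓ) ω +
      biasPart μ Y Z α γ φ Ys Zs θ₀ ξs lam (K₀ * M ^ ℓ) (K₀ * M ^ (ℓ - 1)) ℓ (N ℓ) ω =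
      ((levelIterate α γ φ Ys Zs ℓ (K₀ * M ^ ℓ) (θ₀ ℓ true) (N ℓ) ω).1 -
      (levelIterate α γ φ Ys Zs ℓ (K₀ * M ^ (ℓ - 1)) (θ₀ ℓ false) (N ℓ) ω).1) -
      (ξs (K₀ * M ^ ℓ) - ξs (K₀ * M ^ (ℓ - 1))) := fun ℓ => by
    simp only [biasPart, err]; ring
  simp_rw [e]
  rw [Finset.sum_sub_distrib, sum_Icc_one_eq (fun ℓ => ξs (K₀ * M ^ ℓ) - ξs (K₀ * M ^ (ℓ - 1)))]
  simp only [Nat.add_sub_cancel, Prod.fst_sub, err]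
  have h1 : ∑ ℓ ∈ Finset.range L, (ξs (K₀ * M ^ (ℓ + 1)) - ξs (K₀ * M ^ ℓ)) =
      ξs (K₀ * M ^ L) - ξs (K₀ * M ^ 0) := Finset.sum_range_sub (fun ℓ => ξs (K₀ * M ^ ℓ)) L
  rw [pow_zero, mul_one] at h1
  rw [h1]
  ring

/-- Noises of different levels are orthogonal, so their variances add under the square root; drifts
are added by the triangle inequality. -/
theorem Setup.es_error_le {γ₁ : ℝ} (S : Setup μ φ Y Z α V ξs Ys Zs θ₀ A c lam C δ B)
    (hV : ∀ K, V K = objective μ α (loss μ φ Y Z K)) (hγ₁ : 0 < γ₁) (h1 : 2 < c * γ₁) {K₀ M : ℕ}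
    (hK₀ : 1 ≤ K₀) (hM : 1 ≤ M) :
    ∃ D : ℝ, 0 < D ∧ ∀ (L : ℕ) (N : ℕ → ℕ), (∀ ℓ, 1 ≤ N ℓ) →
      eLpNorm (fun ω => (estimator α (stepSize γ₁ 1) φ Ys Zs θ₀ K₀ M L N ω).2 -
        V (K₀ * M ^ L) (ξs (K₀ * M ^ L))) 2 μ ≤
      ENNReal.ofReal (√(D * ∑ ℓ ∈ Finset.range (L + 1),
          ((2 + Real.log (N ℓ)) / (N ℓ : ℝ) ^ 2 + levelBias K₀ M ℓ / N ℓ)) +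
        D * ∑ ℓ ∈ Finset.range (L + 1), (2 + Real.log (N ℓ)) / N ℓ) := by
  obtain ⟨D₁, hD₁0, hD₁⟩ := S.esNoise_sum_sq_le hγ₁ h1
  obtain ⟨D₂, hD₂0, hD₂⟩ := S.esDrift_sum_le hγ₁ h1
  have hM0 : (0 : ℝ) < M := by exact_mod_cast hM
  have hK0 : (0 : ℝ) < K₀ := by exact_mod_cast hK₀
  obtain ⟨R, hR, hR1⟩ : ∃ R : ℝ, R = K₀ + M + 1 ∧ 1 ≤ R := ⟨_, rfl, by linarith⟩
  refine ⟨D₁ * R + D₂, by positivity, fun L N hN => ?_⟩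
  have hKf : ∀ ℓ, 1 ≤ K₀ * M ^ ℓ := fun ℓ => Nat.mul_pos hK₀ (Nat.pow_pos hM)
  have hKc : ∀ ℓ, 1 ≤ K₀ * M ^ (ℓ - 1) := fun ℓ => hKf _
  have hN0 : ∀ ℓ, (1 : ℝ) ≤ N ℓ := fun ℓ => by exact_mod_cast hN ℓ
  have hlog : ∀ ℓ, 0 ≤ Real.log (N ℓ) := fun ℓ => Real.log_natCast_nonneg _
  have hlb : ∀ ℓ, 0 < levelBias K₀ M ℓ := levelBias_pos hK₀ hM
  -- the noise of a level
  obtain ⟨P, hP⟩ : ∃ P : ℕ → Ω → ℝ, P = fun ℓ ω => (N ℓ : ℝ)⁻¹ * ∑ k ∈ Finset.range (N ℓ),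
    esNoise μ Y Z α (stepSize γ₁ 1) φ Ys Zs θ₀ ξs (levelWeight ℓ) (K₀ * M ^ ℓ)
      (K₀ * M ^ (ℓ - 1)) ℓ k ω := ⟨_, rfl⟩
  obtain ⟨Q, hQ⟩ : ∃ Q : ℕ → Ω → ℝ, Q = fun ℓ ω => (N ℓ : ℝ)⁻¹ * ∑ k ∈ Finset.range (N ℓ),
    esDrift α (stepSize γ₁ 1) φ Ys Zs θ₀ V ξs (levelWeight ℓ) (K₀ * M ^ ℓ)
      (K₀ * M ^ (ℓ - 1)) ℓ k ω := ⟨_, rfl⟩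
  have hPm : ∀ ℓ, MemLp (P ℓ) 2 μ := fun ℓ => by
    rw [hP]
    exact (memLp_finsetSum _ fun k _ => S.memLp_esNoise _ (hKf ℓ) (hKc ℓ) ℓ k).const_mul _
  have hQm : ∀ ℓ, MemLp (Q ℓ) 2 μ := fun ℓ => by
    rw [hQ]
    exact (memLp_finsetSum _ fun k _ => S.memLp_esDrift _ _ _ ℓ k).const_mul _
  have hdec : (fun ω => (estimator α (stepSize γ₁ 1) φ Ys Zs θ₀ K₀ M L N ω).2 -
        V (K₀ * M ^ L) (ξs (K₀ * M ^ L))) =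
      fun ω => ∑ ℓ ∈ Finset.range (L + 1), P ℓ ω + ∑ ℓ ∈ Finset.range (L + 1), Q ℓ ω := by
    funext ω
    rw [estimator_snd_sub (fun K => V K (ξs K)), ← Finset.sum_add_distrib]
    refine Finset.sum_congr rfl fun ℓ _ => ?_
    rw [hP, hQ]
    simp only
    rw [← mul_add, ← S.mul_es_error hV _ (hKf ℓ) (hKc ℓ), ← mul_assoc,
      inv_mul_cancel₀ (by linarith [hN0 ℓ]), one_mul]
  have horth : ∀ i j, i ≠ j → ∫ ω, P i ω * P j ω ∂μ = 0 := fun i j hij => by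
    have h2 := integral_linRec_mul_linRec (a := fun _ _ => 1) (b := fun _ _ => 1)
      (e := fun ℓ n => esNoise μ Y Z α (stepSize γ₁ 1) φ Ys Zs θ₀ ξs (levelWeight ℓ) (K₀ * M ^ ℓ)
        (K₀ * M ^ (ℓ - 1)) ℓ n) (fun ℓ n => S.memLp_esNoise _ (hKf ℓ) (hKc ℓ) ℓ n)
      (S.esNoise_orthogonal levelWeight hKf hKc) hij (N i) (N j)
    simp_rw [linRec_one_eq_sum] at h2
    rw [hP]
    have e : ∀ a b x y : ℝ, a * x * (b * y) = a * b * (x * y) := fun a b x y => by ring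
    simp_rw [e]
    rw [integral_const_mul, h2, mul_zero]
  have hPsq : ∀ ℓ, ∫ ω, P ℓ ω ^ 2 ∂μ ≤
      D₁ * R * ((2 + Real.log (N ℓ)) / (N ℓ : ℝ) ^ 2 + levelBias K₀ M ℓ / N ℓ) := fun ℓ => by
    -- At level `0` the order `1` is `K₀ h_0`; elsewhere the two biases sum to `(1 + M) h_ℓ`.
    obtain ⟨r, hr, hrR⟩ : ∃ r, WeightRate (levelWeight ℓ) r (K₀ * M ^ ℓ) (K₀ * M ^ (ℓ - 1)) ∧
        r ≤ R * levelBias K₀ M ℓ := by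
      rcases ℓ with _ | ℓ
      · refine ⟨1, Or.inl ⟨by simp [levelWeight], rfl⟩, ?_⟩
        have : (K₀ : ℝ) * levelBias K₀ M 0 = 1 := by
          rw [levelBias_eq, bias]; field_simp
        have := hlb 0
        rw [hR]; nlinarith
      · refine ⟨_, Or.inr ⟨by simp [levelWeight], rfl⟩, ?_⟩
        rw [Nat.add_sub_cancel]
        have h2 := levelBias_succ hM K₀ ℓ
        have h3 := hlb (ℓ + 1)
        change levelBias K₀ M (ℓ + 1) + levelBias K₀ M ℓ ≤ _
        rw [h2, hR]
        have : 0 ≤ (K₀ : ℝ) * levelBias K₀ M (ℓ + 1) := by positivity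
        linarith
    have h2 := hD₁ _ _ ℓ _ r (hKf ℓ) (hKc ℓ) hr (N ℓ)
    rw [hP]
    simp only [mul_pow]
    rw [integral_const_mul]
    have hn := hN0 ℓ
    have hn' : (0 : ℝ) < N ℓ := by linarith
    calc _ ≤ ((N ℓ : ℝ)⁻¹) ^ 2 * (D₁ * (2 + Real.log (N ℓ) + N ℓ * r)) := by gcongr
      _ ≤ ((N ℓ : ℝ)⁻¹) ^ 2 * (D₁ * (R * (2 + Real.log (N ℓ)) +
            N ℓ * (R * levelBias K₀ M ℓ))) := by
          have := hlog ℓ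
          gcongr
          nlinarith
      _ = _ := by field_simp
  have hsum0 : ∀ ℓ, 0 ≤ (2 + Real.log (N ℓ)) / (N ℓ : ℝ) ^ 2 + levelBias K₀ M ℓ / N ℓ :=
    fun ℓ => by
      have := hlog ℓ
      have := hlb ℓ
      have := hN0 ℓ
      positivity
  have hsum0' : 0 ≤ ∑ ℓ ∈ Finset.range (L + 1),
      ((2 + Real.log (N ℓ)) / (N ℓ : ℝ) ^ 2 + levelBias K₀ M ℓ / N ℓ) :=
    Finset.sum_nonneg fun ℓ _ => hsum0 ℓ
  have hsum1 : ∀ ℓ, 0 ≤ (2 + Real.log (N ℓ)) / N ℓ := fun ℓ => by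
    have := hlog ℓ
    have := hN0 ℓ
    positivity
  rw [hdec]
  refine eLpNorm_add_le_ofReal (memLp_finsetSum _ fun ℓ _ => hPm ℓ).1
    (memLp_finsetSum _ fun ℓ _ => hQm ℓ).1 (Real.sqrt_nonneg _)
    (mul_nonneg (by positivity) (Finset.sum_nonneg fun ℓ _ => hsum1 ℓ)) ?_ ?_
  · refine eLpNorm_two_le (memLp_finsetSum _ fun ℓ _ => hPm ℓ) (Real.sqrt_nonneg _) ?_
    rw [Real.sq_sqrt (by positivity), integral_sum_sq hPm horth]
    calc _ ≤ ∑ ℓ ∈ Finset.range (L + 1),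
          D₁ * R * ((2 + Real.log (N ℓ)) / (N ℓ : ℝ) ^ 2 + levelBias K₀ M ℓ / N ℓ) :=
          Finset.sum_le_sum fun ℓ _ => hPsq ℓ
      _ = D₁ * R * _ := (Finset.mul_sum _ _ _).symm
      _ ≤ _ := by
          refine mul_le_mul_of_nonneg_right ?_ hsum0'
          linarith
  · have h2 : ∀ ℓ ∈ Finset.range (L + 1),
        eLpNorm (Q ℓ) 2 μ ≤ ENNReal.ofReal (D₂ * ((2 + Real.log (N ℓ)) / N ℓ)) := fun ℓ _ => by
      have hw : |levelWeight ℓ| ≤ 1 := by unfold levelWeight; split_ifs <;> simp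
      have h3 := hD₂ _ _ ℓ _ (hKf ℓ) (hKc ℓ) hw (N ℓ)
      rw [hQ]
      have hn : (0 : ℝ) < N ℓ := by linarith [hN0 ℓ]
      have h4 := eLpNorm_const_smul (N ℓ : ℝ)⁻¹ (fun ω => ∑ k ∈ Finset.range (N ℓ),
        esDrift α (stepSize γ₁ 1) φ Ys Zs θ₀ V ξs (levelWeight ℓ) (K₀ * M ^ ℓ)
          (K₀ * M ^ (ℓ - 1)) ℓ k ω) 2 μ
      refine h4.le.trans ?_
      rw [Real.enorm_of_nonneg (by positivity)]
      refine (mul_le_mul_right h3 _).trans ?_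
      rw [← ENNReal.ofReal_mul (by positivity)]
      exact ENNReal.ofReal_le_ofReal (le_of_eq (by field_simp))
    refine (eLpNorm_sum_le_ofReal (fun ℓ _ => (hQm ℓ).1)
      (fun ℓ _ => mul_nonneg hD₂0.le (hsum1 ℓ)) h2).trans (ENNReal.ofReal_le_ofReal ?_)
    rw [← Finset.mul_sum]
    refine mul_le_mul_of_nonneg_right ?_ (Finset.sum_nonneg fun ℓ _ => hsum1 ℓ)
    linarith [show 0 < D₁ * R by positivity]

/-- The three terms are the level `0` error, the orthogonal noise parts, whose variances add, and
the bias parts, added by the triangle inequality. -/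
theorem Setup.var_error_le {γ₁ β : ℝ} (S : Setup μ φ Y Z α V ξs Ys Zs θ₀ A c lam C δ B)
    (hβ : β ∈ Ioc (0 : ℝ) 1) (hγ₁ : 0 < γ₁) (h1 : β = 1 → 2 < c * γ₁) {s : Scenario} {K₀ M : ℕ}
    (hK₀ : 1 ≤ K₀) (hM : 1 ≤ M) (hs : s.Holds μ φ Y Z K₀ M) (hv : s.Valid K₀) :
    ∃ D : ℝ, 0 < D ∧ ∀ (L : ℕ) (N : ℕ → ℕ), (∀ ℓ, 1 ≤ N ℓ) →
      eLpNorm (fun ω => (estimator α (stepSize γ₁ β) φ Ys Zs θ₀ K₀ M L N ω).1 -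
        ξs (K₀ * M ^ L)) 2 μ ≤
      ENNReal.ofReal (√(D * stepSize γ₁ β (N 0)) +
        (√(D * ∑ ℓ ∈ Finset.range (L + 1), (stepSize γ₁ β (N ℓ) ^ (3 / 2 : ℝ) +
          s.rate (levelBias K₀ M ℓ) * stepSize γ₁ β (N ℓ))) +
        D * ∑ ℓ ∈ Finset.range (L + 1), (stepSize γ₁ β (N ℓ) +
          levelBias K₀ M ℓ ^ (1 / 4 + δ) * √(stepSize γ₁ β (N ℓ))))) := by
  obtain ⟨D₁, hD₁0, hD₁⟩ := S.moments hβ hγ₁ h1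
  obtain ⟨D₂, hD₂0, hD₂⟩ := S.noisePart_sq_le hβ hγ₁ h1
  obtain ⟨D₃, hD₃0, hD₃⟩ := S.biasPart_sq_le hβ hγ₁ h1
  obtain ⟨D₄, hD₄0, hD₄⟩ := S.exists_rate hK₀ hM hs hv
  have hM0 : (0 : ℝ) < M := by exact_mod_cast hM
  have hl : 0 < Real.log 2 ^ (1 / 2 : ℝ) := by
    have := Real.log_pos one_lt_two
    positivity
  obtain ⟨R, hR, hR1⟩ : ∃ R : ℝ, R = D₄ + (1 + M) / Real.log 2 ^ (1 / 2 : ℝ) + 1 ∧ 1 ≤ R :=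
    ⟨_, rfl, by have : 0 < (1 + M) / Real.log 2 ^ (1 / 2 : ℝ) := by positivity
                linarith⟩
  obtain ⟨T, hT, hT1⟩ : ∃ T : ℝ, T = 1 + (M : ℝ) ^ (1 / 4 + δ) ∧ 1 ≤ T :=
    ⟨_, rfl, by have : 0 < (M : ℝ) ^ (1 / 4 + δ) := by positivity
                linarith⟩
  refine ⟨D₁ + D₂ * R + (D₃ + 1) * T, by positivity, fun L N hN => ?_⟩
  have hKf : ∀ ℓ, 1 ≤ K₀ * M ^ ℓ := fun ℓ => Nat.mul_pos hK₀ (Nat.pow_pos hM)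
  have hKc : ∀ ℓ, 1 ≤ K₀ * M ^ (ℓ - 1) := fun ℓ => hKf _
  have hlb : ∀ ℓ, 0 < levelBias K₀ M ℓ := levelBias_pos hK₀ hM
  have hr : ∀ ℓ, 0 < s.rate (levelBias K₀ M ℓ) := Scenario.rate_pos hK₀ hM hv
  have hγ : ∀ ℓ, 0 < stepSize γ₁ β (N ℓ) := fun ℓ => stepSize_pos hγ₁ β (hN ℓ)
  obtain ⟨P, hP⟩ : ∃ P : ℕ → Ω → ℝ, P = fun ℓ => noisePart μ Y Z α (stepSize γ₁ β) φ Ys Zs θ₀ ξs lam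
    (K₀ * M ^ ℓ) (K₀ * M ^ (ℓ - 1)) ℓ (N ℓ) := ⟨_, rfl⟩
  obtain ⟨Q, hQ⟩ : ∃ Q : ℕ → Ω → ℝ, Q = fun ℓ => biasPart μ Y Z α (stepSize γ₁ β) φ Ys Zs θ₀ ξs lam
    (K₀ * M ^ ℓ) (K₀ * M ^ (ℓ - 1)) ℓ (N ℓ) := ⟨_, rfl⟩
  have hPm : ∀ ℓ, MemLp (P ℓ) 2 μ := fun ℓ => hP ▸ S.memLp_noisePart _ _ _ _
  have hQm : ∀ ℓ, MemLp (Q ℓ) 2 μ := fun ℓ => hQ ▸ S.memLp_biasPart _ _ _ _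
  have horth : ∀ i j, i ≠ j → ∫ ω, P i ω * P j ω ∂μ = 0 := fun i j hij => by
    rw [hP]
    exact integral_linRec_mul_linRec
      (a := fun _ n => 1 - lam * stepSize γ₁ β (n + 1)) (b := fun _ n => -stepSize γ₁ β (n + 1))
      (e := fun ℓ n => noise μ Y Z α (stepSize γ₁ β) φ Ys Zs θ₀ ξs (H₁ α) (K₀ * M ^ ℓ)
        (K₀ * M ^ (ℓ - 1)) ℓ n) (fun ℓ n => S.memLp_noise _ _ ℓ n)
      (S.noise_orthogonal (fun ℓ => K₀ * M ^ ℓ) (fun ℓ => K₀ * M ^ (ℓ - 1))) hij (N i) (N j)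
  -- Only for `ℓ ≥ 1` is the coarse bias `M` times the fine one.
  have hbc : ∀ ℓ ∈ Finset.Icc 1 L,
      bias (K₀ * M ^ (ℓ - 1)) = M * levelBias K₀ M ℓ := fun ℓ hℓ => by
    have h2 := levelBias_succ hM K₀ (ℓ - 1)
    rwa [Nat.sub_add_cancel (Finset.mem_Icc.1 hℓ).1] at h2
  have hPsq : ∀ ℓ ∈ Finset.Icc 1 L, ∫ ω, P ℓ ω ^ 2 ∂μ ≤ D₂ * R *
      (stepSize γ₁ β (N ℓ) ^ (3 / 2 : ℝ) +
        s.rate (levelBias K₀ M ℓ) * stepSize γ₁ β (N ℓ)) := fun ℓ hℓ => by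
    have h2 := hD₄ (ℓ - 1) (ξs 0)
    rw [Nat.sub_add_cancel (Finset.mem_Icc.1 hℓ).1] at h2
    have h3 := hD₂ _ _ ℓ (hKf ℓ) (hKc ℓ) _ h2 (N ℓ) (hN ℓ)
    have h4 : levelBias K₀ M ℓ ≤ 1 / Real.log 2 ^ (1 / 2 : ℝ) * s.rate (levelBias K₀ M ℓ) := by
      rw [div_mul_eq_mul_div, one_mul, le_div_iff₀ hl, mul_comm]
      refine le_trans ?_ (Scenario.le_rate_levelBias hK₀ hM hv ℓ)
      refine mul_le_mul_of_nonneg_left ?_ hl.le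
      calc levelBias K₀ M ℓ = levelBias K₀ M ℓ ^ (1 : ℝ) := (Real.rpow_one _).symm
        _ ≤ _ := Real.rpow_le_rpow_of_exponent_ge (hlb ℓ) (levelBias_le_one _ _ _) (by norm_num)
    rw [hP]
    refine h3.trans ?_
    rw [hbc ℓ hℓ, mul_assoc D₂]
    refine mul_le_mul_of_nonneg_left ?_ hD₂0.le
    change _ + (_ + levelBias K₀ M ℓ + _) * _ ≤ _
    have h5 : D₄ * s.rate (levelBias K₀ M ℓ) + levelBias K₀ M ℓ + M * levelBias K₀ M ℓ ≤
        R * s.rate (levelBias K₀ M ℓ) := by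
      have h6 := mul_le_mul_of_nonneg_left h4 (show (0 : ℝ) ≤ 1 + M by positivity)
      have e : R * s.rate (levelBias K₀ M ℓ) = D₄ * s.rate (levelBias K₀ M ℓ) +
        (1 + M) * (1 / Real.log 2 ^ (1 / 2 : ℝ) * s.rate (levelBias K₀ M ℓ)) +
        s.rate (levelBias K₀ M ℓ) := by rw [hR]; ring
      linarith [hr ℓ]
    have h7 : 0 ≤ stepSize γ₁ β (N ℓ) ^ (3 / 2 : ℝ) := (Real.rpow_pos_of_pos (hγ ℓ) _).le
    have h8 := mul_le_mul_of_nonneg_right h5 (hγ ℓ).le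
    nlinarith
  have hsum1 : ∀ ℓ, 0 ≤ stepSize γ₁ β (N ℓ) ^ (3 / 2 : ℝ) +
        s.rate (levelBias K₀ M ℓ) * stepSize γ₁ β (N ℓ) := fun ℓ => by
    have := hr ℓ
    have := hγ ℓ
    positivity
  have hsum2 : ∀ ℓ, 0 ≤ stepSize γ₁ β (N ℓ) +
          levelBias K₀ M ℓ ^ (1 / 4 + δ) * √(stepSize γ₁ β (N ℓ)) := fun ℓ => by
    have := hlb ℓ
    have := hγ ℓ
    positivity
  have hD : (0 : ℝ) < D₂ * R := by positivity
  have hD' : (0 : ℝ) < (D₃ + 1) * T := by positivity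
  simp_rw [estimator_fst_sub (μ := μ) (Y := Y) (Z := Z) (lam := lam)]
  refine eLpNorm_add_le_ofReal (S.memLp_err _ _ _ _).1
    ((memLp_finsetSum _ fun ℓ _ => S.memLp_noisePart _ _ _ _).add
      (memLp_finsetSum _ fun ℓ _ => S.memLp_biasPart _ _ _ _)).1 (Real.sqrt_nonneg _)
    (add_nonneg (Real.sqrt_nonneg _)
      (mul_nonneg (by positivity) (Finset.sum_nonneg fun ℓ _ => hsum2 ℓ))) ?_ ?_
  · refine eLpNorm_two_le (S.memLp_err _ _ _ _) (Real.sqrt_nonneg _) ?_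
    rw [Real.sq_sqrt (mul_nonneg (by positivity) (hγ 0).le)]
    have h2 := (hD₁ 0 K₀ true hK₀ (N 0)).2.1
    rw [max_eq_left (hN 0)] at h2
    refine h2.trans (mul_le_mul_of_nonneg_right ?_ (hγ 0).le)
    linarith
  refine eLpNorm_add_le_ofReal (memLp_finsetSum _ fun ℓ _ => S.memLp_noisePart _ _ _ _).1
    (memLp_finsetSum _ fun ℓ _ => S.memLp_biasPart _ _ _ _).1 (Real.sqrt_nonneg _)
    (mul_nonneg (by positivity) (Finset.sum_nonneg fun ℓ _ => hsum2 ℓ)) ?_ ?_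
  · refine eLpNorm_two_le (memLp_finsetSum _ fun ℓ _ => S.memLp_noisePart _ _ _ _)
      (Real.sqrt_nonneg _) ?_
    have h2 := integral_sum_sq (s := Finset.Icc 1 L) hPm horth
    rw [Real.sq_sqrt (mul_nonneg (by positivity) (Finset.sum_nonneg fun ℓ _ => hsum1 ℓ))]
    rw [hP] at h2 hPsq
    refine h2.le.trans ((Finset.sum_le_sum hPsq).trans ?_)
    rw [← Finset.mul_sum]
    refine mul_le_mul ?_ (sum_Icc_one_le hsum1 L) (Finset.sum_nonneg fun ℓ _ => hsum1 ℓ)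
      (by positivity)
    linarith
  · have h2 : ∀ ℓ ∈ Finset.Icc 1 L, eLpNorm (Q ℓ) 2 μ ≤ ENNReal.ofReal ((D₃ + 1) * T *
        (stepSize γ₁ β (N ℓ) + levelBias K₀ M ℓ ^ (1 / 4 + δ) * √(stepSize γ₁ β (N ℓ)))) :=
        fun ℓ hℓ => by
      refine eLpNorm_two_le (hQm ℓ) (mul_nonneg hD'.le (hsum2 ℓ)) ?_
      have h3 := hD₃ _ _ ℓ (hKf ℓ) (hKc ℓ) (N ℓ) (hN ℓ)
      rw [hQ]
      refine h3.trans ?_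
      rw [hbc ℓ hℓ, Real.mul_rpow hM0.le (hlb ℓ).le]
      change D₃ * (_ + (levelBias K₀ M ℓ ^ (1 / 4 + δ) + _) ^ 2 * _) ≤ _
      have e : levelBias K₀ M ℓ ^ (1 / 4 + δ) + M ^ (1 / 4 + δ) * levelBias K₀ M ℓ ^ (1 / 4 + δ) =
        T * levelBias K₀ M ℓ ^ (1 / 4 + δ) := by rw [hT]; ring
      rw [e]
      have hx := hγ ℓ
      have hH : 0 < levelBias K₀ M ℓ ^ (1 / 4 + δ) := Real.rpow_pos_of_pos (hlb ℓ) _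
      have hsq := Real.sq_sqrt hx.le
      have hs0 := Real.sqrt_nonneg (stepSize γ₁ β (N ℓ))
      generalize levelBias K₀ M ℓ ^ (1 / 4 + δ) = H at hH
      generalize stepSize γ₁ β (N ℓ) = x at hx hsq hs0
      generalize √x = y at hsq hs0
      have h4 : D₃ ≤ (D₃ + 1) ^ 2 := by nlinarith
      have h5 : x ^ 2 + (T * H) ^ 2 * x ≤ T ^ 2 * (x + H * y) ^ 2 := by
        have h6 : 1 * x ^ 2 ≤ T ^ 2 * x ^ 2 :=
          mul_le_mul_of_nonneg_right (by nlinarith) (sq_nonneg x)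
        have h7 : 0 ≤ T ^ 2 * (2 * (x * (H * y))) := by positivity
        have e : T ^ 2 * (x + H * y) ^ 2 =
          T ^ 2 * x ^ 2 + T ^ 2 * (2 * (x * (H * y))) + (T * H) ^ 2 * y ^ 2 := by ring
        rw [e, hsq]
        linarith
      calc D₃ * (x ^ 2 + (T * H) ^ 2 * x) ≤ (D₃ + 1) ^ 2 * (T ^ 2 * (x + H * y) ^ 2) :=
            mul_le_mul h4 h5 (by positivity) (by positivity)
        _ = _ := by ring
    rw [hQ] at h2
    refine (eLpNorm_sum_le_ofReal (fun ℓ _ => (S.memLp_biasPart _ _ _ _).1)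
      (fun ℓ _ => mul_nonneg hD'.le (hsum2 ℓ)) h2).trans (ENNReal.ofReal_le_ofReal ?_)
    rw [← Finset.mul_sum]
    refine mul_le_mul ?_ (sum_Icc_one_le hsum2 L) (Finset.sum_nonneg fun ℓ _ => hsum2 ℓ)
      (by positivity)
    linarith

end Multilevel

/-! ### Geometric sums and the number of levels -/

section Levels

variable {K₀ M : ℕ}

theorem sum_pow_le {x : ℝ} (hx : 0 ≤ x) (hx1 : x < 1) (n : ℕ) :
    ∑ i ∈ Finset.range n, x ^ i ≤ (1 - x)⁻¹ := by
  rw [← tsum_geometric_of_lt_one hx hx1]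
  exact (summable_geometric_of_lt_one hx hx1).sum_le_tsum _ fun i _ => by positivity

theorem sum_pow_sub_le {x : ℝ} (hx : 0 ≤ x) (hx1 : x < 1) (L : ℕ) :
    ∑ ℓ ∈ Finset.range (L + 1), x ^ (L - ℓ) ≤ (1 - x)⁻¹ := by
  rw [Finset.sum_flip (fun i => x ^ i)]
  exact sum_pow_le hx hx1 _

theorem levelBias_eq_mul_pow (hM : 1 ≤ M) (K₀ : ℕ) {ℓ L : ℕ} (h : ℓ ≤ L) :
    levelBias K₀ M ℓ = levelBias K₀ M L * (M : ℝ) ^ (L - ℓ) := by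
  have : (M : ℝ) ≠ 0 := by positivity
  rw [levelBias_eq, levelBias_eq, mul_assoc]
  congr 1
  rw [inv_mul_eq_div, eq_div_iff (by positivity), inv_mul_eq_iff_eq_mul₀ (by positivity), ← pow_add,
    Nat.add_sub_cancel' h]

theorem levelBias_anti (hM : 1 ≤ M) (K₀ : ℕ) {ℓ L : ℕ} (h : ℓ ≤ L) :
    levelBias K₀ M L ≤ levelBias K₀ M ℓ := by
  rw [levelBias_eq_mul_pow hM K₀ h]
  have h1 : (1 : ℝ) ≤ (M : ℝ) ^ (L - ℓ) := one_le_pow₀ (by exact_mod_cast hM)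
  exact le_mul_of_one_le_right (inv_nonneg.2 (Nat.cast_nonneg _)) h1

theorem rpow_neg_lt_one (hM : 2 ≤ M) {a : ℝ} (ha : 0 < a) : (M : ℝ) ^ (-a) < 1 :=
  Real.rpow_lt_one_of_one_lt_of_neg (by exact_mod_cast hM) (by linarith)

theorem sum_levelBias_rpow_le (hM : 2 ≤ M) (K₀ : ℕ) {a : ℝ} (ha : 0 < a) (n : ℕ) :
    ∑ ℓ ∈ Finset.range n, levelBias K₀ M ℓ ^ a ≤ (1 - (M : ℝ) ^ (-a))⁻¹ := by
  have hM0 : (0 : ℝ) < M := by positivity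
  refine le_trans (Finset.sum_le_sum fun ℓ _ => ?_)
    (sum_pow_le (by positivity) (rpow_neg_lt_one hM ha) n)
  have hb : 0 ≤ bias K₀ := inv_nonneg.2 (Nat.cast_nonneg _)
  rw [levelBias_eq, Real.mul_rpow hb (by positivity),
    ← Real.rpow_natCast, ← Real.rpow_natCast, ← Real.rpow_neg hM0.le, ← Real.rpow_mul hM0.le,
    ← Real.rpow_mul hM0.le]
  rw [show -(ℓ : ℝ) * a = -a * ℓ by ring]
  exact mul_le_of_le_one_left (by positivity) (Real.rpow_le_one hb (bias_le_one _)
    ha.le)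

/-- The finest level dominates, the ratio being at most `1/2`. -/
theorem sum_inv_levelBias_le (hM : 2 ≤ M) (K₀ L : ℕ) :
    ∑ ℓ ∈ Finset.range (L + 1), (levelBias K₀ M ℓ)⁻¹ ≤ 2 * (levelBias K₀ M L)⁻¹ := by
  have hM0 : (0 : ℝ) < M := by positivity
  have h2 : (M : ℝ)⁻¹ ≤ 1 / 2 := by
    rw [one_div]; exact inv_anti₀ two_pos (by exact_mod_cast hM)
  calc ∑ ℓ ∈ Finset.range (L + 1), (levelBias K₀ M ℓ)⁻¹
      = ∑ ℓ ∈ Finset.range (L + 1), (levelBias K₀ M L)⁻¹ * (M : ℝ)⁻¹ ^ (L - ℓ) :=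
        Finset.sum_congr rfl fun ℓ hℓ => by
          rw [levelBias_eq_mul_pow (by omega) K₀ (Nat.lt_succ_iff.1 (Finset.mem_range.1 hℓ)),
            mul_inv, inv_pow]
    _ = (levelBias K₀ M L)⁻¹ * ∑ ℓ ∈ Finset.range (L + 1), (M : ℝ)⁻¹ ^ (L - ℓ) := by
        rw [Finset.mul_sum]
    _ ≤ (levelBias K₀ M L)⁻¹ * 2 := by
        refine mul_le_mul_of_nonneg_left ?_ (inv_nonneg.2 (inv_nonneg.2 (Nat.cast_nonneg _)))
        refine (sum_pow_sub_le (by positivity) (by linarith) L).trans ?_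
        refine inv_le_of_inv_le₀ two_pos ?_
        rw [← one_div]; linarith
    _ = _ := mul_comm _ _

variable {ε : ℝ}

theorem one_le_numLevels (hM : 2 ≤ M) (hε : ε ∈ Ioo 0 (bias K₀)) : 1 ≤ numLevels K₀ M ε := by
  rw [numLevels, Nat.one_le_ceil_iff]
  exact div_pos (Real.log_pos (by rw [lt_div_iff₀ hε.1]; linarith [hε.2]))
    (Real.log_pos (by exact_mod_cast hM))

theorem levelBias_numLevels_le (hM : 2 ≤ M) (hε : ε ∈ Ioo 0 (bias K₀)) :
    levelBias K₀ M (numLevels K₀ M ε) ≤ ε := by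
  have hM0 : (0 : ℝ) < M := by positivity
  have hl : 0 < Real.log M := Real.log_pos (by exact_mod_cast hM)
  have h1 : Real.log (bias K₀ / ε) / Real.log M ≤ numLevels K₀ M ε := Nat.le_ceil _
  have hb : 0 < bias K₀ := hε.1.trans hε.2
  rw [div_le_iff₀ hl, ← Real.log_pow, Real.log_le_log_iff (div_pos hb hε.1) (by positivity),
    div_le_iff₀ hε.1] at h1
  rw [levelBias_eq, ← div_eq_mul_inv, div_le_iff₀ (by positivity)]
  linarith

theorem numLevels_le (hM : 2 ≤ M) (hε : ε ∈ Ioo 0 (bias K₀)) :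
    (numLevels K₀ M ε : ℝ) ≤ Real.log (bias K₀ / ε) / Real.log M + 1 := by
  refine (Nat.ceil_lt_add_one ?_).le
  exact (div_pos (Real.log_pos (by rw [lt_div_iff₀ hε.1]; linarith [hε.2]))
    (Real.log_pos (by exact_mod_cast hM))).le

/-- The ceiling overshoots by less than one level, so `h_L` is within a factor `M` of `ε`. -/
theorem le_mul_levelBias_numLevels (hM : 2 ≤ M) (hε : ε ∈ Ioo 0 (bias K₀)) :
    ε ≤ M * levelBias K₀ M (numLevels K₀ M ε) := by
  have hM0 : (0 : ℝ) < M := by positivity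
  have hl : 0 < Real.log M := Real.log_pos (by exact_mod_cast hM)
  have h1 := numLevels_le hM hε
  have hb : 0 < bias K₀ := hε.1.trans hε.2
  rw [← sub_le_iff_le_add, le_div_iff₀ hl, sub_mul, one_mul, ← Real.log_pow,
    ← Real.log_div (by positivity) (by positivity), Real.log_le_log_iff (by positivity)
    (div_pos hb hε.1), div_le_div_iff₀ hM0 hε.1] at h1
  rw [levelBias_eq, ← mul_assoc, ← div_eq_mul_inv, le_div_iff₀ (by positivity)]
  linarith

theorem lt_one_of_lt_bias (hε : ε ∈ Ioo 0 (bias K₀)) : ε < 1 := hε.2.trans_le (bias_le_one _)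

/-- Since `h_L ≤ ε`, `-ln ε ≤ ln K₀ + L ln M`, and `L ≥ 1` absorbs `ln K₀`. -/
theorem neg_log_le_mul_numLevels (hK₀ : 1 ≤ K₀) (hM : 2 ≤ M) (hε : ε ∈ Ioo 0 (bias K₀)) :
    -Real.log ε ≤ (Real.log K₀ + Real.log M) * numLevels K₀ M ε := by
  have hp := levelBias_pos hK₀ (one_le_two.trans hM) (numLevels K₀ M ε)
  have h1 := Real.log_le_log hp (levelBias_numLevels_le hM hε)
  have hL : (1 : ℝ) ≤ numLevels K₀ M ε := by exact_mod_cast one_le_numLevels hM hε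
  have hK : 0 ≤ Real.log K₀ := Real.log_natCast_nonneg _
  rw [levelBias_eq, Real.log_mul (bias_pos hK₀).ne' (by positivity), bias, Real.log_inv,
    Real.log_inv, Real.log_pow] at h1
  nlinarith

end Levels

/-! ### Growth of the rates between levels -/

section RateGrowth

variable {K₀ M : ℕ} {s : Scenario}

/-- All powers involved are at most `1/2`, and the logarithm is larger at finer levels. Hence
`ϵ(h_ℓ)/h_ℓ` grows at least by the factor `√M` per level, which makes the finest level dominate the
cost. -/
theorem Scenario.rate_levelBias_le_sqrt_pow (hK₀ : 1 ≤ K₀) (hM : 1 ≤ M)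
    (hs : s.Valid K₀) {ℓ L : ℕ} (hℓ : ℓ ≤ L) :
    s.rate (levelBias K₀ M ℓ) ≤ √M ^ (L - ℓ) * s.rate (levelBias K₀ M L) := by
  have hb := levelBias_pos hK₀ hM L
  have hM1 : (1 : ℝ) ≤ M := by exact_mod_cast hM
  have e : √(M : ℝ) ^ (L - ℓ) = ((M : ℝ) ^ (L - ℓ)) ^ (1 / 2 : ℝ) := by
    rw [Real.sqrt_eq_rpow, ← Real.rpow_natCast, ← Real.rpow_natCast, ← Real.rpow_mul (by linarith),
      ← Real.rpow_mul (by linarith), mul_comm]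
  have hpow : ∀ ρ : ℝ, ρ ≤ 1 / 2 →
      levelBias K₀ M ℓ ^ ρ ≤ √M ^ (L - ℓ) * levelBias K₀ M L ^ ρ := fun ρ hρ => by
    rw [levelBias_eq_mul_pow hM K₀ hℓ, Real.mul_rpow hb.le (by positivity), mul_comm, e]
    gcongr
    exact one_le_pow₀ hM1
  cases s with
  | moment p =>
    have hp := hs.1 p rfl
    refine hpow _ ?_
    rw [div_le_div_iff₀ (by linarith) two_pos]; linarith
  | gaussian =>
    simp only [Scenario.rate]
    have h1 := hpow (1 / 2) le_rfl
    have h2 : |Real.log (levelBias K₀ M ℓ)| ≤ |Real.log (levelBias K₀ M L)| := by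
      have h0 := levelBias_pos hK₀ hM ℓ
      rw [abs_of_nonpos (Real.log_nonpos h0.le (levelBias_le_one _ _ _)),
        abs_of_nonpos (Real.log_nonpos hb.le (levelBias_le_one _ _ _)), neg_le_neg_iff]
      exact Real.log_le_log hb (levelBias_anti hM K₀ hℓ)
    rw [← mul_assoc]
    gcongr
  | lipschitz => exact hpow (1 / 2) le_rfl

/-- The rate at the finest level is at least of order `√ε`. -/
theorem Scenario.exists_mul_sqrt_le_rate (hK₀ : 1 ≤ K₀) (hM : 2 ≤ M) (hs : s.Valid K₀) :
    ∃ a : ℝ, 0 < a ∧ ∀ ε ∈ Ioo 0 (bias K₀), ∀ ℓ ≤ numLevels K₀ M ε,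
      a * √ε ≤ s.rate (levelBias K₀ M ℓ) := by
  have hM0 : (0 : ℝ) < M := by positivity
  have hl : 0 < Real.log 2 := Real.log_pos one_lt_two
  refine ⟨Real.log 2 ^ (1 / 2 : ℝ) * (√M)⁻¹, by positivity, fun ε hε ℓ hℓ => ?_⟩
  refine le_trans ?_ (Scenario.le_rate_levelBias hK₀ (one_le_two.trans hM) hs ℓ)
  rw [mul_assoc]
  gcongr
  rw [← Real.sqrt_eq_rpow, inv_mul_le_iff₀ (by positivity), ← Real.sqrt_mul hM0.le]
  refine Real.sqrt_le_sqrt ((le_mul_levelBias_numLevels hM hε).trans ?_)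
  gcongr
  exact levelBias_anti (one_le_two.trans hM) K₀ hℓ

/-- The complexity dominates the rate at the finest level. -/
theorem Scenario.exists_rate_le_complexity (hK₀ : 1 ≤ K₀) (hM : 2 ≤ M) (hs : s.Valid K₀) :
    ∃ C : ℝ, 0 < C ∧ ∀ ε ∈ Ioo 0 (bias K₀),
      (ε ^ 3)⁻¹ * s.rate (levelBias K₀ M (numLevels K₀ M ε)) ≤ C * s.complexity ε := by
  have e3 : ∀ ε : ℝ, 0 < ε → ∀ x : ℝ, (ε ^ 3)⁻¹ * ε ^ x = ε ^ (-3 + x) := fun ε hε x => by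
    rw [Real.rpow_add hε, Real.rpow_neg hε.le]; norm_cast
  have hpos := fun ε => levelBias_pos hK₀ (one_le_two.trans hM) (numLevels K₀ M ε)
  have hpow : ∀ ρ : ℝ, 0 ≤ ρ → ∀ ε ∈ Ioo 0 (bias K₀),
      (ε ^ 3)⁻¹ * levelBias K₀ M (numLevels K₀ M ε) ^ ρ ≤ ε ^ (-3 + ρ) := fun ρ hρ ε hε => by
    rw [← e3 ε hε.1]
    have := hε.1
    gcongr
    · exact (hpos ε).le
    · exact levelBias_numLevels_le hM hε
  cases s with
  | moment p =>
    have hp := hs.1 p rfl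
    refine ⟨1, one_pos, fun ε hε => ?_⟩
    rw [one_mul]
    exact hpow _ (by positivity) ε hε
  | gaussian =>
    have hK2 := hs.2 rfl
    have hl : 0 < Real.log 2 := Real.log_pos one_lt_two
    have hlM : 0 ≤ Real.log M := Real.log_natCast_nonneg _
    refine ⟨(Real.log M / Real.log 2 + 1) ^ (1 / 2 : ℝ), by positivity, fun ε hε => ?_⟩
    simp only [Scenario.rate, Scenario.complexity]
    have h1 := hpow (1 / 2) (by norm_num) ε hε
    rw [show (-3 + 1 / 2 : ℝ) = -5 / 2 by norm_num] at h1
    have hε1 := lt_one_of_lt_bias hε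
    have hε2 : ε ≤ 1 / 2 := hε.2.le.trans (by
      rw [bias, one_div]; exact inv_anti₀ two_pos (by exact_mod_cast hK2))
    have h2 : |Real.log (levelBias K₀ M (numLevels K₀ M ε))| ≤
        (Real.log M / Real.log 2 + 1) * |Real.log ε| := by
      rw [abs_of_nonpos (Real.log_nonpos (hpos ε).le (levelBias_le_one _ _ _)),
        abs_of_nonpos (Real.log_nonpos hε.1.le hε1.le)]
      have h3 := Real.log_le_log hε.1 (le_mul_levelBias_numLevels hM hε)
      rw [Real.log_mul (by positivity) (hpos ε).ne'] at h3
      have h4 : Real.log 2 ≤ -Real.log ε := by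
        have := Real.log_le_log hε.1 hε2
        rw [one_div, Real.log_inv] at this; linarith
      have h5 : Real.log M ≤ Real.log M / Real.log 2 * -Real.log ε := by
        rw [div_mul_eq_mul_div, le_div_iff₀ hl]; gcongr
      linarith
    have hε0 := hε.1
    calc _ = ((ε ^ 3)⁻¹ * levelBias K₀ M (numLevels K₀ M ε) ^ (1 / 2 : ℝ)) *
        |Real.log (levelBias K₀ M (numLevels K₀ M ε))| ^ (1 / 2 : ℝ) := by ring
      _ ≤ ε ^ (-5 / 2 : ℝ) * ((Real.log M / Real.log 2 + 1) * |Real.log ε|) ^ (1 / 2 : ℝ) := by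
        gcongr
      _ = _ := by rw [Real.mul_rpow (by positivity) (abs_nonneg _)]; ring
  | lipschitz =>
    refine ⟨1, one_pos, fun ε hε => ?_⟩
    rw [one_mul]
    have h1 := hpow (1 / 2) (by norm_num) ε hε
    rwa [show (-3 + 1 / 2 : ℝ) = -5 / 2 by norm_num] at h1

end RateGrowth

/-! ### Two-sided bounds of the cost -/

section Cost

variable {K₀ M : ℕ} (c : UnitCosts)

theorem numSchemes_le (ℓ : ℕ) : (numSchemes ℓ : ℝ) ≤ 2 := by
  unfold numSchemes; split_ifs <;> norm_num

theorem inv_levelBias (K₀ M ℓ : ℕ) : (levelBias K₀ M ℓ)⁻¹ = (K₀ * M ^ ℓ : ℕ) := by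
  rw [levelBias, bias, inv_inv]

theorem iterationCost_le (hK₀ : 1 ≤ K₀) (hM : 1 ≤ M) (ℓ : ℕ) :
    iterationCost c K₀ M ℓ ≤
      (c.drawY + (c.drawZ + c.evalφ) + 2 * c.update) * (levelBias K₀ M ℓ)⁻¹ := by
  have h1 : (1 : ℝ) ≤ (levelBias K₀ M ℓ)⁻¹ := by
    rw [inv_levelBias]; exact_mod_cast Nat.mul_pos hK₀ (Nat.pow_pos hM)
  rw [iterationCost, Finset.sum_const, Finset.card_range, nsmul_eq_mul, ← inv_levelBias]
  have h2 := numSchemes_le ℓ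
  nlinarith [c.drawY_pos, c.update_pos, mul_nonneg c.drawY_pos.le (sub_nonneg.2 h1),
    mul_nonneg c.update_pos.le (sub_nonneg.2 h1), mul_nonneg c.update_pos.le (sub_nonneg.2 h2)]

theorem le_iterationCost (K₀ M ℓ : ℕ) :
    c.drawZ * (levelBias K₀ M ℓ)⁻¹ ≤ iterationCost c K₀ M ℓ := by
  rw [iterationCost, Finset.sum_const, Finset.card_range, nsmul_eq_mul, ← inv_levelBias]
  have h1 : 0 ≤ (levelBias K₀ M ℓ)⁻¹ := by rw [inv_levelBias]; positivity
  have h2 : (0 : ℝ) ≤ numSchemes ℓ := Nat.cast_nonneg _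
  nlinarith [c.drawY_pos, mul_nonneg h2 c.update_pos.le, mul_nonneg h1 c.evalφ_pos.le]

/-- Since `N ℓ ≥ 1` and `1/h_ℓ ≥ 1`, the fixed costs of a level are absorbed by `N ℓ/h_ℓ`. -/
theorem exists_cost_le (hK₀ : 1 ≤ K₀) (hM : 1 ≤ M) :
    ∃ D : ℝ, 0 < D ∧ ∀ (L : ℕ) (N : ℕ → ℕ), (∀ ℓ, 1 ≤ N ℓ) →
      cost c K₀ M L N ≤ D * ∑ ℓ ∈ Finset.range (L + 1), N ℓ * (levelBias K₀ M ℓ)⁻¹ := by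
  have := c.init_pos; have := c.drawY_pos; have := c.drawZ_pos
  have := c.evalφ_pos; have := c.update_pos; have := c.combine_pos
  refine ⟨2 * c.init + (c.drawY + (c.drawZ + c.evalφ) + 2 * c.update) + 2 * c.combine,
    by positivity, fun L N hN => ?_⟩
  rw [cost, Finset.mul_sum]
  refine Finset.sum_le_sum fun ℓ _ => ?_
  rw [Finset.sum_const, Finset.card_range, nsmul_eq_mul]
  have h1 : (1 : ℝ) ≤ (levelBias K₀ M ℓ)⁻¹ := by
    rw [inv_levelBias]; exact_mod_cast Nat.mul_pos hK₀ (Nat.pow_pos hM)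
  have h2 : (1 : ℝ) ≤ N ℓ := by exact_mod_cast hN ℓ
  have h3 : 1 ≤ N ℓ * (levelBias K₀ M ℓ)⁻¹ := one_le_mul_of_one_le_of_one_le h2 h1
  have h4 := numSchemes_le ℓ
  have h5 := mul_le_mul_of_nonneg_left (iterationCost_le c hK₀ hM ℓ) (Nat.cast_nonneg (N ℓ))
  have h6 : numSchemes ℓ * c.init ≤ 2 * c.init * (N ℓ * (levelBias K₀ M ℓ)⁻¹) :=
    (mul_le_mul_of_nonneg_right h4 c.init_pos.le).trans (le_mul_of_one_le_right (by positivity) h3)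
  have h7 : numSchemes ℓ * c.combine ≤ 2 * c.combine * (N ℓ * (levelBias K₀ M ℓ)⁻¹) :=
    (mul_le_mul_of_nonneg_right h4 c.combine_pos.le).trans
      (le_mul_of_one_le_right (by positivity) h3)
  linarith

theorem le_cost (K₀ M L : ℕ) (N : ℕ → ℕ) :
    c.drawZ * (N L * (levelBias K₀ M L)⁻¹) ≤ cost c K₀ M L N := by
  have := c.init_pos; have := c.combine_pos; have := c.drawZ_pos
  have h0 : ∀ ℓ, 0 ≤ (levelBias K₀ M ℓ)⁻¹ := fun ℓ => by rw [inv_levelBias]; positivity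
  have hi : ∀ ℓ, 0 ≤ iterationCost c K₀ M ℓ := fun ℓ =>
    (mul_nonneg c.drawZ_pos.le (h0 ℓ)).trans (le_iterationCost c K₀ M ℓ)
  have h1 : ∀ ℓ, (N ℓ : ℝ) * iterationCost c K₀ M ℓ ≤ numSchemes ℓ * c.init +
      ∑ _n ∈ Finset.range (N ℓ), iterationCost c K₀ M ℓ + numSchemes ℓ * c.combine := fun ℓ => by
    rw [Finset.sum_const, Finset.card_range, nsmul_eq_mul]
    have : 0 ≤ numSchemes ℓ * c.init := by positivity
    have : 0 ≤ numSchemes ℓ * c.combine := by positivity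
    linarith
  rw [cost]
  refine le_trans ?_ (Finset.single_le_sum (fun ℓ _ => ?_) (Finset.self_mem_range_succ L))
  · refine le_trans ?_ (h1 L)
    have := mul_le_mul_of_nonneg_left (le_iterationCost c K₀ M L) (Nat.cast_nonneg (N L))
    linarith
  · exact (mul_nonneg (Nat.cast_nonneg _) (hi ℓ)).trans (h1 ℓ)

end Cost

/-! ### Error and cost of the VaR focused parametrization -/

section VaRParameters

variable {s : Scenario} {κ γ₁ β : ℝ} {K₀ M : ℕ} {ε : ℝ}

/-- The relative weight of level `ℓ` in the VaR focused parametrization. -/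
def varWeight (s : Scenario) (β : ℝ) (K₀ M ℓ : ℕ) : ℝ :=
  levelBias K₀ M ℓ ^ (-β / (1 + β)) * s.rate (levelBias K₀ M ℓ) ^ (1 / (1 + β))

/-- The sum of the weights of the levels `0, …, L`. -/
def varTotal (s : Scenario) (β : ℝ) (K₀ M L : ℕ) : ℝ :=
  ∑ i ∈ Finset.range (L + 1), varWeight s β K₀ M i

/-- The real number whose ceiling is the number of iterations at level `ℓ`. -/
def varTarget (s : Scenario) (κ γ₁ β : ℝ) (K₀ M : ℕ) (ε : ℝ) (ℓ : ℕ) : ℝ :=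
  (κ * γ₁) ^ (1 / β) * ε ^ (-2 / β) * varTotal s β K₀ M (numLevels K₀ M ε) ^ (1 / β) *
    levelBias K₀ M ℓ ^ (1 / (1 + β)) * s.rate (levelBias K₀ M ℓ) ^ (1 / (1 + β))

theorem varWeight_pos (hK₀ : 1 ≤ K₀) (hM : 1 ≤ M) (hs : s.Valid K₀) (β : ℝ) (ℓ : ℕ) :
    0 < varWeight s β K₀ M ℓ :=
  mul_pos (Real.rpow_pos_of_pos (levelBias_pos hK₀ hM ℓ) _)
    (Real.rpow_pos_of_pos (Scenario.rate_pos hK₀ hM hs ℓ) _)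

theorem varWeight_le_total (hK₀ : 1 ≤ K₀) (hM : 1 ≤ M) (hs : s.Valid K₀) (β : ℝ) {ℓ L : ℕ}
    (h : ℓ ≤ L) : varWeight s β K₀ M ℓ ≤ varTotal s β K₀ M L :=
  Finset.single_le_sum (f := varWeight s β K₀ M) (fun i _ => (varWeight_pos hK₀ hM hs β i).le)
    (Finset.mem_range.2 (Nat.lt_succ_of_le h))

theorem varTotal_pos (hK₀ : 1 ≤ K₀) (hM : 1 ≤ M) (hs : s.Valid K₀) (β : ℝ) (L : ℕ) :
    0 < varTotal s β K₀ M L :=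
  (varWeight_pos hK₀ hM hs β 0).trans_le (varWeight_le_total hK₀ hM hs β (Nat.zero_le L))

theorem varTarget_pos (hK₀ : 1 ≤ K₀) (hM : 1 ≤ M) (hs : s.Valid K₀) (hκ : 0 < κ) (hγ₁ : 0 < γ₁)
    (hε : 0 < ε) (ℓ : ℕ) : 0 < varTarget s κ γ₁ β K₀ M ε ℓ := by
  have h1 := levelBias_pos hK₀ hM ℓ
  have h2 := Scenario.rate_pos hK₀ hM hs ℓ
  have h3 := varTotal_pos hK₀ hM hs β (numLevels K₀ M ε)
  rw [varTarget]; positivity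

theorem one_le_itersVaR (hK₀ : 1 ≤ K₀) (hM : 1 ≤ M) (hs : s.Valid K₀) (hκ : 0 < κ) (hγ₁ : 0 < γ₁)
    (hε : 0 < ε) (ℓ : ℕ) : 1 ≤ itersVaR s κ γ₁ β K₀ M ε ℓ :=
  Nat.ceil_pos.2 (varTarget_pos hK₀ hM hs hκ hγ₁ hε ℓ)

theorem varTarget_rpow (hK₀ : 1 ≤ K₀) (hM : 1 ≤ M) (hs : s.Valid K₀) (hκ : 0 < κ) (hγ₁ : 0 < γ₁)
    (hε : 0 < ε) (hβ : 0 < β) (ℓ : ℕ) : varTarget s κ γ₁ β K₀ M ε ℓ ^ β =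
      κ * γ₁ * (ε ^ 2)⁻¹ * varTotal s β K₀ M (numLevels K₀ M ε) *
        (levelBias K₀ M ℓ ^ (β / (1 + β)) * s.rate (levelBias K₀ M ℓ) ^ (β / (1 + β))) := by
  have h1 := levelBias_pos hK₀ hM ℓ
  have h2 := Scenario.rate_pos hK₀ hM hs ℓ
  have h3 := varTotal_pos hK₀ hM hs β (numLevels K₀ M ε)
  have e1 : 1 / β * β = 1 := by field_simp
  have e2 : -2 / β * β = -2 := by field_simp
  have e3 : 1 / (1 + β) * β = β / (1 + β) := by ring
  rw [varTarget, Real.mul_rpow (by positivity) (by positivity),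
    Real.mul_rpow (by positivity) (by positivity), Real.mul_rpow (by positivity) (by positivity),
    Real.mul_rpow (by positivity) (by positivity), ← Real.rpow_mul (by positivity),
    ← Real.rpow_mul hε.le, ← Real.rpow_mul h3.le, ← Real.rpow_mul h1.le, ← Real.rpow_mul h2.le,
    e1, e2, e3, Real.rpow_one, Real.rpow_one, Real.rpow_neg hε.le]
  norm_cast
  ring

/-- This is what the parametrization is made for: the leading variance of level `ℓ` is at most
`ε²/κ` times its share of the total weight, so these variances sum to at most `ε²/κ`. -/
theorem rate_mul_stepSize_le (hK₀ : 1 ≤ K₀) (hM : 1 ≤ M) (hs : s.Valid K₀) (hκ : 0 < κ)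
    (hγ₁ : 0 < γ₁) (hε : 0 < ε) (hβ : 0 < β) (ℓ : ℕ) :
    s.rate (levelBias K₀ M ℓ) * stepSize γ₁ β (itersVaR s κ γ₁ β K₀ M ε ℓ) ≤
      κ⁻¹ * ε ^ 2 * (varWeight s β K₀ M ℓ / varTotal s β K₀ M (numLevels K₀ M ε)) := by
  have h1 := levelBias_pos hK₀ hM ℓ
  have h2 := Scenario.rate_pos hK₀ hM hs ℓ
  have h3 := varTotal_pos hK₀ hM hs β (numLevels K₀ M ε)
  have h4 : 0 < varTarget s κ γ₁ β K₀ M ε ℓ := varTarget_pos hK₀ hM hs hκ hγ₁ hε ℓ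
  have h5 : varTarget s κ γ₁ β K₀ M ε ℓ ≤ itersVaR s κ γ₁ β K₀ M ε ℓ := Nat.le_ceil _
  have h6 := Real.rpow_le_rpow_of_nonpos h4 h5 (neg_nonpos.2 hβ.le)
  rw [Real.rpow_neg h4.le, varTarget_rpow hK₀ hM hs hκ hγ₁ hε hβ] at h6
  have h7 : s.rate (levelBias K₀ M ℓ) ^ (1 / (1 + β)) * s.rate (levelBias K₀ M ℓ) ^ (β / (1 + β)) =
      s.rate (levelBias K₀ M ℓ) := by
    rw [← Real.rpow_add h2, ← add_div, div_self (by positivity), Real.rpow_one]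
  rw [stepSize]
  refine (mul_le_mul_of_nonneg_left (mul_le_mul_of_nonneg_left h6 hγ₁.le) h2.le).trans_eq ?_
  rw [varWeight, neg_div, Real.rpow_neg h1.le]
  nth_rw 1 [← h7]
  have : 0 < s.rate (levelBias K₀ M ℓ) ^ (β / (1 + β)) := by positivity
  have : 0 < levelBias K₀ M ℓ ^ (β / (1 + β)) := by positivity
  generalize varTotal s β K₀ M (numLevels K₀ M ε) = S at *
  generalize s.rate (levelBias K₀ M ℓ) ^ (β / (1 + β)) = x at *
  generalize levelBias K₀ M ℓ ^ (β / (1 + β)) = y at *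
  field_simp

theorem sum_varWeight_div (hK₀ : 1 ≤ K₀) (hM : 1 ≤ M) (hs : s.Valid K₀) (β : ℝ) (L : ℕ) :
    ∑ ℓ ∈ Finset.range (L + 1), varWeight s β K₀ M ℓ / varTotal s β K₀ M L = 1 := by
  rw [← Finset.sum_div]
  exact div_self (varTotal_pos hK₀ hM hs β L).ne'

theorem varWeight_div_le_one (hK₀ : 1 ≤ K₀) (hM : 1 ≤ M) (hs : s.Valid K₀) (β : ℝ) {ℓ L : ℕ}
    (h : ℓ ≤ L) : varWeight s β K₀ M ℓ / varTotal s β K₀ M L ≤ 1 :=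
  (div_le_one (varTotal_pos hK₀ hM hs β L)).2 (varWeight_le_total hK₀ hM hs β h)

theorem sqrt_le_sqrt_mul {x y ε : ℝ} (hε : 0 ≤ ε) (hy : 0 ≤ y) (h : x ≤ y * ε ^ 2) :
    √x ≤ √y * ε :=
  (Real.sqrt_le_sqrt h).trans_eq (by rw [Real.sqrt_mul hy, Real.sqrt_sq hε])

theorem rpow_quarter_sq {x : ℝ} (hx : 0 ≤ x) : (x ^ (1 / 4 : ℝ)) ^ 2 = x ^ (1 / 2 : ℝ) := by
  rw [← Real.rpow_natCast, ← Real.rpow_mul hx]; norm_num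

/-- The error bound of the VaR estimator is of order `ε` for the VaR focused parametrization. -/
theorem exists_var_error_le (hK₀ : 1 ≤ K₀) (hM : 2 ≤ M) (hs : s.Valid K₀) (hκ : 0 < κ)
    (hγ₁ : 0 < γ₁) (hβ : 0 < β) {D δ : ℝ} (hD : 0 < D) (hδ : 0 < δ) :
    ∃ C : ℝ, 0 < C ∧ ∀ ε ∈ Ioo 0 (bias K₀), ∀ γ : ℕ → ℝ,
      γ = (fun ℓ => stepSize γ₁ β (itersVaR s κ γ₁ β K₀ M ε ℓ)) →
      √(D * γ 0) + (√(D * ∑ ℓ ∈ Finset.range (numLevels K₀ M ε + 1), (γ ℓ ^ (3 / 2 : ℝ) +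
          s.rate (levelBias K₀ M ℓ) * γ ℓ)) +
        D * ∑ ℓ ∈ Finset.range (numLevels K₀ M ε + 1), (γ ℓ +
          levelBias K₀ M ℓ ^ (1 / 4 + δ) * √(γ ℓ))) ≤ C * ε := by
  have hM1 : 1 ≤ M := one_le_two.trans hM
  obtain ⟨a, ha, hra⟩ := Scenario.exists_mul_sqrt_le_rate (M := M) hK₀ hM hs
  set ρ₀ := s.rate (levelBias K₀ M 0)
  have hρ₀ : 0 < ρ₀ := Scenario.rate_pos hK₀ hM1 hs 0
  have hl : 0 < Real.log 2 ^ (1 / 2 : ℝ) := Real.rpow_pos_of_pos (Real.log_pos one_lt_two) _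
  set b := Real.log 2 ^ (1 / 2 : ℝ)
  set G := (1 - (M : ℝ) ^ (-δ))⁻¹
  have hG : 0 < G := inv_pos.2 (sub_pos.2 (rpow_neg_lt_one hM hδ))
  set e := κ⁻¹ / a with he
  have he0 : 0 < e := by positivity
  refine ⟨√(D * (κ⁻¹ / ρ₀)) + (√(D * (e * √e + κ⁻¹)) + D * (e + √(κ⁻¹ / b) * G)), by positivity,
    fun ε hε γ hγ => ?_⟩
  have hε0 := hε.1
  have hε1 := (lt_one_of_lt_bias hε).le
  set L := numLevels K₀ M ε with hL
  set w : ℕ → ℝ := fun ℓ => varWeight s β K₀ M ℓ / varTotal s β K₀ M L with hw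
  have hw0 : ∀ ℓ, 0 ≤ w ℓ := fun ℓ => div_nonneg (varWeight_pos hK₀ hM1 hs β ℓ).le
    (varTotal_pos hK₀ hM1 hs β L).le
  have hw1 : ∀ ℓ ≤ L, w ℓ ≤ 1 := fun ℓ h => varWeight_div_le_one hK₀ hM1 hs β h
  have hws : ∑ ℓ ∈ Finset.range (L + 1), w ℓ = 1 := sum_varWeight_div hK₀ hM1 hs β L
  have hrγ : ∀ ℓ, s.rate (levelBias K₀ M ℓ) * γ ℓ ≤ κ⁻¹ * ε ^ 2 * w ℓ := fun ℓ => by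
    rw [hγ]; exact rate_mul_stepSize_le hK₀ hM1 hs hκ hγ₁ hε0 hβ ℓ
  have hγ0 : ∀ ℓ, 0 ≤ γ ℓ := fun ℓ => by rw [hγ]; simp only [stepSize]; positivity
  have hr : ∀ ℓ, 0 < s.rate (levelBias K₀ M ℓ) := Scenario.rate_pos hK₀ hM1 hs
  have hsq : √ε * √ε = ε := Real.mul_self_sqrt hε0.le
  have hsε : 0 < √ε := Real.sqrt_pos.2 hε0
  have hsε1 : √ε ≤ 1 := Real.sqrt_le_one.2 hε1
  -- Dividing by the rate, which is at least `a√ε`, leaves steps of order `ε^{3/2}`. Both `γ` and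
  -- `γ^{3/2}` are then small enough.
  have hγe : ∀ ℓ ≤ L, γ ℓ ≤ e * (ε * √ε) * w ℓ := fun ℓ hℓ => by
    have h1 : a * √ε * γ ℓ ≤ κ⁻¹ * ε ^ 2 * w ℓ :=
      (mul_le_mul_of_nonneg_right (hra ε hε ℓ hℓ) (hγ0 ℓ)).trans (hrγ ℓ)
    have h2 : κ⁻¹ * ε ^ 2 * w ℓ = a * √ε * (e * (ε * √ε) * w ℓ) := by
      calc _ = a * a⁻¹ * κ⁻¹ * ε * (√ε * √ε) * w ℓ := by rw [mul_inv_cancel₀ ha.ne', hsq]; ring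
        _ = _ := by rw [he]; ring
    rw [h2] at h1
    exact le_of_mul_le_mul_left h1 (by positivity)
  have t1 : √(D * γ 0) ≤ √(D * (κ⁻¹ / ρ₀)) * ε := by
    refine sqrt_le_sqrt_mul hε0.le (by positivity) ?_
    rw [mul_assoc]
    gcongr
    rw [div_mul_eq_mul_div, le_div_iff₀ hρ₀, mul_comm]
    refine (hrγ 0).trans (mul_le_of_le_one_right (by positivity) (hw1 0 (Nat.zero_le _)))
  have t2 : ∑ ℓ ∈ Finset.range (L + 1), (γ ℓ ^ (3 / 2 : ℝ) + s.rate (levelBias K₀ M ℓ) * γ ℓ) ≤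
      (e * √e + κ⁻¹) * ε ^ 2 := by
    calc _ ≤ ∑ ℓ ∈ Finset.range (L + 1), (e * √e + κ⁻¹) * ε ^ 2 * w ℓ := by
          refine Finset.sum_le_sum fun ℓ hℓ => ?_
          have hℓ' : ℓ ≤ L := Nat.lt_succ_iff.1 (Finset.mem_range.1 hℓ)
          have h1 := hγe ℓ hℓ'
          have h2 : √(γ ℓ) ≤ √e * √ε := by
            rw [← Real.sqrt_mul he0.le]
            refine Real.sqrt_le_sqrt (h1.trans ?_)
            have h3 : ε * √ε * w ℓ ≤ ε := by
              rw [mul_assoc]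
              exact mul_le_of_le_one_right hε0.le (mul_le_one₀ hsε1 (hw0 ℓ) (hw1 ℓ hℓ'))
            rw [mul_assoc]; gcongr
          have h3 : γ ℓ ^ (3 / 2 : ℝ) = γ ℓ * √(γ ℓ) := by
            rw [Real.sqrt_eq_rpow, show (3 / 2 : ℝ) = 1 + 1 / 2 by norm_num,
              Real.rpow_add_of_nonneg (hγ0 ℓ) zero_le_one (by norm_num), Real.rpow_one]
          have h4 : γ ℓ * √(γ ℓ) ≤ e * (ε * √ε) * w ℓ * (√e * √ε) := by
            gcongr
            exact mul_nonneg (by positivity) (hw0 ℓ)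
          have h5 : e * (ε * √ε) * w ℓ * (√e * √ε) = e * √e * ε ^ 2 * w ℓ := by
            calc _ = e * √e * ε * (√ε * √ε) * w ℓ := by ring
              _ = _ := by rw [hsq]; ring
          rw [h3]
          linarith [hrγ ℓ]
      _ = _ := by rw [← Finset.mul_sum, hws, mul_one]
  have t3 : ∑ ℓ ∈ Finset.range (L + 1), γ ℓ ≤ e * ε := by
    calc _ ≤ ∑ ℓ ∈ Finset.range (L + 1), e * ε * w ℓ := by
          refine Finset.sum_le_sum fun ℓ hℓ => (hγe ℓ (Nat.lt_succ_iff.1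
            (Finset.mem_range.1 hℓ))).trans ?_
          refine mul_le_mul_of_nonneg_right ?_ (hw0 ℓ)
          gcongr
          exact mul_le_of_le_one_right hε0.le hsε1
      _ = _ := by rw [← Finset.mul_sum, hws, mul_one]
  -- As the rate dominates `h^{1/2}`, each `h^{1/4} √γ` is already `O(ε)`. The extra factor `h^δ`
  -- makes the sum over the levels converge, which is where `δ > 0` enters.
  have t4 : ∑ ℓ ∈ Finset.range (L + 1), levelBias K₀ M ℓ ^ (1 / 4 + δ) * √(γ ℓ) ≤
      √(κ⁻¹ / b) * G * ε := by
    calc _ ≤ ∑ ℓ ∈ Finset.range (L + 1), √(κ⁻¹ / b) * ε * levelBias K₀ M ℓ ^ δ := by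
          refine Finset.sum_le_sum fun ℓ hℓ => ?_
          have hh := levelBias_pos hK₀ hM1 ℓ
          have h1 : b * levelBias K₀ M ℓ ^ (1 / 2 : ℝ) * γ ℓ ≤ κ⁻¹ * ε ^ 2 :=
            ((mul_le_mul_of_nonneg_right (Scenario.le_rate_levelBias hK₀ hM1 hs ℓ)
              (hγ0 ℓ)).trans (hrγ ℓ)).trans (mul_le_of_le_one_right (by positivity)
              (hw1 ℓ (Nat.lt_succ_iff.1 (Finset.mem_range.1 hℓ))))
          have h2 : levelBias K₀ M ℓ ^ (1 / 4 : ℝ) * √(γ ℓ) ≤ √(κ⁻¹ / b) * ε := by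
            refine le_of_sq_le_sq ?_ (by positivity)
            rw [mul_pow, mul_pow, Real.sq_sqrt (hγ0 ℓ), Real.sq_sqrt (by positivity),
              rpow_quarter_sq hh.le, div_mul_eq_mul_div, le_div_iff₀ hl]
            linarith
          rw [Real.rpow_add hh]
          calc _ = levelBias K₀ M ℓ ^ (1 / 4 : ℝ) * √(γ ℓ) * levelBias K₀ M ℓ ^ δ := by ring
            _ ≤ _ := by gcongr
      _ = √(κ⁻¹ / b) * ε * ∑ ℓ ∈ Finset.range (L + 1), levelBias K₀ M ℓ ^ δ := by
          rw [Finset.mul_sum]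
      _ ≤ √(κ⁻¹ / b) * ε * G := by
          gcongr
          exact sum_levelBias_rpow_le hM K₀ hδ _
      _ = _ := by ring
  have t5 : √(D * ∑ ℓ ∈ Finset.range (L + 1), (γ ℓ ^ (3 / 2 : ℝ) +
      s.rate (levelBias K₀ M ℓ) * γ ℓ)) ≤ √(D * (e * √e + κ⁻¹)) * ε := by
    refine sqrt_le_sqrt_mul hε0.le (by positivity) ?_
    rw [mul_assoc]
    gcongr
  have t6 : D * ∑ ℓ ∈ Finset.range (L + 1), (γ ℓ + levelBias K₀ M ℓ ^ (1 / 4 + δ) * √(γ ℓ)) ≤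
      D * (e + √(κ⁻¹ / b) * G) * ε := by
    rw [Finset.sum_add_distrib, mul_assoc]
    gcongr
    linarith
  linarith

/-- The cost of the VaR focused parametrization for `β = 1`. -/
theorem exists_costVaR_le (c : UnitCosts) (hK₀ : 1 ≤ K₀) (hM : 2 ≤ M) (hs : s.Valid K₀)
    (hκ : 0 < κ) (hγ₁ : 0 < γ₁) :
    ∃ C : ℝ, 0 < C ∧ ∀ ε ∈ Ioo 0 (bias K₀), costVaR c s κ γ₁ 1 K₀ M ε ≤
      C * ((ε ^ 2)⁻¹ * s.rate (levelBias K₀ M (numLevels K₀ M ε)) *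
        (levelBias K₀ M (numLevels K₀ M ε))⁻¹) := by
  have hM1 : 1 ≤ M := one_le_two.trans hM
  have hM0 : (0 : ℝ) < M := by positivity
  obtain ⟨D, hD, hcost⟩ := exists_cost_le c hK₀ hM1
  obtain ⟨a, ha, hra⟩ := Scenario.exists_mul_sqrt_le_rate (M := M) hK₀ hM hs
  -- For `β = 1` the weight of a level is `√(ϵ(h)/h)`, which shrinks at least by the factor `x =
  -- M^{-1/4}` towards coarser levels.
  set x := √(√(M : ℝ))⁻¹ with hx
  have hx1 : x < 1 := by
    have h1 : (1 : ℝ) < √M := Real.lt_sqrt_of_sq_lt (by norm_num; omega)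
    exact (Real.sqrt_lt' one_pos).2 (by rw [one_pow]; exact inv_lt_one_of_one_lt₀ h1)
  have hx0 : 0 ≤ x := Real.sqrt_nonneg _
  have hG : 0 < (1 - x)⁻¹ := inv_pos.2 (sub_pos.2 hx1)
  refine ⟨D * (κ * γ₁ * (1 - x)⁻¹ ^ 2 + 2 / a), by positivity, fun ε hε => ?_⟩
  have hε0 := hε.1
  have hε1 := (lt_one_of_lt_bias hε).le
  refine (hcost _ _ (one_le_itersVaR hK₀ hM1 hs hκ hγ₁ hε0)).trans ?_
  rw [mul_assoc]
  refine mul_le_mul_of_nonneg_left ?_ hD.le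
  have hra' := hra ε hε _ le_rfl
  set L := numLevels K₀ M ε with hL
  have hh := levelBias_pos hK₀ hM1
  have hr : ∀ ℓ, 0 < s.rate (levelBias K₀ M ℓ) := Scenario.rate_pos hK₀ hM1 hs
  have hw : ∀ ℓ, varWeight s 1 K₀ M ℓ = √(s.rate (levelBias K₀ M ℓ) / levelBias K₀ M ℓ) :=
    fun ℓ => by
      rw [varWeight, Real.sqrt_div (hr ℓ).le, Real.sqrt_eq_rpow, Real.sqrt_eq_rpow,
        show (-1 / (1 + 1) : ℝ) = -(1 / 2) by norm_num, Real.rpow_neg (hh ℓ).le,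
        show (1 / (1 + 1) : ℝ) = 1 / 2 by norm_num]
      exact (div_eq_inv_mul _ _).symm
  have hT : ∀ ℓ, varTarget s κ γ₁ 1 K₀ M ε ℓ * (levelBias K₀ M ℓ)⁻¹ =
      κ * γ₁ * (ε ^ 2)⁻¹ * varTotal s 1 K₀ M L * varWeight s 1 K₀ M ℓ := fun ℓ => by
    have h1 := varTarget_rpow (β := 1) hK₀ hM1 hs hκ hγ₁ hε0 one_pos ℓ
    rw [Real.rpow_one] at h1
    have h2 : levelBias K₀ M ℓ ^ (1 / (1 + 1) : ℝ) * (levelBias K₀ M ℓ)⁻¹ =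
        levelBias K₀ M ℓ ^ (-1 / (1 + 1) : ℝ) := by
      rw [← Real.rpow_neg_one, ← Real.rpow_add (hh ℓ)]; norm_num
    rw [h1, varWeight, ← h2]; ring
  have hS : varTotal s 1 K₀ M L ≤ √(s.rate (levelBias K₀ M L) / levelBias K₀ M L) * (1 - x)⁻¹ := by
    calc _ ≤ ∑ ℓ ∈ Finset.range (L + 1),
          √(s.rate (levelBias K₀ M L) / levelBias K₀ M L) * x ^ (L - ℓ) := by
          refine Finset.sum_le_sum fun ℓ hℓ => ?_
          have hℓ' : ℓ ≤ L := Nat.lt_succ_iff.1 (Finset.mem_range.1 hℓ)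
          have e1 : x ^ (L - ℓ) = √((√(M : ℝ))⁻¹ ^ (L - ℓ)) := by
            rw [hx]
            exact (Real.sqrt_eq_iff_eq_sq (by positivity) (by positivity)).2
              (by rw [← pow_mul, mul_comm, pow_mul, Real.sq_sqrt (by positivity)]) |>.symm
          rw [hw, e1, ← Real.sqrt_mul (div_pos (hr L) (hh L)).le]
          refine Real.sqrt_le_sqrt ?_
          rw [levelBias_eq_mul_pow hM1 K₀ hℓ', ← levelBias_eq_mul_pow hM1 K₀ hℓ',
            div_mul_eq_mul_div]
          have h2 := Scenario.rate_levelBias_le_sqrt_pow hK₀ hM1 hs hℓ'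
          rw [levelBias_eq_mul_pow hM1 K₀ hℓ', ← levelBias_eq_mul_pow hM1 K₀ hℓ'] at h2
          rw [div_le_div_iff₀ (hh ℓ) (hh L)]
          have e2 : (√(M : ℝ))⁻¹ ^ (L - ℓ) * (M : ℝ) ^ (L - ℓ) = √(M : ℝ) ^ (L - ℓ) := by
            rw [← mul_pow]; congr 1
            rw [inv_mul_eq_iff_eq_mul₀ (by positivity), Real.mul_self_sqrt hM0.le]
          calc _ ≤ √(M : ℝ) ^ (L - ℓ) * s.rate (levelBias K₀ M L) * levelBias K₀ M L :=
                mul_le_mul_of_nonneg_right h2 (hh L).le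
            _ = s.rate (levelBias K₀ M L) * (√(M : ℝ))⁻¹ ^ (L - ℓ) *
                (levelBias K₀ M L * (M : ℝ) ^ (L - ℓ)) := by rw [← e2]; ring
            _ = _ := by rw [← levelBias_eq_mul_pow hM1 K₀ hℓ']
      _ ≤ _ := by
          rw [← Finset.mul_sum]
          gcongr
          exact sum_pow_sub_le hx0 hx1 L
  have hS2 : varTotal s 1 K₀ M L ^ 2 ≤
      s.rate (levelBias K₀ M L) * (levelBias K₀ M L)⁻¹ * (1 - x)⁻¹ ^ 2 := by
    refine (pow_le_pow_left₀ (varTotal_pos hK₀ hM1 hs 1 L).le hS 2).trans_eq ?_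
    rw [mul_pow, Real.sq_sqrt (div_pos (hr L) (hh L)).le, div_eq_mul_inv]
  -- This absorbs the ceilings, which add at most `∑ 1/h_ℓ ≤ 2/h_L` to the cost.
  have hone : 1 ≤ a⁻¹ * ((ε ^ 2)⁻¹ * s.rate (levelBias K₀ M L)) := by
    have h1 : ε ^ 2 ≤ √ε :=
      Real.le_sqrt_of_sq_le (by rw [← pow_mul]; exact pow_le_of_le_one hε0.le hε1 (by norm_num))
    rw [← mul_assoc, ← mul_inv, le_inv_mul_iff₀ (by positivity), mul_one]
    exact le_trans (by gcongr) hra'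
  calc ∑ ℓ ∈ Finset.range (L + 1), (itersVaR s κ γ₁ 1 K₀ M ε ℓ : ℝ) * (levelBias K₀ M ℓ)⁻¹
      ≤ ∑ ℓ ∈ Finset.range (L + 1), (κ * γ₁ * (ε ^ 2)⁻¹ * varTotal s 1 K₀ M L *
        varWeight s 1 K₀ M ℓ + (levelBias K₀ M ℓ)⁻¹) := by
        refine Finset.sum_le_sum fun ℓ _ => ?_
        rw [← hT]
        have h1 : (itersVaR s κ γ₁ 1 K₀ M ε ℓ : ℝ) ≤ varTarget s κ γ₁ 1 K₀ M ε ℓ + 1 :=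
          (Nat.ceil_lt_add_one (varTarget_pos hK₀ hM1 hs hκ hγ₁ hε0 ℓ).le).le
        have h2 := mul_le_mul_of_nonneg_right h1 (inv_pos.2 (hh ℓ)).le
        linarith
    _ = κ * γ₁ * (ε ^ 2)⁻¹ * varTotal s 1 K₀ M L ^ 2 +
        ∑ ℓ ∈ Finset.range (L + 1), (levelBias K₀ M ℓ)⁻¹ := by
        rw [Finset.sum_add_distrib, ← Finset.mul_sum]
        simp only [varTotal]; ring
    _ ≤ κ * γ₁ * (ε ^ 2)⁻¹ * (s.rate (levelBias K₀ M L) * (levelBias K₀ M L)⁻¹ * (1 - x)⁻¹ ^ 2) +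
        2 * (levelBias K₀ M L)⁻¹ * (a⁻¹ * ((ε ^ 2)⁻¹ * s.rate (levelBias K₀ M L))) := by
        refine add_le_add (mul_le_mul_of_nonneg_left hS2 (by positivity)) ?_
        have h0 := inv_pos.2 (hh L)
        exact (sum_inv_levelBias_le hM K₀ L).trans (le_mul_of_one_le_right (by positivity) hone)
    _ = _ := by ring

/-- A lower bound of the cost of the VaR focused parametrization. -/
theorem exists_le_costVaR (c : UnitCosts) (hK₀ : 1 ≤ K₀) (hM : 2 ≤ M) (hs : s.Valid K₀)
    (hκ : 0 < κ) (hγ₁ : 0 < γ₁) (hβ : β ∈ Ioc (0 : ℝ) 1) :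
    ∃ C : ℝ, 0 < C ∧ ∀ ε ∈ Ioo 0 (bias K₀), (ε ^ 2)⁻¹ * s.rate (levelBias K₀ M (numLevels K₀ M ε)) *
        (levelBias K₀ M (numLevels K₀ M ε))⁻¹ ≤ C * costVaR c s κ γ₁ β K₀ M ε := by
  have hM1 : 1 ≤ M := one_le_two.trans hM
  have hβ0 := hβ.1
  obtain ⟨a, ha, hra⟩ := Scenario.exists_mul_sqrt_le_rate (M := M) hK₀ hM hs
  have hc := c.drawZ_pos
  refine ⟨(c.drawZ * ((κ * γ₁) ^ (1 / β) * a ^ (1 / β - 1)))⁻¹, by positivity, fun ε hε => ?_⟩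
  have hε0 := hε.1
  have hε1 := (lt_one_of_lt_bias hε).le
  have hra' := hra ε hε _ le_rfl
  set L := numLevels K₀ M ε with hL
  have hh := levelBias_pos hK₀ hM1 L
  have hr : 0 < s.rate (levelBias K₀ M L) := Scenario.rate_pos hK₀ hM1 hs L
  rw [le_inv_mul_iff₀ (by positivity)]
  refine le_trans ?_ (le_cost c K₀ M L _)
  rw [mul_assoc]
  refine mul_le_mul_of_nonneg_left ?_ hc.le
  rw [← mul_assoc]
  refine mul_le_mul_of_nonneg_right ?_ (inv_pos.2 hh).le
  refine le_trans ?_ (Nat.le_ceil (varTarget s κ γ₁ β K₀ M ε L))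
  set y := (ε ^ 2)⁻¹ * s.rate (levelBias K₀ M L) with hy
  have hy0 : 0 < y := by positivity
  have hay : a ≤ y := by
    have h1 : ε ^ 2 ≤ √ε :=
      Real.le_sqrt_of_sq_le (by rw [← pow_mul]; exact pow_le_of_le_one hε0.le hε1 (by norm_num))
    rw [hy, le_inv_mul_iff₀ (by positivity), mul_comm]
    exact le_trans (by gcongr) hra'
  -- Since `1/β ≥ 1` and `y` is bounded away from zero, `y^{1/β}` dominates `y`; this is why no `β <
  -- 1` is cheaper.
  have h1 : a ^ (1 / β - 1) * y ≤ y ^ (1 / β) := by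
    calc a ^ (1 / β - 1) * y ≤ y ^ (1 / β - 1) * y := by
          gcongr
          rw [sub_nonneg, le_div_iff₀ hβ0]; linarith [hβ.2]
      _ = y ^ (1 / β) := by
          nth_rw 2 [← Real.rpow_one y]
          rw [← Real.rpow_add hy0]; ring_nf
  -- The total weight is bounded below by the weight of the finest level alone.
  have h2 : (κ * γ₁) ^ (1 / β) * y ^ (1 / β) ≤ varTarget s κ γ₁ β K₀ M ε L := by
    have h3 := varTarget_pos (β := β) hK₀ hM1 hs hκ hγ₁ hε0 L
    rw [← Real.rpow_le_rpow_iff (by positivity) h3.le hβ0, varTarget_rpow hK₀ hM1 hs hκ hγ₁ hε0 hβ0,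
      ← Real.mul_rpow (by positivity) hy0.le, ← Real.rpow_mul (by positivity),
      one_div_mul_cancel hβ0.ne', Real.rpow_one, hy, ← hL]
    have h4 := varWeight_le_total hK₀ hM1 hs β le_rfl (ℓ := L)
    have h5 : varWeight s β K₀ M L * (levelBias K₀ M L ^ (β / (1 + β)) *
        s.rate (levelBias K₀ M L) ^ (β / (1 + β))) = s.rate (levelBias K₀ M L) := by
      rw [varWeight, mul_mul_mul_comm, ← Real.rpow_add hh, ← Real.rpow_add hr, ← add_div,
        ← add_div, neg_add_cancel, zero_div, Real.rpow_zero, one_mul, div_self (by positivity),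
        Real.rpow_one]
    have h6 : 0 ≤ levelBias K₀ M L ^ (β / (1 + β)) *
        s.rate (levelBias K₀ M L) ^ (β / (1 + β)) := by positivity
    have h7 := mul_le_mul_of_nonneg_right h4 h6
    rw [h5] at h7
    rw [mul_assoc (κ * γ₁ * (ε ^ 2)⁻¹), ← mul_assoc (κ * γ₁)]
    gcongr
  calc _ = (κ * γ₁) ^ (1 / β) * (a ^ (1 / β - 1) * y) := by ring
    _ ≤ (κ * γ₁) ^ (1 / β) * y ^ (1 / β) := by gcongr
    _ ≤ _ := h2

end VaRParameters

/-! ### Error and cost of the ES focused parametrization -/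

section ESParameters

variable {κ : ℝ} {K₀ M : ℕ} {ε : ℝ}

/-- From `h_ℓ = h_L M^{L-ℓ}` and `h_L ≥ ε/M`: counted from the finest level, the numbers of
iterations grow geometrically. -/
theorem le_itersES (hM : 2 ≤ M) (hκ : 0 < κ) (hε : ε ∈ Ioo 0 (bias K₀)) {ℓ : ℕ}
    (hℓ : ℓ ≤ numLevels K₀ M ε) :
    κ / M * numLevels K₀ M ε * (M : ℝ) ^ (numLevels K₀ M ε - ℓ) / ε ≤ itersES κ K₀ M ε ℓ := by
  have hM0 : (0 : ℝ) < M := by positivity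
  have hε0 := hε.1
  refine le_trans ?_ (Nat.le_ceil _)
  have h1 : ε⁻¹ / M ≤ ε ^ (-2 : ℝ) * levelBias K₀ M (numLevels K₀ M ε) := by
    rw [Real.rpow_neg hε0.le, Real.rpow_two, le_inv_mul_iff₀ (by positivity), ← mul_div_assoc,
      div_le_iff₀ hM0]
    have := le_mul_levelBias_numLevels hM hε
    rw [pow_two, mul_assoc, mul_inv_cancel₀ hε0.ne']
    linarith
  rw [levelBias_eq_mul_pow (one_le_two.trans hM) K₀ hℓ]
  calc _ = κ * numLevels K₀ M ε * (M : ℝ) ^ (numLevels K₀ M ε - ℓ) * (ε⁻¹ / M) := by ring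
    _ ≤ κ * numLevels K₀ M ε * (M : ℝ) ^ (numLevels K₀ M ε - ℓ) *
        (ε ^ (-2 : ℝ) * levelBias K₀ M (numLevels K₀ M ε)) := by gcongr
    _ = _ := by ring

theorem itersES_target_pos (hK₀ : 1 ≤ K₀) (hM : 2 ≤ M) (hκ : 0 < κ) (hε : ε ∈ Ioo 0 (bias K₀))
    (ℓ : ℕ) : 0 < κ * ε ^ (-2 : ℝ) * numLevels K₀ M ε * levelBias K₀ M ℓ := by
  have hL : (0 : ℝ) < numLevels K₀ M ε := Nat.cast_pos.2 (one_le_numLevels hM hε)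
  have hh := levelBias_pos hK₀ (one_le_two.trans hM) ℓ
  have hε0 := hε.1
  positivity

theorem one_le_itersES (hK₀ : 1 ≤ K₀) (hM : 2 ≤ M) (hκ : 0 < κ) (hε : ε ∈ Ioo 0 (bias K₀))
    (ℓ : ℕ) : 1 ≤ itersES κ K₀ M ε ℓ := Nat.ceil_pos.2 (itersES_target_pos hK₀ hM hκ hε ℓ)

/-- Replaces `n` by a lower bound `t`. Monotonicity fails for small arguments, so `ln n ≤ ln t +
n/t` is used instead. -/
theorem two_add_log_div_le {t n : ℝ} (ht : 0 < t) (h : t ≤ n) :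
    (2 + Real.log n) / n ≤ (3 + |Real.log t|) / t := by
  have hn : 0 < n := ht.trans_le h
  have h1 : Real.log n ≤ Real.log t + n / t := by
    have := Real.log_le_sub_one_of_pos (div_pos hn ht)
    rw [Real.log_div hn.ne' ht.ne'] at this; linarith
  have h2 : (2 + |Real.log t|) / n ≤ (2 + |Real.log t|) / t := by gcongr
  calc (2 + Real.log n) / n ≤ (2 + |Real.log t| + n / t) / n := by
        gcongr ?_ / n
        linarith [le_abs_self (Real.log t)]
    _ = (2 + |Real.log t|) / n + 1 / t := by field_simp
    _ ≤ (2 + |Real.log t|) / t + 1 / t := by linarith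
    _ = _ := by ring

/-- The level contributions to the error of the ES estimator that are not of Monte Carlo type. -/
theorem exists_two_add_log_div_le (hK₀ : 1 ≤ K₀) (hM : 2 ≤ M) (hκ : 0 < κ) :
    ∃ C : ℝ, 0 < C ∧ ∀ ε ∈ Ioo 0 (bias K₀), ∀ ℓ ≤ numLevels K₀ M ε,
      (2 + Real.log (itersES κ K₀ M ε ℓ)) / itersES κ K₀ M ε ℓ ≤
        C * ε * (M : ℝ)⁻¹ ^ (numLevels K₀ M ε - ℓ) := by
  have hM0 : (0 : ℝ) < M := by positivity
  have hlM : 0 ≤ Real.log M := Real.log_natCast_nonneg _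
  have hlK : 0 ≤ Real.log K₀ := Real.log_natCast_nonneg _
  have hb : 0 < κ / M := by positivity
  refine ⟨(4 + |Real.log (κ / M)| + Real.log M + (Real.log K₀ + Real.log M)) / (κ / M),
    by positivity, fun ε hε ℓ hℓ => ?_⟩
  have hε0 := hε.1
  have h1 := le_itersES hM hκ hε hℓ
  have hLε := neg_log_le_mul_numLevels hK₀ hM hε
  have hL1 : (1 : ℝ) ≤ numLevels K₀ M ε := by exact_mod_cast one_le_numLevels hM hε
  set L := numLevels K₀ M ε
  set m : ℝ := (M : ℝ) ^ (L - ℓ) with hm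
  have hm0 : 0 < m := by positivity
  have hL0 : (0 : ℝ) < L := by linarith
  refine (two_add_log_div_le (by positivity) h1).trans ?_
  -- The logarithm is `O(L)` and is cancelled by the factor `L` in the number of iterations.
  have h2 : |Real.log (κ / M * L * m / ε)| ≤
      |Real.log (κ / M)| + L + Real.log M * L + (Real.log K₀ + Real.log M) * L := by
    rw [Real.log_div (by positivity) hε0.ne', Real.log_mul (by positivity) hm0.ne',
      Real.log_mul hb.ne' hL0.ne', sub_eq_add_neg]
    refine (abs_add_le _ _).trans (add_le_add ((abs_add_le _ _).trans (add_le_add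
      ((abs_add_le _ _).trans (add_le_add le_rfl ?_)) ?_)) ?_)
    · rw [abs_of_nonneg (Real.log_nonneg hL1)]
      exact (Real.log_le_sub_one_of_pos hL0).trans (by linarith)
    · rw [hm, Real.log_pow, abs_of_nonneg (by positivity), mul_comm]
      gcongr
      exact Nat.sub_le _ _
    · rwa [abs_of_nonneg (neg_nonneg.2 (Real.log_nonpos hε0.le (lt_one_of_lt_bias hε).le))]
  have h3 : 3 + |Real.log (κ / M * L * m / ε)| ≤
      (4 + |Real.log (κ / M)| + Real.log M + (Real.log K₀ + Real.log M)) * L := by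
    nlinarith [abs_nonneg (Real.log (κ / M))]
  calc _ ≤ (4 + |Real.log (κ / M)| + Real.log M + (Real.log K₀ + Real.log M)) * L /
        (κ / M * L * m / ε) := by gcongr
    _ = _ := by
        rw [inv_pow, ← hm]
        generalize 4 + |Real.log (κ / M)| + Real.log M + (Real.log K₀ + Real.log M) = c
        field_simp

/-- The error bound of the ES estimator is of order `ε` for the ES focused parametrization. -/
theorem exists_es_error_le (hK₀ : 1 ≤ K₀) (hM : 2 ≤ M) (hκ : 0 < κ) {D : ℝ} (hD : 0 < D) :
    ∃ C : ℝ, 0 < C ∧ ∀ ε ∈ Ioo 0 (bias K₀), ∀ N : ℕ → ℕ, N = itersES κ K₀ M ε →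
      √(D * ∑ ℓ ∈ Finset.range (numLevels K₀ M ε + 1),
          ((2 + Real.log (N ℓ)) / (N ℓ : ℝ) ^ 2 + levelBias K₀ M ℓ / N ℓ)) +
        D * ∑ ℓ ∈ Finset.range (numLevels K₀ M ε + 1), (2 + Real.log (N ℓ)) / N ℓ ≤ C * ε := by
  have hM0 : (0 : ℝ) < M := by positivity
  have hM1 : 1 ≤ M := one_le_two.trans hM
  obtain ⟨E, hE, hEl⟩ := exists_two_add_log_div_le hK₀ hM hκ
  have hi : (M : ℝ)⁻¹ < 1 := inv_lt_one_of_one_lt₀ (by exact_mod_cast hM)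
  have hG : 0 < (1 - (M : ℝ)⁻¹)⁻¹ := inv_pos.2 (sub_pos.2 hi)
  set G := (1 - (M : ℝ)⁻¹)⁻¹
  set b := κ / M with hb
  have hb0 : 0 < b := by positivity
  refine ⟨√(D * (E * G / b + 2 / κ)) + D * (E * G), by positivity, fun ε hε N hN => ?_⟩
  have hε0 := hε.1
  have hN1 : ∀ ℓ, (1 : ℝ) ≤ N ℓ := fun ℓ => by
    rw [hN]; exact_mod_cast one_le_itersES hK₀ hM hκ hε ℓ
  have hL1 : (1 : ℝ) ≤ numLevels K₀ M ε := by exact_mod_cast one_le_numLevels hM hε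
  have hNl := fun ℓ hℓ => le_itersES (ℓ := ℓ) hM hκ hε hℓ
  have hEN := hEl ε hε
  have hNt : ∀ ℓ, κ * ε ^ (-2 : ℝ) * numLevels K₀ M ε * levelBias K₀ M ℓ ≤ N ℓ := fun ℓ => by
    rw [hN]; exact Nat.le_ceil _
  rw [← hN] at hNl hEN
  set L := numLevels K₀ M ε
  have t1 : ∑ ℓ ∈ Finset.range (L + 1), (2 + Real.log (N ℓ)) / N ℓ ≤ E * G * ε := by
    calc _ ≤ ∑ ℓ ∈ Finset.range (L + 1), E * ε * (M : ℝ)⁻¹ ^ (L - ℓ) :=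
          Finset.sum_le_sum fun ℓ hℓ => hEN ℓ (Nat.lt_succ_iff.1 (Finset.mem_range.1 hℓ))
      _ ≤ E * ε * G := by
          rw [← Finset.mul_sum]
          gcongr
          exact sum_pow_sub_le (by positivity) hi L
      _ = _ := by ring
  have t2 : ∑ ℓ ∈ Finset.range (L + 1), (2 + Real.log (N ℓ)) / (N ℓ : ℝ) ^ 2 ≤
      E * G / b * ε ^ 2 := by
    calc _ ≤ ∑ ℓ ∈ Finset.range (L + 1), ε / b * ((2 + Real.log (N ℓ)) / N ℓ) := by
          refine Finset.sum_le_sum fun ℓ hℓ => ?_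
          have h1 : 0 ≤ (2 + Real.log (N ℓ)) / N ℓ :=
            div_nonneg (by linarith [Real.log_nonneg (hN1 ℓ)]) (by linarith [hN1 ℓ])
          have h2 : (N ℓ : ℝ)⁻¹ ≤ ε / b := by
            rw [inv_le_comm₀ (by linarith [hN1 ℓ]) (by positivity), inv_div]
            refine le_trans ?_ (hNl ℓ (Nat.lt_succ_iff.1 (Finset.mem_range.1 hℓ)))
            gcongr
            rw [mul_assoc]
            exact le_mul_of_one_le_right hb0.le (one_le_mul_of_one_le_of_one_le hL1
              (one_le_pow₀ (by exact_mod_cast hM1)))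
          calc _ = (N ℓ : ℝ)⁻¹ * ((2 + Real.log (N ℓ)) / N ℓ) := by rw [pow_two]; ring
            _ ≤ _ := by gcongr
      _ ≤ ε / b * (E * G * ε) := by rw [← Finset.mul_sum]; gcongr
      _ = _ := by ring
  -- Every level contributes at most `ε²/(κL)`, and there are `L + 1 ≤ 2L` of them.
  have t3 : ∑ ℓ ∈ Finset.range (L + 1), levelBias K₀ M ℓ / N ℓ ≤ 2 / κ * ε ^ 2 := by
    calc _ ≤ ∑ ℓ ∈ Finset.range (L + 1), ε ^ 2 / (κ * L) := by
          refine Finset.sum_le_sum fun ℓ hℓ => ?_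
          have h1 := hNt ℓ
          rw [Real.rpow_neg hε0.le, Real.rpow_two] at h1
          rw [div_le_div_iff₀ (by linarith [hN1 ℓ]) (by positivity)]
          calc _ = ε ^ 2 * (κ * (ε ^ 2)⁻¹ * L * levelBias K₀ M ℓ) := by field_simp
            _ ≤ _ := by gcongr
      _ = (L + 1) * (ε ^ 2 / (κ * L)) := by
          rw [Finset.sum_const, Finset.card_range, nsmul_eq_mul]; push_cast; ring
      _ ≤ (2 * L) * (ε ^ 2 / (κ * L)) := by gcongr; linarith
      _ = _ := by field_simp
  have t4 := sqrt_le_sqrt_mul (x := D * ∑ ℓ ∈ Finset.range (L + 1),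
    ((2 + Real.log (N ℓ)) / (N ℓ : ℝ) ^ 2 + levelBias K₀ M ℓ / N ℓ))
    (y := D * (E * G / b + 2 / κ)) hε0.le (by positivity) (by
      rw [Finset.sum_add_distrib, mul_assoc]
      gcongr
      linarith)
  have t5 := mul_le_mul_of_nonneg_left t1 hD.le
  linarith

/-- The cost of the ES focused parametrization. -/
theorem exists_costES_le (c : UnitCosts) (hK₀ : 1 ≤ K₀) (hM : 2 ≤ M) (hκ : 0 < κ) {ε₀ : ℝ}
    (hε₀ : ε₀ ∈ Ioo (0 : ℝ) 1) :
    ∃ C : ℝ, 0 < C ∧ ∀ ε ∈ Ioo 0 (bias K₀), ε ≤ ε₀ →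
      costES c κ K₀ M ε ≤ C * (ε ^ (-2 : ℝ) * |Real.log ε| ^ 2) := by
  have hM0 : (0 : ℝ) < M := by positivity
  have hM1 : 1 ≤ M := one_le_two.trans hM
  have hlM : 0 < Real.log M := Real.log_pos (by exact_mod_cast hM)
  have hl0 : 0 < -Real.log ε₀ := neg_pos.2 (Real.log_neg hε₀.1 hε₀.2)
  obtain ⟨D, hD, hcost⟩ := exists_cost_le c hK₀ hM1
  -- The second summand converts the `+1` of the ceiling into a multiple of `|ln ε|`, which requires
  -- `ε ≤ ε₀ < 1`.
  set Q := 1 / Real.log M + 1 / -Real.log ε₀ with hQ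
  have hQ0 : 0 < Q := by positivity
  refine ⟨D * (2 * κ + 2 * M) * Q ^ 2, by positivity, fun ε hε hle => ?_⟩
  have hε0 := hε.1
  have hε1 := (lt_one_of_lt_bias hε).le
  refine (hcost _ _ (one_le_itersES hK₀ hM hκ hε)).trans ?_
  have hL1 : (1 : ℝ) ≤ numLevels K₀ M ε := by exact_mod_cast one_le_numLevels hM hε
  have hLQ : (numLevels K₀ M ε : ℝ) ≤ Q * |Real.log ε| := by
    have h1 := numLevels_le hM hε
    have h2 : Real.log (bias K₀ / ε) ≤ -Real.log ε := by
      rw [Real.log_div (bias_pos hK₀).ne' hε0.ne']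
      linarith [Real.log_nonpos (bias_pos hK₀).le (bias_le_one K₀)]
    have h3 : 1 ≤ 1 / -Real.log ε₀ * -Real.log ε := by
      rw [one_div_mul_eq_div, one_le_div hl0]
      linarith [Real.log_le_log hε0 hle]
    rw [abs_of_nonpos (Real.log_nonpos hε0.le hε1), hQ, add_mul, one_div_mul_eq_div]
    refine h1.trans (add_le_add ?_ h3)
    gcongr
  have hb := le_mul_levelBias_numLevels hM hε
  have ht := itersES_target_pos hK₀ hM hκ hε
  have hn : ∀ ℓ, (itersES κ K₀ M ε ℓ : ℝ) ≤
      κ * ε ^ (-2 : ℝ) * numLevels K₀ M ε * levelBias K₀ M ℓ + 1 := fun ℓ =>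
    (Nat.ceil_lt_add_one (ht ℓ).le).le
  set L := numLevels K₀ M ε
  have hh := levelBias_pos hK₀ hM1
  have hh' : (levelBias K₀ M L)⁻¹ ≤ M * ε ^ (-2 : ℝ) := by
    rw [Real.rpow_neg hε0.le, Real.rpow_two, inv_le_comm₀ (hh L) (by positivity), mul_inv, inv_inv,
      inv_mul_le_iff₀ hM0]
    nlinarith
  have hsum : ∑ ℓ ∈ Finset.range (L + 1), (itersES κ K₀ M ε ℓ : ℝ) * (levelBias K₀ M ℓ)⁻¹ ≤
      (2 * κ + 2 * M) * (ε ^ (-2 : ℝ) * L ^ 2) := by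
    calc _ ≤ ∑ ℓ ∈ Finset.range (L + 1), (κ * ε ^ (-2 : ℝ) * L + (levelBias K₀ M ℓ)⁻¹) := by
          refine Finset.sum_le_sum fun ℓ _ => ?_
          refine (mul_le_mul_of_nonneg_right (hn ℓ) (inv_pos.2 (hh ℓ)).le).trans_eq ?_
          rw [add_mul, one_mul, mul_assoc, mul_inv_cancel₀ (hh ℓ).ne', mul_one]
      _ = (L + 1) * (κ * ε ^ (-2 : ℝ) * L) + ∑ ℓ ∈ Finset.range (L + 1), (levelBias K₀ M ℓ)⁻¹ := by
          rw [Finset.sum_add_distrib, Finset.sum_const, Finset.card_range, nsmul_eq_mul]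
          push_cast; ring
      _ ≤ (2 * L) * (κ * ε ^ (-2 : ℝ) * L) + 2 * (M * ε ^ (-2 : ℝ)) * L ^ 2 := by
          have h1 := sum_inv_levelBias_le hM K₀ L
          have h2 : 2 * (M * ε ^ (-2 : ℝ)) ≤ 2 * (M * ε ^ (-2 : ℝ)) * L ^ 2 :=
            le_mul_of_one_le_right (by positivity) (one_le_pow₀ hL1)
          refine add_le_add ?_ (by linarith)
          gcongr
          linarith
      _ = _ := by ring
  calc _ ≤ D * ((2 * κ + 2 * M) * (ε ^ (-2 : ℝ) * L ^ 2)) := by gcongr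
    _ ≤ D * ((2 * κ + 2 * M) * (ε ^ (-2 : ℝ) * (Q * |Real.log ε|) ^ 2)) := by gcongr
    _ = _ := by ring

end ESParameters

/-! ### Exponential moments of the initializations -/

section Init

variable {Ω : Type*} [MeasurableSpace Ω] {μ : Measure Ω} [IsProbabilityMeasure μ]

theorem exp_mul_abs_le {a : ℝ} (ha : 0 ≤ a) (x : ℝ) :
    Real.exp (a * |x|) ≤ Real.exp a + |x| ^ 4 * Real.exp (a * |x|) := by
  rcases le_total |x| 1 with h | h
  · have h1 : Real.exp (a * |x|) ≤ Real.exp a :=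
      Real.exp_le_exp.2 (mul_le_of_le_one_right ha h)
    have : 0 ≤ |x| ^ 4 * Real.exp (a * |x|) := by positivity
    linarith
  · have h1 : Real.exp (a * |x|) ≤ |x| ^ 4 * Real.exp (a * |x|) :=
      le_mul_of_one_le_left (Real.exp_pos _).le (one_le_pow₀ h)
    linarith [Real.exp_pos a]

/-- The moment condition bounds the exponential moments of the initializations. -/
theorem InitMoment.exists_integral_exp_le {α F : ℝ} (hα : α < 1) (hF : 0 ≤ F)
    {θ₀ : ℕ → Bool → Ω → ℝ × ℝ} (hθ : ∀ ℓ j, Measurable (θ₀ ℓ j)) (h : InitMoment μ α F θ₀) :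
    ∃ B : ℝ, ∀ ℓ j,
      Integrable (fun ω => Real.exp (16 * (F / (1 - α)) * kAlpha α * |(θ₀ ℓ j ω).1|)) μ ∧
      ∫ ω, Real.exp (16 * (F / (1 - α)) * kAlpha α * |(θ₀ ℓ j ω).1|) ∂μ ≤ B := by
  have hk := one_le_kAlpha α
  have h1α : 0 < 1 - α := by linarith
  set a := 16 * (F / (1 - α)) * kAlpha α with ha
  have ha0 : 0 ≤ a := by positivity
  -- With `A = F/(1 - α)` this exponent is `16A · k_α`, the one needed for the Lyapunov function
  -- `lyap (16A)` of the initial error, as `V` has slope at most `k_α`.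
  have hae : 16 / (1 - α) * kAlpha α * F = a := by rw [ha]; ring
  rw [InitMoment, hae] at h
  have hS := (ENNReal.add_lt_top.1 h).1
  set S : ENNReal := ⨆ (ℓ : ℕ) (j : Bool), ∫⁻ ω, ENNReal.ofReal (|(θ₀ ℓ j ω).1| ^ 4 *
    Real.exp (a * |(θ₀ ℓ j ω).1|)) ∂μ with hSd
  refine ⟨(ENNReal.ofReal (Real.exp a) + S).toReal, fun ℓ j => ?_⟩
  have hle : ∫⁻ ω, ENNReal.ofReal (Real.exp (a * |(θ₀ ℓ j ω).1|)) ∂μ ≤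
      ENNReal.ofReal (Real.exp a) + S := by
    calc _ ≤ ∫⁻ ω, (ENNReal.ofReal (Real.exp a) + ENNReal.ofReal (|(θ₀ ℓ j ω).1| ^ 4 *
          Real.exp (a * |(θ₀ ℓ j ω).1|))) ∂μ := lintegral_mono fun ω => by
          rw [← ENNReal.ofReal_add (by positivity) (by positivity)]
          exact ENNReal.ofReal_le_ofReal (exp_mul_abs_le ha0 _)
      _ = ENNReal.ofReal (Real.exp a) + ∫⁻ ω, ENNReal.ofReal (|(θ₀ ℓ j ω).1| ^ 4 *
          Real.exp (a * |(θ₀ ℓ j ω).1|)) ∂μ := by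
          rw [lintegral_add_left measurable_const, lintegral_const, measure_univ, mul_one]
      _ ≤ _ := by
          gcongr
          rw [hSd]
          exact le_iSup₂ (f := fun ℓ j => ∫⁻ ω, ENNReal.ofReal (|(θ₀ ℓ j ω).1| ^ 4 *
            Real.exp (a * |(θ₀ ℓ j ω).1|)) ∂μ) ℓ j
  have hfin : ENNReal.ofReal (Real.exp a) + S ≠ ⊤ :=
    ENNReal.add_ne_top.2 ⟨ENNReal.ofReal_ne_top, hS.ne⟩
  have hm : Measurable (fun ω => Real.exp (a * |(θ₀ ℓ j ω).1|)) := by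
    have := hθ ℓ j
    have h2 : Measurable (fun ω => (θ₀ ℓ j ω).1) := measurable_fst.comp this
    exact Real.measurable_exp.comp ((continuous_abs.measurable.comp h2).const_mul a)
  have hi : Integrable (fun ω => Real.exp (a * |(θ₀ ℓ j ω).1|)) μ := by
    refine ⟨hm.aestronglyMeasurable, ?_⟩
    rw [hasFiniteIntegral_iff_ofReal (Eventually.of_forall fun ω => (Real.exp_pos _).le)]
    exact hle.trans_lt hfin.lt_top
  refine ⟨hi, ?_⟩
  rw [integral_eq_lintegral_of_nonneg_ae (Eventually.of_forall fun ω => (Real.exp_pos _).le)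
    hm.aestronglyMeasurable]
  exact ENNReal.toReal_mono hfin hle

end Init

end MLSA

end

/-! ### The main theorem -/

theorem mainTheorem1 {Ω : Type*} [MeasurableSpace Ω] (μ : Measure Ω) [IsProbabilityMeasure μ]
    {d q : ℕ} (φ : (Fin d → ℝ) → (Fin q → ℝ) → ℝ)
    (hφ : Measurable (fun p : (Fin d → ℝ) × (Fin q → ℝ) => φ p.1 p.2))
    (Y : Ω → Fin d → ℝ) (Z : ℕ → Ω → Fin q → ℝ) (hYZ : MLSA.IsGeneric μ Y Z)
    (hL2 : MemLp (fun ω => φ (Y ω) (Z 0 ω)) 2 μ)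
    (α : ℝ) (hα : α ∈ Ioo (0 : ℝ) 1)
    -- the approximating losses, objective functions, minimisers and densities
    (X : ℕ → Ω → ℝ) (hX : X = MLSA.loss μ φ Y Z)
    (V : ℕ → ℝ → ℝ) (hV : ∀ K, V K = MLSA.objective μ α (X K))
    (ξs : ℕ → ℝ) (hξs : ∀ K ξ, V K (ξs K) ≤ V K ξ)
    (f : ℕ → ℝ → ℝ) (hf : ∀ K, MLSA.IsContinuousPDF μ (X K) (f K))
    -- standing assumptions on the family of losses
    (hexp : MLSA.WeakExpansion μ X V)
    (hloc : TendstoLocallyUniformly f (f 0) atTop)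
    (hpos : MLSA.UniformlyPositive f (ξs 0))
    (hlip : MLSA.UniformlyBoundedLipschitz f)
    (hrate : MLSA.DensityRate f)
    -- the geometric sequence of bias parameters and the scenario
    (K₀ M : ℕ) (hK₀ : 1 ≤ K₀) (hM : 2 ≤ M)
    (s : MLSA.Scenario) (hs : s.Holds μ φ Y Z K₀ M)
    -- the simulations, the initializations and the cost model
    (Ys : ℕ → ℕ → Ω → Fin d → ℝ) (Zs : ℕ → ℕ → ℕ → Ω → Fin q → ℝ)
    (θ₀ : ℕ → Bool → Ω → ℝ × ℝ) (hsim : MLSA.IsSimulation μ Y (Z 0) Ys Zs θ₀)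
    (hinit : MLSA.InitMoment μ α (⨆ K, MLSA.supNorm (f K)) θ₀)
    (c : MLSA.UnitCosts) :
    -- VaR focused parametrization
    ((s = MLSA.Scenario.gaussian → 2 ≤ K₀) →
      -- statistical error of order `ε`
      (∀ β γ₁ κ : ℝ, β ∈ Ioc (0 : ℝ) 1 → 0 < γ₁ → 0 < κ →
        (β = 1 → 2 < MLSA.lambdaBar 2 V ξs * γ₁) →
        ∃ C : ℝ, 0 < C ∧ ∀ ε ∈ Ioo (0 : ℝ) (MLSA.bias K₀),
          eLpNorm (fun ω =>
            (MLSA.estimator α (MLSA.stepSize γ₁ β) φ Ys Zs θ₀ K₀ M (MLSA.numLevels K₀ M ε)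
              (MLSA.itersVaR s κ γ₁ β K₀ M ε) ω).1
            - ξs (K₀ * M ^ MLSA.numLevels K₀ M ε)) 2 μ ≤ ENNReal.ofReal (C * ε)) ∧
      -- cost for `β = 1`, and optimality of `β = 1`
      (∀ γ₁ κ : ℝ, 0 < γ₁ → 0 < κ → 2 < MLSA.lambdaBar 2 V ξs * γ₁ →
        (∃ C : ℝ, 0 < C ∧ ∀ ε ∈ Ioo (0 : ℝ) (MLSA.bias K₀),
          MLSA.costVaR c s κ γ₁ 1 K₀ M ε ≤ C * s.complexity ε) ∧
        (∀ β γ₁' κ' : ℝ, β ∈ Ioc (0 : ℝ) 1 → 0 < γ₁' → 0 < κ' →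
          ∃ C : ℝ, 0 < C ∧ ∀ ε ∈ Ioo (0 : ℝ) (MLSA.bias K₀),
            MLSA.costVaR c s κ γ₁ 1 K₀ M ε ≤ C * MLSA.costVaR c s κ' γ₁' β K₀ M ε))) ∧
    -- ES focused parametrization, with `β = 1`
    (∀ γ₁ κ : ℝ, 0 < γ₁ → 0 < κ → 2 < MLSA.lambdaBar 2 V ξs * γ₁ →
      (∃ C : ℝ, 0 < C ∧ ∀ ε ∈ Ioo (0 : ℝ) (MLSA.bias K₀),
        eLpNorm (fun ω =>
          (MLSA.estimator α (MLSA.stepSize γ₁ 1) φ Ys Zs θ₀ K₀ M (MLSA.numLevels K₀ M ε)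
            (MLSA.itersES κ K₀ M ε) ω).2
          - V (K₀ * M ^ MLSA.numLevels K₀ M ε) (ξs (K₀ * M ^ MLSA.numLevels K₀ M ε))) 2 μ
        ≤ ENNReal.ofReal (C * ε)) ∧
      (∀ ε₀ ∈ Ioo (0 : ℝ) 1, ∃ C : ℝ, 0 < C ∧
        ∀ ε ∈ Ioo (0 : ℝ) (MLSA.bias K₀), ε ≤ ε₀ →
          MLSA.costES c κ K₀ M ε ≤ C * (ε ^ (-2 : ℝ) * |Real.log ε| ^ 2))) := by
  subst hX
  have h1α : 0 < 1 - α := sub_pos.2 hα.2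
  obtain ⟨lam, C, δ, hreg⟩ := MLSA.exists_regularity hα (hYZ.measurable_loss hφ)
    (fun K => (hYZ.memLp_loss hφ hL2 K).integrable one_le_two) hV hξs hf hexp hpos hlip hrate
  have hF : 0 ≤ ⨆ K, MLSA.supNorm (f K) :=
    Real.iSup_nonneg fun K => Real.iSup_nonneg fun x => abs_nonneg _
  obtain ⟨B, hB⟩ := hinit.exists_integral_exp_le hα.2 hF hsim.measurable_init
  have S : MLSA.Setup μ φ Y Z α V ξs Ys Zs θ₀ ((⨆ K, MLSA.supNorm (f K)) / (1 - α))
      (MLSA.lambdaBar 2 V ξs) lam C δ B := ⟨hφ, hYZ, hL2, hα, hreg, hsim, hB⟩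
  have hM1 : 1 ≤ M := one_le_two.trans hM
  refine ⟨fun hgauss => ?_, fun γ₁ κ hγ₁ hκ hlam => ⟨?_, fun ε₀ hε₀ =>
    MLSA.exists_costES_le c hK₀ hM hκ hε₀⟩⟩
  · have hv : s.Valid K₀ := ⟨fun p hp => by subst hp; exact hs.1, hgauss⟩
    refine ⟨fun β γ₁ κ hβ hγ₁ hκ hlam => ?_, fun γ₁ κ hγ₁ hκ _ => ⟨?_, ?_⟩⟩
    · obtain ⟨D, hD, herr⟩ := S.var_error_le hβ hγ₁ hlam hK₀ hM1 hs hv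
      obtain ⟨E, hE, hnum⟩ := MLSA.exists_var_error_le hK₀ hM hv hκ hγ₁ hβ.1 hD hreg.δ_pos
      exact ⟨E, hE, fun ε hε => (herr _ _ (MLSA.one_le_itersVaR hK₀ hM1 hv hκ hγ₁ hε.1)).trans
        (ENNReal.ofReal_le_ofReal (hnum ε hε _ rfl))⟩
    · obtain ⟨D, hD, hcost⟩ := MLSA.exists_costVaR_le c hK₀ hM hv hκ hγ₁
      obtain ⟨E, hE, hrate'⟩ := MLSA.Scenario.exists_rate_le_complexity hK₀ hM hv
      refine ⟨D * (M * E), by positivity, fun ε hε => (hcost ε hε).trans ?_⟩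
      rw [mul_assoc D (M * E), mul_assoc (M : ℝ)]
      refine mul_le_mul_of_nonneg_left ?_ hD.le
      refine le_trans ?_ (mul_le_mul_of_nonneg_left (hrate' ε hε) (Nat.cast_nonneg M))
      have hε0 := hε.1
      have h1 := MLSA.le_mul_levelBias_numLevels hM hε
      have h2 := MLSA.levelBias_pos hK₀ hM1 (MLSA.numLevels K₀ M ε)
      have h3 := MLSA.Scenario.rate_pos hK₀ hM1 hv (MLSA.numLevels K₀ M ε)
      -- Since `h_L` is within a factor `M` of `ε`, the cost `ε⁻² ϵ(h_L)/h_L` becomes `ε⁻³ ϵ(h_L)`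
      -- up to that factor.
      have h4 : (MLSA.levelBias K₀ M (MLSA.numLevels K₀ M ε))⁻¹ ≤ M * ε⁻¹ := by
        rw [← div_eq_mul_inv, le_div_iff₀ hε0, inv_mul_le_iff₀ h2]
        linarith
      refine (mul_le_mul_of_nonneg_left h4 (by positivity)).trans_eq ?_
      field_simp
    · intro β γ₁' κ' hβ hγ₁' hκ'
      obtain ⟨D, hD, hup⟩ := MLSA.exists_costVaR_le c hK₀ hM hv hκ hγ₁
      obtain ⟨E, hE, hlow⟩ := MLSA.exists_le_costVaR c hK₀ hM hv hκ' hγ₁' hβ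
      refine ⟨D * E, by positivity, fun ε hε => (hup ε hε).trans ?_⟩
      rw [mul_assoc D E]
      exact mul_le_mul_of_nonneg_left (hlow ε hε) hD.le
  · obtain ⟨D, hD, herr⟩ := S.es_error_le hV hγ₁ hlam hK₀ hM1
    obtain ⟨E, hE, hnum⟩ := MLSA.exists_es_error_le hK₀ hM hκ hD
    exact ⟨E, hE, fun ε hε => (herr _ _ (MLSA.one_le_itersES hK₀ hM hκ hε)).trans
      (ENNReal.ofReal_le_ofReal (hnum ε hε _ rfl))⟩
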